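/- **Setting.** For each $n$ let $m_1,\dots,m_{p}:[0,1]\to\mathbb R$, $p=p_n\ge 1$ (functions and $p$ may depend on $n$), and observe $Y_{ij}=m_j(X_i)+\epsilon_{ij}$, $1\le i\le n$, $1\le j\le p_n$, with $X_i$ i.i.d. uniform on $(0,1)$, independent of the errors. Let $w$ be a weight function on $[0,1]$, let $Q=(\int_0^1 m_im_jw)_{i,j\le p_n}$, and let $\beta_0$ minimize $\beta\mapsto\int_0^1(m_1'-\beta^Tm)^2w$ over $\mathbb R^{p_n}$. Assume $\beta_0=(\beta_{10}^T,0)^T$ with $\beta_{10}\in\mathbb R^{k_n}$, $k_n\le p_n$. Let $\hat m_j$ and $\hat m_1'$ be the local polynomial estimators of degree $3$ (kernel $K$, bandwidth $h=h_n>0$) of $m_j$ and of $m_1'$: with $\hat\alpha(x)=(X^TWX)^{-1}X^TWy$ the kernel-weighted least squares coefficients of $y=(Y_{ij})_i$ on $(X_i-x)^d$, $0\le d\le 3$, the estimator of the $d$-th derivative at $x$ is $d!\,\hat\alpha_d(x)$. Put $$S(\beta)=\int_0^1\big(\hat m_1'(x)-\beta^T\hat m(x)\big)^2w(x)\,dx+\sum_{j=1}^{p_n}p_{\lambda_n}(|\beta_j|),$$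 where $p_\lambda$ is the SCAD penalty: $p_\lambda(0)=0$, $p_\lambda'(\theta)=\lambda\{I(\theta\le\lambda)+\frac{(a\lambda-\theta)_+}{(a-1)\lambda}I(\theta>\lambda)\}$ for $\theta>0$, with $a>2$ fixed. **Conditions.** (A) $K$ is a continuous bounded symmetric density supported on $[-1,1]$. (B) All $m_j$ are $C^3$ on $[0,1]$, and $|m_j^{(d)}|$, $0\le d\le 3$, are bounded by one constant not depending on $j$, $n$. (C) $w$ is nonnegative, bounded and $C^2$ on $[0,1]$, with $w^{(i)}(0)=w^{(i)}(1)=0$, $i=0,1,2$. (D) The $\epsilon_{ij}$ are i.i.d. $N(0,\sigma^2)$, $\sigma>0$. (E) $nh^4\to\infty$, $nh^6\to0$, $\sqrt n\,p_n(h^3+\frac1{nh^2})\to0$. (F) $0<\rho_{1n}\le\lambda_{\min}(Q)\le\lambda_{\max}(Q)\le\rho_{2n}$. (G) $\frac{p_n}{\sqrt n}=o(\rho_{1n})$, $\frac{p_n}{\sqrt n}=o(\rho_{2n})$, $0<\lambda_n\to0$, $\frac{p_n^2}{\sqrt n\rho_{1n}\lambda_n}\to0$, $\frac{\rho_{2n}p_n^2}{\sqrt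 n\rho_{1n}\lambda_n}\to0$. (H) $\max_{j\le k_n}|\beta_{0j}|\le C$ with $C$ independent of $n$. (I) $\min_{j\le k_n}|\beta_{0j}|/\lambda_n\to\infty$. **Covariances.** Let $Q_{11}=(\int m_im_jw)_{i,j\le k_n}$ and $M_1=[b_1,Q_{11}]$ with $b_1=(\int m_1'm_iw)_{i\le k_n}$; let $\mathrm{vech}(M_1)$ list its nonrepetitive entries and let $\Phi_{k_n}$ be the binary matrix with $\mathrm{vec}(M_1)=\Phi_{k_n}\mathrm{vech}(M_1)$. Let $G_n$ be the asymptotic covariance matrix of the plug-in estimator of $\mathrm{vech}(M_1)$, i.e. its leading, order $1/n$, term: $$(G_n)_{uv}=\frac{\sigma^2}{n}\sum_{l=1}^{p_n}\int_0^1 g_{u,l}\,g_{v,l}\,dx,$$ where $g_{u,l}=\delta_{li}\,m_1'w-\delta_{l1}(m_iw)'$ if $u$ is the entry $\int m_1'm_iw$, and $g_{u,l}=(\delta_{lj}m_i+\delta_{li}m_j)w$ if $u$ is the entry $\int m_im_jw$. Put $$P_n=[(1,-\beta_{10}^T)\otimes Q_{11}^{-1}]\,\Phi_{k_n}G_n\Phi_{k_n}^T\,[(1,-\beta_{10}^T)\otimes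 Q_{11}^{-1}]^T .$$ Nondegeneracy condition (ND): there are $g_n>0$ with $\lambda_{\min}(nG_n)\ge g_n$ for all large $n$, $\sqrt n\,p_n(h^3+\frac1{nh^2})/\sqrt{g_n}\to0$ and $\frac{p_n^2}{\sqrt n\rho_{1n}\sqrt{g_n}}\to0$. (If $\|G_n^{-1/2}\|=O(\sqrt n)$, i.e. $g_n$ can be taken constant, the two limits follow from (E) and (G).) **Theorem (oracle property).** Assume (A)–(I). There is a sequence of random vectors $\hat\beta=(\hat\beta_1^T,\hat\beta_2^T)^T$, $\hat\beta_1\in\mathbb R^{k_n}$, which with probability tending to one are local minimizers of $S$, with $\|\hat\beta-\beta_0\|=O_p\big(\frac{p_n^2}{\sqrt n\rho_{1n}}\big)$. For every such sequence: (i) $\hat\beta_2=0$ with probability tending to $1$. (ii) If (ND) holds, then for all $\gamma_n\in\mathbb R^{k_n}$ with unit norm, $\gamma_n^TP_n^{-1/2}(\hat\beta_1-\beta_{10})\to N(0,1)$ in distribution. Moreover, under (ND), the limit in (ii), with the same $P_n$, holds for every sequence $\tilde\beta_1\in\mathbb R^{k_n}$ of random vectors that with probability tending to one are local minimizers of $v\mapsto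 S((v^T,0)^T)$ (zero coefficients known), with $\|\tilde\beta_1-\beta_{10}\|=O_p\big(\frac{p_n^2}{\sqrt n\rho_{1n}}\big)$. -/

import Mathlib

open MeasureTheory ProbabilityTheory Filter Topology Set
open scoped Kronecker Asymptotics

namespace LinODE

noncomputable section

/-! ### Local polynomial regression -/

/-- Design matrix of the local polynomial fit of degree `s` at the point `x`. -/
def lpDesign {n : ℕ} (s : ℕ) (X : Fin n → ℝ) (x : ℝ) : Matrix (Fin n) (Fin (s + 1)) ℝ :=
  Matrix.of fun i d => (X i - x) ^ (d : ℕ)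

/-- Diagonal matrix of kernel weights at the point `x` with bandwidth `h`. -/
def lpWeight {n : ℕ} (K : ℝ → ℝ) (h : ℝ) (X : Fin n → ℝ) (x : ℝ) : Matrix (Fin n) (Fin n) ℝ :=
  Matrix.diagonal fun i => K ((X i - x) / h)

/-- The weighted least squares coefficients `(XᵀWX)⁻¹XᵀWy`. -/
def lpCoef {n : ℕ} (s : ℕ) (K : ℝ → ℝ) (h : ℝ) (X y : Fin n → ℝ) (x : ℝ) : Fin (s + 1) → ℝ :=
  Matrix.mulVec
    (((lpDesign s X x).transpose * lpWeight K h X x * lpDesign s X x)⁻¹ *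
      (lpDesign s X x).transpose * lpWeight K h X x) y

/-- The local polynomial estimator (degree `s`) of the `d`-th derivative at `x`. -/
def lpEst {n : ℕ} (s : ℕ) (K : ℝ → ℝ) (h : ℝ) (X y : Fin n → ℝ) (d : Fin (s + 1)) (x : ℝ) : ℝ :=
  (Nat.factorial (d : ℕ) : ℝ) * lpCoef s K h X y x d

/-! ### The SCAD penalty and the penalized criterion -/

/-- Derivative of the SCAD penalty on `(0, ∞)`. -/
def scadDeriv (a lam t : ℝ) : ℝ :=
  lam * (if t ≤ lam then 1 else max (a * lam - t) 0 / ((a - 1) * lam))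

/-- The SCAD penalty `p_λ(t)`, `t ≥ 0`, normalized by `p_λ(0) = 0`. -/
def scad (a lam t : ℝ) : ℝ := ∫ u in (0 : ℝ)..t, scadDeriv a lam u

/-- The criterion
`S(β) = ∫₀¹ (m̂₁'(x) - βᵀ m̂(x))² w(x) dx + ∑ⱼ p_λ(|βⱼ|)`,
where `m̂ⱼ` and `m̂₁'` are the local cubic estimators computed from the design points `X` and the
responses `Y i j`. -/
def criterion {n p : ℕ} [NeZero p] (K : ℝ → ℝ) (h : ℝ) (w : ℝ → ℝ) (a lam : ℝ)
    (X : Fin n → ℝ) (Y : Fin n → Fin p → ℝ) (β : EuclideanSpace ℝ (Fin p)) : ℝ :=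
  (∫ x in (0 : ℝ)..1,
      (lpEst 3 K h X (fun i => Y i 0) 1 x
        - ∑ j, β j * lpEst 3 K h X (fun i => Y i j) 0 x) ^ 2 * w x)
    + ∑ j, scad a lam |β j|

/-! ### Population quantities -/

/-- The population loss `∫₀¹ (m₁' - βᵀ m)² w` of the first equation. -/
def popLoss {p : ℕ} [NeZero p] (w : ℝ → ℝ) (m : Fin p → ℝ → ℝ)
    (β : EuclideanSpace ℝ (Fin p)) : ℝ :=
  ∫ x in (0 : ℝ)..1, (deriv (m 0) x - ∑ j, β j * m j x) ^ 2 * w x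

/-- The matrix `Q` with entries `∫₀¹ mᵢ mⱼ w`. -/
def gram {q : ℕ} (w : ℝ → ℝ) (m : Fin q → ℝ → ℝ) : Matrix (Fin q) (Fin q) ℝ :=
  Matrix.of fun i j => ∫ x in (0 : ℝ)..1, m i x * m j x * w x

/-- Index set of the nonrepetitive entries of a `q × (q+1)` matrix `[b, Q]` with `Q` symmetric:
the entries of `b`, and the entries `(i, j)` of `Q` with `j ≤ i`. It has `q (q + 3) / 2`
elements. -/
abbrev VechIdx (q : ℕ) : Type := Fin q ⊕ {ij : Fin q × Fin q // ij.2 ≤ ij.1}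

/-- The half-vectorization of `[b, Q]`. The columns are indexed by `Unit ⊕ Fin q`. -/
def vech {q : ℕ} (C : Matrix (Fin q) (Unit ⊕ Fin q) ℝ) : VechIdx q → ℝ
  | Sum.inl i => C i (Sum.inl ())
  | Sum.inr ij => C ij.1.1 (Sum.inr ij.1.2)

/-- The binary duplication matrix `Φ`. Rows are indexed by (column, row) as for `Matrix.vec`. -/
def dup (q : ℕ) : Matrix ((Unit ⊕ Fin q) × Fin q) (VechIdx q) ℝ :=
  Matrix.of fun c a =>
    match c, a with
    | (Sum.inl _, i), Sum.inl i' => if i = i' then 1 else 0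
    | (Sum.inr j, i), Sum.inr ij => if max i j = ij.1.1 ∧ min i j = ij.1.2 then 1 else 0
    | _, _ => 0

/-- `vec C = Φ vech C` whenever the square part of `C` is symmetric. -/
theorem vec_eq_dup_mulVec_vech {q : ℕ} (C : Matrix (Fin q) (Unit ⊕ Fin q) ℝ)
    (hC : ∀ i j, C i (Sum.inr j) = C j (Sum.inr i)) :
    C.vec = (dup q).mulVec (vech C) := by
  funext c
  obtain ⟨c, i⟩ := c
  rcases c with u | j
  · simp [Matrix.vec, Matrix.mulVec, dotProduct, dup, vech]
  · simp only [Matrix.vec, Matrix.mulVec, dotProduct, dup, vech, Fintype.sum_sum_type,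
      Matrix.of_apply, zero_mul, Finset.sum_const_zero, zero_add, ite_mul, one_mul]
    rw [Finset.sum_eq_single ⟨(max i j, min i j), min_le_max⟩]
    · rcases le_total i j with h | h
      · simp [h, hC i j]
      · simp [h]
    · rintro ⟨⟨a, b⟩, hab⟩ - hne
      rw [if_neg]
      rintro ⟨h1, h2⟩
      exact hne (by simp only [Subtype.mk.injEq, Prod.mk.injEq]; exact ⟨h1.symm, h2.symm⟩)
    · simp

/-- Influence functions of the plug-in functionals. In the linearization
`n⁻¹ ∑ₜ ∑ₗ infl a l (Xₜ) εₜₗ` of the error of the plug-in estimator of entry `a` of `vech [b, Q]`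
(`bᵢ = ∫ m₁' mᵢ w`, `Qᵢⱼ = ∫ mᵢ mⱼ w`), `infl a l` is the coefficient of the noise of variable `l`:
the perturbation `∫ (m₁' ηᵢ + η₁' mᵢ) w = ∫ (m₁' w ηᵢ - (mᵢ w)' η₁)` of `bᵢ` and
`∫ (mᵢ ηⱼ + mⱼ ηᵢ) w` of `Qᵢⱼ`. The map `e` selects the variables that enter. -/
def infl {p q : ℕ} [NeZero p] (w : ℝ → ℝ) (m : Fin p → ℝ → ℝ) (e : Fin q → Fin p) :
    VechIdx q → Fin p → ℝ → ℝ
  | Sum.inl i, l, x =>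
      (if l = e i then deriv (m 0) x * w x else 0)
        - (if l = 0 then deriv (fun y => m (e i) y * w y) x else 0)
  | Sum.inr ij, l, x =>
      ((if l = e ij.1.2 then m (e ij.1.1) x else 0)
        + (if l = e ij.1.1 then m (e ij.1.2) x else 0)) * w x

/-- The asymptotic covariance matrix `G` of `vech [b̂, Q̂]` for sample size `n` and uniform design
on `(0, 1)`: the leading, order `1/n`, term of the covariance of the plug-in functionals. -/
def asympCov {p q : ℕ} [NeZero p] (n : ℕ) (σ : ℝ) (w : ℝ → ℝ) (m : Fin p → ℝ → ℝ)
    (e : Fin q → Fin p) : Matrix (VechIdx q) (VechIdx q) ℝ :=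
  Matrix.of fun a b =>
    σ ^ 2 / (n : ℝ) * ∑ l, ∫ x in (0 : ℝ)..1, infl w m e a l x * infl w m e b l x

/-- The matrix `(1, -βᵀ) ⊗ Q⁻¹`, its row index `Unit × Fin q` being identified with `Fin q`. -/
def sandwich {q : ℕ} (β : Fin q → ℝ) (Q : Matrix (Fin q) (Fin q) ℝ) :
    Matrix (Fin q) ((Unit ⊕ Fin q) × Fin q) ℝ :=
  ((Matrix.of fun (_ : Unit) (c : Unit ⊕ Fin q) => Sum.elim (fun _ => (1 : ℝ)) (fun j => -β j) c)
    ⊗ₖ Q⁻¹).submatrix (fun i => ((), i)) id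

/-- The sandwich covariance `[(1, -βᵀ) ⊗ Q⁻¹] Φ G Φᵀ [(1, -βᵀ) ⊗ Q⁻¹]ᵀ`. -/
def sandwichCov {q : ℕ} (β : Fin q → ℝ) (Q : Matrix (Fin q) (Fin q) ℝ)
    (G : Matrix (VechIdx q) (VechIdx q) ℝ) : Matrix (Fin q) (Fin q) ℝ :=
  sandwich β Q * dup q * G * (dup q).transpose * (sandwich β Q).transpose

/-- The symmetric inverse square root `A^{-1/2}` of a symmetric positive definite matrix. -/
def invSqrt {q : ℕ} (A : Matrix (Fin q) (Fin q) ℝ) : Matrix (Fin q) (Fin q) ℝ :=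
  cfc (fun t : ℝ => (Real.sqrt t)⁻¹) A

/-! ### Coordinates -/

/-- The first `k` coordinates of a vector of length `p`. -/
def head {k p : ℕ} (hk : k ≤ p) (v : EuclideanSpace ℝ (Fin p)) : EuclideanSpace ℝ (Fin k) :=
  WithLp.toLp 2 fun i => v (Fin.castLE hk i)

/-- The vector of length `p` obtained from a vector of length `k` by appending zeros. -/
def padZero {k : ℕ} (p : ℕ) (v : EuclideanSpace ℝ (Fin k)) : EuclideanSpace ℝ (Fin p) :=
  WithLp.toLp 2 fun j => if h : (j : ℕ) < k then v ⟨j, h⟩ else 0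

/-! ### Asymptotic notions -/

/-- The events `E n` hold with probability tending to one (stated with the complement, so that it
is meaningful for events that are not known to be measurable). -/
def WithProbTendingToOne {Ω : ℕ → Type*} [∀ n, MeasurableSpace (Ω n)] (P : ∀ n, Measure (Ω n))
    (E : ∀ n, Set (Ω n)) : Prop :=
  Tendsto (fun n => P n (E n)ᶜ) atTop (𝓝 0)

/-- `Z n = O_P(r n)`. -/
def IsBigOP {Ω : ℕ → Type*} [∀ n, MeasurableSpace (Ω n)] (P : ∀ n, Measure (Ω n))
    (Z : ∀ n, Ω n → ℝ) (r : ℕ → ℝ) : Prop :=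
  ∀ δ : ENNReal, 0 < δ → ∃ C : ℝ, ∀ᶠ n in atTop, P n {ω | C * r n < |Z n ω|} ≤ δ

/-- The random vectors `T n` are, with probability tending to one, local minimizers of the random
criteria `S n`, and `‖T n - c n‖ = O_P(r n)`. -/
structure IsConsistentLocalMinimizer {Ω : ℕ → Type*} [∀ n, MeasurableSpace (Ω n)]
    (P : ∀ n, Measure (Ω n)) {d : ℕ → ℕ}
    (S : ∀ n, Ω n → EuclideanSpace ℝ (Fin (d n)) → ℝ)
    (c : ∀ n, EuclideanSpace ℝ (Fin (d n))) (r : ℕ → ℝ)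
    (T : ∀ n, Ω n → EuclideanSpace ℝ (Fin (d n))) : Prop where
  aemeasurable : ∀ n, AEMeasurable (T n) (P n)
  isLocalMin : WithProbTendingToOne P fun n => {ω | IsLocalMin (S n ω) (T n ω)}
  rate : IsBigOP P (fun n ω => ‖T n ω - c n‖) r

/-! ### Regularity conditions -/

/-- `K` is a continuous bounded symmetric density supported on `[-1, 1]`. -/
structure KernelCondition (K : ℝ → ℝ) : Prop where
  continuous : Continuous K
  bounded : ∃ B : ℝ, ∀ u, K u ≤ B
  symm : ∀ u, K (-u) = K u
  nonneg : ∀ u, 0 ≤ K u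
  integral_eq_one : ∫ u, K u = 1
  support : Function.support K ⊆ Icc (-1) 1

/-- The functions are three times continuously differentiable on `[0, 1]`, with a bound on the
functions and their first three derivatives that is common to all of them. -/
def SmoothnessCondition {p : ℕ → ℕ} (m : ∀ n, Fin (p n) → ℝ → ℝ) : Prop :=
  ∃ B : ℝ, ∀ n j, ContDiffOn ℝ 3 (m n j) (Icc 0 1) ∧
    ∀ d : ℕ, d ≤ 3 → ∀ x ∈ Icc (0 : ℝ) 1, |iteratedDerivWithin d (m n j) (Icc 0 1) x| ≤ B

/-- `w` is nonnegative, bounded and twice continuously differentiable on `[0, 1]`, and vanishes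
with its first two derivatives at both end points. -/
structure WeightCondition (w : ℝ → ℝ) : Prop where
  nonneg : ∀ x ∈ Icc (0 : ℝ) 1, 0 ≤ w x
  bounded : ∃ B : ℝ, ∀ x ∈ Icc (0 : ℝ) 1, w x ≤ B
  contDiffOn : ContDiffOn ℝ 2 w (Icc 0 1)
  left : ∀ d : ℕ, d ≤ 2 → iteratedDerivWithin d w (Icc 0 1) 0 = 0
  right : ∀ d : ℕ, d ≤ 2 → iteratedDerivWithin d w (Icc 0 1) 1 = 0

/-- The observation times are uniform on `(0, 1)`, the errors are `N(0, σ²)`, and all of them are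
mutually independent. -/
structure SamplingCondition {Ω : Type*} [MeasurableSpace Ω] (P : Measure Ω) (σ : ℝ) {n p : ℕ}
    (X : Fin n → Ω → ℝ) (ε : Fin n → Fin p → Ω → ℝ) : Prop where
  law_time : ∀ i, HasLaw (X i) (volume.restrict (Ioo (0 : ℝ) 1)) P
  law_error : ∀ i j, HasLaw (ε i j) (gaussianReal 0 ⟨σ ^ 2, sq_nonneg σ⟩) P
  indep : iIndepFun (fun s : Fin n ⊕ (Fin n × Fin p) =>
    Sum.elim (fun i => X i) (fun ij => ε ij.1 ij.2) s) P

/-- The conditions on the bandwidth and the number of variables. -/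
structure BandwidthCondition (h : ℕ → ℝ) (p : ℕ → ℕ) : Prop where
  pos : ∀ n, 0 < h n
  tendsto_four : Tendsto (fun n : ℕ => (n : ℝ) * h n ^ 4) atTop atTop
  tendsto_six : Tendsto (fun n : ℕ => (n : ℝ) * h n ^ 6) atTop (𝓝 0)
  tendsto_dim : Tendsto (fun n : ℕ => √(n : ℝ) * p n * (h n ^ 3 + 1 / (n * h n ^ 2))) atTop (𝓝 0)

/-- The eigenvalues of `Q` lie in `[ρ₁, ρ₂]` with `ρ₁ > 0`. -/
structure EigenvalueCondition {q : ℕ} (Q : Matrix (Fin q) (Fin q) ℝ) (ρ₁ ρ₂ : ℝ) : Prop where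
  pos : 0 < ρ₁
  bounds : ∀ μ ∈ spectrum ℝ Q, ρ₁ ≤ μ ∧ μ ≤ ρ₂

/-- The conditions on the tuning parameter, the dimension and the eigenvalue bounds. -/
structure TuningCondition (p : ℕ → ℕ) (ρ₁ ρ₂ lam : ℕ → ℝ) : Prop where
  littleO_one : (fun n : ℕ => (p n : ℝ) / √(n : ℝ)) =o[atTop] ρ₁
  littleO_two : (fun n : ℕ => (p n : ℝ) / √(n : ℝ)) =o[atTop] ρ₂
  lam_pos : ∀ n, 0 < lam n
  lam_tendsto : Tendsto lam atTop (𝓝 0)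
  tendsto_one : Tendsto (fun n : ℕ => (p n : ℝ) ^ 2 / (√(n : ℝ) * ρ₁ n * lam n)) atTop (𝓝 0)
  tendsto_two :
    Tendsto (fun n : ℕ => ρ₂ n * (p n : ℝ) ^ 2 / (√(n : ℝ) * ρ₁ n * lam n)) atTop (𝓝 0)

/-- Quantitative nondegeneracy of the asymptotic covariance matrices `G n`: for some `g n > 0`
every eigenvalue of `G n` is at least `g n / n`, where `g n` does not vanish too fast. If `g` is
bounded away from zero (that is, `‖G n ^ (-1/2)‖ = O(√n)`), then the two rate conditions are
implied by those on the bandwidth and on the tuning parameter. -/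
def NondegeneracyCondition (p : ℕ → ℕ) (h ρ₁ : ℕ → ℝ) {k : ℕ → ℕ}
    (G : ∀ n, Matrix (VechIdx (k n)) (VechIdx (k n)) ℝ) : Prop :=
  ∃ g : ℕ → ℝ, (∀ n, 0 < g n) ∧
    (∀ᶠ n in atTop, ∀ μ ∈ spectrum ℝ (G n), g n / (n : ℝ) ≤ μ) ∧
    Tendsto (fun n : ℕ => √(n : ℝ) * p n * (h n ^ 3 + 1 / (n * h n ^ 2)) / √(g n)) atTop (𝓝 0) ∧
    Tendsto (fun n : ℕ => (p n : ℝ) ^ 2 / (√(n : ℝ) * ρ₁ n * √(g n))) atTop (𝓝 0)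

end

end LinODE

open LinODE

-- On a well-behaved design the criterion is a quadratic form in β plus the SCAD penalty. Its
-- coefficients `gramHat` and `crossHat` are plug-in estimators Q̂, b̂ of Q and of b = (∫ m₁' mᵢ
-- w)ᵢ. The population minimizer solves Q β₀ = b, so everything rests on the size and the law of Q̂
-- − Q and b̂ − Q̂ β₀.
--
-- Plug-in estimators. With high probability all bins of width of order h contain about as many
-- observations as expected, and then the local least squares problems are uniformly well
-- conditioned on the whole interval (`KernelCondition.exists_designGood`). The scaled fit errors
-- solve normal equations driven by a Taylor remainder and the noise. Replacing the random moment
-- matrix by its limit leaves only a product of two small terms (`DesignGood.lpErr_decomp`). The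
-- integral of a fit error against a smooth function dominated by the weight is therefore a sample
-- mean of an influence function times the errors, plus a remainder (`DesignGood.linRem_sq_le`). The
-- integration gains one order in the bias, because a shift is moved from the merely continuous
-- third derivative of mⱼ onto the smooth function: the bias is h⁴ before the division by h that a
-- derivative costs. Near the ends of the interval the weight is O(h²), which makes boundary effects
-- negligible. In Frobenius norm the remainders are O_p(p (h³ + 1/(n h²))) = o_p(n^(-1/2)), and the
-- linear parts are O_p(p/√n) (`exists_tightEvents_sampleGood`).
--
-- Oracle property. Once Q̂ − Q and b̂ − Q̂ β₀ are at most τ = D p/√n (`EstGood`), the argument is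
-- deterministic. SCAD is linear with slope λ near zero and constant beyond aλ. Within a distance of
-- order r_n from β₀ the vector Q̂β − b̂ has entries below λ/2. At a local minimizer a nonzero
-- coefficient smaller than λ forces the entry to be exactly λ/2 in absolute value, so the
-- coefficients that should vanish do vanish. The others exceed aλ, where the penalty is flat, and
-- solve the unpenalized normal equations of the leading block (`EstGood.sparse_of_isLocalMin`).
-- Conversely the solution of these equations, padded by zeros, is a local minimizer
-- (`EstGood.exists_isLocalMin`). The estimator that knows the zeros solves the same linear system,
-- which is why the limits agree.
--
-- Normality. The functional γᵀ P^(-1/2) δ of the estimation error δ equals yᵀ Q₁₁ δ, and up to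
-- remainders this is cᵀ vech of the linear part of [b̂, Q̂], with cᵀ G c = 1
-- (`exists_sandwich_functional`, `abs_functional_sub_linStat_le`). Given the design this statistic
-- is exactly Gaussian, and its conditional variance is a sample mean with expectation one. So it is
-- enough that this variance concentrates (`norm_integral_cexp_linStat_sub_le`). Condition (ND)
-- bounds c and y by √(n/g), and its two limits dispose of the two remainders.
--
-- Probabilities are handled by `TightEvents`: a statement is proved for each fixed constant D and
-- all large n, on events whose probability is close to one when D is large.

namespace LinODE

/-! ### The law of the data -/

/-- The uniform distribution on `(0, 1)`. -/
noncomputable abbrev unifLaw : Measure ℝ := volume.restrict (Ioo (0 : ℝ) 1)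

instance : IsProbabilityMeasure unifLaw := ⟨by simp [unifLaw]⟩

/-- The law of `n` independent uniform observation times. -/
noncomputable abbrev designLaw (n : ℕ) : Measure (Fin n → ℝ) := Measure.pi fun _ => unifLaw

/-- The law of one centred Gaussian error. -/
noncomputable abbrev errLaw (σ : ℝ) : Measure ℝ := gaussianReal 0 (σ ^ 2).toNNReal

theorem SamplingCondition.hasLaw_error {Ω : Type*} [MeasurableSpace Ω] {P : Measure Ω}
    {σ : ℝ} {n p : ℕ} {X : Fin n → Ω → ℝ} {ε : Fin n → Fin p → Ω → ℝ}
    (h : SamplingCondition P σ X ε) (i : Fin n) (j : Fin p) : HasLaw (ε i j) (errLaw σ) P := by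
  have := h.law_error i j
  rwa [show (⟨σ ^ 2, sq_nonneg σ⟩ : NNReal) = (σ ^ 2).toNNReal from
    NNReal.eq (Real.coe_toNNReal _ (sq_nonneg σ)).symm] at this

/-- The law of a finite family of independent centred Gaussian errors. -/
noncomputable abbrev noiseLaw (σ : ℝ) (ι : Type*) [Fintype ι] : Measure (ι → ℝ) :=
  Measure.pi fun _ => errLaw σ

/-- The data enter only through this law. Every moment bound is computed on the product of the
design law and the noise law, where the design can be held fixed while the errors are integrated
out. -/
theorem SamplingCondition.hasLaw {Ω : Type*} [MeasurableSpace Ω] {P : Measure Ω}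
    [IsProbabilityMeasure P] {σ : ℝ} {n p : ℕ} {X : Fin n → Ω → ℝ} {ε : Fin n → Fin p → Ω → ℝ}
    (h : SamplingCondition P σ X ε) :
    HasLaw (fun ω => ((fun i => X i ω), (fun ij : Fin n × Fin p => ε ij.1 ij.2 ω)))
      ((designLaw n).prod (noiseLaw σ (Fin n × Fin p))) P := by
  have hm : ∀ s : Fin n ⊕ (Fin n × Fin p),
      AEMeasurable (Sum.elim (fun i => X i) (fun ij => ε ij.1 ij.2) s) P := by
    rintro (i | ij)
    · exact (h.law_time i).aemeasurable
    · exact (h.hasLaw_error ij.1 ij.2).aemeasurable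
  have h1 := (iIndepFun_iff_map_fun_eq_pi_map hm).1 h.indep
  have h2 : (fun s : Fin n ⊕ (Fin n × Fin p) =>
      P.map (Sum.elim (fun i => X i) (fun ij => ε ij.1 ij.2) s)) =
      Sum.elim (fun _ => unifLaw) (fun _ => errLaw σ) := by
    funext s
    rcases s with i | ij
    · exact (h.law_time i).map_eq
    · exact (h.hasLaw_error ij.1 ij.2).map_eq
  have hL : HasLaw (fun ω s => Sum.elim (fun i => X i) (fun ij => ε ij.1 ij.2) s ω)
      (Measure.pi (Sum.elim (fun _ : Fin n => unifLaw)
        (fun _ : Fin n × Fin p => errLaw σ))) P :=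
    ⟨aemeasurable_pi_lambda _ hm, by rw [h1]; simp only [h2]⟩
  have : ∀ s, SigmaFinite ((Sum.elim (fun _ : Fin n => unifLaw)
        (fun _ : Fin n × Fin p => errLaw σ)) s) := by
    rintro (i | ij) <;> simp only [Sum.elim_inl, Sum.elim_inr] <;> infer_instance
  have hE := measurePreserving_sumPiEquivProdPi (X := fun _ : Fin n ⊕ (Fin n × Fin p) => ℝ)
    (Sum.elim (fun _ : Fin n => unifLaw)
        (fun _ : Fin n × Fin p => errLaw σ))
  exact hE.hasLaw.comp hL

theorem integral_unifLaw (f : ℝ → ℝ) : ∫ y, f y ∂unifLaw = ∫ y in (0 : ℝ)..1, f y := by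
  rw [intervalIntegral.integral_of_le zero_le_one, integral_Ioc_eq_integral_Ioo]

theorem memLp_unifLaw {φ : ℝ → ℝ} (hφ : Measurable φ) {M : ℝ}
    (hM : ∀ y ∈ Ioo (0 : ℝ) 1, |φ y| ≤ M) : MemLp φ 2 unifLaw := by
  refine MemLp.of_bound hφ.aestronglyMeasurable M ?_
  exact (ae_restrict_mem measurableSet_Ioo).mono fun y hy => hM y hy

/-- Mean squared error of the sample mean of a bounded function of the observation times. -/
theorem lintegral_sq_sampleMean_le {n : ℕ} {φ : ℝ → ℝ} (hφ : Measurable φ) {M : ℝ}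
    (hM : ∀ y ∈ Ioo (0 : ℝ) 1, |φ y| ≤ M) :
    ∫⁻ x, ENNReal.ofReal (((n : ℝ)⁻¹ * ∑ t, φ (x t) - ∫ y in (0 : ℝ)..1, φ y) ^ 2) ∂designLaw n
      ≤ ENNReal.ofReal ((n : ℝ)⁻¹ * ∫ y in (0 : ℝ)..1, φ y ^ 2)
        + if n = 0 then ENNReal.ofReal ((∫ y in (0 : ℝ)..1, φ y) ^ 2) else 0 := by
  -- For `n = 0` the sample mean is 0, and the extra term of the bound is the whole error.
  rcases Nat.eq_zero_or_pos n with rfl | hn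
  · simp
  have hn' : (n : ℝ) ≠ 0 := by positivity
  rw [if_neg hn.ne', add_zero]
  have hL := memLp_unifLaw hφ hM
  have hLi : ∀ i : Fin n, MemLp (fun x : Fin n → ℝ => φ (x i)) 2 (designLaw n) := fun i =>
    hL.comp_measurePreserving (measurePreserving_eval (fun _ : Fin n => unifLaw) i)
  have hmean : ∀ i : Fin n, ∫ x : Fin n → ℝ, φ (x i) ∂designLaw n = ∫ y in (0 : ℝ)..1, φ y := by
    intro i
    rw [← integral_unifLaw]
    exact integral_comp_eval (μ := fun _ : Fin n => unifLaw) hφ.aestronglyMeasurable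
  have hvar := variance_sum_pi (μ := fun _ : Fin n => unifLaw) (X := fun _ => φ) (fun _ => hL)
  have hS : (∑ i, fun x : Fin n → ℝ => φ (x i)) = fun x => ∑ i, φ (x i) := by
    funext x; simp
  rw [hS] at hvar
  have hSL : MemLp (fun x : Fin n → ℝ => ∑ i, φ (x i)) 2 (designLaw n) :=
    memLp_finsetSum _ fun i _ => hLi i
  have hSm : ∫ x : Fin n → ℝ, ∑ i, φ (x i) ∂designLaw n = n * ∫ y in (0 : ℝ)..1, φ y := by
    rw [integral_finsetSum _ fun i _ => (hLi i).integrable one_le_two]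
    simp [hmean]
  rw [variance_eq_integral hSL.aestronglyMeasurable.aemeasurable, hSm] at hvar
  have hv1 : variance φ unifLaw ≤ ∫ y in (0 : ℝ)..1, φ y ^ 2 := by
    rw [variance_eq_sub hL, integral_unifLaw, integral_unifLaw]
    simp only [Pi.pow_apply]
    linarith [sq_nonneg (∫ y in (0 : ℝ)..1, φ y)]
  have hint : Integrable (fun x : Fin n → ℝ =>
      ((n : ℝ)⁻¹ * ∑ t, φ (x t) - ∫ y in (0 : ℝ)..1, φ y) ^ 2) (designLaw n) := by
    refine MemLp.integrable_sq ?_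
    exact (hSL.const_mul _).sub (memLp_const _)
  rw [← ofReal_integral_eq_lintegral_ofReal hint (ae_of_all _ fun _ => sq_nonneg _)]
  refine ENNReal.ofReal_le_ofReal ?_
  have : ∀ x : Fin n → ℝ, ((n : ℝ)⁻¹ * ∑ t, φ (x t) - ∫ y in (0 : ℝ)..1, φ y) ^ 2 =
      ((n : ℝ)⁻¹) ^ 2 * (∑ t, φ (x t) - n * ∫ y in (0 : ℝ)..1, φ y) ^ 2 := by
    intro x; field_simp
  simp_rw [this]
  rw [integral_const_mul, hvar]
  simp only [Finset.sum_const, Finset.card_univ, Fintype.card_fin, nsmul_eq_mul]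
  calc ((n : ℝ)⁻¹) ^ 2 * (n * variance φ unifLaw) = (n : ℝ)⁻¹ * variance φ unifLaw := by
        field_simp
    _ ≤ _ := by gcongr

/-- With the design fixed every noise term is a linear form in independent Gaussians. Its second
moment, here, and its characteristic function, below, are the only computations made with the error
law. -/
theorem lintegral_sq_noise {ι : Type*} [Fintype ι] (σ : ℝ) (a : ι → ℝ) :
    ∫⁻ e, ENNReal.ofReal ((∑ i, a i * e i) ^ 2) ∂noiseLaw σ ι
      = ENNReal.ofReal (σ ^ 2 * ∑ i, a i ^ 2) := by
  set g := errLaw σ with hg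
  have : IsProbabilityMeasure g := by rw [hg]; infer_instance
  have hid : MemLp id 2 g := memLp_id_gaussianReal 2
  have hL : ∀ i, MemLp (fun y : ℝ => a i * y) 2 g := fun i => hid.const_mul (a i)
  have hvar := variance_sum_pi (μ := fun _ : ι => g) (X := fun i y => a i * y) hL
  have hS : (∑ i, fun x : ι → ℝ => a i * x i) = fun x => ∑ i, a i * x i := by
    funext x; simp
  rw [hS] at hvar
  have hLi : ∀ i, MemLp (fun x : ι → ℝ => a i * x i) 2 (noiseLaw σ ι) := fun i =>
    (hL i).comp_measurePreserving (measurePreserving_eval (fun _ : ι => g) i)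
  have hSL : MemLp (fun x : ι → ℝ => ∑ i, a i * x i) 2 (noiseLaw σ ι) :=
    memLp_finsetSum _ fun i _ => hLi i
  have hmean : ∀ i, ∫ x : ι → ℝ, a i * x i ∂noiseLaw σ ι = 0 := by
    intro i
    rw [integral_const_mul, integral_comp_eval (μ := fun _ : ι => g) (f := fun y => y)
      aestronglyMeasurable_id, hg, integral_id_gaussianReal, mul_zero]
  have hSm : ∫ x : ι → ℝ, ∑ i, a i * x i ∂noiseLaw σ ι = 0 := by
    rw [integral_finsetSum _ fun i _ => (hLi i).integrable one_le_two]
    simp [hmean]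
  rw [variance_eq_integral hSL.aestronglyMeasurable.aemeasurable, hSm] at hvar
  rw [← ofReal_integral_eq_lintegral_ofReal hSL.integrable_sq (ae_of_all _ fun _ => sq_nonneg _)]
  congr 1
  simp only [sub_zero] at hvar
  rw [hvar]
  have : ∀ i, Var[fun y => a i * y; g] = a i ^ 2 * σ ^ 2 := by
    intro i
    rw [variance_const_mul, hg, variance_fun_id_gaussianReal]
    rw [Real.coe_toNNReal _ (sq_nonneg σ)]
  simp_rw [this]
  rw [Finset.mul_sum]
  exact Finset.sum_congr rfl fun i _ => by ring

theorem integral_cexp_noise {ι : Type*} [Fintype ι] (σ s : ℝ) (a : ι → ℝ) :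
    ∫ e, Complex.exp (s * (∑ i, a i * e i : ℝ) * Complex.I) ∂noiseLaw σ ι
      = Complex.exp (-(s ^ 2 * (σ ^ 2 * ∑ i, a i ^ 2) / 2 : ℝ)) := by
  have h1 : ∀ e : ι → ℝ, Complex.exp (s * (∑ i, a i * e i : ℝ) * Complex.I) =
      ∏ i, Complex.exp (((s * a i : ℝ) : ℂ) * (e i : ℂ) * Complex.I) := by
    intro e
    rw [← Complex.exp_sum]
    congr 1
    push_cast
    rw [Finset.mul_sum, Finset.sum_mul]
    exact Finset.sum_congr rfl fun i _ => by ring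
  simp_rw [h1]
  rw [integral_fintype_prod_eq_prod (μ := fun _ : ι => errLaw σ)
    (f := fun i (y : ℝ) => Complex.exp (((s * a i : ℝ) : ℂ) * (y : ℂ) * Complex.I))]
  have h2 : ∀ i, ∫ y : ℝ, Complex.exp (((s * a i : ℝ) : ℂ) * (y : ℂ) * Complex.I)
      ∂(errLaw σ) =
      Complex.exp (-((s * a i) ^ 2 * σ ^ 2 / 2 : ℝ)) := by
    intro i
    have := charFun_gaussianReal (μ := 0) (v := (σ ^ 2).toNNReal) (s * a i)
    rw [charFun_apply_real] at this
    rw [this]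
    congr 1
    push_cast
    rw [Real.coe_toNNReal _ (sq_nonneg σ)]
    push_cast
    ring
  simp_rw [h2]
  rw [← Complex.exp_sum]
  congr 1
  push_cast
  rw [Finset.sum_neg_distrib, Finset.mul_sum, Finset.mul_sum, Finset.sum_div]
  congr 1
  exact Finset.sum_congr rfl fun i _ => by ring


/-! ### Extension of smooth functions from the unit interval -/

theorem uniqueDiffOn_unitInterval : UniqueDiffOn ℝ (Icc (0 : ℝ) 1) :=
  uniqueDiffOn_Icc zero_lt_one

/-- A `C^k` function on `[0, 1]` is the restriction of a `C^k` function on the line whose `k`-th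
derivative is constant to the left and to the right of the interval. -/
theorem exists_contDiff_extension (k : ℕ) (f : ℝ → ℝ) (hf : ContDiffOn ℝ k f (Icc 0 1)) :
    ∃ F : ℝ → ℝ, ContDiff ℝ k F ∧
      (∀ d ≤ k, ∀ x ∈ Icc (0 : ℝ) 1, iteratedDeriv d F x = iteratedDerivWithin d f (Icc 0 1) x) ∧
      (∀ x, ∃ y ∈ Icc (0 : ℝ) 1, iteratedDeriv k F x = iteratedDerivWithin k f (Icc 0 1) y) ∧
      ((∀ d ≤ k, iteratedDerivWithin d f (Icc 0 1) 0 = 0) →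
        ∀ d ≤ k, ∀ x ≤ 0, iteratedDeriv d F x = 0) ∧
      ((∀ d ≤ k, iteratedDerivWithin d f (Icc 0 1) 1 = 0) →
        ∀ d ≤ k, ∀ x, 1 ≤ x → iteratedDeriv d F x = 0) := by
  -- Extend the derivative by induction and integrate it from 0. The base case continues a
  -- continuous function by its end point values. Vanishing beyond an end point is inherited in the
  -- same way.
  induction k generalizing f with
  | zero =>
    refine ⟨IccExtend zero_le_one ((Icc (0 : ℝ) 1).domRestrict f), ?_, ?_, ?_, ?_, ?_⟩
    · rw [Nat.cast_zero, contDiff_zero]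
      exact (continuousOn_iff_continuous_domRestrict.1 hf.continuousOn).Icc_extend'
    · intro d hd x hx
      obtain rfl : d = 0 := by omega
      simp [IccExtend_of_mem _ _ hx]
    · intro x
      exact ⟨projIcc 0 1 zero_le_one x, (projIcc 0 1 zero_le_one x).2, by simp [IccExtend]⟩
    · intro h d hd x hx
      obtain rfl : d = 0 := by omega
      simpa [IccExtend_of_le_left _ _ hx] using h 0 le_rfl
    · intro h d hd x hx
      obtain rfl : d = 0 := by omega
      simpa [IccExtend_of_right_le _ _ hx] using h 0 le_rfl
  | succ k ih =>
    have hU := uniqueDiffOn_unitInterval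
    have hf2 : ContDiffOn ℝ ((k : WithTop ℕ∞) + 1) f (Icc 0 1) := by exact_mod_cast hf
    rw [contDiffOn_succ_iff_derivWithin hU] at hf2
    obtain ⟨hdiff, -, hf'⟩ := hf2
    obtain ⟨G, hG, hGe, hGk, hG0, hG1⟩ := ih (derivWithin f (Icc 0 1)) hf'
    have hGc : Continuous G := hG.continuous
    set F : ℝ → ℝ := fun x => f 0 + ∫ y in (0 : ℝ)..x, G y with hF
    have hFd : ∀ x, HasDerivAt F (G x) x := fun x =>
      (hGc.integral_hasStrictDerivAt 0 x).hasDerivAt.const_add (f 0)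
    have hdF : deriv F = G := funext fun x => (hFd x).deriv
    have hEq : ∀ x ∈ Icc (0 : ℝ) 1, F x = f x := by
      intro x hx
      have : ∫ y in (0 : ℝ)..x, G y = f x - f 0 := by
        refine intervalIntegral.integral_eq_sub_of_hasDerivAt_of_le hx.1
          (hdiff.continuousOn.mono (Icc_subset_Icc_right hx.2)) ?_ (hGc.intervalIntegrable _ _)
        intro y hy
        have hy' : y ∈ Icc (0 : ℝ) 1 := ⟨hy.1.le, hy.2.le.trans hx.2⟩
        have h2 := (hdiff y hy').hasDerivWithinAt.hasDerivAt
          (Icc_mem_nhds hy.1 (hy.2.trans_le hx.2))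
        have h3 := hGe 0 (Nat.zero_le _) y hy'
        simp only [iteratedDeriv_zero, iteratedDerivWithin_zero] at h3
        rwa [h3]
      simp [hF, this]
    have hzero : ∀ (e : ℝ), (∀ d ≤ k + 1, iteratedDerivWithin d f (Icc 0 1) e = 0) →
        ∀ d ≤ k, iteratedDerivWithin d (derivWithin f (Icc 0 1)) (Icc 0 1) e = 0 := by
      intro e h d hd
      rw [← iteratedDerivWithin_succ']
      exact h (d + 1) (by omega)
    refine ⟨F, ?_, ?_, ?_, ?_, ?_⟩
    · have : ContDiff ℝ ((k : WithTop ℕ∞) + 1) F := by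
        rw [contDiff_succ_iff_deriv]
        refine ⟨fun x => (hFd x).differentiableAt, fun h => ?_, by rwa [hdF]⟩
        exact absurd h (by exact_mod_cast WithTop.coe_ne_top)
      exact_mod_cast this
    · intro d hd x hx
      rcases d with _ | d
      · simpa using hEq x hx
      · rw [iteratedDeriv_succ', iteratedDerivWithin_succ', hdF]
        exact hGe d (by omega) x hx
    · intro x
      rw [iteratedDeriv_succ', iteratedDerivWithin_succ', hdF]
      exact hGk x
    · intro h d hd x hx
      have hz := hG0 (hzero 0 h)
      rcases d with _ | d
      · have h0 : ∫ y in (0 : ℝ)..x, G y = 0 := by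
          rw [intervalIntegral.integral_symm, intervalIntegral.integral_zero_ae, neg_zero]
          refine ae_of_all _ fun y hy => ?_
          rw [uIoc_of_le hx] at hy
          simpa using hz 0 (Nat.zero_le _) y hy.2
        have := h 0 (Nat.zero_le _)
        simp only [iteratedDerivWithin_zero] at this
        simp [hF, h0, this]
      · rw [iteratedDeriv_succ', hdF]
        exact hz d (by omega) x hx
    · intro h d hd x hx
      have hz := hG1 (hzero 1 h)
      rcases d with _ | d
      · have h0 : ∫ y in (1 : ℝ)..x, G y = 0 := by
          rw [intervalIntegral.integral_zero_ae]
          refine ae_of_all _ fun y hy => ?_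
          rw [uIoc_of_le hx] at hy
          simpa using hz 0 (Nat.zero_le _) y hy.1.le
        have h1 := h 0 (Nat.zero_le _)
        simp only [iteratedDerivWithin_zero] at h1
        have h2 := hEq 1 (by simp)
        simp only [iteratedDeriv_zero]
        simp only [hF] at h2 ⊢
        rw [← intervalIntegral.integral_add_adjacent_intervals (hGc.intervalIntegrable 0 1)
          (hGc.intervalIntegrable 1 x), h0, add_zero, h2, h1]
      · rw [iteratedDeriv_succ', hdF]
        exact hz d (by omega) x hx

/-- `f 0, …, f 3` are a function on the line and its first three derivatives, with bounds. -/
structure SmoothFun (B : ℝ) (f : ℕ → ℝ → ℝ) : Prop where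
  hasDerivAt : ∀ d < 3, ∀ x, HasDerivAt (f d) (f (d + 1) x) x
  continuous_three : Continuous (f 3)
  bound : ∀ d ≤ 3, ∀ x ∈ Icc (0 : ℝ) 1, |f d x| ≤ B
  bound_three : ∀ x, |f 3 x| ≤ B

/-- `w 0, w 1, w 2` are a nonnegative function supported in `[0, 1]` and its first two derivatives,
with bounds. -/
structure WeightFun (L : ℝ) (w : ℕ → ℝ → ℝ) : Prop where
  hasDerivAt : ∀ d < 2, ∀ x, HasDerivAt (w d) (w (d + 1) x) x
  continuous_two : Continuous (w 2)
  bound : ∀ d ≤ 2, ∀ x, |w d x| ≤ L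
  nonneg : ∀ x, 0 ≤ w 0 x
  eq_zero : ∀ d ≤ 2, ∀ x, x ∉ Ioo (0 : ℝ) 1 → w d x = 0

/-- `f 0, f 1, f 2` are a function and its first two derivatives, bounded by `L`, the function
itself being dominated by the weight `w`. -/
structure TestFun (L : ℝ) (w : ℝ → ℝ) (f : ℕ → ℝ → ℝ) : Prop where
  hasDerivAt : ∀ d < 2, ∀ x, HasDerivAt (f d) (f (d + 1) x) x
  continuous_two : Continuous (f 2)
  bound : ∀ d ≤ 2, ∀ x, |f d x| ≤ L
  bound_weight : ∀ x, |f 0 x| ≤ L * w x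

theorem SmoothFun.continuous {B : ℝ} {f : ℕ → ℝ → ℝ} (hf : SmoothFun B f) {d : ℕ} (hd : d ≤ 3) :
    Continuous (f d) := by
  rcases hd.lt_or_eq with h | rfl
  · exact continuous_iff_continuousAt.2 fun x => (hf.hasDerivAt d h x).continuousAt
  · exact hf.continuous_three

theorem SmoothFun.nonneg_bound {B : ℝ} {f : ℕ → ℝ → ℝ} (hf : SmoothFun B f) : 0 ≤ B :=
  (abs_nonneg _).trans (hf.bound_three 0)

theorem WeightFun.continuous {B : ℝ} {f : ℕ → ℝ → ℝ} (hf : WeightFun B f) {d : ℕ} (hd : d ≤ 2) :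
    Continuous (f d) := by
  rcases hd.lt_or_eq with h | rfl
  · exact continuous_iff_continuousAt.2 fun x => (hf.hasDerivAt d h x).continuousAt
  · exact hf.continuous_two

theorem WeightFun.nonneg_bound {B : ℝ} {f : ℕ → ℝ → ℝ} (hf : WeightFun B f) : 0 ≤ B :=
  (abs_nonneg _).trans (hf.bound 0 (by omega) 0)

theorem TestFun.continuous {B : ℝ} {w : ℝ → ℝ} {f : ℕ → ℝ → ℝ} (hf : TestFun B w f) {d : ℕ}
    (hd : d ≤ 2) : Continuous (f d) := by
  rcases hd.lt_or_eq with h | rfl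
  · exact continuous_iff_continuousAt.2 fun x => (hf.hasDerivAt d h x).continuousAt
  · exact hf.continuous_two

theorem TestFun.nonneg_bound {B : ℝ} {w : ℝ → ℝ} {f : ℕ → ℝ → ℝ} (hf : TestFun B w f) : 0 ≤ B :=
  (abs_nonneg _).trans (hf.bound 0 (by omega) 0)

theorem TestFun.abs_sub_le {B : ℝ} {w : ℝ → ℝ} {f : ℕ → ℝ → ℝ} (hf : TestFun B w f) {d : ℕ}
    (hd : d < 2) (x y : ℝ) : |f d y - f d x| ≤ B * |y - x| := by
  have := Convex.norm_image_sub_le_of_norm_hasDerivWithin_le (f := f d) (f' := f (d + 1))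
    (s := univ) (C := B) (fun z _ => (hf.hasDerivAt d hd z).hasDerivWithinAt)
    (fun z _ => hf.bound (d + 1) (by omega) z) convex_univ (mem_univ x) (mem_univ y)
  simpa using this

theorem exists_smoothFun {f : ℝ → ℝ} {B : ℝ} (hf : ContDiffOn ℝ 3 f (Icc 0 1))
    (hB : ∀ d : ℕ, d ≤ 3 → ∀ x ∈ Icc (0 : ℝ) 1, |iteratedDerivWithin d f (Icc 0 1) x| ≤ B) :
    ∃ F : ℕ → ℝ → ℝ, SmoothFun B F ∧ ∀ x ∈ Icc (0 : ℝ) 1, F 0 x = f x := by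
  obtain ⟨F, hF, h1, h2, -, -⟩ := exists_contDiff_extension 3 f (by exact_mod_cast hf)
  refine ⟨fun d => iteratedDeriv d F, ⟨?_, ?_, ?_, ?_⟩, ?_⟩
  · intro d hd x
    rw [iteratedDeriv_succ]
    exact (hF.differentiable_iteratedDeriv d (by exact_mod_cast hd) x).hasDerivAt
  · exact hF.continuous_iteratedDeriv 3 le_rfl
  · intro d hd x hx
    simp only [h1 d hd x hx]
    exact hB d hd x hx
  · intro x
    obtain ⟨y, hy, hxy⟩ := h2 x
    simp only [hxy]
    exact hB 3 le_rfl y hy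
  · intro x hx
    simpa using h1 0 (by omega) x hx

/-- As `w` and two derivatives vanish at both end points, the extension is zero outside the interval
and still twice continuously differentiable. This is why no boundary terms appear later. -/
theorem WeightCondition.exists_weightFun {w : ℝ → ℝ} (hw : WeightCondition w) :
    ∃ L : ℝ, ∃ W : ℕ → ℝ → ℝ, WeightFun L W ∧ ∀ x ∈ Icc (0 : ℝ) 1, W 0 x = w x := by
  obtain ⟨F, hF, h1, -, h3, h4⟩ := exists_contDiff_extension 2 w (by exact_mod_cast hw.contDiffOn)
  have hz : ∀ d ≤ 2, ∀ x, x ∉ Ioo (0 : ℝ) 1 → iteratedDeriv d F x = 0 := by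
    intro d hd x hx
    rcases le_or_gt x 0 with h | h
    · exact h3 (fun d hd => hw.left d hd) d hd x h
    · exact h4 (fun d hd => hw.right d hd) d hd x (not_lt.1 fun h' => hx ⟨h, h'⟩)
  have hcont : ∀ d ≤ 2, Continuous (iteratedDeriv d F) := fun d hd =>
    hF.continuous_iteratedDeriv d (by exact_mod_cast hd)
  have hb : ∀ d ≤ 2, ∃ L : ℝ, ∀ x, |iteratedDeriv d F x| ≤ L := by
    intro d hd
    obtain ⟨L, hL⟩ := isCompact_Icc.exists_bound_of_continuousOn
      (hcont d hd).continuousOn (s := Icc (0 : ℝ) 1)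
    refine ⟨max L 0, fun x => ?_⟩
    by_cases hx : x ∈ Ioo (0 : ℝ) 1
    · exact (hL x (Ioo_subset_Icc_self hx)).trans (le_max_left _ _)
    · rw [hz d hd x hx, abs_zero]
      exact le_max_right _ _
  obtain ⟨L0, hL0⟩ := hb 0 (by omega)
  obtain ⟨L1, hL1⟩ := hb 1 (by omega)
  obtain ⟨L2, hL2⟩ := hb 2 (by omega)
  refine ⟨max L0 (max L1 L2), fun d => iteratedDeriv d F, ⟨?_, hcont 2 le_rfl, ?_, ?_, hz⟩, ?_⟩
  · intro d hd x
    rw [iteratedDeriv_succ]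
    exact (hF.differentiable_iteratedDeriv d (by exact_mod_cast hd) x).hasDerivAt
  · intro d hd x
    interval_cases d
    · exact (hL0 x).trans (le_max_left _ _)
    · exact (hL1 x).trans ((le_max_left _ _).trans (le_max_right _ _))
    · exact (hL2 x).trans ((le_max_right _ _).trans (le_max_right _ _))
  · intro x
    by_cases hx : x ∈ Icc (0 : ℝ) 1
    · have := h1 0 (by omega) x hx
      simp only [iteratedDerivWithin_zero] at this
      rw [this]
      exact hw.nonneg x hx
    · exact (hz 0 (by omega) x fun h => hx (Ioo_subset_Icc_self h)).ge
  · intro x hx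
    simpa using h1 0 (by omega) x hx

/-- Near the boundary of the interval the weight is of second order. -/
theorem WeightFun.le_sq {L : ℝ} {w : ℕ → ℝ → ℝ} (hw : WeightFun L w) {h x : ℝ} (hh : 0 ≤ h)
    (hx : x ∉ Ioo h (1 - h)) : w 0 x ≤ L * h ^ 2 := by
  have hL := hw.nonneg_bound
  -- Taylor expansion at an end point `e`: `w''` is bounded by `L` and `w`, `w'` vanish at `e`.
  -- Within distance `h` this gives `|w'| ≤ L h`, and then `w ≤ L h²`.
  have main : ∀ e, e ∉ Ioo (0 : ℝ) 1 → |x - e| ≤ h → w 0 x ≤ L * h ^ 2 := by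
    intro e he hxe
    have h1 : ∀ s, |s - e| ≤ h → |w 1 s| ≤ L * h := by
      intro s hs
      have := Convex.norm_image_sub_le_of_norm_hasDerivWithin_le (f := w 1) (f' := w 2)
        (s := univ) (C := L) (fun z _ => (hw.hasDerivAt 1 (by omega) z).hasDerivWithinAt)
        (fun z _ => hw.bound 2 (by omega) z) convex_univ (mem_univ e) (mem_univ s)
      rw [hw.eq_zero 1 (by omega) e he, sub_zero] at this
      simp only [Real.norm_eq_abs] at this
      exact this.trans (by gcongr)
    have := Convex.norm_image_sub_le_of_norm_hasDerivWithin_le (f := w 0) (f' := w 1)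
      (s := uIcc e x) (C := L * h) (fun z _ => (hw.hasDerivAt 0 (by omega) z).hasDerivWithinAt)
      (fun s hs => h1 s ((abs_sub_left_of_mem_uIcc hs).trans (by rwa [abs_sub_comm] at hxe ⊢)))
      (convex_uIcc e x) left_mem_uIcc right_mem_uIcc
    rw [hw.eq_zero 0 (by omega) e he, sub_zero] at this
    simp only [Real.norm_eq_abs] at this
    calc w 0 x ≤ |w 0 x| := le_abs_self _
      _ ≤ L * h * |x - e| := this
      _ ≤ L * h * h := by gcongr
      _ = _ := by ring
  by_cases hx0 : x ∈ Ioo (0 : ℝ) 1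
  · rcases le_or_gt x h with h1 | h1
    · exact main 0 (by simp) (by rw [sub_zero, abs_of_pos hx0.1]; exact h1)
    · have : 1 - h ≤ x := not_lt.1 fun h2 => hx ⟨h1, h2⟩
      exact main 1 (by simp) (by rw [abs_sub_comm, abs_of_pos (by linarith [hx0.2])]; linarith)
  · rw [hw.eq_zero 0 (by omega) x hx0]
    positivity

/-- The product of a smooth function with the weight is a test function. -/
theorem WeightFun.testFun_mul {B L : ℝ} {w m : ℕ → ℝ → ℝ} (hw : WeightFun L w)
    (hd : ∀ d < 2, ∀ x, HasDerivAt (m d) (m (d + 1) x) x) (hc : Continuous (m 2)) (hB0 : 0 ≤ B)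
    (hB : ∀ d ≤ 2, ∀ x ∈ Icc (0 : ℝ) 1, |m d x| ≤ B) :
    TestFun (max B (4 * B * L)) (w 0) (fun d x =>
      match d with
      | 0 => m 0 x * w 0 x
      | 1 => m 1 x * w 0 x + m 0 x * w 1 x
      | _ => m 2 x * w 0 x + 2 * (m 1 x * w 1 x) + m 0 x * w 2 x) := by
  have hL := hw.nonneg_bound
  have hmul : ∀ i ≤ 2, ∀ j ≤ 2, ∀ x, |m i x * w j x| ≤ B * L := by
    intro i hi j hj x
    by_cases hx : x ∈ Ioo (0 : ℝ) 1
    · rw [abs_mul]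
      exact mul_le_mul (hB i hi x (Ioo_subset_Icc_self hx)) (hw.bound j hj x) (abs_nonneg _) hB0
    · rw [hw.eq_zero j hj x hx]; simp; positivity
  have hBL : 0 ≤ B * L := by positivity
  refine ⟨?_, ?_, ?_, ?_⟩
  · intro d hd' x
    interval_cases d
    · exact (hd 0 (by omega) x).mul (hw.hasDerivAt 0 (by omega) x)
    · have := ((hd 1 (by omega) x).mul (hw.hasDerivAt 0 (by omega) x)).add
        ((hd 0 (by omega) x).mul (hw.hasDerivAt 1 (by omega) x))
      refine this.congr_deriv ?_
      simp only [zero_add]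
      ring
  · have hc' : ∀ i < 2, Continuous (m i) := fun i hi =>
      continuous_iff_continuousAt.2 fun x => (hd i hi x).continuousAt
    have h0 := hc' 0 (by omega)
    have h1 := hc' 1 (by omega)
    have hw0 := hw.continuous (d := 0) (by omega)
    have hw1 := hw.continuous (d := 1) (by omega)
    have hw2 := hw.continuous (d := 2) (by omega)
    fun_prop
  · intro d hd' x
    refine le_trans ?_ (le_max_right _ _)
    interval_cases d
    · have := hmul 0 (by omega) 0 (by omega) x
      simp only
      linarith
    · have h1 := hmul 1 (by omega) 0 (by omega) x
      have h2 := hmul 0 (by omega) 1 (by omega) x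
      have := abs_add_le (m 1 x * w 0 x) (m 0 x * w 1 x)
      simp only
      linarith
    -- The coefficients 1, 2, 1 of the second derivative of a product add up to the factor 4 of the
    -- bound.
    · have h1 := hmul 2 (by omega) 0 (by omega) x
      have h2 := hmul 1 (by omega) 1 (by omega) x
      have h3 := hmul 0 (by omega) 2 (by omega) x
      have := abs_add_three (m 2 x * w 0 x) (2 * (m 1 x * w 1 x)) (m 0 x * w 2 x)
      rw [abs_mul 2, abs_two] at this
      simp only
      linarith
  · intro x
    simp only
    have hwx := hw.nonneg x
    rw [abs_mul, abs_of_nonneg hwx]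
    by_cases hx : x ∈ Ioo (0 : ℝ) 1
    · gcongr
      exact (hB 0 (by omega) x (Ioo_subset_Icc_self hx)).trans (le_max_left _ _)
    · rw [hw.eq_zero 0 (by omega) x hx]; simp


/-! ### The kernel -/

/-- A symmetric kernel supported in `[-1, 1]` that vanished on `(0, 1)` would vanish off three
points and could not integrate to one. -/
theorem KernelCondition.exists_pos {K : ℝ → ℝ} (hK : KernelCondition K) :
    ∃ u ∈ Ioo (0 : ℝ) 1, 0 < K u := by
  by_contra! h
  have h0 : ∀ u ∈ Ioo (0 : ℝ) 1, K u = 0 := fun u hu => le_antisymm (h u hu) (hK.nonneg u)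
  have hae : K =ᵐ[volume] 0 := by
    have hfin : ({-1, 0, 1} : Set ℝ).Finite := by simp
    have := hfin.measure_zero volume
    rw [← compl_mem_ae_iff] at this
    filter_upwards [this] with u hu
    simp only [mem_compl_iff, mem_insert_iff, mem_singleton_iff, not_or] at hu
    obtain ⟨hu1, hu2, hu3⟩ := hu
    by_contra hne
    obtain ⟨h1, h2⟩ := hK.support (Function.mem_support.2 hne)
    rcases lt_or_gt_of_ne hu2 with h3 | h3
    · have := h0 (-u) ⟨by linarith, by
        have := lt_of_le_of_ne h1 (Ne.symm hu1); linarith⟩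
      rw [hK.symm] at this
      exact hne this
    · exact hne (h0 u ⟨h3, lt_of_le_of_ne h2 hu3⟩)
  have := hK.integral_eq_one
  rw [integral_congr_ae hae] at this
  simp at this

/-- An interval on one side of the origin is what is needed at the boundary: the fit at `x` is
controlled by the observations on the side of `x` that faces the interior, and by symmetry of the
kernel either side will do. -/
theorem KernelCondition.exists_interval {K : ℝ → ℝ} (hK : KernelCondition K) :
    ∃ κ a b : ℝ, 0 < κ ∧ 0 < a ∧ a < b ∧ b < 1 ∧ ∀ u ∈ Icc a b, κ ≤ K u := by
  obtain ⟨u, hu, hpos⟩ := hK.exists_pos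
  have h1 : ∀ᶠ y in 𝓝 u, K u / 2 < K y :=
    hK.continuous.continuousAt.eventually (lt_mem_nhds (by linarith))
  have h2 : ∀ᶠ y in 𝓝 u, y ∈ Ioo (0 : ℝ) 1 := Ioo_mem_nhds hu.1 hu.2
  obtain ⟨r, hr, hball⟩ := Metric.eventually_nhds_iff.1 (h1.and h2)
  have hd : ∀ y ∈ Icc (u - r / 2) (u + r / 2), dist y u < r := fun y hy => by
    rw [Real.dist_eq, abs_lt]; constructor <;> linarith [hy.1, hy.2]
  refine ⟨K u / 2, u - r / 2, u + r / 2, by linarith, ?_, by linarith, ?_, fun y hy =>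
    (hball (hd y hy)).1.le⟩
  · exact (hball (hd (u - r / 2) ⟨le_rfl, by linarith⟩)).2.1
  · exact (hball (hd (u + r / 2) ⟨by linarith, le_rfl⟩)).2.2

theorem KernelCondition.eq_zero {K : ℝ → ℝ} (hK : KernelCondition K) {u : ℝ} (hu : 1 < |u|) :
    K u = 0 := by
  by_contra hne
  exact absurd (abs_le.2 (hK.support (Function.mem_support.2 hne))) (not_le.2 hu)

theorem KernelCondition.hasCompactSupport {K : ℝ → ℝ} (hK : KernelCondition K) :
    HasCompactSupport K :=
  HasCompactSupport.of_support_subset_isCompact isCompact_Icc hK.support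

/-- A polynomial of degree at most three. -/
def cubic (v : Fin 4 → ℝ) (u : ℝ) : ℝ := ∑ i, v i * u ^ (i : ℕ)

theorem cubic_eq_zero {v : Fin 4 → ℝ} {u : Fin 4 → ℝ} (hu : Function.Injective u)
    (h : ∀ r, cubic v (u r) = 0) : v = 0 := by
  refine Matrix.eq_zero_of_mulVec_eq_zero (Matrix.det_vandermonde_ne_zero_iff.2 hu) ?_
  funext r
  simpa [Matrix.mulVec, dotProduct, Matrix.vandermonde_apply, cubic, mul_comm] using h r

/-- Four separated points determine a cubic, quantitatively. -/
theorem exists_cubic_lower_bound {a δ : ℝ} (hδ : 0 < δ) :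
    ∃ c : ℝ, 0 < c ∧ ∀ u : Fin 4 → ℝ,
      (∀ r : Fin 4, u r ∈ Icc (a + 2 * (r : ℕ) * δ) (a + (2 * (r : ℕ) + 1) * δ)) →
      ∀ v : Fin 4 → ℝ, c * ∑ i, v i ^ 2 ≤ ∑ r, cubic v (u r) ^ 2 := by
  set I : Fin 4 → Set ℝ := fun r => Icc (a + 2 * (r : ℕ) * δ) (a + (2 * (r : ℕ) + 1) * δ) with hI
  set s : Set ((Fin 4 → ℝ) × EuclideanSpace ℝ (Fin 4)) :=
    (univ.pi I) ×ˢ Metric.sphere (0 : EuclideanSpace ℝ (Fin 4)) 1 with hs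
  -- The sum of squares is homogeneous in the coefficients, so the constant is its minimum over
  -- nodes in the four intervals and coefficients on the unit sphere. The minimum is attained by
  -- compactness and is positive because the nodes are distinct.
  have hsc : IsCompact s :=
    (isCompact_univ_pi fun r => isCompact_Icc).prod (isCompact_sphere _ _)
  have hsne : s.Nonempty := by
    refine ⟨(fun r => a + 2 * (r : ℕ) * δ, EuclideanSpace.single 0 1), ?_, ?_⟩
    · intro r _
      exact ⟨le_rfl, by nlinarith⟩
    · simp
  have hcont : Continuous fun q : (Fin 4 → ℝ) × EuclideanSpace ℝ (Fin 4) =>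
      ∑ r, cubic (fun i => q.2 i) (q.1 r) ^ 2 := by
    unfold cubic
    refine continuous_finsetSum _ fun r _ => Continuous.pow (continuous_finsetSum _ fun i _ => ?_) 2
    refine Continuous.mul ?_ (by fun_prop)
    fun_prop
  obtain ⟨q, hq, hmin⟩ := hsc.exists_isMinOn hsne hcont.continuousOn
  -- Consecutive intervals are separated by a gap of length `δ`.
  have hinj : ∀ u : Fin 4 → ℝ, (∀ r, u r ∈ I r) → Function.Injective u := by
    intro u hu r r' hrr
    by_contra hne
    have key : ∀ r r' : Fin 4, r < r' → u r < u r' := by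
      intro r r' hlt
      have h1 := (hu r).2
      have h2 := (hu r').1
      have h3 : ((r : ℕ) : ℝ) + 1 ≤ ((r' : ℕ) : ℝ) := by exact_mod_cast hlt
      nlinarith
    rcases lt_or_gt_of_ne hne with h | h
    · exact (key _ _ h).ne hrr
    · exact (key _ _ h).ne' hrr
  have hcpos : 0 < ∑ r, cubic (fun i => q.2 i) (q.1 r) ^ 2 := by
    refine lt_of_le_of_ne (Finset.sum_nonneg fun _ _ => sq_nonneg _) fun h0 => ?_
    have h1 := (Finset.sum_eq_zero_iff_of_nonneg fun _ _ => sq_nonneg _).1 h0.symm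
    have h2 := cubic_eq_zero (hinj q.1 fun r => hq.1 r (mem_univ r))
      fun r => pow_eq_zero_iff two_ne_zero |>.1 (h1 r (Finset.mem_univ r))
    have h3 : q.2 = 0 := by
      ext i
      exact congrFun h2 i
    have h4 := hq.2
    rw [h3] at h4
    simp at h4
  refine ⟨_, hcpos, fun u hu v => ?_⟩
  set V : EuclideanSpace ℝ (Fin 4) := WithLp.toLp 2 v with hV
  have hVn : ‖V‖ ^ 2 = ∑ i, v i ^ 2 := by
    rw [EuclideanSpace.norm_sq_eq]; simp [hV]
  rcases eq_or_ne V 0 with h0 | h0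
  · rw [h0] at hVn
    rw [← hVn]
    simp only [norm_zero, ne_eq, OfNat.ofNat_ne_zero, not_false_eq_true, zero_pow, mul_zero]
    exact Finset.sum_nonneg fun _ _ => sq_nonneg _
  · have hVp : 0 < ‖V‖ := norm_pos_iff.2 h0
    have hmem : ((u, ‖V‖⁻¹ • V) : (Fin 4 → ℝ) × EuclideanSpace ℝ (Fin 4)) ∈ s := by
      refine ⟨fun r _ => hu r, ?_⟩
      simp [norm_smul, hVp.ne']
    have h1 := hmin hmem
    simp only [mem_ofPred_eq] at h1
    have h2 : ∀ r, cubic (fun i => (‖V‖⁻¹ • V) i) (u r) = ‖V‖⁻¹ * cubic v (u r) := by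
      intro r
      simp only [cubic, Finset.mul_sum]
      exact Finset.sum_congr rfl fun i _ => by simp [hV, mul_assoc]
    simp_rw [h2, mul_pow] at h1
    rw [← Finset.mul_sum] at h1
    rw [← hVn]
    calc _ ≤ ((‖V‖⁻¹) ^ 2 * ∑ r, cubic v (u r) ^ 2) * ‖V‖ ^ 2 := by gcongr
      _ = _ := by field_simp

/-! ### Regular designs -/

/-- The number of observation times in a set. -/
noncomputable def hits {n : ℕ} (x : Fin n → ℝ) (s : Set ℝ) : ℝ :=
  ∑ t, s.indicator (fun _ => (1 : ℝ)) (x t)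

/-- The observation times lie in the open interval, and each of `N` bins of equal length contains
about as many of them as expected. -/
def BinsRegular (n N : ℕ) : Set (Fin n → ℝ) :=
  {x | (∀ t, x t ∈ Ioo (0 : ℝ) 1) ∧ ∀ s < N,
    |(n : ℝ)⁻¹ * hits x (Ico ((s : ℝ) / N) ((s + 1 : ℝ) / N)) - (N : ℝ)⁻¹| < (2 * N : ℝ)⁻¹}

theorem measurable_hits {n : ℕ} {s : Set ℝ} (hs : MeasurableSet s) :
    Measurable fun x : Fin n → ℝ => hits x s := by
  unfold hits
  refine Finset.measurable_fun_sum _ fun t _ => ?_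
  exact (measurable_const.indicator hs).comp (measurable_pi_apply t)

theorem measurableSet_binsRegular (n N : ℕ) : MeasurableSet (BinsRegular n N) := by
  have : BinsRegular n N = (⋂ t, {x : Fin n → ℝ | x t ∈ Ioo (0 : ℝ) 1}) ∩ ⋂ s, ⋂ (_ : s < N),
      {x | |(n : ℝ)⁻¹ * hits x (Ico ((s : ℝ) / N) ((s + 1 : ℝ) / N)) - (N : ℝ)⁻¹|
        < (2 * N : ℝ)⁻¹} := by
    ext x; simp [BinsRegular]
  rw [this]
  refine MeasurableSet.inter ?_ ?_
  · exact MeasurableSet.iInter fun t => measurableSet_Ioo.preimage (measurable_pi_apply t)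
  · refine MeasurableSet.iInter fun s => MeasurableSet.iInter fun _ => ?_
    refine measurableSet_lt ?_ measurable_const
    have := measurable_hits (n := n) (measurableSet_Ico (a := (s : ℝ) / N) (b := (s + 1 : ℝ) / N))
    fun_prop

theorem ae_mem_Ioo_designLaw (n : ℕ) : ∀ᵐ x ∂designLaw n, ∀ t, x t ∈ Ioo (0 : ℝ) 1 := by
  refine ae_all_iff.2 fun t => ?_
  have h := (measurePreserving_eval (fun _ : Fin n => unifLaw) t)
  exact h.quasiMeasurePreserving.ae (ae_restrict_mem measurableSet_Ioo)

/-- Chebyshev's inequality for each bin: its frequency has variance at most `1 / (n N)` and the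
tolerance is `1 / (2 N)`, so it fails with probability at most `4 N / n`. There are `N` bins. -/
theorem designLaw_binsRegular_compl_le {n N : ℕ} (hn : 0 < n) (hN : 0 < N) :
    designLaw n (BinsRegular n N)ᶜ ≤ ENNReal.ofReal (4 * (N : ℝ) ^ 2 / n) := by
  have hn' : (0 : ℝ) < n := by exact_mod_cast hn
  have hN' : (0 : ℝ) < N := by exact_mod_cast hN
  set b : ℕ → Set ℝ := fun s => Ico ((s : ℝ) / N) ((s + 1 : ℝ) / N) with hb
  set φ : ℕ → ℝ → ℝ := fun s => (b s).indicator fun _ => 1 with hφ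
  set E : ℕ → Set (Fin n → ℝ) := fun s =>
    {x | (2 * N : ℝ)⁻¹ ≤ |(n : ℝ)⁻¹ * hits x (b s) - (N : ℝ)⁻¹|} with hE
  have hint : ∀ s < N, ∫ y in (0 : ℝ)..1, φ s y = (N : ℝ)⁻¹ := by
    intro s hs
    have hs' : (s : ℝ) + 1 ≤ N := by exact_mod_cast hs
    rw [intervalIntegral.integral_of_le zero_le_one, integral_Ioc_eq_integral_Ioo,
      ← integral_Ico_eq_integral_Ioo, integral_indicator measurableSet_Ico,
      Measure.restrict_restrict measurableSet_Ico, inter_eq_left.2]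
    · simp only [integral_const, smul_eq_mul, mul_one, measureReal_restrict_apply_univ]
      rw [Real.volume_real_Ico_of_le (by gcongr; linarith)]
      field_simp
      ring
    · refine Ico_subset_Ico (by positivity) ?_
      rw [div_le_one hN']
      exact hs'
  have hEs : ∀ s < N, designLaw n (E s) ≤ ENNReal.ofReal (4 * (N : ℝ) / n) := by
    intro s hs
    have hφm : Measurable (φ s) := measurable_const.indicator measurableSet_Ico
    have h1 := lintegral_sq_sampleMean_le (n := n) hφm (M := 1) fun y _ => by
      simp only [hφ, indicator]; split_ifs <;> simp
    rw [if_neg hn.ne', add_zero, hint s hs] at h1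
    have hsq : ∀ y, φ s y ^ 2 = φ s y := fun y => by
      simp only [hφ, indicator]; split_ifs <;> simp
    simp_rw [hsq] at h1
    rw [hint s hs] at h1
    have h2 : designLaw n (E s) ≤ designLaw n {x | ENNReal.ofReal (((2 * N : ℝ)⁻¹) ^ 2) ≤
        ENNReal.ofReal (((n : ℝ)⁻¹ * ∑ t, φ s (x t) - (N : ℝ)⁻¹) ^ 2)} := by
      refine measure_mono fun x hx => ENNReal.ofReal_le_ofReal ?_
      rw [← sq_abs (_ - _)]
      have hx' : (2 * N : ℝ)⁻¹ ≤ |(n : ℝ)⁻¹ * ∑ t, φ s (x t) - (N : ℝ)⁻¹| := hx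
      gcongr
    refine h2.trans ((meas_ge_le_lintegral_div ?_ ?_ ENNReal.ofReal_ne_top).trans ?_)
    · refine Measurable.aemeasurable ?_
      have : Measurable fun x : Fin n → ℝ => ∑ t, φ s (x t) :=
        Finset.measurable_fun_sum _ fun t _ => hφm.comp (measurable_pi_apply t)
      fun_prop
    · simpa using by positivity
    · refine (ENNReal.div_le_div_right h1 _).trans ?_
      rw [← ENNReal.ofReal_div_of_pos (by positivity)]
      refine ENNReal.ofReal_le_ofReal (le_of_eq ?_)
      field_simp
      ring
  have hsub : (BinsRegular n N)ᶜ ⊆ {x | ∀ t, x t ∈ Ioo (0 : ℝ) 1}ᶜ ∪ ⋃ s ∈ Finset.range N, E s := by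
    intro x hx
    by_contra hx2
    simp only [mem_union, mem_compl_iff, mem_ofPred_eq, not_or, not_not, mem_iUnion,
      Finset.mem_range, not_exists, hE, not_le] at hx2
    exact hx ⟨hx2.1, fun s hs => hx2.2 s hs⟩
  calc designLaw n (BinsRegular n N)ᶜ
      ≤ designLaw n {x | ∀ t, x t ∈ Ioo (0 : ℝ) 1}ᶜ
        + designLaw n (⋃ s ∈ Finset.range N, E s) :=
        (measure_mono hsub).trans (measure_union_le _ _)
    _ ≤ 0 + ∑ s ∈ Finset.range N, designLaw n (E s) := by
        gcongr
        · exact (ae_mem_Ioo_designLaw n).le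
        · exact measure_biUnion_finset_le _ _
    _ ≤ ∑ s ∈ Finset.range N, ENNReal.ofReal (4 * (N : ℝ) / n) := by
        rw [zero_add]
        exact Finset.sum_le_sum fun s hs => hEs s (Finset.mem_range.1 hs)
    _ = _ := by
        rw [Finset.sum_const, Finset.card_range, ← ENNReal.ofReal_nsmul]
        congr 1
        rw [nsmul_eq_mul]
        ring

/-- The weighted least squares problems of the local cubic fits are uniformly well conditioned. -/
structure DesignGood {n : ℕ} (K : ℝ → ℝ) (c₀ C₁ h : ℝ) (X : Fin n → ℝ) : Prop where
  lower : ∀ x ∈ Icc (0 : ℝ) 1, ∀ v : Fin 4 → ℝ, c₀ * ∑ i, v i ^ 2 ≤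
    ((n : ℝ) * h)⁻¹ * ∑ t, K ((X t - x) / h) * cubic v ((X t - x) / h) ^ 2
  upper : ∀ x, ((n : ℝ) * h)⁻¹ * hits X (Icc (x - h) (x + h)) ≤ C₁

theorem hits_eq_card {n : ℕ} (x : Fin n → ℝ) (s : Set ℝ) [DecidablePred (· ∈ s)] :
    hits x s = (Finset.univ.filter fun t => x t ∈ s).card := by
  simp [hits, indicator, Finset.sum_boole]

/-- At most `N (b - a) + 2` bins can meet the interval, and a regular bin holds at most `2 n / N`
points. -/
theorem BinsRegular.upper {n N : ℕ} (hn : 0 < n) (hN : 0 < N) {X : Fin n → ℝ}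
    (hX : X ∈ BinsRegular n N) {a b : ℝ} (hab : a ≤ b) :
    hits X (Icc a b) ≤ n * (2 * (b - a) + 4 / N) := by
  have hn' : (0 : ℝ) < n := by exact_mod_cast hn
  have hN' : (0 : ℝ) < N := by exact_mod_cast hN
  set F := (Finset.range N).filter fun s : ℕ => N * a - 1 ≤ (s : ℝ) ∧ (s : ℝ) ≤ N * b with hF
  have hcard : (F.card : ℝ) ≤ N * (b - a) + 2 := by
    have h1 : F.card ≤ (Finset.Icc ⌈N * a - 1⌉ ⌊N * b⌋).card := by
      refine Finset.card_le_card_of_injOn (fun s : ℕ => (s : ℤ)) ?_ Nat.cast_injective.injOn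
      intro s hs
      simp only [hF, Finset.coe_filter, Finset.mem_range, mem_ofPred_eq] at hs
      simp only [Finset.coe_Icc, mem_Icc]
      refine ⟨Int.ceil_le.2 (by exact_mod_cast hs.2.1), Int.le_floor.2 (by exact_mod_cast hs.2.2)⟩
    rw [Int.card_Icc] at h1
    have h2 : (⌊N * b⌋ : ℝ) ≤ N * b := Int.floor_le _
    have h3 : (N * a - 1 : ℝ) ≤ ⌈N * a - 1⌉ := Int.le_ceil _
    have h4 : ((⌊N * b⌋ + 1 - ⌈N * a - 1⌉).toNat : ℝ) ≤ max ((⌊N * b⌋ : ℝ) + 1 - ⌈N * a - 1⌉) 0 := by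
      have : (((⌊N * b⌋ + 1 - ⌈N * a - 1⌉).toNat : ℤ) : ℝ) =
        ((max (⌊N * b⌋ + 1 - ⌈N * a - 1⌉) 0 : ℤ) : ℝ) := by rw [Int.toNat_eq_max]
      push_cast at this
      rw [← this]
    have h5 : 0 ≤ N * (b - a) := mul_nonneg hN'.le (by linarith)
    have h6 : (F.card : ℝ) ≤ ((⌊N * b⌋ + 1 - ⌈N * a - 1⌉).toNat : ℝ) := by exact_mod_cast h1
    refine h6.trans (h4.trans (max_le ?_ (by linarith)))
    nlinarith
  have hle : hits X (Icc a b) ≤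
      ∑ s ∈ F, hits X (Ico ((s : ℝ) / N) ((s + 1 : ℝ) / N)) := by
    unfold hits
    rw [Finset.sum_comm]
    refine Finset.sum_le_sum fun t _ => ?_
    have hnn : ∀ s ∈ F, (0 : ℝ) ≤ (Ico ((s : ℝ) / N) ((s + 1 : ℝ) / N)).indicator
        (fun _ => (1 : ℝ)) (X t) := fun s _ => indicator_nonneg (fun _ _ => zero_le_one) _
    by_cases ht : X t ∈ Icc a b
    · rw [indicator_of_mem ht]
      set s := ⌊N * X t⌋₊ with hs
      have hXt := hX.1 t
      have hpos : 0 ≤ N * X t := mul_nonneg hN'.le hXt.1.le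
      have h1 : (s : ℝ) ≤ N * X t := Nat.floor_le hpos
      have h2 : N * X t < s + 1 := Nat.lt_floor_add_one _
      have hsF : s ∈ F := by
        simp only [hF, Finset.mem_filter, Finset.mem_range]
        refine ⟨?_, ?_, ?_⟩
        · have : (s : ℝ) < N := h1.trans_lt (by nlinarith [hXt.2])
          exact_mod_cast this
        · nlinarith [ht.1]
        · nlinarith [ht.2]
      have hmem : X t ∈ Ico ((s : ℝ) / N) ((s + 1 : ℝ) / N) := by
        rw [mem_Ico, div_le_iff₀ hN', lt_div_iff₀ hN']
        constructor <;> linarith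
      calc (1 : ℝ) = (Ico ((s : ℝ) / N) ((s + 1 : ℝ) / N)).indicator (fun _ => (1 : ℝ)) (X t) :=
            (indicator_of_mem hmem fun _ => (1 : ℝ)).symm
        _ ≤ _ := Finset.single_le_sum hnn hsF
    · rw [indicator_of_notMem ht]
      exact Finset.sum_nonneg hnn
  have hbin : ∀ s ∈ F, hits X (Ico ((s : ℝ) / N) ((s + 1 : ℝ) / N)) ≤ n * (2 / N) := by
    intro s hs
    have hs' : s < N := Finset.mem_range.1 (Finset.mem_filter.1 hs).1
    have := (abs_lt.1 (hX.2 s hs')).2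
    have h1 : (n : ℝ)⁻¹ * hits X (Ico ((s : ℝ) / N) ((s + 1 : ℝ) / N)) ≤ 2 / N := by
      have : (2 * N : ℝ)⁻¹ = (N : ℝ)⁻¹ / 2 := by rw [mul_inv]; ring
      have h2 : 0 < (N : ℝ)⁻¹ := by positivity
      rw [div_eq_mul_inv 2]
      linarith
    rwa [inv_mul_le_iff₀ hn'] at h1
  calc hits X (Icc a b) ≤ ∑ s ∈ F, hits X (Ico ((s : ℝ) / N) ((s + 1 : ℝ) / N)) := hle
    _ ≤ ∑ s ∈ F, n * (2 / N : ℝ) := Finset.sum_le_sum hbin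
    _ = F.card * (n * (2 / N : ℝ)) := by rw [Finset.sum_const, nsmul_eq_mul]
    _ ≤ (N * (b - a) + 2) * (n * (2 / N : ℝ)) := by gcongr
    _ = _ := by field_simp; ring

/-- An interval of length `2 / N` contains a whole bin, namely the one starting at the first
multiple of `1 / N` not below `a`. A regular bin holds at least half of the expected number of
points. -/
theorem BinsRegular.exists_bin {n N : ℕ} (hn : 0 < n) (hN : 0 < N) {X : Fin n → ℝ}
    (hX : X ∈ BinsRegular n N) {a b : ℝ} (ha : 0 ≤ a) (hb : b ≤ 1) (hab : 2 / (N : ℝ) ≤ b - a) :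
    ∃ T : Finset (Fin n), (∀ t ∈ T, X t ∈ Icc a b) ∧ (n : ℝ) / (2 * N) ≤ T.card := by
  classical
  have hn' : (0 : ℝ) < n := by exact_mod_cast hn
  have hN' : (0 : ℝ) < N := by exact_mod_cast hN
  set s := ⌈N * a⌉₊ with hs
  have h1 : N * a ≤ s := Nat.le_ceil _
  have h2 : (s : ℝ) < N * a + 1 := Nat.ceil_lt_add_one (by positivity)
  rw [div_le_iff₀ hN'] at hab
  have hsN : s < N := by
    have : (s : ℝ) < N := by nlinarith
    exact_mod_cast this
  refine ⟨Finset.univ.filter fun t => X t ∈ Ico ((s : ℝ) / N) ((s + 1 : ℝ) / N), ?_, ?_⟩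
  · intro t ht
    have ht' := (Finset.mem_filter.1 ht).2
    rw [mem_Ico, div_le_iff₀ hN', lt_div_iff₀ hN'] at ht'
    constructor <;> nlinarith [ht'.1, ht'.2]
  · rw [← hits_eq_card X (Ico ((s : ℝ) / N) ((s + 1 : ℝ) / N))]
    have := (abs_lt.1 (hX.2 s hsN)).1
    have h3 : (2 * N : ℝ)⁻¹ ≤ (n : ℝ)⁻¹ * hits X (Ico ((s : ℝ) / N) ((s + 1 : ℝ) / N)) := by
      have : (2 * N : ℝ)⁻¹ = (N : ℝ)⁻¹ / 2 := by rw [mul_inv]; ring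
      linarith
    rwa [le_inv_mul_iff₀ hn', ← div_eq_mul_inv] at h3

/-- Four separated subintervals of `[a, b]`, where the kernel is at least `κ`, are scaled by `h` and
placed next to `x`. Each of them contains at least a fixed fraction of `n h` observations, and four
separated points determine a cubic quantitatively, which bounds the quadratic form from below. The
failure probability `4 N² / n` becomes `C₂ / (n h²)` because `N` is of order `1 / h`. -/
theorem KernelCondition.exists_designGood {K : ℝ → ℝ} (hK : KernelCondition K) :
    ∃ c₀ C₁ C₂ : ℝ, 0 < c₀ ∧ 0 < C₁ ∧ 0 < C₂ ∧ ∀ (n : ℕ) (h : ℝ), 0 < n → 0 < h → h ≤ 1 / 2 →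
      ∃ A : Set (Fin n → ℝ), MeasurableSet A ∧
        designLaw n Aᶜ ≤ ENNReal.ofReal (C₂ / (n * h ^ 2)) ∧
        ∀ X ∈ A, DesignGood K c₀ C₁ h X := by
  obtain ⟨κ, a, b, hκ, ha, hab, hb, hKκ⟩ := hK.exists_interval
  -- Four intervals of length `δ` with three gaps of length `δ` between them fill `[a, b]`.
  set δ := (b - a) / 7 with hδ
  have hδ0 : 0 < δ := by rw [hδ]; linarith
  have hδ1 : δ < 1 := by rw [hδ]; linarith
  obtain ⟨c, hc, hcub⟩ := exists_cubic_lower_bound (a := a) hδ0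
  refine ⟨κ * c * δ / 24, 4 + 4 * δ, 36 / δ ^ 2, by positivity, by positivity, by positivity, ?_⟩
  intro n h hn hh hh2
  have hn' : (0 : ℝ) < n := by exact_mod_cast hn
  have hδh : 0 < δ * h := by positivity
  have hδh1 : δ * h < 1 := by nlinarith
  -- Bins so narrow that every interval of length `δ * h` in `[0, 1]` contains one of them, but not
  -- more than `3 / (δ * h)` bins.
  set N := ⌈2 / (δ * h)⌉₊ with hNdef
  have hN1 : 2 / (δ * h) ≤ N := Nat.le_ceil _
  have hN2 : (N : ℝ) < 2 / (δ * h) + 1 := Nat.ceil_lt_add_one (by positivity)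
  have hN0 : (0 : ℝ) < N := lt_of_lt_of_le (by positivity) hN1
  have hN0' : 0 < N := by exact_mod_cast hN0
  have hN3 : (N : ℝ) ≤ 3 / (δ * h) := by
    have : 1 ≤ 1 / (δ * h) := by rw [le_div_iff₀ hδh]; linarith
    have h3 : 3 / (δ * h) = 2 / (δ * h) + 1 / (δ * h) := by ring
    linarith
  have h2N : 2 / (N : ℝ) ≤ δ * h := by
    rw [div_le_iff₀ hN0]
    rw [div_le_iff₀ hδh] at hN1
    linarith
  refine ⟨BinsRegular n N, measurableSet_binsRegular n N, ?_, fun X hX => ⟨?_, ?_⟩⟩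
  · refine (designLaw_binsRegular_compl_le hn hN0').trans (ENNReal.ofReal_le_ofReal ?_)
    calc 4 * (N : ℝ) ^ 2 / n ≤ 4 * (3 / (δ * h)) ^ 2 / n := by gcongr
      _ = _ := by field_simp; ring
  · intro x hx v
    set I : Fin 4 → Set ℝ := fun r => Icc (a + 2 * (r : ℕ) * δ) (a + (2 * (r : ℕ) + 1) * δ) with hI
    have hIab : ∀ r, I r ⊆ Icc a b := by
      intro r
      have h3 : ((r : ℕ) : ℝ) ≤ 3 := by exact_mod_cast Nat.le_of_lt_succ r.2
      have h0 : (0 : ℝ) ≤ ((r : ℕ) : ℝ) := by positivity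
      refine Icc_subset_Icc (by nlinarith) ?_
      have : b = a + 7 * δ := by rw [hδ]; ring
      nlinarith
    -- The sign `e` tells the side: observations to the right of `x` when `x ≤ 1 / 2`, to the left
    -- otherwise. As `h ≤ 1 / 2`, the cells stay in `[0, 1]`.
    have key : ∃ e : ℝ, (e = 1 ∨ e = -1) ∧ ∀ r, ∃ T : Finset (Fin n),
        (∀ t ∈ T, e * ((X t - x) / h) ∈ I r) ∧ (n : ℝ) / (2 * N) ≤ T.card := by
      rcases le_or_gt x (1 / 2) with hx2 | hx2
      · refine ⟨1, Or.inl rfl, fun r => ?_⟩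
        have hr0 := hIab r (left_mem_Icc.2 (by nlinarith))
        have hr1 := hIab r (right_mem_Icc.2 (by nlinarith))
        obtain ⟨T, hT, hTc⟩ := BinsRegular.exists_bin hn hN0' hX
          (a := x + h * (a + 2 * (r : ℕ) * δ)) (b := x + h * (a + (2 * (r : ℕ) + 1) * δ))
          (by have := hx.1; have := hr0.1; positivity) (by nlinarith [hr1.2]) (by linarith)
        refine ⟨T, fun t ht => ?_, hTc⟩
        have := hT t ht
        rw [one_mul]
        refine ⟨?_, ?_⟩
        · rw [le_div_iff₀ hh]; linarith [this.1]
        · rw [div_le_iff₀ hh]; linarith [this.2]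
      · refine ⟨-1, Or.inr rfl, fun r => ?_⟩
        have hr0 := hIab r (left_mem_Icc.2 (by nlinarith))
        have hr1 := hIab r (right_mem_Icc.2 (by nlinarith))
        obtain ⟨T, hT, hTc⟩ := BinsRegular.exists_bin hn hN0' hX
          (a := x - h * (a + (2 * (r : ℕ) + 1) * δ)) (b := x - h * (a + 2 * (r : ℕ) * δ))
          (by nlinarith [hr1.2]) (by nlinarith [hr0.1, hx.2]) (by linarith)
        refine ⟨T, fun t ht => ?_, hTc⟩
        have := hT t ht
        rw [show -1 * ((X t - x) / h) = (x - X t) / h by ring]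
        refine ⟨?_, ?_⟩
        · rw [le_div_iff₀ hh]; linarith [this.2]
        · rw [div_le_iff₀ hh]; linarith [this.1]
    obtain ⟨e, he, hT⟩ := key
    choose T hTI hTc using hT
    have hcard0 : (0 : ℝ) < (n : ℝ) / (2 * N) := by positivity
    have hTne : ∀ r, (T r).Nonempty := fun r => by
      rw [← Finset.card_pos]
      exact_mod_cast hcard0.trans_le (hTc r)
    have he2 : e * e = 1 := by rcases he with rfl | rfl <;> norm_num
    -- For `e = -1` the odd coefficients change sign. This turns the cubic at `u` into a cubic at `e
    -- * u` with the same sum of squared coefficients.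
    set v' : Fin 4 → ℝ := fun i => v i * e ^ (i : ℕ) with hv'
    have hv'n : ∑ i, v' i ^ 2 = ∑ i, v i ^ 2 := by
      refine Finset.sum_congr rfl fun i _ => ?_
      simp only [hv']
      rw [mul_pow, ← pow_mul, mul_comm _ 2, pow_mul, sq e, he2, one_pow, mul_one]
    have hv'c : ∀ u, cubic v' (e * u) = cubic v u := by
      intro u
      simp only [cubic, hv']
      refine Finset.sum_congr rfl fun i _ => ?_
      rw [mul_pow, mul_assoc, ← mul_assoc (e ^ _) (e ^ _), ← mul_pow, he2, one_pow, one_mul]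
    -- In each cell keep the observation where the squared cubic is smallest; the sum over the cell
    -- is then at least its cardinality times that value.
    choose tm htm hmin using fun r =>
      Finset.exists_min_image (T r) (fun t => cubic v ((X t - x) / h) ^ 2) (hTne r)
    have hK2 : ∀ r, ∀ t ∈ T r, κ ≤ K ((X t - x) / h) := by
      intro r t ht
      have := hKκ _ (hIab r (hTI r t ht))
      rcases he with rfl | rfl
      · simpa using this
      · rw [neg_one_mul, hK.symm] at this
        exact this
    have hnn : ∀ t, 0 ≤ K ((X t - x) / h) * cubic v ((X t - x) / h) ^ 2 := fun t =>
      mul_nonneg (hK.nonneg _) (sq_nonneg _)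
    have h1 : ∀ r, (n : ℝ) / (2 * N) * (κ * cubic v ((X (tm r) - x) / h) ^ 2) ≤
        ∑ t, K ((X t - x) / h) * cubic v ((X t - x) / h) ^ 2 := by
      intro r
      calc (n : ℝ) / (2 * N) * (κ * cubic v ((X (tm r) - x) / h) ^ 2)
          ≤ (T r).card * (κ * cubic v ((X (tm r) - x) / h) ^ 2) := by
            gcongr
            exact hTc r
        _ = ∑ t ∈ T r, κ * cubic v ((X (tm r) - x) / h) ^ 2 := by
            rw [Finset.sum_const, nsmul_eq_mul]
        _ ≤ ∑ t ∈ T r, K ((X t - x) / h) * cubic v ((X t - x) / h) ^ 2 := by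
            refine Finset.sum_le_sum fun t ht => ?_
            have := hK2 r t ht
            have := hmin r t ht
            have := hK.nonneg ((X t - x) / h)
            gcongr
        _ ≤ _ := Finset.sum_le_sum_of_subset_of_nonneg (Finset.subset_univ _) fun t _ _ => hnn t
    have h2 := Finset.sum_le_sum fun r (_ : r ∈ Finset.univ) => h1 r
    rw [← Finset.mul_sum, ← Finset.mul_sum, Finset.sum_const, Finset.card_univ, Fintype.card_fin,
      nsmul_eq_mul] at h2
    have h3 := hcub (fun r => e * ((X (tm r) - x) / h)) (fun r => hTI r _ (htm r)) v'
    simp only [hv'c, hv'n] at h3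
    set S := ∑ t, K ((X t - x) / h) * cubic v ((X t - x) / h) ^ 2 with hS
    have h4 : (n : ℝ) / (2 * N) * (κ * (c * ∑ i, v i ^ 2)) ≤ 4 * S := by
      rw [show ((4 : ℕ) : ℝ) = 4 by norm_num] at h2
      refine le_trans ?_ h2
      gcongr
    have hsn : 0 ≤ ∑ i, v i ^ 2 := Finset.sum_nonneg fun _ _ => sq_nonneg _
    have h5 : (n : ℝ) * (δ * h) / 6 ≤ (n : ℝ) / (2 * N) := by
      rw [le_div_iff₀ hδh] at hN3
      rw [div_le_div_iff₀ (by norm_num) (by positivity)]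
      nlinarith
    have h6 : (n : ℝ) * (δ * h) / 6 * (κ * (c * ∑ i, v i ^ 2)) ≤ 4 * S := by
      refine le_trans ?_ h4
      gcongr
    rw [le_inv_mul_iff₀ (by positivity)]
    linarith
  · intro x
    have := BinsRegular.upper hn hN0' hX (a := x - h) (b := x + h) (by linarith)
    rw [inv_mul_le_iff₀ (by positivity)]
    refine this.trans ?_
    have h4 : 4 / (N : ℝ) ≤ 2 * (δ * h) := by
      have : 4 / (N : ℝ) = 2 * (2 / N) := by ring
      linarith
    have : 2 * (x + h - (x - h)) + 4 / (N : ℝ) ≤ h * (4 + 4 * δ) := by nlinarith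
    calc _ ≤ (n : ℝ) * (h * (4 + 4 * δ)) := by gcongr
      _ = _ := by ring


/-! ### The normal equations of the local cubic fit -/

/-- Kernel weighted moments of the responses `y` about the point `x`. -/
noncomputable def lpMoment {n : ℕ} (K : ℝ → ℝ) (h : ℝ) (X : Fin n → ℝ) (x : ℝ) (y : Fin n → ℝ)
    (b : ℕ) : ℝ :=
  ((n : ℝ) * h)⁻¹ * ∑ t, K ((X t - x) / h) * ((X t - x) / h) ^ b * y t

/-- Remainder of the Taylor polynomial of degree three at `x`. -/
noncomputable def taylorRem (f : ℕ → ℝ → ℝ) (x y : ℝ) : ℝ :=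
  f 0 y - ∑ i : Fin 4, f i x / (Nat.factorial (i : ℕ) : ℝ) * (y - x) ^ (i : ℕ)

/-- The scaled estimation errors of the local cubic fit to `f (X t) + e t`. -/
noncomputable def lpErr {n : ℕ} (K : ℝ → ℝ) (h : ℝ) (X : Fin n → ℝ) (f : ℕ → ℝ → ℝ)
    (e : Fin n → ℝ) (x : ℝ) (a : Fin 4) : ℝ :=
  h ^ (a : ℕ) * (lpCoef 3 K h X (fun t => f 0 (X t) + e t) x a
    - f a x / (Nat.factorial (a : ℕ) : ℝ))

section Design

variable {n : ℕ} {K : ℝ → ℝ} {c₀ C₁ h : ℝ} {X : Fin n → ℝ}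

theorem lpMoment_add (x : ℝ) (y z : Fin n → ℝ) (b : ℕ) :
    lpMoment K h X x (fun t => y t + z t) b = lpMoment K h X x y b + lpMoment K h X x z b := by
  simp only [lpMoment]
  rw [← mul_add, ← Finset.sum_add_distrib]
  congr 1
  exact Finset.sum_congr rfl fun t _ => by ring

theorem lpMoment_sub (x : ℝ) (y z : Fin n → ℝ) (b : ℕ) :
    lpMoment K h X x (fun t => y t - z t) b = lpMoment K h X x y b - lpMoment K h X x z b := by
  simp only [lpMoment]
  rw [← mul_sub, ← Finset.sum_sub_distrib]
  congr 1
  exact Finset.sum_congr rfl fun t _ => by ring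

theorem sum_lpMoment_mul (x : ℝ) (v : Fin 4 → ℝ) (b : ℕ) :
    ∑ a : Fin 4, lpMoment K h X x (fun _ => 1) (a + b) * v a =
      lpMoment K h X x (fun t => cubic v ((X t - x) / h)) b := by
  simp only [lpMoment, cubic, Finset.mul_sum, Finset.sum_mul]
  rw [Finset.sum_comm]
  refine Finset.sum_congr rfl fun t _ => Finset.sum_congr rfl fun a _ => ?_
  rw [pow_add]
  ring

theorem sum_lpMoment_quadratic (x : ℝ) (v : Fin 4 → ℝ) :
    ∑ b : Fin 4, v b * lpMoment K h X x (fun t => cubic v ((X t - x) / h)) b =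
      ((n : ℝ) * h)⁻¹ * ∑ t, K ((X t - x) / h) * cubic v ((X t - x) / h) ^ 2 := by
  simp only [lpMoment, Finset.mul_sum]
  rw [Finset.sum_comm]
  refine Finset.sum_congr rfl fun t _ => ?_
  rw [sq, ← mul_assoc (K _), ← mul_assoc]
  conv_rhs => rw [cubic, Finset.mul_sum]
  rw [← cubic]
  refine Finset.sum_congr rfl fun b _ => ?_
  ring

/-- The solution of the normal equations is controlled by their right-hand side. -/
theorem DesignGood.sq_le (hX : DesignGood K c₀ C₁ h X) (hc : 0 < c₀) {x : ℝ}
    (hx : x ∈ Icc (0 : ℝ) 1) {v τ : Fin 4 → ℝ}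
    (hv : ∀ b : Fin 4, ∑ a : Fin 4, lpMoment K h X x (fun _ => 1) (a + b) * v a = τ b) :
    ∑ a, v a ^ 2 ≤ (c₀ ^ 2)⁻¹ * ∑ b, τ b ^ 2 := by
  have h1 := hX.lower x hx v
  rw [← sum_lpMoment_quadratic] at h1
  have h2 : ∀ b : Fin 4, lpMoment K h X x (fun t => cubic v ((X t - x) / h)) b = τ b := fun b => by
    rw [← sum_lpMoment_mul, hv]
  simp_rw [h2] at h1
  have h3 := Finset.sum_mul_sq_le_sq_mul_sq Finset.univ v τ
  have hv0 : 0 ≤ ∑ a, v a ^ 2 := Finset.sum_nonneg fun _ _ => sq_nonneg _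
  have h4 : (c₀ * ∑ a, v a ^ 2) ^ 2 ≤ (∑ a, v a ^ 2) * ∑ b, τ b ^ 2 := by
    refine le_trans ?_ h3
    gcongr
  rw [le_inv_mul_iff₀ (by positivity)]
  rcases hv0.eq_or_lt with h0 | h0
  · rw [← h0, mul_zero]
    exact Finset.sum_nonneg fun _ _ => sq_nonneg _
  · nlinarith

/-- In the unknowns `h ^ a * v a` the normal matrix is, up to a diagonal factor, the matrix of the
moments of order `a + b`, whose entries stay of order one as `h` tends to zero. This is the reason
for the scaling in `lpErr`. -/
theorem lpGram_mulVec (x : ℝ) (hn : 0 < n) (hh : 0 < h) (v : Fin 4 → ℝ) (b : Fin 4) :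
    Matrix.mulVec ((lpDesign 3 X x).transpose * lpWeight K h X x * lpDesign 3 X x) v b =
      n * h * h ^ (b : ℕ) * ∑ a : Fin 4, lpMoment K h X x (fun _ => 1) (a + b)
        * (h ^ (a : ℕ) * v a) := by
  have hn' : (0 : ℝ) < n := by exact_mod_cast hn
  rw [sum_lpMoment_mul (v := fun a : Fin 4 => h ^ (a : ℕ) * v a), lpMoment]
  have h0 : (n : ℝ) * h ≠ 0 := by positivity
  have hassoc : ∀ s : ℝ, (n : ℝ) * h * h ^ (b : ℕ) * (((n : ℝ) * h)⁻¹ * s) = h ^ (b : ℕ) * s :=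
    fun s => by field_simp
  rw [hassoc]
  rw [← Matrix.mulVec_mulVec, ← Matrix.mulVec_mulVec]
  simp only [Matrix.mulVec, dotProduct, lpWeight, lpDesign, Matrix.transpose_apply, Matrix.of_apply,
    Matrix.diagonal_apply, ite_mul, zero_mul, Finset.sum_ite_eq, Finset.mem_univ, if_true, cubic]
  rw [Finset.mul_sum]
  refine Finset.sum_congr rfl fun t _ => ?_
  rw [div_pow]
  have hb : h ^ (b : ℕ) ≠ 0 := by positivity
  have : ∑ i : Fin 4, h ^ (i : ℕ) * v i * ((X t - x) / h) ^ (i : ℕ) =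
      ∑ i : Fin 4, (X t - x) ^ (i : ℕ) * v i := by
    refine Finset.sum_congr rfl fun i _ => ?_
    rw [div_pow]
    have : h ^ (i : ℕ) ≠ 0 := by positivity
    field_simp
  rw [this]
  field_simp

theorem DesignGood.isUnit_det (hX : DesignGood K c₀ C₁ h X) (hc : 0 < c₀) (hn : 0 < n)
    (hh : 0 < h) {x : ℝ} (hx : x ∈ Icc (0 : ℝ) 1) :
    IsUnit ((lpDesign 3 X x).transpose * lpWeight K h X x * lpDesign 3 X x).det := by
  rw [isUnit_iff_ne_zero]
  intro h0
  obtain ⟨v, hv, hv0⟩ := Matrix.exists_mulVec_eq_zero_iff.2 h0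
  have hn' : (0 : ℝ) < n := by exact_mod_cast hn
  have h1 := hX.sq_le hc hx (v := fun a : Fin 4 => h ^ (a : ℕ) * v a) (τ := 0) fun b => by
    have := congrFun hv0 b
    rw [lpGram_mulVec x hn hh] at this
    simpa [hn'.ne', hh.ne'] using this
  simp only [Pi.zero_apply, ne_eq, OfNat.ofNat_ne_zero, not_false_eq_true, zero_pow,
    Finset.sum_const_zero, mul_zero] at h1
  have h2 := (Finset.sum_eq_zero_iff_of_nonneg fun _ _ => sq_nonneg _).1
    (le_antisymm h1 (Finset.sum_nonneg fun _ _ => sq_nonneg _))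
  apply hv
  funext a
  have := h2 a (Finset.mem_univ a)
  simpa [hh.ne'] using this

theorem DesignGood.normal_eq (hX : DesignGood K c₀ C₁ h X) (hc : 0 < c₀) (hn : 0 < n)
    (hh : 0 < h) {x : ℝ} (hx : x ∈ Icc (0 : ℝ) 1) (y : Fin n → ℝ) (b : Fin 4) :
    ∑ a : Fin 4, lpMoment K h X x (fun _ => 1) (a + b) * (h ^ (a : ℕ) * lpCoef 3 K h X y x a) =
      lpMoment K h X x y b := by
  have hn' : (0 : ℝ) < n := by exact_mod_cast hn
  have hdet := hX.isUnit_det hc hn hh hx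
  have h1 : Matrix.mulVec ((lpDesign 3 X x).transpose * lpWeight K h X x * lpDesign 3 X x)
      (lpCoef 3 K h X y x) b =
      Matrix.mulVec ((lpDesign 3 X x).transpose * lpWeight K h X x) y b := by
    rw [lpCoef, Matrix.mulVec_mulVec, ← Matrix.mul_assoc, ← Matrix.mul_assoc,
      Matrix.mul_nonsing_inv _ hdet, Matrix.one_mul]
  rw [lpGram_mulVec x hn hh] at h1
  have h2 : Matrix.mulVec ((lpDesign 3 X x).transpose * lpWeight K h X x) y b =
      n * h * h ^ (b : ℕ) * lpMoment K h X x y b := by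
    rw [← Matrix.mulVec_mulVec, lpMoment]
    simp only [Matrix.mulVec, dotProduct, lpWeight, lpDesign, Matrix.transpose_apply,
      Matrix.of_apply, Matrix.diagonal_apply, ite_mul, zero_mul, Finset.sum_ite_eq,
      Finset.mem_univ, if_true, Finset.mul_sum]
    refine Finset.sum_congr rfl fun t _ => ?_
    rw [div_pow]
    have hb : h ^ (b : ℕ) ≠ 0 := by positivity
    field_simp
  rw [h2] at h1
  exact mul_left_cancel₀ (by positivity) h1

/-- A cubic fit reproduces the Taylor polynomial at `x` exactly, so the errors are driven by the
Taylor remainder and the noise alone. -/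
theorem DesignGood.lpErr_eq (hX : DesignGood K c₀ C₁ h X) (hc : 0 < c₀) (hn : 0 < n)
    (hh : 0 < h) {x : ℝ} (hx : x ∈ Icc (0 : ℝ) 1) (f : ℕ → ℝ → ℝ) (e : Fin n → ℝ) (b : Fin 4) :
    ∑ a : Fin 4, lpMoment K h X x (fun _ => 1) (a + b) * lpErr K h X f e x a =
      lpMoment K h X x (fun t => taylorRem f x (X t)) b + lpMoment K h X x e b := by
  have h1 := hX.normal_eq hc hn hh hx (fun t => f 0 (X t) + e t) b
  have h2 := sum_lpMoment_mul (K := K) (h := h) (X := X) x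
    (fun a => h ^ (a : ℕ) * (f a x / (Nat.factorial (a : ℕ) : ℝ))) b
  simp only [lpErr, mul_sub, Finset.sum_sub_distrib]
  rw [h1, h2, ← lpMoment_add, ← lpMoment_sub]
  congr 1
  funext t
  simp only [taylorRem, cubic]
  have : ∀ i : Fin 4, h ^ (i : ℕ) * (f i x / (Nat.factorial (i : ℕ) : ℝ))
      * ((X t - x) / h) ^ (i : ℕ) =
      f i x / (Nat.factorial (i : ℕ) : ℝ) * (X t - x) ^ (i : ℕ) := fun i => by
    rw [div_pow]
    have : h ^ (i : ℕ) ≠ 0 := by positivity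
    field_simp
  simp_rw [this]
  ring

theorem taylorRem_eq (f : ℕ → ℝ → ℝ) (x s : ℝ) :
    taylorRem f x (x + s) = f 0 (x + s) - f 0 x - f 1 x * s - f 2 x / 2 * s ^ 2
      - f 3 x / 6 * s ^ 3 := by
  simp [taylorRem, Fin.sum_univ_four, Nat.factorial]
  ring

/-- A function vanishing at the origin whose derivative is `O(|s|^k)` is `O(|s|^(k+1))`. -/
theorem abs_le_pow_succ_of_hasDerivAt {F F' : ℝ → ℝ} {C : ℝ} {k : ℕ}
    (hF : ∀ s, HasDerivAt F (F' s) s) (h0 : F 0 = 0) (hb : ∀ s, |F' s| ≤ C * |s| ^ k) (s : ℝ) :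
    |F s| ≤ C * |s| ^ (k + 1) := by
  have hC : 0 ≤ C := by
    have := (abs_nonneg _).trans (hb 1)
    simpa using this
  have := Convex.norm_image_sub_le_of_norm_hasDerivWithin_le (f := F) (f' := F')
    (s := uIcc 0 s) (C := C * |s| ^ k) (fun z _ => (hF z).hasDerivWithinAt)
    (fun z hz => (hb z).trans (by
      have : |z| ≤ |s| := by simpa using abs_sub_left_of_mem_uIcc hz
      gcongr))
    (convex_uIcc 0 s) left_mem_uIcc right_mem_uIcc
  simp only [h0, sub_zero, Real.norm_eq_abs] at this
  calc |F s| ≤ C * |s| ^ k * |s| := this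
    _ = _ := by ring

/-- The third derivative is bounded but need not be Lipschitz. Two of its values differ by at most
`2 * B`, and three integrations give order three, not four. -/
theorem SmoothFun.abs_taylorRem_le {B : ℝ} {f : ℕ → ℝ → ℝ} (hf : SmoothFun B f) (x y : ℝ) :
    |taylorRem f x y| ≤ 2 * B * |y - x| ^ 3 := by
  have hd : ∀ d < 3, ∀ s, HasDerivAt (fun s => f d (x + s)) (f (d + 1) (x + s)) s := by
    intro d hd s
    exact HasDerivAt.comp_const_add x s (hf.hasDerivAt d hd (x + s))
  have h3 : ∀ s, |f 3 (x + s) - f 3 x| ≤ 2 * B * |s| ^ 0 := fun s => by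
    have h1 := hf.bound_three (x + s)
    have h2 := hf.bound_three x
    rw [pow_zero, mul_one]
    exact (abs_sub _ _).trans (by linarith)
  have h2 := abs_le_pow_succ_of_hasDerivAt (F := fun s => f 2 (x + s) - f 2 x - f 3 x * s)
    (fun s => by
      have := ((hd 2 (by omega) s).sub_const (f 2 x)).sub ((hasDerivAt_id s).const_mul (f 3 x))
      exact this.congr_deriv (by simp)) (by simp) h3
  have h1 := abs_le_pow_succ_of_hasDerivAt
    (F := fun s => f 1 (x + s) - f 1 x - f 2 x * s - f 3 x / 2 * s ^ 2)
    (fun s => by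
      have := (((hd 1 (by omega) s).sub_const (f 1 x)).sub
        ((hasDerivAt_id s).const_mul (f 2 x))).sub ((hasDerivAt_pow 2 s).const_mul (f 3 x / 2))
      refine this.congr_deriv ?_
      simp only [mul_one, Nat.cast_ofNat]
      ring) (by simp) h2
  have h0 := abs_le_pow_succ_of_hasDerivAt
    (F := fun s => taylorRem f x (x + s))
    (fun s => by
      simp_rw [taylorRem_eq]
      have := ((((hd 0 (by omega) s).sub_const (f 0 x)).sub
        ((hasDerivAt_id s).const_mul (f 1 x))).sub
        ((hasDerivAt_pow 2 s).const_mul (f 2 x / 2))).sub ((hasDerivAt_pow 3 s).const_mul (f 3 x / 6))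
      refine this.congr_deriv ?_
      simp only [mul_one, Nat.cast_ofNat]
      ring) (by rw [taylorRem_eq]; simp) h1
  have := h0 (y - x)
  simpa using this

theorem KernelCondition.exists_abs_le (hK : KernelCondition K) :
    ∃ B, 0 ≤ B ∧ ∀ u, |K u| ≤ B := by
  obtain ⟨B, hB⟩ := hK.bounded
  exact ⟨B, (hK.nonneg 0).trans (hB 0), fun u => by rw [abs_of_nonneg (hK.nonneg u)]; exact hB u⟩

theorem KernelCondition.abs_mul_pow_le (hK : KernelCondition K) {B : ℝ} (hB : ∀ u, |K u| ≤ B)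
    (u : ℝ) (b : ℕ) : |K u * u ^ b| ≤ B := by
  by_cases hu : 1 < |u|
  · rw [hK.eq_zero hu, zero_mul, abs_zero]
    exact (abs_nonneg _).trans (hB 0)
  · rw [abs_mul, abs_pow]
    calc |K u| * |u| ^ b ≤ |K u| * 1 := by
          gcongr
          exact pow_le_one₀ (abs_nonneg _) (not_lt.1 hu)
      _ ≤ B := by rw [mul_one]; exact hB u

theorem KernelCondition.abs_mul_pow_le_indicator (hK : KernelCondition K) {B : ℝ}
    (hB : ∀ u, |K u| ≤ B) (hh : 0 < h) (y x : ℝ) (b : ℕ) :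
    |K ((y - x) / h) * ((y - x) / h) ^ b| ≤
      B * (Icc (x - h) (x + h)).indicator (fun _ => (1 : ℝ)) y := by
  by_cases hy : y ∈ Icc (x - h) (x + h)
  · rw [indicator_of_mem hy, mul_one]
    exact hK.abs_mul_pow_le hB _ b
  · rw [indicator_of_notMem hy, hK.eq_zero, zero_mul, abs_zero, mul_zero]
    rw [abs_div, abs_of_pos hh, lt_div_iff₀ hh, one_mul]
    by_contra hle
    rw [not_lt, abs_le] at hle
    exact hy ⟨by linarith, by linarith⟩

theorem DesignGood.abs_lpMoment_le (hX : DesignGood K c₀ C₁ h X) (hK : KernelCondition K) {B : ℝ}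
    (hB : ∀ u, |K u| ≤ B) (hn : 0 < n) (hh : 0 < h) (x : ℝ) {y : Fin n → ℝ} {M : ℝ} (hM : 0 ≤ M)
    (hy : ∀ t, |X t - x| ≤ h → |y t| ≤ M) (b : ℕ) :
    |lpMoment K h X x y b| ≤ C₁ * B * M := by
  have hn' : (0 : ℝ) < n := by exact_mod_cast hn
  have hB0 : 0 ≤ B := (abs_nonneg _).trans (hB 0)
  have hu := hX.upper x
  rw [lpMoment, abs_mul, abs_of_nonneg (by positivity)]
  calc ((n : ℝ) * h)⁻¹ * |∑ t, K ((X t - x) / h) * ((X t - x) / h) ^ b * y t|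
      ≤ ((n : ℝ) * h)⁻¹ * ∑ t, B * M * (Icc (x - h) (x + h)).indicator (fun _ => (1 : ℝ)) (X t) := by
        gcongr
        refine (Finset.abs_sum_le_sum_abs _ _).trans (Finset.sum_le_sum fun t _ => ?_)
        rw [abs_mul]
        have h1 := hK.abs_mul_pow_le_indicator hB hh (X t) x b
        by_cases hy' : X t ∈ Icc (x - h) (x + h)
        · rw [indicator_of_mem hy', mul_one] at h1 ⊢
          have := hy t (abs_le.2 ⟨by linarith [hy'.1], by linarith [hy'.2]⟩)
          gcongr
        · rw [indicator_of_notMem hy', mul_zero] at h1 ⊢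
          have : |K ((X t - x) / h) * ((X t - x) / h) ^ b| = 0 := le_antisymm h1 (abs_nonneg _)
          rw [this, zero_mul]
    _ = B * M * (((n : ℝ) * h)⁻¹ * hits X (Icc (x - h) (x + h))) := by
        rw [hits, ← Finset.mul_sum]; ring
    _ ≤ B * M * C₁ := by gcongr
    _ = _ := by ring

theorem DesignGood.sum_sq_le (hX : DesignGood K c₀ C₁ h X) (hK : KernelCondition K) {B : ℝ}
    (hB : ∀ u, |K u| ≤ B) (hn : 0 < n) (hh : 0 < h) (x : ℝ) (b : ℕ) :
    ∑ t, (((n : ℝ) * h)⁻¹ * (K ((X t - x) / h) * ((X t - x) / h) ^ b)) ^ 2 ≤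
      B ^ 2 * C₁ / (n * h) := by
  have hn' : (0 : ℝ) < n := by exact_mod_cast hn
  have hu := hX.upper x
  calc ∑ t, (((n : ℝ) * h)⁻¹ * (K ((X t - x) / h) * ((X t - x) / h) ^ b)) ^ 2
      ≤ ∑ t, (((n : ℝ) * h)⁻¹) ^ 2 *
          (B ^ 2 * (Icc (x - h) (x + h)).indicator (fun _ => (1 : ℝ)) (X t)) := by
        refine Finset.sum_le_sum fun t _ => ?_
        rw [mul_pow]
        gcongr
        have h1 := hK.abs_mul_pow_le_indicator hB hh (X t) x b
        rw [← sq_abs]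
        by_cases hy' : X t ∈ Icc (x - h) (x + h)
        · rw [indicator_of_mem hy', mul_one] at h1 ⊢
          gcongr
        · rw [indicator_of_notMem hy', mul_zero] at h1 ⊢
          rw [le_antisymm h1 (abs_nonneg _)]
          simp
    _ = B ^ 2 * ((n : ℝ) * h)⁻¹ * (((n : ℝ) * h)⁻¹ * hits X (Icc (x - h) (x + h))) := by
        rw [hits, ← Finset.mul_sum, ← Finset.mul_sum]; ring
    _ ≤ B ^ 2 * ((n : ℝ) * h)⁻¹ * C₁ := by gcongr
    _ = _ := by rw [div_eq_mul_inv]; ring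

end Design

/-! ### The equivalent kernels -/

/-- Moments of the kernel. -/
noncomputable def kernelMoment (K : ℝ → ℝ) (b : ℕ) : ℝ := ∫ u, K u * u ^ b

theorem KernelCondition.integrable_mul {K : ℝ → ℝ} (hK : KernelCondition K) {g : ℝ → ℝ}
    (hg : Continuous g) : Integrable fun u => K u * g u :=
  (hK.continuous.mul hg).integrable_of_hasCompactSupport hK.hasCompactSupport.mul_right

/-- The moment matrix of the kernel is invertible. -/
theorem KernelCondition.exists_inverse {K : ℝ → ℝ} (hK : KernelCondition K) :
    ∃ T : Matrix (Fin 4) (Fin 4) ℝ,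
      ∀ d a : Fin 4, ∑ b : Fin 4, T d b * kernelMoment K (a + b) = if d = a then 1 else 0 := by
  set S : Matrix (Fin 4) (Fin 4) ℝ := Matrix.of fun b a => kernelMoment K (a + b) with hS
  have hdet : IsUnit S.det := by
    rw [isUnit_iff_ne_zero]
    intro h0
    obtain ⟨v, hv, hv0⟩ := Matrix.exists_mulVec_eq_zero_iff.2 h0
    -- A null vector of the moment matrix annihilates the quadratic form `∫ K cubic²`. By continuity
    -- the cubic then vanishes wherever `K` does not, in particular at four points of an interval.
    have h1 : ∫ u, K u * cubic v u ^ 2 = 0 := by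
      have : ∀ u, K u * cubic v u ^ 2 = ∑ b : Fin 4, v b * ∑ a : Fin 4, v a *
          (K u * u ^ ((a : ℕ) + b)) := by
        intro u
        rw [sq, cubic, Finset.sum_mul, Finset.mul_sum]
        refine Finset.sum_congr rfl fun b _ => ?_
        simp only [Finset.mul_sum]
        refine Finset.sum_congr rfl fun a _ => ?_
        rw [pow_add]; ring
      simp_rw [this]
      have hi : ∀ b : ℕ, Integrable fun u => K u * u ^ b := fun b =>
        hK.integrable_mul (continuous_pow b)
      rw [integral_finsetSum _ fun b _ => (integrable_finsetSum _ fun a _ =>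
        (hi _).const_mul _).const_mul _]
      refine Finset.sum_eq_zero fun b _ => ?_
      rw [integral_const_mul, integral_finsetSum _ fun a _ => (hi _).const_mul _]
      have := congrFun hv0 b
      simp only [Matrix.mulVec, dotProduct, hS, Matrix.of_apply, kernelMoment, Pi.zero_apply]
        at this
      simp_rw [integral_const_mul, mul_comm (v _)]
      rw [this, zero_mul]
    have hcc : Continuous fun u => cubic v u ^ 2 := by unfold cubic; fun_prop
    have h2 : (fun u => K u * cubic v u ^ 2) = 0 := by
      have h3 := (integral_eq_zero_iff_of_nonneg (fun u => mul_nonneg (hK.nonneg u)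
        (sq_nonneg _)) (hK.integrable_mul hcc)).1 h1
      exact Continuous.ae_eq_iff_eq volume (hK.continuous.mul hcc) continuous_zero |>.1 h3
    obtain ⟨κ, a, b, hκ, ha, hab, hb, hKκ⟩ := hK.exists_interval
    apply hv
    refine cubic_eq_zero (u := fun r : Fin 4 => a + (b - a) * ((r : ℕ) : ℝ) / 4) ?_ ?_
    · intro r r' hr
      simp only at hr
      have hba : b - a ≠ 0 := by linarith
      have : (b - a) * ((r : ℕ) : ℝ) = (b - a) * ((r' : ℕ) : ℝ) := by linarith
      exact Fin.ext (by exact_mod_cast mul_left_cancel₀ hba this)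
    · intro r
      have h3 : ((r : ℕ) : ℝ) ≤ 4 := by exact_mod_cast r.2.le
      have hr0 : (0 : ℝ) ≤ ((r : ℕ) : ℝ) := by positivity
      have h4 := hKκ (a + (b - a) * ((r : ℕ) : ℝ) / 4) ⟨by nlinarith, by nlinarith⟩
      have h5 := congrFun h2 (a + (b - a) * ((r : ℕ) : ℝ) / 4)
      simp only [Pi.zero_apply, mul_eq_zero] at h5
      rcases h5 with h5 | h5
      · linarith
      · exact pow_eq_zero_iff two_ne_zero |>.1 h5
  refine ⟨S⁻¹, fun d a => ?_⟩
  have := congrFun (congrFun (Matrix.nonsing_inv_mul S hdet) d) a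
  rw [Matrix.mul_apply, Matrix.one_apply] at this
  simpa [hS] using this

/-- The equivalent kernel `u ↦ ∑ b, T d b K(u) u ^ b`. -/
noncomputable def equivKernel (K : ℝ → ℝ) (T : Matrix (Fin 4) (Fin 4) ℝ) (d : Fin 4) (u : ℝ) : ℝ :=
  ∑ b : Fin 4, T d b * (K u * u ^ (b : ℕ))

/-- The normal matrix is singular for some designs, so the inverse is not continuous. As the inverse
of the determinant times the adjugate it is measurable everywhere, the default value 0 included. -/
theorem measurable_lpCoef {n : ℕ} {K : ℝ → ℝ} (hK : Continuous K) (h : ℝ) (a : Fin 4) :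
    Measurable fun q : (Fin n → ℝ) × (Fin n → ℝ) × ℝ => lpCoef 3 K h q.1 q.2.1 q.2.2 a := by
  have hD : Continuous fun q : (Fin n → ℝ) × (Fin n → ℝ) × ℝ => lpDesign 3 q.1 q.2.2 := by
    refine continuous_matrix fun i j => ?_
    simp only [lpDesign, Matrix.of_apply]
    fun_prop
  have hW : Continuous fun q : (Fin n → ℝ) × (Fin n → ℝ) × ℝ => lpWeight K h q.1 q.2.2 := by
    refine Continuous.matrix_diagonal ?_
    fun_prop
  have hG := ((hD.matrix_transpose.matrix_mul hW).matrix_mul hD)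
  have hR := hD.matrix_transpose.matrix_mul hW
  have h1 : ∀ q : (Fin n → ℝ) × (Fin n → ℝ) × ℝ, lpCoef 3 K h q.1 q.2.1 q.2.2 a =
      (((lpDesign 3 q.1 q.2.2).transpose * lpWeight K h q.1 q.2.2 * lpDesign 3 q.1 q.2.2).det)⁻¹ *
      ((((lpDesign 3 q.1 q.2.2).transpose * lpWeight K h q.1 q.2.2 *
        lpDesign 3 q.1 q.2.2).adjugate *
        ((lpDesign 3 q.1 q.2.2).transpose * lpWeight K h q.1 q.2.2)).mulVec q.2.1) a := by
    intro q
    rw [lpCoef, Matrix.inv_def, Ring.inverse_eq_inv', Matrix.mul_assoc, Matrix.smul_mul,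
      Matrix.smul_mulVec, Pi.smul_apply, smul_eq_mul]
  simp_rw [h1]
  refine (hG.matrix_det.measurable.inv).mul (Continuous.measurable ?_)
  exact (continuous_apply a).comp
    ((hG.matrix_adjugate.matrix_mul hR).matrix_mulVec (by fun_prop))


/-! ### Convolution with the equivalent kernels -/

section EquivKernel

variable {K : ℝ → ℝ} {T : Matrix (Fin 4) (Fin 4) ℝ}

theorem integral_equivKernel_mul (hK : KernelCondition K) (d : Fin 4) {g : ℝ → ℝ}
    (hg : Continuous g) :
    ∫ u, equivKernel K T d u * g u = ∑ b : Fin 4, T d b * ∫ u, K u * u ^ (b : ℕ) * g u := by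
  simp only [equivKernel, Finset.sum_mul]
  rw [integral_finsetSum]
  · simp_rw [mul_assoc, integral_const_mul]
  · intro b _
    simp_rw [mul_assoc]
    exact (hK.integrable_mul (g := fun u => u ^ (b : ℕ) * g u) (by fun_prop)).const_mul _

/-- `T` inverts the moment matrix, so the equivalent kernels are dual to the monomials of degree at
most three. -/
theorem integral_equivKernel_mul_pow (hK : KernelCondition K)
    (hT : ∀ d a : Fin 4, ∑ b : Fin 4, T d b * kernelMoment K (a + b) = if d = a then 1 else 0)
    (d a : Fin 4) : ∫ u, equivKernel K T d u * u ^ (a : ℕ) = if d = a then 1 else 0 := by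
  rw [integral_equivKernel_mul hK d (by fun_prop), ← hT d a]
  refine Finset.sum_congr rfl fun b _ => ?_
  rw [kernelMoment]
  congr 2
  funext u
  rw [pow_add]; ring

theorem continuous_equivKernel (hK : KernelCondition K) (d : Fin 4) :
    Continuous (equivKernel K T d) := by
  have := hK.continuous
  unfold equivKernel
  fun_prop

theorem equivKernel_eq_zero (hK : KernelCondition K) (d : Fin 4) {u : ℝ} (hu : 1 < |u|) :
    equivKernel K T d u = 0 := by
  simp [equivKernel, hK.eq_zero hu]

theorem exists_abs_equivKernel_le (hK : KernelCondition K) (T : Matrix (Fin 4) (Fin 4) ℝ) :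
    ∃ B, 0 ≤ B ∧ ∀ d u, |equivKernel K T d u| ≤ B := by
  obtain ⟨B, hB0, hB⟩ := hK.exists_abs_le
  refine ⟨∑ d, ∑ b, |T d b| * B, by positivity, fun d u => ?_⟩
  calc |equivKernel K T d u| ≤ ∑ b, |T d b| * B := by
        refine (Finset.abs_sum_le_sum_abs _ _).trans (Finset.sum_le_sum fun b _ => ?_)
        rw [abs_mul]
        gcongr
        exact hK.abs_mul_pow_le hB u b
    _ ≤ _ := Finset.single_le_sum (f := fun d => ∑ b, |T d b| * B)
        (fun _ _ => by positivity) (Finset.mem_univ d)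

theorem hasCompactSupport_of_eq_zero {k : ℝ → ℝ} (hk : ∀ u, 1 < |u| → k u = 0) :
    HasCompactSupport k :=
  HasCompactSupport.of_support_subset_isCompact (isCompact_Icc (a := (-1 : ℝ)) (b := 1))
    fun u hu => abs_le.1 (not_lt.1 fun h => hu (hk u h))

/-- Integrals against a bounded function supported in `[-1, 1]`. -/
theorem abs_integral_mul_le {k g : ℝ → ℝ} {B M : ℝ} (hB0 : 0 ≤ B) (hB : ∀ u, |k u| ≤ B)
    (hk : ∀ u, 1 < |u| → k u = 0) (hM : ∀ u, |u| ≤ 1 → |g u| ≤ M) :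
    |∫ u, k u * g u| ≤ 2 * B * M := by
  have h1 : ∫ u, k u * g u = ∫ u in Icc (-1 : ℝ) 1, k u * g u := by
    rw [setIntegral_eq_integral_of_forall_compl_eq_zero]
    intro u hu
    rw [hk u (by by_contra h; exact hu (abs_le.1 (not_lt.1 h))), zero_mul]
  rw [h1]
  have := norm_setIntegral_le_of_norm_le_const (μ := volume) (s := Icc (-1 : ℝ) 1)
    (f := fun u => k u * g u) (C := B * M) (by simp) (fun u hu => by
      have hu' := abs_le.2 hu
      have hM0 := (abs_nonneg _).trans (hM u hu')
      rw [Real.norm_eq_abs, abs_mul]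
      exact mul_le_mul (hB u) (hM u hu') (abs_nonneg _) hB0)
  rw [Real.norm_eq_abs, Real.volume_real_Icc_of_le (by norm_num)] at this
  linarith

theorem integral_mul_comp_sub_div (f k : ℝ → ℝ) {h : ℝ} (hh : 0 < h) (X : ℝ) :
    ∫ x, f x * k ((X - x) / h) = h * ∫ u, k u * f (X - h * u) := by
  have h1 := integral_sub_left_eq_self (fun y => f (X - y) * k (y / h)) volume X
  simp only [sub_sub_cancel] at h1
  rw [h1]
  have h2 := Measure.integral_comp_div (fun u => k u * f (X - h * u)) h
  rw [abs_of_pos hh, smul_eq_mul] at h2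
  rw [← h2]
  congr 1
  funext y
  rw [mul_div_cancel₀ _ hh.ne', mul_comm]

theorem TestFun.eq_zero {L : ℝ} {w f : ℕ → ℝ → ℝ} (hf : TestFun L (w 0) f) {L' : ℝ}
    (hw : WeightFun L' w) {x : ℝ} (hx : x ∉ Ioo (0 : ℝ) 1) : f 0 x = 0 := by
  have := hf.bound_weight x
  rw [hw.eq_zero 0 (by omega) x hx, mul_zero] at this
  exact abs_eq_zero.1 (le_antisymm this (abs_nonneg _))

theorem intervalIntegral_eq_integral {g : ℝ → ℝ} (hg : ∀ x, x ∉ Ioo (0 : ℝ) 1 → g x = 0) :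
    ∫ x in (0 : ℝ)..1, g x = ∫ x, g x := by
  rw [intervalIntegral.integral_of_le zero_le_one, integral_Ioc_eq_integral_Ioo,
    setIntegral_eq_integral_of_forall_compl_eq_zero hg]

theorem TestFun.abs_sub_sub_le {L : ℝ} {w : ℝ → ℝ} {f : ℕ → ℝ → ℝ} (hf : TestFun L w f)
    (x s : ℝ) : |f 0 (x + s) - f 0 x - f 1 x * s| ≤ L * |s| ^ 2 := by
  refine abs_le_pow_succ_of_hasDerivAt (k := 1)
    (F := fun s => f 0 (x + s) - f 0 x - f 1 x * s) (F' := fun s => f 1 (x + s) - f 1 x)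
    (fun s => ?_) (by simp) (fun s => ?_) s
  · have := ((HasDerivAt.comp_const_add x s (hf.hasDerivAt 0 (by omega) (x + s))).sub_const
      (f 0 x)).sub ((hasDerivAt_id s).const_mul (f 1 x))
    exact this.congr_deriv (by simp)
  · have := hf.abs_sub_le (d := 1) (by omega) x (x + s)
    simpa using this

/-- The equivalent kernels reproduce a test function and its derivative. -/
theorem TestFun.abs_convolution_sub_le (hK : KernelCondition K)
    (hT : ∀ d a : Fin 4, ∑ b : Fin 4, T d b * kernelMoment K (a + b) = if d = a then 1 else 0)
    {B : ℝ} (hB0 : 0 ≤ B) (hB : ∀ d u, |equivKernel K T d u| ≤ B) {L L' : ℝ} {w f : ℕ → ℝ → ℝ}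
    (hw : WeightFun L' w) (hf : TestFun L (w 0) f) {h : ℝ} (hh : 0 < h) (d : Fin 2) (X : ℝ) :
    |(∫ x in (0 : ℝ)..1, f 0 x * ((h ^ (1 + (d : ℕ)))⁻¹ *
        equivKernel K T (Fin.castLE (by omega) d) ((X - x) / h))) - (-1) ^ (d : ℕ) * f d X|
      ≤ 2 * B * L * h := by
  have hL := hf.nonneg_bound
  rw [intervalIntegral_eq_integral fun x hx => by rw [hf.eq_zero hw hx, zero_mul]]
  have hc0 : Continuous (f 0) := hf.continuous (by omega)
  set k := equivKernel K T (Fin.castLE (by omega) d) with hk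
  have hkc : Continuous k := continuous_equivKernel hK _
  have hcs : HasCompactSupport k := hasCompactSupport_of_eq_zero fun u hu =>
    equivKernel_eq_zero hK _ hu
  have h1 : ∫ x, f 0 x * ((h ^ (1 + (d : ℕ)))⁻¹ * k ((X - x) / h)) =
      (h ^ (d : ℕ))⁻¹ * ∫ u, k u * f 0 (X - h * u) := by
    have : ∀ x, f 0 x * ((h ^ (1 + (d : ℕ)))⁻¹ * k ((X - x) / h)) =
        (h ^ (1 + (d : ℕ)))⁻¹ * (f 0 x * k ((X - x) / h)) := fun x => by ring
    simp_rw [this]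
    rw [integral_const_mul, integral_mul_comp_sub_div _ _ hh, pow_add]
    field_simp
  rw [h1]
  have hint : ∀ g : ℝ → ℝ, Continuous g → Integrable fun u => k u * g u := fun g hg =>
    (hkc.mul hg).integrable_of_hasCompactSupport hcs.mul_right
  have m0 : ∫ u, k u = if Fin.castLE (by omega) d = (0 : Fin 4) then 1 else 0 := by
    have := integral_equivKernel_mul_pow hK hT (Fin.castLE (by omega) d) 0
    simpa using this
  have m1 : ∫ u, k u * u = if Fin.castLE (by omega) d = (1 : Fin 4) then 1 else 0 := by
    have := integral_equivKernel_mul_pow hK hT (Fin.castLE (by omega) d) 1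
    simpa using this
  have hik : Integrable k := by simpa using hint (fun _ => 1) continuous_const
  have hku : Integrable fun u => k u * u := hint (fun u => u) continuous_id
  have hkf : Integrable fun u => k u * f 0 (X - h * u) := hint _ (by fun_prop)
  fin_cases d
  · have : ∫ u, k u = 1 := by rw [m0]; rfl
    have h2 : ∫ u, k u * (f 0 (X - h * u) - f 0 X) = (∫ u, k u * f 0 (X - h * u)) - f 0 X := by
      simp_rw [mul_sub]
      rw [integral_sub hkf (hik.mul_const _), integral_mul_const, this, one_mul]
    have h3 := abs_integral_mul_le (k := k) (g := fun u => f 0 (X - h * u) - f 0 X) (M := L * h)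
      hB0 (hB _) (fun u hu => equivKernel_eq_zero hK _ hu) (fun u hu => by
        have := hf.abs_sub_le (d := 0) (by omega) X (X - h * u)
        have h4 : |X - h * u - X| ≤ h := by
          rw [show X - h * u - X = -(h * u) by ring, abs_neg, abs_mul, abs_of_pos hh]
          nlinarith
        exact this.trans (by gcongr))
    rw [h2] at h3
    simp only [pow_zero, inv_one, one_mul]
    linarith
  -- For `d = 1` the kernel has mean zero and first moment one. The substitution `x = X - h * u`
  -- makes the first order term `-h * f'(X)`, which is the source of the sign `(-1) ^ d`. The second
  -- order error `h ^ 2` is divided by `h`.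
  · have hz : ∫ u, k u = 0 := by rw [m0]; rfl
    have h1' : ∫ u, k u * u = 1 := by rw [m1]; rfl
    have h2 : ∫ u, k u * (f 0 (X - h * u) - f 0 X - f 1 X * (-(h * u))) =
        (∫ u, k u * f 0 (X - h * u)) + h * f 1 X := by
      have e : ∀ u, k u * (f 0 (X - h * u) - f 0 X - f 1 X * (-(h * u))) =
          k u * f 0 (X - h * u) - k u * f 0 X + h * f 1 X * (k u * u) := fun u => by ring
      simp_rw [e]
      have hs : Integrable fun u => k u * f 0 (X - h * u) - k u * f 0 X :=
        hkf.sub (hik.mul_const _)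
      rw [integral_add hs (hku.const_mul _),
        integral_sub hkf (hik.mul_const _), integral_mul_const, integral_const_mul, hz, h1']
      ring
    have h3 := abs_integral_mul_le (k := k)
      (g := fun u => f 0 (X - h * u) - f 0 X - f 1 X * (-(h * u))) (M := L * h ^ 2)
      hB0 (hB _) (fun u hu => equivKernel_eq_zero hK _ hu) (fun u hu => by
        have := hf.abs_sub_sub_le X (-(h * u))
        rw [← sub_eq_add_neg] at this
        have h4 : |-(h * u)| ≤ h := by
          rw [abs_neg, abs_mul, abs_of_pos hh]
          nlinarith
        exact this.trans (by gcongr))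
    rw [h2] at h3
    simp only [pow_one]
    have h5 : h⁻¹ * (∫ u, k u * f 0 (X - h * u)) - -1 * f 1 X =
        h⁻¹ * ((∫ u, k u * f 0 (X - h * u)) + h * f 1 X) := by field_simp; ring
    rw [h5, abs_mul, abs_of_pos (by positivity), inv_mul_le_iff₀ hh]
    linarith

end EquivKernel

/-! ### The integrated bias -/

theorem hasDerivAt_integral_comp_add {f φ φ' : ℝ → ℝ} (hf : Continuous f)
    (hφ : ∀ x, HasDerivAt φ (φ' x) x) (hφ' : Continuous φ') (s : ℝ) :
    HasDerivAt (fun s => ∫ x in (0 : ℝ)..1, f x * φ (x + s))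
      (∫ x in (0 : ℝ)..1, f x * φ' (x + s)) s := by
  have hφc : Continuous φ := continuous_iff_continuousAt.2 fun x => (hφ x).continuousAt
  obtain ⟨M, hM⟩ := (isCompact_Icc (a := (0 : ℝ)) (b := 1)).exists_bound_of_continuousOn
    hf.continuousOn
  obtain ⟨M', hM'⟩ := (isCompact_Icc (a := s - 1) (b := s + 2)).exists_bound_of_continuousOn
    hφ'.continuousOn
  refine (intervalIntegral.hasDerivAt_integral_of_dominated_loc_of_deriv_le (μ := volume)
    (F := fun s x => f x * φ (x + s)) (F' := fun s x => f x * φ' (x + s))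
    (bound := fun _ => M * M') (Metric.ball_mem_nhds s one_pos) ?_ ?_ ?_ ?_ ?_ ?_).2
  · refine Eventually.of_forall fun s => Continuous.aestronglyMeasurable ?_
    fun_prop
  · exact Continuous.intervalIntegrable (by fun_prop) _ _
  · exact Continuous.aestronglyMeasurable (by fun_prop)
  · refine ae_of_all _ fun x hx s' hs' => ?_
    rw [uIoc_of_le zero_le_one] at hx
    rw [Metric.mem_ball, Real.dist_eq, abs_lt] at hs'
    rw [norm_mul]
    have h1 := hM x ⟨hx.1.le, hx.2⟩
    exact mul_le_mul h1 (hM' _ ⟨by linarith [hx.1], by linarith [hx.2]⟩) (norm_nonneg _)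
      ((norm_nonneg _).trans h1)
  · exact intervalIntegrable_const
  · refine ae_of_all _ fun x _ s' _ => ?_
    exact (HasDerivAt.comp_const_add x s' (hφ (x + s'))).const_mul (f x)

/-- `m 3` is merely continuous. A translation moves the shift onto the test function, which is
Lipschitz and vanishes outside the interval. For `|s| ≤ 1` the integrand lives on `[-1, 2]`, whose
length is the factor 3; for larger shifts the trivial bound is enough. -/
theorem TestFun.abs_integral_shift_le {L L' B : ℝ} {w f m : ℕ → ℝ → ℝ} (hw : WeightFun L' w)
    (hf : TestFun L (w 0) f) (hm : SmoothFun B m) (s : ℝ) :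
    |(∫ x in (0 : ℝ)..1, f 0 x * m 3 (x + s)) - ∫ x in (0 : ℝ)..1, f 0 x * m 3 x|
      ≤ 3 * (L * B) * |s| := by
  have hL := hf.nonneg_bound
  have hB := hm.nonneg_bound
  have hc0 : Continuous (f 0) := hf.continuous (by omega)
  have hc3 := hm.continuous_three
  have hLB : 0 ≤ L * B := by positivity
  rcases le_or_gt |s| 1 with hs | hs
  · have hz : ∀ x, x ∉ Ioo (0 : ℝ) 1 → f 0 x = 0 := fun x hx => hf.eq_zero hw hx
    have hcs : HasCompactSupport (f 0) :=
      HasCompactSupport.of_support_subset_isCompact (isCompact_Icc (a := (0 : ℝ)) (b := 1))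
        fun u hu => Ioo_subset_Icc_self (by by_contra h; exact hu (hz u h))
    rw [intervalIntegral_eq_integral fun x hx => by rw [hz x hx, zero_mul],
      intervalIntegral_eq_integral fun x hx => by rw [hz x hx, zero_mul]]
    have h1 : ∫ x, f 0 x * m 3 (x + s) = ∫ y, f 0 (y - s) * m 3 y := by
      have := integral_add_right_eq_self (μ := volume) (fun y => f 0 (y - s) * m 3 y) s
      simpa using this
    have hi : Integrable fun y => f 0 y * m 3 y :=
      (hc0.mul hc3).integrable_of_hasCompactSupport hcs.mul_right
    have hi' : Integrable fun y => f 0 (y - s) * m 3 y := by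
      refine Continuous.integrable_of_hasCompactSupport (by fun_prop) ?_
      exact HasCompactSupport.mul_right (hcs.comp_homeomorph (Homeomorph.subRight s))
    rw [h1, ← integral_sub hi' hi]
    have h2 : ∫ y, (f 0 (y - s) * m 3 y - f 0 y * m 3 y) =
        ∫ y in Icc (-1 : ℝ) 2, (f 0 (y - s) * m 3 y - f 0 y * m 3 y) := by
      rw [setIntegral_eq_integral_of_forall_compl_eq_zero]
      intro y hy
      rw [abs_le] at hs
      rw [hz y fun h => hy ⟨by linarith [h.1], by linarith [h.2]⟩,
        hz (y - s) fun h => hy ⟨by linarith [h.1], by linarith [h.2]⟩]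
      ring
    rw [h2]
    have := norm_setIntegral_le_of_norm_le_const (μ := volume) (s := Icc (-1 : ℝ) 2)
      (f := fun y => f 0 (y - s) * m 3 y - f 0 y * m 3 y) (C := L * |s| * B) (by simp)
      (fun y _ => by
        rw [Real.norm_eq_abs, ← sub_mul, abs_mul]
        have h3 := hf.abs_sub_le (d := 0) (by omega) y (y - s)
        rw [show y - s - y = -s by ring, abs_neg] at h3
        exact mul_le_mul h3 (hm.bound_three y) (abs_nonneg _) (by positivity))
    rw [Real.norm_eq_abs, Real.volume_real_Icc_of_le (by norm_num)] at this
    linarith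
  · have hb : ∀ s, |∫ x in (0 : ℝ)..1, f 0 x * m 3 (x + s)| ≤ L * B := by
      intro s
      have := intervalIntegral.norm_integral_le_of_norm_le_const (a := (0 : ℝ)) (b := 1)
        (f := fun x => f 0 x * m 3 (x + s)) (C := L * B) (fun x _ => by
          rw [Real.norm_eq_abs, abs_mul]
          exact mul_le_mul (hf.bound 0 (by omega) x) (hm.bound_three _) (abs_nonneg _) hL)
      simpa using this
    have h1 := hb s
    have h2 := hb 0
    simp only [add_zero] at h2
    refine (abs_sub _ _).trans ?_
    nlinarith

/-- Averaging the third order Taylor remainder against a test function gains one order. -/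
theorem TestFun.abs_integral_taylorRem_le {L L' B : ℝ} {w f m : ℕ → ℝ → ℝ} (hw : WeightFun L' w)
    (hf : TestFun L (w 0) f) (hm : SmoothFun B m) (s : ℝ) :
    |∫ x in (0 : ℝ)..1, f 0 x * taylorRem m x (x + s)| ≤ 3 * (L * B) * |s| ^ 4 := by
  have hc0 : Continuous (f 0) := hf.continuous (by omega)
  -- As functions of the shift the integrals `G d` are successive derivatives of each other, and the
  -- averaged Taylor remainder is the Taylor remainder of `G 0` at the origin. Since `|G 3 s - G 3
  -- 0|` is of order `|s|`, three integrations give order four.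
  set G : ℕ → ℝ → ℝ := fun d s => ∫ x in (0 : ℝ)..1, f 0 x * m d (x + s) with hG
  have hd : ∀ d < 3, ∀ s, HasDerivAt (G d) (G (d + 1) s) s := fun d hd s =>
    hasDerivAt_integral_comp_add hc0 (hm.hasDerivAt d hd) (hm.continuous (by omega)) s
  have h3 : ∀ s, |G 3 s - G 3 0| ≤ 3 * (L * B) * |s| ^ 1 := fun s => by
    have := hf.abs_integral_shift_le hw hm s
    simpa [hG] using this
  have h2 := abs_le_pow_succ_of_hasDerivAt (F := fun s => G 2 s - G 2 0 - G 3 0 * s)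
    (fun s => by
      have := ((hd 2 (by omega) s).sub_const (G 2 0)).sub ((hasDerivAt_id s).const_mul (G 3 0))
      exact this.congr_deriv (by simp)) (by simp) h3
  have h1 := abs_le_pow_succ_of_hasDerivAt
    (F := fun s => G 1 s - G 1 0 - G 2 0 * s - G 3 0 / 2 * s ^ 2)
    (fun s => by
      have := (((hd 1 (by omega) s).sub_const (G 1 0)).sub
        ((hasDerivAt_id s).const_mul (G 2 0))).sub ((hasDerivAt_pow 2 s).const_mul (G 3 0 / 2))
      refine this.congr_deriv ?_
      simp only [mul_one, Nat.cast_ofNat]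
      ring) (by simp) h2
  have h0 := abs_le_pow_succ_of_hasDerivAt
    (F := fun s => G 0 s - G 0 0 - G 1 0 * s - G 2 0 / 2 * s ^ 2 - G 3 0 / 6 * s ^ 3)
    (fun s => by
      have := ((((hd 0 (by omega) s).sub_const (G 0 0)).sub
        ((hasDerivAt_id s).const_mul (G 1 0))).sub
        ((hasDerivAt_pow 2 s).const_mul (G 2 0 / 2))).sub ((hasDerivAt_pow 3 s).const_mul (G 3 0 / 6))
      refine this.congr_deriv ?_
      simp only [mul_one, Nat.cast_ofNat]
      ring) (by simp) h1
  have hi : ∀ d ≤ 3, ∀ s, IntervalIntegrable (fun x => f 0 x * m d (x + s)) volume 0 1 := by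
    intro d hd s
    have := hm.continuous hd
    exact Continuous.intervalIntegrable (by fun_prop) _ _
  have hi0 : ∀ d ≤ 3, IntervalIntegrable (fun x => f 0 x * m d x) volume 0 1 := by
    intro d hd
    simpa using hi d hd 0
  have : ∫ x in (0 : ℝ)..1, f 0 x * taylorRem m x (x + s) =
      G 0 s - G 0 0 - G 1 0 * s - G 2 0 / 2 * s ^ 2 - G 3 0 / 6 * s ^ 3 := by
    have e : ∀ x, f 0 x * taylorRem m x (x + s) = f 0 x * m 0 (x + s) - f 0 x * m 0 x
        - f 0 x * m 1 x * s - f 0 x * m 2 x * (s ^ 2 / 2) - f 0 x * m 3 x * (s ^ 3 / 6) := by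
      intro x
      rw [taylorRem_eq]; ring
    simp_rw [e]
    rw [intervalIntegral.integral_sub, intervalIntegral.integral_sub,
      intervalIntegral.integral_sub, intervalIntegral.integral_sub,
      intervalIntegral.integral_mul_const, intervalIntegral.integral_mul_const,
      intervalIntegral.integral_mul_const]
    · simp only [hG, add_zero]; ring
    · exact hi 0 (by omega) s
    · exact hi0 0 (by omega)
    · exact (hi 0 (by omega) s).sub (hi0 0 (by omega))
    · exact (hi0 1 (by omega)).mul_const _
    · exact ((hi 0 (by omega) s).sub (hi0 0 (by omega))).sub ((hi0 1 (by omega)).mul_const _)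
    · exact (hi0 2 (by omega)).mul_const _
    · exact (((hi 0 (by omega) s).sub (hi0 0 (by omega))).sub
        ((hi0 1 (by omega)).mul_const _)).sub ((hi0 2 (by omega)).mul_const _)
    · exact (hi0 3 (by omega)).mul_const _
  rw [this]
  exact h0 s

/-- The expectation of a kernel weighted moment at a point away from the boundary. -/
noncomputable def lpMean (K : ℝ → ℝ) (h : ℝ) (g : ℝ → ℝ → ℝ) (x : ℝ) (b : ℕ) : ℝ :=
  ∫ u, K u * u ^ b * g x (x + h * u)

theorem lpMean_one (K : ℝ → ℝ) (h x : ℝ) (b : ℕ) :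
    lpMean K h (fun _ _ => 1) x b = kernelMoment K b := by
  simp [lpMean, kernelMoment]

theorem SmoothFun.continuous_taylorRem {B : ℝ} {m : ℕ → ℝ → ℝ} (hm : SmoothFun B m) :
    Continuous fun q : ℝ × ℝ => taylorRem m q.1 q.2 := by
  have h0 := hm.continuous (d := 0) (by omega)
  have h1 : ∀ i : Fin 4, Continuous (m i) := fun i => hm.continuous (by omega)
  unfold taylorRem
  refine Continuous.sub (by fun_prop) (continuous_finsetSum _ fun i _ => ?_)
  have := h1 i
  fun_prop

theorem intervalIntegral_intervalIntegral_swap {F : ℝ → ℝ → ℝ} {a b c d : ℝ}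
    (hab : a ≤ b) (hcd : c ≤ d) (hF : Continuous fun q : ℝ × ℝ => F q.1 q.2) :
    ∫ x in a..b, ∫ y in c..d, F x y = ∫ y in c..d, ∫ x in a..b, F x y := by
  simp only [intervalIntegral.integral_of_le hab, intervalIntegral.integral_of_le hcd]
  refine integral_integral_swap ?_
  rw [Measure.prod_restrict]
  exact (hF.continuousOn.integrableOn_compact (isCompact_Icc.prod isCompact_Icc)).mono_set
    (prod_mono Ioc_subset_Icc_self Ioc_subset_Icc_self)

/-- Pointwise the bias is only of order `h ^ 3`. Integrating over `x` first, with `s = h * u` fixed,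
gives `h ^ 4`. This extra order pays for the division by `h` in the estimation of a derivative. -/
theorem abs_integral_equivKernel_bias_le {K : ℝ → ℝ} {T : Matrix (Fin 4) (Fin 4) ℝ}
    (hK : KernelCondition K) {Bk : ℝ} (hB0 : 0 ≤ Bk) (hBk : ∀ d u, |equivKernel K T d u| ≤ Bk)
    {L L' B : ℝ} {w f m : ℕ → ℝ → ℝ} (hw : WeightFun L' w)
    (hf : TestFun L (w 0) f) (hm : SmoothFun B m) {h : ℝ} (hh : 0 < h) (d : Fin 4) :
    |∫ x in (0 : ℝ)..1, f 0 x * ∑ b : Fin 4, T d b * lpMean K h (taylorRem m) x b|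
      ≤ 6 * Bk * (L * B) * h ^ 4 := by
  have hL := hf.nonneg_bound
  have hB := hm.nonneg_bound
  have hc0 : Continuous (f 0) := hf.continuous (by omega)
  have htr := hm.continuous_taylorRem
  have hkc := continuous_equivKernel (T := T) hK d
  have h1 : ∀ x, ∑ b : Fin 4, T d b * lpMean K h (taylorRem m) x b =
      ∫ u in (-1 : ℝ)..1, equivKernel K T d u * taylorRem m x (x + h * u) := by
    intro x
    rw [intervalIntegral.integral_of_le (by norm_num), ← integral_Icc_eq_integral_Ioc,
      setIntegral_eq_integral_of_forall_compl_eq_zero, integral_equivKernel_mul hK]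
    · rfl
    · exact htr.comp (by fun_prop : Continuous fun u : ℝ => (x, x + h * u))
    · intro u hu
      rw [equivKernel_eq_zero hK, zero_mul]
      by_contra h; exact hu (abs_le.1 (not_lt.1 h))
  simp_rw [h1, ← intervalIntegral.integral_const_mul]
  rw [intervalIntegral_intervalIntegral_swap zero_le_one (by norm_num)]
  · have := intervalIntegral.norm_integral_le_of_norm_le_const (a := (-1 : ℝ)) (b := 1)
      (f := fun u => ∫ x in (0 : ℝ)..1, f 0 x *
        (equivKernel K T d u * taylorRem m x (x + h * u))) (C := Bk * (3 * (L * B) * h ^ 4))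
      (fun u hu => by
        have e : ∀ x, f 0 x * (equivKernel K T d u * taylorRem m x (x + h * u)) =
          equivKernel K T d u * (f 0 x * taylorRem m x (x + h * u)) := fun x => by ring
        simp_rw [e]
        rw [intervalIntegral.integral_const_mul, Real.norm_eq_abs, abs_mul]
        rw [uIoc_of_le (by norm_num)] at hu
        have hu' : |h * u| ≤ h := by
          rw [abs_mul, abs_of_pos hh]
          have : |u| ≤ 1 := abs_le.2 ⟨hu.1.le, hu.2⟩
          nlinarith
        refine mul_le_mul (hBk d u) ?_ (abs_nonneg _) hB0
        refine (hf.abs_integral_taylorRem_le hw hm (h * u)).trans ?_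
        gcongr)
    rw [Real.norm_eq_abs] at this
    refine this.trans (le_of_eq ?_)
    norm_num
    ring
  · have := htr.comp (by fun_prop : Continuous fun q : ℝ × ℝ => (q.1, q.1 + h * q.2))
    exact (hc0.comp continuous_fst).mul ((hkc.comp continuous_snd).mul this)


/-! ### Mean squared errors of the kernel weighted moments -/

/-- Cauchy–Schwarz inequality for a function dominated by a geometric mean. -/
theorem sq_intervalIntegral_le {g A D : ℝ → ℝ} (hA : IntervalIntegrable A volume 0 1)
    (hD : IntervalIntegrable D volume 0 1) (hA0 : ∀ x ∈ Icc (0 : ℝ) 1, 0 ≤ A x)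
    (hD0 : ∀ x ∈ Icc (0 : ℝ) 1, 0 ≤ D x) (hg : ∀ x ∈ Icc (0 : ℝ) 1, g x ^ 2 ≤ A x * D x) :
    (∫ x in (0 : ℝ)..1, g x) ^ 2 ≤ (∫ x in (0 : ℝ)..1, A x) * ∫ x in (0 : ℝ)..1, D x := by
  set G := |∫ x in (0 : ℝ)..1, g x| with hG
  -- For `t > 0` one has `2 |g| ≤ t A + t⁻¹ D` pointwise. Integrated and multiplied by `t` this is a
  -- quadratic polynomial in `t` without sign change, and its discriminant is the inequality.
  have key : ∀ t : ℝ, 0 ≤ (∫ x in (0 : ℝ)..1, A x) * (t * t) + (-(2 * G)) * t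
      + ∫ x in (0 : ℝ)..1, D x := by
    intro t
    rcases le_or_gt t 0 with ht | ht
    · have h1 : 0 ≤ ∫ x in (0 : ℝ)..1, A x := intervalIntegral.integral_nonneg zero_le_one hA0
      have h2 : 0 ≤ ∫ x in (0 : ℝ)..1, D x := intervalIntegral.integral_nonneg zero_le_one hD0
      have h3 : 0 ≤ G := abs_nonneg _
      nlinarith [mul_nonneg h1 (mul_self_nonneg t), mul_nonneg h3 (neg_nonneg.2 ht)]
    · have h1 : G ≤ ∫ x in (0 : ℝ)..1, (t * A x + t⁻¹ * D x) / 2 := by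
        refine intervalIntegral.norm_integral_le_of_norm_le (f := g) zero_le_one ?_
          (((hA.const_mul t).add (hD.const_mul t⁻¹)).div_const 2)
        refine ae_of_all _ fun x hx => ?_
        have hx' : x ∈ Icc (0 : ℝ) 1 := Ioc_subset_Icc_self hx
        have ha := hA0 x hx'
        have hd := hD0 x hx'
        rw [Real.norm_eq_abs]
        refine abs_le_of_sq_le_sq ?_ (by positivity)
        refine (hg x hx').trans ?_
        have : A x * D x = (t * A x) * (t⁻¹ * D x) := by field_simp
        rw [this]
        nlinarith [sq_nonneg (t * A x - t⁻¹ * D x)]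
      rw [intervalIntegral.integral_div, intervalIntegral.integral_add (hA.const_mul t)
        (hD.const_mul t⁻¹), intervalIntegral.integral_const_mul,
        intervalIntegral.integral_const_mul] at h1
      have h2 : 2 * G * t ≤ (t * (∫ x in (0 : ℝ)..1, A x) + t⁻¹ * ∫ x in (0 : ℝ)..1, D x) * t := by
        gcongr
        linarith
      have h3 : t⁻¹ * (∫ x in (0 : ℝ)..1, D x) * t = ∫ x in (0 : ℝ)..1, D x := by
        field_simp
      nlinarith
  have := discrim_le_zero key
  rw [discrim] at this
  rw [← sq_abs]
  nlinarith

theorem lintegral_ofReal_intervalIntegral_le {α : Type*} [TopologicalSpace α] [MeasurableSpace α]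
    [OpensMeasurableSpace α] [SecondCountableTopology α] (μ : Measure α) [SFinite μ] {F : α → ℝ → ℝ}
    (hF : Continuous fun q : α × ℝ => F q.1 q.2) (hF0 : ∀ a x, 0 ≤ F a x) {c : ENNReal}
    (hc : ∀ x ∈ Icc (0 : ℝ) 1, ∫⁻ a, ENNReal.ofReal (F a x) ∂μ ≤ c) :
    ∫⁻ a, ENNReal.ofReal (∫ x in (0 : ℝ)..1, F a x) ∂μ ≤ c := by
  have h1 : ∀ a, ENNReal.ofReal (∫ x in (0 : ℝ)..1, F a x) =
      ∫⁻ x in Ioc (0 : ℝ) 1, ENNReal.ofReal (F a x) := by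
    intro a
    have hFa : Continuous (F a) := hF.comp (by fun_prop : Continuous fun x : ℝ => (a, x))
    rw [intervalIntegral.integral_of_le zero_le_one]
    exact ofReal_integral_eq_lintegral_ofReal
      ((hFa.integrableOn_Icc (a := 0) (b := 1)).mono_set Ioc_subset_Icc_self)
      (ae_of_all _ fun x => hF0 a x)
  simp_rw [h1]
  rw [lintegral_lintegral_swap]
  · calc ∫⁻ x in Ioc (0 : ℝ) 1, ∫⁻ a, ENNReal.ofReal (F a x) ∂μ
        ≤ ∫⁻ x in Ioc (0 : ℝ) 1, c := by
          refine setLIntegral_mono' measurableSet_Ioc fun x hx => hc x (Ioc_subset_Icc_self hx)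
      _ = c := by simp
  · exact (ENNReal.measurable_ofReal.comp hF.measurable).aemeasurable

theorem continuous_lpMoment {n : ℕ} {K : ℝ → ℝ} (hK : Continuous K) (h : ℝ) (b : ℕ) {α : Type*}
    [TopologicalSpace α] {X y : α → Fin n → ℝ} {x : α → ℝ} (hX : Continuous X) (hx : Continuous x)
    (hy : Continuous y) : Continuous fun q => lpMoment K h (X q) (x q) (y q) b := by
  unfold lpMoment
  fun_prop

theorem SmoothFun.continuous_lpMean {K : ℝ → ℝ} (hK : KernelCondition K) {B : ℝ}
    {m : ℕ → ℝ → ℝ} (hm : SmoothFun B m) (h : ℝ) (b : ℕ) :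
    Continuous fun x => lpMean K h (taylorRem m) x b := by
  have h1 : ∀ x, lpMean K h (taylorRem m) x b =
      ∫ u in (-1 : ℝ)..1, K u * u ^ b * taylorRem m x (x + h * u) := by
    intro x
    rw [intervalIntegral.integral_of_le (by norm_num), ← integral_Icc_eq_integral_Ioc,
      setIntegral_eq_integral_of_forall_compl_eq_zero, lpMean]
    intro u hu
    rw [hK.eq_zero, zero_mul, zero_mul]
    by_contra h; exact hu (abs_le.1 (not_lt.1 h))
  simp_rw [h1]
  refine intervalIntegral.continuous_parametric_intervalIntegral_of_continuous' ?_ _ _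
  have hKc := hK.continuous
  have := hm.continuous_taylorRem.comp
    (by fun_prop : Continuous fun q : ℝ × ℝ => (q.1, q.1 + h * q.2))
  exact ((hKc.comp continuous_snd).mul (continuous_snd.pow b)).mul this

section Expectation

variable {n : ℕ} {K : ℝ → ℝ} {B L h : ℝ}

/-- Weighted mean squared deviation of a kernel weighted moment from its interior expectation. -/
theorem lintegral_weight_sq_lpMoment_sub_le (hK : KernelCondition K) (hB : ∀ u, |K u| ≤ B)
    {w : ℕ → ℝ → ℝ} (hw : WeightFun L w) (hn : 0 < n) (hh : 0 < h)
    (x : ℝ) {g : ℝ → ℝ → ℝ} (hg : Continuous (g x)) {M : ℝ} (hM0 : 0 ≤ M)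
    (hM : ∀ y, |y - x| ≤ h → |g x y| ≤ M) (b : ℕ) :
    ∫⁻ X, ENNReal.ofReal (w 0 x ^ 2 *
        (lpMoment K h X x (fun t => g x (X t)) b - lpMean K h g x b) ^ 2) ∂designLaw n
      ≤ ENNReal.ofReal (36 * B ^ 2 * L ^ 2 * M ^ 2 * (1 / (n * h) + h ^ 4)) := by
  have hn' : (0 : ℝ) < n := by exact_mod_cast hn
  have hB0 : 0 ≤ B := (abs_nonneg _).trans (hB 0)
  have hKc := hK.continuous
  set φ : ℝ → ℝ := fun y => h⁻¹ * (K ((y - x) / h) * ((y - x) / h) ^ b * g x y) with hφ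
  have hφc : Continuous φ := by rw [hφ]; fun_prop
  have hφb : ∀ y, |φ y| ≤ h⁻¹ * (B * M) := by
    intro y
    rw [hφ, abs_mul, abs_of_pos (by positivity : 0 < h⁻¹), abs_mul]
    refine mul_le_mul_of_nonneg_left ?_ (by positivity)
    have h1 := hK.abs_mul_pow_le_indicator hB hh y x b
    by_cases hy : y ∈ Icc (x - h) (x + h)
    · rw [indicator_of_mem hy, mul_one] at h1
      exact mul_le_mul h1 (hM y (abs_le.2 ⟨by linarith [hy.1], by linarith [hy.2]⟩))
        (abs_nonneg _) hB0
    · rw [indicator_of_notMem hy, mul_zero] at h1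
      rw [le_antisymm h1 (abs_nonneg _), zero_mul]
      positivity
  have hφz : ∀ y, y ∉ Icc (x - h) (x + h) → φ y = 0 := by
    intro y hy
    have h1 := hK.abs_mul_pow_le_indicator hB hh y x b
    rw [indicator_of_notMem hy, mul_zero] at h1
    rw [hφ]
    simp only
    rw [abs_eq_zero.1 (le_antisymm h1 (abs_nonneg _))]
    ring
  have hmom : ∀ X : Fin n → ℝ, lpMoment K h X x (fun t => g x (X t)) b =
      (n : ℝ)⁻¹ * ∑ t, φ (X t) := by
    intro X
    rw [lpMoment, hφ, ← Finset.mul_sum, mul_inv, mul_assoc]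
  set μ := ∫ y in (0 : ℝ)..1, φ y with hμ
  have hset : ∀ {f : ℝ → ℝ} {c : ℝ}, (∀ y, |f y| ≤ c) → (∀ y, y ∉ Icc (x - h) (x + h) → f y = 0) →
      |∫ y in (0 : ℝ)..1, f y| ≤ c * (2 * h) := by
    intro f c hf hz
    rw [intervalIntegral.integral_of_le zero_le_one]
    have h1 : ∫ y in Ioc (0 : ℝ) 1, f y = ∫ y in Ioc (0 : ℝ) 1 ∩ Icc (x - h) (x + h), f y := by
      rw [← setIntegral_eq_of_subset_of_forall_sdiff_eq_zero measurableSet_Ioc inter_subset_left]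
      intro y hy
      exact hz y fun h' => hy.2 ⟨hy.1, h'⟩
    rw [h1]
    have hc : 0 ≤ c := (abs_nonneg _).trans (hf 0)
    have := norm_setIntegral_le_of_norm_le_const (μ := volume)
      (s := Ioc (0 : ℝ) 1 ∩ Icc (x - h) (x + h)) (f := f) (C := c)
      ((measure_mono inter_subset_left).trans_lt (by simp)) (fun y _ => hf y)
    rw [Real.norm_eq_abs] at this
    refine this.trans ?_
    gcongr
    calc volume.real (Ioc (0 : ℝ) 1 ∩ Icc (x - h) (x + h)) ≤ volume.real (Icc (x - h) (x + h)) :=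
          measureReal_mono inter_subset_right (by simp)
      _ = 2 * h := by rw [Real.volume_real_Icc_of_le (by linarith)]; ring
  have hφsq : ∫ y in (0 : ℝ)..1, φ y ^ 2 ≤ 2 * (B * M) ^ 2 / h := by
    have h1 := hset (f := fun y => φ y ^ 2) (c := (h⁻¹ * (B * M)) ^ 2)
      (fun y => by rw [abs_pow]; gcongr; exact hφb y) (fun y hy => by rw [hφz y hy]; ring)
    refine (le_abs_self _).trans (h1.trans (le_of_eq ?_))
    field_simp
  have hμb : |μ| ≤ 2 * (B * M) := by
    have h1 := hset hφb hφz
    refine h1.trans (le_of_eq ?_)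
    field_simp
  have hmb : |lpMean K h g x b| ≤ 2 * (B * M) := by
    rw [lpMean]
    have := abs_integral_mul_le (k := fun u => K u * u ^ b) (g := fun u => g x (x + h * u)) (M := M)
      hB0 (fun u => hK.abs_mul_pow_le hB u b) (fun u hu => by rw [hK.eq_zero hu, zero_mul])
      (fun u hu => hM _ (by
        rw [add_sub_cancel_left, abs_mul, abs_of_pos hh]
        nlinarith))
    linarith
  -- Away from the ends the kernel window lies inside the unit interval, and the expectation is
  -- exactly `lpMean`.
  have hint : x ∈ Ioo h (1 - h) → lpMean K h g x b = μ := by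
    intro hx'
    rw [hμ, intervalIntegral_eq_integral fun y hy => hφz y fun h' => hy
      ⟨by linarith [h'.1, hx'.1], by linarith [h'.2, hx'.2]⟩]
    rw [lpMean]
    have h1 := integral_sub_right_eq_self (μ := volume)
      (fun z => h⁻¹ * (K (z / h) * (z / h) ^ b * g x (x + z))) x
    have h2 := Measure.integral_comp_div (fun u => K u * u ^ b * g x (x + h * u)) h
    rw [abs_of_pos hh, smul_eq_mul] at h2
    have h3 : ∫ y, φ y = ∫ z, h⁻¹ * (K (z / h) * (z / h) ^ b * g x (x + z)) := by
      rw [← h1]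
      congr 1
      funext y
      rw [hφ]
      simp
    rw [h3, integral_const_mul]
    have h4 : ∀ z, K (z / h) * (z / h) ^ b * g x (x + z) =
        K (z / h) * (z / h) ^ b * g x (x + h * (z / h)) := fun z => by
      rw [mul_div_cancel₀ _ hh.ne']
    simp_rw [h4]
    rw [h2]
    field_simp
  have hvar := lintegral_sq_sampleMean_le (n := n) hφc.measurable (M := h⁻¹ * (B * M))
    fun y _ => hφb y
  rw [if_neg hn.ne', add_zero] at hvar
  have hL := hw.nonneg_bound
  have hwx := hw.nonneg x
  have hwL : w 0 x ≤ L := (le_abs_self _).trans (hw.bound 0 (by omega) x)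
  -- Within `h` of an end the expectation may be off by a multiple of `B * M`, but there the weight
  -- is at most `L * h ^ 2`. Its square is the term `h ^ 4`.
  have hdet : w 0 x ^ 2 * (2 * (μ - lpMean K h g x b) ^ 2) ≤
      32 * B ^ 2 * L ^ 2 * M ^ 2 * h ^ 4 := by
    by_cases hx' : x ∈ Ioo h (1 - h)
    · rw [hint hx']
      simp only [sub_self, ne_eq, OfNat.ofNat_ne_zero, not_false_eq_true, zero_pow, mul_zero]
      positivity
    · have h1 := hw.le_sq hh.le hx'
      have h2 : (μ - lpMean K h g x b) ^ 2 ≤ (4 * (B * M)) ^ 2 := by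
        rw [← sq_abs]
        gcongr
        exact (abs_sub _ _).trans (by linarith)
      calc w 0 x ^ 2 * (2 * (μ - lpMean K h g x b) ^ 2)
          ≤ (L * h ^ 2) ^ 2 * (2 * (4 * (B * M)) ^ 2) := by gcongr
        _ = _ := by ring
  have hpt : ∀ X : Fin n → ℝ, w 0 x ^ 2 *
      (lpMoment K h X x (fun t => g x (X t)) b - lpMean K h g x b) ^ 2 ≤
      2 * L ^ 2 * ((n : ℝ)⁻¹ * ∑ t, φ (X t) - μ) ^ 2 +
        w 0 x ^ 2 * (2 * (μ - lpMean K h g x b) ^ 2) := by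
    intro X
    rw [hmom X]
    set a := (n : ℝ)⁻¹ * ∑ t, φ (X t)
    have h1 : (a - lpMean K h g x b) ^ 2 ≤ 2 * (a - μ) ^ 2 + 2 * (μ - lpMean K h g x b) ^ 2 := by
      nlinarith [sq_nonneg ((a - μ) - (μ - lpMean K h g x b))]
    have h2 : w 0 x ^ 2 ≤ L ^ 2 := by gcongr
    nlinarith [mul_le_mul_of_nonneg_left h1 (sq_nonneg (w 0 x)),
      mul_le_mul_of_nonneg_right h2 (sq_nonneg (a - μ))]
  calc ∫⁻ X, ENNReal.ofReal (w 0 x ^ 2 *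
        (lpMoment K h X x (fun t => g x (X t)) b - lpMean K h g x b) ^ 2) ∂designLaw n
      ≤ ∫⁻ X : Fin n → ℝ, (ENNReal.ofReal (2 * L ^ 2) *
          ENNReal.ofReal (((n : ℝ)⁻¹ * ∑ t, φ (X t) - μ) ^ 2) +
          ENNReal.ofReal (32 * B ^ 2 * L ^ 2 * M ^ 2 * h ^ 4)) ∂designLaw n := by
        refine lintegral_mono fun X => ?_
        rw [← ENNReal.ofReal_mul (by positivity), ← ENNReal.ofReal_add (by positivity)
          (by positivity)]
        exact ENNReal.ofReal_le_ofReal ((hpt X).trans (by gcongr))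
    _ ≤ ENNReal.ofReal (2 * L ^ 2) * ENNReal.ofReal ((n : ℝ)⁻¹ * ∫ y in (0 : ℝ)..1, φ y ^ 2) +
          ENNReal.ofReal (32 * B ^ 2 * L ^ 2 * M ^ 2 * h ^ 4) := by
        rw [lintegral_add_right _ measurable_const, lintegral_const, measure_univ, mul_one,
          lintegral_const_mul' _ _ ENNReal.ofReal_ne_top]
        gcongr
    _ ≤ _ := by
        rw [← ENNReal.ofReal_mul (by positivity), ← ENNReal.ofReal_add (by
          have : 0 ≤ ∫ y in (0 : ℝ)..1, φ y ^ 2 :=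
            intervalIntegral.integral_nonneg zero_le_one fun _ _ => sq_nonneg _
          positivity) (by positivity)]
        refine ENNReal.ofReal_le_ofReal ?_
        calc 2 * L ^ 2 * ((n : ℝ)⁻¹ * ∫ y in (0 : ℝ)..1, φ y ^ 2) +
              32 * B ^ 2 * L ^ 2 * M ^ 2 * h ^ 4
            ≤ 2 * L ^ 2 * ((n : ℝ)⁻¹ * (2 * (B * M) ^ 2 / h)) +
              32 * B ^ 2 * L ^ 2 * M ^ 2 * h ^ 4 := by gcongr
          _ = 4 * B ^ 2 * L ^ 2 * M ^ 2 * (1 / (n * h)) +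
              32 * B ^ 2 * L ^ 2 * M ^ 2 * h ^ 4 := by field_simp; ring
          _ ≤ 36 * B ^ 2 * L ^ 2 * M ^ 2 * (1 / (n * h)) +
              36 * B ^ 2 * L ^ 2 * M ^ 2 * h ^ 4 := by gcongr <;> norm_num
          _ = _ := by ring

/-- Integrated squared deviation of the moments of the design. -/
noncomputable def devDesign (K : ℝ → ℝ) (h : ℝ) (w : ℝ → ℝ) (X : Fin n → ℝ) : ℝ :=
  ∫ x in (0 : ℝ)..1, ∑ k ∈ Finset.range 7,
    w x ^ 2 * (lpMoment K h X x (fun _ => 1) k - kernelMoment K k) ^ 2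

/-- Integrated squared deviation of the moments of the Taylor remainder. -/
noncomputable def devTaylor (K : ℝ → ℝ) (h : ℝ) (w : ℝ → ℝ) (m : ℕ → ℝ → ℝ) (X : Fin n → ℝ) : ℝ :=
  ∫ x in (0 : ℝ)..1, ∑ b : Fin 4, w x ^ 2 *
    (lpMoment K h X x (fun t => taylorRem m x (X t)) b - lpMean K h (taylorRem m) x b) ^ 2

/-- Integrated square of the moments of the noise. -/
noncomputable def noiseEnergy (K : ℝ → ℝ) (h : ℝ) (X e : Fin n → ℝ) : ℝ :=
  ∫ x in (0 : ℝ)..1, ∑ b : Fin 4, lpMoment K h X x e b ^ 2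

theorem continuous_devDesign_integrand (hK : KernelCondition K) {w : ℝ → ℝ} (hw : Continuous w) :
    Continuous fun q : (Fin n → ℝ) × ℝ => ∑ k ∈ Finset.range 7,
      w q.2 ^ 2 * (lpMoment K h q.1 q.2 (fun _ => 1) k - kernelMoment K k) ^ 2 := by
  refine continuous_finsetSum _ fun k _ => ?_
  have := continuous_lpMoment (n := n) hK.continuous h k (X := fun q : (Fin n → ℝ) × ℝ => q.1)
    (x := fun q => q.2) (y := fun _ _ => 1) (by fun_prop) (by fun_prop) (by fun_prop)
  fun_prop

theorem continuous_devTaylor_integrand (hK : KernelCondition K) {w : ℝ → ℝ} (hw : Continuous w)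
    {m : ℕ → ℝ → ℝ} (hm : SmoothFun B m) :
    Continuous fun q : (Fin n → ℝ) × ℝ => ∑ b : Fin 4, w q.2 ^ 2 *
      (lpMoment K h q.1 q.2 (fun t => taylorRem m q.2 (q.1 t)) b
        - lpMean K h (taylorRem m) q.2 b) ^ 2 := by
  refine continuous_finsetSum _ fun b _ => ?_
  have h1 : Continuous fun q : (Fin n → ℝ) × ℝ => fun t => taylorRem m q.2 (q.1 t) :=
    continuous_pi fun t => hm.continuous_taylorRem.comp
      (by fun_prop : Continuous fun q : (Fin n → ℝ) × ℝ => (q.2, q.1 t))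
  have := continuous_lpMoment (n := n) hK.continuous h b (X := fun q : (Fin n → ℝ) × ℝ => q.1)
    (x := fun q => q.2) (by fun_prop) (by fun_prop) h1
  have h2 := (hm.continuous_lpMean hK h b).comp (continuous_snd (X := Fin n → ℝ))
  exact ((hw.comp continuous_snd).pow 2).mul ((this.sub h2).pow 2)

theorem continuous_noiseEnergy_integrand (hK : KernelCondition K) :
    Continuous fun q : ((Fin n → ℝ) × (Fin n → ℝ)) × ℝ =>
      ∑ b : Fin 4, lpMoment K h q.1.1 q.2 q.1.2 b ^ 2 := by
  refine continuous_finsetSum _ fun b _ => ?_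
  exact (continuous_lpMoment (n := n) hK.continuous h b (by fun_prop) (by fun_prop)
    (by fun_prop)).pow 2

theorem continuous_devDesign (hK : KernelCondition K) {w : ℝ → ℝ} (hw : Continuous w) :
    Continuous fun X : Fin n → ℝ => devDesign K h w X :=
  intervalIntegral.continuous_parametric_intervalIntegral_of_continuous'
    (continuous_devDesign_integrand hK hw) 0 1

theorem continuous_devTaylor (hK : KernelCondition K) {w : ℝ → ℝ} (hw : Continuous w)
    {m : ℕ → ℝ → ℝ} (hm : SmoothFun B m) :
    Continuous fun X : Fin n → ℝ => devTaylor K h w m X :=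
  intervalIntegral.continuous_parametric_intervalIntegral_of_continuous'
    (continuous_devTaylor_integrand hK hw hm) 0 1

theorem continuous_noiseEnergy (hK : KernelCondition K) :
    Continuous fun q : (Fin n → ℝ) × (Fin n → ℝ) => noiseEnergy K h q.1 q.2 :=
  intervalIntegral.continuous_parametric_intervalIntegral_of_continuous'
    (continuous_noiseEnergy_integrand hK) 0 1

theorem noiseEnergy_nonneg (X e : Fin n → ℝ) : 0 ≤ noiseEnergy K h X e :=
  intervalIntegral.integral_nonneg zero_le_one fun _ _ => Finset.sum_nonneg fun _ _ => sq_nonneg _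

theorem devDesign_nonneg (w : ℝ → ℝ) (X : Fin n → ℝ) : 0 ≤ devDesign K h w X :=
  intervalIntegral.integral_nonneg zero_le_one fun _ _ => Finset.sum_nonneg fun _ _ => by positivity

theorem devTaylor_nonneg (w : ℝ → ℝ) (m : ℕ → ℝ → ℝ) (X : Fin n → ℝ) :
    0 ≤ devTaylor K h w m X :=
  intervalIntegral.integral_nonneg zero_le_one fun _ _ => Finset.sum_nonneg fun _ _ => by positivity

theorem lintegral_ofReal_sum_le {α ι : Type*} [MeasurableSpace α] (μ : Measure α) (s : Finset ι)
    {F : ι → α → ℝ} (hF : ∀ i ∈ s, Measurable (F i)) (hF0 : ∀ i ∈ s, ∀ a, 0 ≤ F i a) {c : ℝ}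
    (hc : ∀ i ∈ s, ∫⁻ a, ENNReal.ofReal (F i a) ∂μ ≤ ENNReal.ofReal c) :
    ∫⁻ a, ENNReal.ofReal (∑ i ∈ s, F i a) ∂μ ≤ ENNReal.ofReal (s.card * c) := by
  have h1 : ∀ a, ENNReal.ofReal (∑ i ∈ s, F i a) = ∑ i ∈ s, ENNReal.ofReal (F i a) := fun a =>
    ENNReal.ofReal_sum_of_nonneg fun i hi => hF0 i hi a
  simp_rw [h1]
  rw [lintegral_finsetSum _ fun i hi => (hF i hi).ennreal_ofReal]
  calc ∑ i ∈ s, ∫⁻ a, ENNReal.ofReal (F i a) ∂μ ≤ ∑ i ∈ s, ENNReal.ofReal c :=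
        Finset.sum_le_sum hc
    _ = _ := by rw [Finset.sum_const, nsmul_eq_mul, ENNReal.ofReal_mul (by positivity),
        ENNReal.ofReal_natCast]

theorem lintegral_devDesign_le (hK : KernelCondition K) (hB : ∀ u, |K u| ≤ B)
    {w : ℕ → ℝ → ℝ} (hw : WeightFun L w) (hn : 0 < n) (hh : 0 < h) :
    ∫⁻ X, ENNReal.ofReal (devDesign K h (w 0) X) ∂designLaw n ≤
      ENNReal.ofReal (7 * (36 * B ^ 2 * L ^ 2 * (1 / (n * h) + h ^ 4))) := by
  refine lintegral_ofReal_intervalIntegral_le _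
    (continuous_devDesign_integrand hK (hw.continuous (by omega)))
    (fun _ _ => Finset.sum_nonneg fun _ _ => by positivity) fun x _ => ?_
  refine (lintegral_ofReal_sum_le _ _ (fun k _ => ?_) (fun _ _ _ => by positivity)
    (c := 36 * B ^ 2 * L ^ 2 * (1 / (n * h) + h ^ 4)) fun k _ => ?_).trans
    (by simp)
  · have := continuous_lpMoment (n := n) hK.continuous h k (X := fun q : Fin n → ℝ => q)
      (x := fun _ => x) (y := fun _ _ => 1) (by fun_prop) (by fun_prop) (by fun_prop)
    exact (Continuous.measurable (by fun_prop))
  · have := lintegral_weight_sq_lpMoment_sub_le hK hB hw hn hh x (g := fun _ _ => 1) (M := 1)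
      (by fun_prop) zero_le_one (fun _ _ => by simp) k
    simp_rw [lpMean_one] at this
    simpa using this

theorem lintegral_devTaylor_le (hK : KernelCondition K) (hB : ∀ u, |K u| ≤ B)
    {w : ℕ → ℝ → ℝ} (hw : WeightFun L w) {B' : ℝ} {m : ℕ → ℝ → ℝ} (hm : SmoothFun B' m)
    (hn : 0 < n) (hh : 0 < h) :
    ∫⁻ X, ENNReal.ofReal (devTaylor K h (w 0) m X) ∂designLaw n ≤
      ENNReal.ofReal (4 * (36 * B ^ 2 * L ^ 2 * (2 * B' * h ^ 3) ^ 2 * (1 / (n * h) + h ^ 4))) := by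
  have hB' := hm.nonneg_bound
  refine lintegral_ofReal_intervalIntegral_le _
    (continuous_devTaylor_integrand hK (hw.continuous (by omega)) hm)
    (fun _ _ => Finset.sum_nonneg fun _ _ => by positivity) fun x _ => ?_
  refine (lintegral_ofReal_sum_le _ _ (fun b _ => ?_) (fun _ _ _ => by positivity)
    (c := 36 * B ^ 2 * L ^ 2 * (2 * B' * h ^ 3) ^ 2 * (1 / (n * h) + h ^ 4))
    fun b _ => ?_).trans (by simp)
  · have h1 : Continuous fun q : Fin n → ℝ => fun t => taylorRem m x (q t) :=
      continuous_pi fun t => hm.continuous_taylorRem.comp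
        (by fun_prop : Continuous fun q : Fin n → ℝ => (x, q t))
    have := continuous_lpMoment (n := n) hK.continuous h b (X := fun q : Fin n → ℝ => q)
      (x := fun _ => x) (by fun_prop) (by fun_prop) h1
    exact (Continuous.measurable (by fun_prop))
  · refine lintegral_weight_sq_lpMoment_sub_le hK hB hw hn hh x (g := taylorRem m)
      (M := 2 * B' * h ^ 3) ?_ (by positivity) (fun y hy => ?_) b
    · exact hm.continuous_taylorRem.comp (by fun_prop : Continuous fun y : ℝ => (x, y))
    · refine (hm.abs_taylorRem_le x y).trans ?_
      gcongr

theorem lintegral_sq_noise_column {p : ℕ} (σ : ℝ) (a : Fin n → ℝ) (j : Fin p) :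
    ∫⁻ e, ENNReal.ofReal ((∑ t, a t * e (t, j)) ^ 2) ∂noiseLaw σ (Fin n × Fin p)
      = ENNReal.ofReal (σ ^ 2 * ∑ t, a t ^ 2) := by
  have h1 := lintegral_sq_noise (ι := Fin n × Fin p) σ fun s => if s.2 = j then a s.1 else 0
  simp_rw [Fintype.sum_prod_type, ite_mul, zero_mul, Finset.sum_ite_eq' Finset.univ, ite_pow] at h1
  simpa using h1

/-- About `n h` observations enter a moment, each with weight of order `1 / (n h)`, so its variance
is of order `1 / (n h)`. -/
theorem lintegral_noiseEnergy_le {p : ℕ} (σ : ℝ) (hK : KernelCondition K) (hB : ∀ u, |K u| ≤ B)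
    {c₀ C₁ : ℝ} {X : Fin n → ℝ} (hX : DesignGood K c₀ C₁ h X) (hn : 0 < n) (hh : 0 < h) (j : Fin p) :
    ∫⁻ e, ENNReal.ofReal (noiseEnergy K h X fun t => e (t, j)) ∂noiseLaw σ (Fin n × Fin p) ≤
      ENNReal.ofReal (4 * (σ ^ 2 * (B ^ 2 * C₁ / (n * h)))) := by
  have hcont : ∀ b : ℕ, Continuous fun q : (Fin n × Fin p → ℝ) × ℝ =>
      lpMoment K h X q.2 (fun t => q.1 (t, j)) b := fun b =>
    continuous_lpMoment (n := n) hK.continuous h b (by fun_prop) (by fun_prop) (by fun_prop)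
  refine lintegral_ofReal_intervalIntegral_le _ (F := fun (e : Fin n × Fin p → ℝ) x =>
      ∑ b : Fin 4, lpMoment K h X x (fun t => e (t, j)) b ^ 2)
    (continuous_finsetSum _ fun b _ => (hcont b).pow 2)
    (fun _ _ => Finset.sum_nonneg fun _ _ => sq_nonneg _) fun x _ => ?_
  refine (lintegral_ofReal_sum_le _ _ (fun b _ => ?_) (fun _ _ _ => by positivity)
    (c := σ ^ 2 * (B ^ 2 * C₁ / (n * h))) fun b _ => ?_).trans (by simp)
  · exact (((hcont b).comp (by fun_prop :
      Continuous fun e : Fin n × Fin p → ℝ => (e, x))).pow 2).measurable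
  · have h1 : ∀ e : Fin n × Fin p → ℝ, lpMoment K h X x (fun t => e (t, j)) b =
        ∑ t, (((n : ℝ) * h)⁻¹ * (K ((X t - x) / h) * ((X t - x) / h) ^ (b : ℕ))) * e (t, j) := by
      intro e
      rw [lpMoment, Finset.mul_sum]
      exact Finset.sum_congr rfl fun t _ => by ring
    simp_rw [h1]
    rw [lintegral_sq_noise_column]
    refine ENNReal.ofReal_le_ofReal ?_
    gcongr
    exact hX.sum_sq_le hK hB hn hh x b

end Expectation


/-! ### Smooth functionals of the estimation error -/

/-- The equivalent kernels of `K`, with a bound for all the kernels. -/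
structure EquivKernelData (K : ℝ → ℝ) (T : Matrix (Fin 4) (Fin 4) ℝ) (B : ℝ) : Prop where
  kernel : KernelCondition K
  inverse : ∀ d a : Fin 4, ∑ b : Fin 4, T d b * kernelMoment K (a + b) = if d = a then 1 else 0
  nonneg : 0 ≤ B
  abs_le : ∀ u, |K u| ≤ B
  abs_equiv_le : ∀ d u, |equivKernel K T d u| ≤ B

theorem KernelCondition.exists_equivKernelData {K : ℝ → ℝ} (hK : KernelCondition K) :
    ∃ T B, EquivKernelData K T B := by
  obtain ⟨T, hT⟩ := hK.exists_inverse
  obtain ⟨B₁, h1, h1'⟩ := hK.exists_abs_le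
  obtain ⟨B₂, h2, h2'⟩ := exists_abs_equivKernel_le hK T
  exact ⟨T, max B₁ B₂, hK, hT, h1.trans (le_max_left _ _), fun u => (h1' u).trans (le_max_left _ _),
    fun d u => (h2' d u).trans (le_max_right _ _)⟩

section Functional

variable {n : ℕ} {K : ℝ → ℝ} {T : Matrix (Fin 4) (Fin 4) ℝ} {B h c₀ C₁ L L' M : ℝ}
  {w f m : ℕ → ℝ → ℝ} {X e : Fin n → ℝ}

/-- The remainder in the linearization of a smooth functional of the estimation error. -/
noncomputable def linRem (K : ℝ → ℝ) (h : ℝ) (f m : ℕ → ℝ → ℝ) (d : Fin 2) (X e : Fin n → ℝ) : ℝ :=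
  (∫ x in (0 : ℝ)..1, f 0 x * ((h ^ (d : ℕ))⁻¹ * lpErr K h X m e x (Fin.castLE (by omega) d)))
    - (-1) ^ (d : ℕ) * ((n : ℝ)⁻¹ * ∑ t, f d (X t) * e t)

/-- The coefficients of the noise in the difference between the smoothed and the exact
influence function. -/
noncomputable def smoothingCoef (K : ℝ → ℝ) (T : Matrix (Fin 4) (Fin 4) ℝ) (h : ℝ)
    (f : ℕ → ℝ → ℝ) (d : Fin 2) (n : ℕ) (y : ℝ) : ℝ :=
  (n : ℝ)⁻¹ * ((∫ x in (0 : ℝ)..1, f 0 x * ((h ^ (1 + (d : ℕ)))⁻¹ *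
    equivKernel K T (Fin.castLE (by omega) d) ((y - x) / h))) - (-1) ^ (d : ℕ) * f d y)

theorem intervalIntegrable_of_abs_le {g : ℝ → ℝ} (hg : Measurable g) {M : ℝ}
    (hM : ∀ x ∈ Icc (0 : ℝ) 1, |g x| ≤ M) : IntervalIntegrable g volume 0 1 := by
  rw [intervalIntegrable_iff_integrableOn_Ioc_of_le zero_le_one]
  refine Integrable.mono' (g := fun _ => M) (integrable_const _) hg.aestronglyMeasurable ?_
  exact (ae_restrict_mem measurableSet_Ioc).mono fun x hx => hM x (Ioc_subset_Icc_self hx)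

theorem measurable_lpErr (hK : KernelCondition K) (hm : SmoothFun M m) (a : Fin 4) :
    Measurable fun x => lpErr K h X m e x a := by
  have h1 := (measurable_lpCoef (n := n) hK.continuous h a).comp
    (by fun_prop : Measurable fun x : ℝ => (X, (fun t => m 0 (X t) + e t), x))
  have h2 := (hm.continuous (d := a) (by omega)).measurable
  simp only [Function.comp_def] at h1
  unfold lpErr
  fun_prop

theorem DesignGood.sum_sq_lpErr_le (hX : DesignGood K c₀ C₁ h X) (hK : EquivKernelData K T B)
    (hc : 0 < c₀) (hn : 0 < n) (hh : 0 < h) (hm : SmoothFun M m) {x : ℝ}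
    (hx : x ∈ Icc (0 : ℝ) 1) :
    ∑ a, lpErr K h X m e x a ^ 2 ≤ (c₀ ^ 2)⁻¹ *
      (8 * (C₁ * B * (2 * M * h ^ 3)) ^ 2 + 2 * ∑ b : Fin 4, lpMoment K h X x e b ^ 2) := by
  have hM := hm.nonneg_bound
  have h1 := hX.sq_le hc hx fun b => hX.lpErr_eq hc hn hh hx m e b
  refine h1.trans (mul_le_mul_of_nonneg_left ?_ (by positivity))
  have h2 : ∀ b : Fin 4, (lpMoment K h X x (fun t => taylorRem m x (X t)) b +
      lpMoment K h X x e b) ^ 2 ≤ 2 * (C₁ * B * (2 * M * h ^ 3)) ^ 2 +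
      2 * lpMoment K h X x e b ^ 2 := by
    intro b
    have h3 := hX.abs_lpMoment_le hK.kernel hK.abs_le hn hh x (M := 2 * M * h ^ 3)
      (y := fun t => taylorRem m x (X t)) (by positivity)
      (fun t ht => (hm.abs_taylorRem_le x (X t)).trans (by gcongr)) b
    have h4 : lpMoment K h X x (fun t => taylorRem m x (X t)) b ^ 2 ≤
        (C₁ * B * (2 * M * h ^ 3)) ^ 2 := by
      rw [← sq_abs]
      gcongr
    nlinarith [sq_nonneg (lpMoment K h X x (fun t => taylorRem m x (X t)) b -
      lpMoment K h X x e b)]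
  refine (Finset.sum_le_sum fun b _ => h2 b).trans (le_of_eq ?_)
  rw [Finset.sum_add_distrib, Finset.sum_const, Finset.card_univ, Fintype.card_fin,
    ← Finset.mul_sum, nsmul_eq_mul, Nat.cast_ofNat]
  ring

theorem continuous_sum_sq_lpMoment (hK : KernelCondition K) :
    Continuous fun x => ∑ b : Fin 4, lpMoment K h X x e b ^ 2 :=
  continuous_finsetSum _ fun b _ =>
    (continuous_lpMoment hK.continuous h b (by fun_prop) (by fun_prop) (by fun_prop)).pow 2

theorem DesignGood.exists_abs_lpErr_le (hX : DesignGood K c₀ C₁ h X) (hK : EquivKernelData K T B)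
    (hc : 0 < c₀) (hn : 0 < n) (hh : 0 < h) (hm : SmoothFun M m) :
    ∃ D, ∀ x ∈ Icc (0 : ℝ) 1, ∀ a, |lpErr K h X m e x a| ≤ D := by
  obtain ⟨D, hD⟩ := (isCompact_Icc (a := (0 : ℝ)) (b := 1)).exists_bound_of_continuousOn
    (continuous_sum_sq_lpMoment (h := h) (X := X) (e := e) hK.kernel).continuousOn
  refine ⟨√((c₀ ^ 2)⁻¹ * (8 * (C₁ * B * (2 * M * h ^ 3)) ^ 2 + 2 * D)), fun x hx a => ?_⟩
  refine Real.abs_le_sqrt ?_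
  calc lpErr K h X m e x a ^ 2 ≤ ∑ a, lpErr K h X m e x a ^ 2 :=
        Finset.single_le_sum (f := fun a => lpErr K h X m e x a ^ 2)
          (fun _ _ => sq_nonneg _) (Finset.mem_univ a)
    _ ≤ _ := (hX.sum_sq_lpErr_le hK hc hn hh hm hx).trans (by
        gcongr
        exact (le_abs_self _).trans (hD x hx))

theorem DesignGood.intervalIntegrable_lpErr (hX : DesignGood K c₀ C₁ h X)
    (hK : EquivKernelData K T B) (hc : 0 < c₀) (hn : 0 < n) (hh : 0 < h) (hm : SmoothFun M m)
    (a : Fin 4) : IntervalIntegrable (fun x => lpErr K h X m e x a) volume 0 1 := by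
  obtain ⟨D, hD⟩ := hX.exists_abs_lpErr_le (e := e) hK hc hn hh hm
  exact intervalIntegrable_of_abs_le (measurable_lpErr hK.kernel hm a) fun x hx => hD x hx a

theorem DesignGood.intervalIntegrable_lpErr_mul (hX : DesignGood K c₀ C₁ h X)
    (hK : EquivKernelData K T B) (hc : 0 < c₀) (hn : 0 < n) (hh : 0 < h) (hm : SmoothFun M m)
    {M' : ℝ} {m' : ℕ → ℝ → ℝ} {e' : Fin n → ℝ} (hm' : SmoothFun M' m')
    (a a' : Fin 4) :
    IntervalIntegrable (fun x => lpErr K h X m e x a * lpErr K h X m' e' x a') volume 0 1 := by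
  obtain ⟨D, hD⟩ := hX.exists_abs_lpErr_le (e := e) hK hc hn hh hm
  obtain ⟨D', hD'⟩ := hX.exists_abs_lpErr_le (e := e') hK hc hn hh hm'
  refine intervalIntegrable_of_abs_le ((measurable_lpErr hK.kernel hm a).mul
    (measurable_lpErr hK.kernel hm' a')) (M := D * D') fun x hx => ?_
  rw [abs_mul]
  exact mul_le_mul (hD x hx a) (hD' x hx a') (abs_nonneg _) ((abs_nonneg _).trans (hD x hx a))

theorem DesignGood.integral_sum_sq_lpErr_le (hX : DesignGood K c₀ C₁ h X)
    (hK : EquivKernelData K T B) (hc : 0 < c₀) (hn : 0 < n) (hh : 0 < h) (hm : SmoothFun M m) :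
    ∫ x in (0 : ℝ)..1, ∑ a, lpErr K h X m e x a ^ 2 ≤ (c₀ ^ 2)⁻¹ *
      (8 * (C₁ * B * (2 * M * h ^ 3)) ^ 2 + 2 * noiseEnergy K h X e) := by
  have hc2 := continuous_sum_sq_lpMoment (h := h) (X := X) (e := e) hK.kernel
  have h1 : ∫ x in (0 : ℝ)..1, ∑ a, lpErr K h X m e x a ^ 2 ≤ ∫ x in (0 : ℝ)..1, (c₀ ^ 2)⁻¹ *
      (8 * (C₁ * B * (2 * M * h ^ 3)) ^ 2 + 2 * ∑ b : Fin 4, lpMoment K h X x e b ^ 2) := by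
    refine intervalIntegral.integral_mono_on zero_le_one ?_
      (Continuous.intervalIntegrable (by fun_prop) _ _)
      fun x hx => hX.sum_sq_lpErr_le hK hc hn hh hm hx
    have := IntervalIntegrable.sum (μ := volume) (a := 0) (b := 1) Finset.univ
      (f := fun (a : Fin 4) x => lpErr K h X m e x a ^ 2) fun a _ => by
        simp_rw [sq]
        exact hX.intervalIntegrable_lpErr_mul hK hc hn hh hm hm a a
    simpa [Finset.sum_fn] using this
  refine h1.trans (le_of_eq ?_)
  rw [intervalIntegral.integral_const_mul, intervalIntegral.integral_add
    (by simp) ((hc2.intervalIntegrable _ _).const_mul 2), intervalIntegral.integral_const_mul]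
  simp [noiseEnergy]

/-- Multiply the normal equations by `T`, the inverse of the limiting moment matrix. The difference
between the random matrix and its limit goes to the right-hand side, where it multiplies the error
itself and is of second order. -/
theorem DesignGood.lpErr_decomp (hX : DesignGood K c₀ C₁ h X) (hK : EquivKernelData K T B)
    (hc : 0 < c₀) (hn : 0 < n) (hh : 0 < h) {x : ℝ} (hx : x ∈ Icc (0 : ℝ) 1) (d : Fin 4) :
    lpErr K h X m e x d =
      ∑ b : Fin 4, T d b * lpMoment K h X x (fun t => taylorRem m x (X t)) b
      + ∑ b : Fin 4, T d b * lpMoment K h X x e b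
      + ∑ b : Fin 4, T d b * ∑ a : Fin 4,
        (kernelMoment K (a + b) - lpMoment K h X x (fun _ => 1) (a + b)) * lpErr K h X m e x a := by
  have h1 : ∀ b : Fin 4, ∑ a : Fin 4, (kernelMoment K (a + b) -
      lpMoment K h X x (fun _ => 1) (a + b)) * lpErr K h X m e x a =
      ∑ a : Fin 4, kernelMoment K (a + b) * lpErr K h X m e x a -
      (lpMoment K h X x (fun t => taylorRem m x (X t)) b + lpMoment K h X x e b) := by
    intro b
    rw [← hX.lpErr_eq hc hn hh hx, ← Finset.sum_sub_distrib]
    exact Finset.sum_congr rfl fun a _ => by ring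
  simp_rw [h1]
  rw [← Finset.sum_add_distrib, ← Finset.sum_add_distrib]
  have h2 : ∀ b : Fin 4, T d b * lpMoment K h X x (fun t => taylorRem m x (X t)) b +
      T d b * lpMoment K h X x e b + T d b * (∑ a : Fin 4, kernelMoment K (a + b) *
        lpErr K h X m e x a - (lpMoment K h X x (fun t => taylorRem m x (X t)) b +
        lpMoment K h X x e b)) =
      ∑ a : Fin 4, T d b * kernelMoment K (a + b) * lpErr K h X m e x a := by
    intro b
    simp_rw [mul_assoc, ← Finset.mul_sum]
    ring
  simp_rw [h2]
  rw [Finset.sum_comm]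
  simp_rw [← Finset.sum_mul, hK.inverse d]
  simp

/-- By linearity the smoothed noise is a linear form in the errors. Its coefficient at `X t` is `1 /
n` times a convolution of `g` with the equivalent kernel, which reproduces `g` or, up to sign, its
derivative. -/
theorem integral_equivKernel_noise (hK : KernelCondition K) (hn : 0 < n) (hh : 0 < h)
    {g : ℝ → ℝ} (hg : Continuous g) (d : Fin 2) :
    ∫ x in (0 : ℝ)..1, g x * ((h ^ (d : ℕ))⁻¹ *
        ∑ b : Fin 4, T (Fin.castLE (by omega) d) b * lpMoment K h X x e b) =
      ∑ t, ((n : ℝ)⁻¹ * ∫ x in (0 : ℝ)..1, g x * ((h ^ (1 + (d : ℕ)))⁻¹ *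
        equivKernel K T (Fin.castLE (by omega) d) ((X t - x) / h))) * e t := by
  have hn' : (0 : ℝ) < n := by exact_mod_cast hn
  have h1 : ∀ x, g x * ((h ^ (d : ℕ))⁻¹ *
      ∑ b : Fin 4, T (Fin.castLE (by omega) d) b * lpMoment K h X x e b) =
      ∑ t, (n : ℝ)⁻¹ * (g x * ((h ^ (1 + (d : ℕ)))⁻¹ *
        equivKernel K T (Fin.castLE (by omega) d) ((X t - x) / h))) * e t := by
    intro x
    have h2 : ∑ b : Fin 4, T (Fin.castLE (by omega) d) b * lpMoment K h X x e b =
        ((n : ℝ) * h)⁻¹ * ∑ t, equivKernel K T (Fin.castLE (by omega) d) ((X t - x) / h) * e t := by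
      simp only [lpMoment, equivKernel, Finset.mul_sum, Finset.sum_mul]
      rw [Finset.sum_comm]
      exact Finset.sum_congr rfl fun t _ => Finset.sum_congr rfl fun b _ => by ring
    rw [h2, Finset.mul_sum, Finset.mul_sum, Finset.mul_sum]
    refine Finset.sum_congr rfl fun t _ => ?_
    rw [pow_add]
    field_simp
  simp_rw [h1]
  have hkc := continuous_equivKernel (T := T) hK (Fin.castLE (by omega) d)
  rw [intervalIntegral.integral_finsetSum fun t _ =>
    Continuous.intervalIntegrable (by fun_prop) _ _]
  refine Finset.sum_congr rfl fun t _ => ?_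
  rw [intervalIntegral.integral_mul_const, intervalIntegral.integral_const_mul]

/-- The sum of the squared entries of a matrix. -/
noncomputable def sumSq (T : Matrix (Fin 4) (Fin 4) ℝ) : ℝ := ∑ d, ∑ b, T d b ^ 2

theorem sq_sum_mul_le_sumSq (T : Matrix (Fin 4) (Fin 4) ℝ) (d : Fin 4) (v : Fin 4 → ℝ) :
    (∑ b, T d b * v b) ^ 2 ≤ sumSq T * ∑ b, v b ^ 2 := by
  refine (Finset.sum_mul_sq_le_sq_mul_sq Finset.univ (T d) v).trans ?_
  gcongr
  exact Finset.single_le_sum (f := fun d => ∑ b, T d b ^ 2)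
    (fun _ _ => Finset.sum_nonneg fun _ _ => sq_nonneg _) (Finset.mem_univ d)

/-- An explicit bound for the squared remainder of a smooth functional. -/
noncomputable def remBound (K : ℝ → ℝ) (T : Matrix (Fin 4) (Fin 4) ℝ) (h : ℝ) (w f m : ℕ → ℝ → ℝ)
    (d : Fin 2) (X e : Fin n → ℝ) : ℝ :=
  h ^ 6 + (∑ t, smoothingCoef K T h f d n (X t) * e t) ^ 2
    + (h ^ 2)⁻¹ * (devTaylor K h (w 0) m X
      + devDesign K h (w 0) X * (h ^ 6 + noiseEnergy K h X e))

/-- The contribution of the fluctuation of the Taylor remainders to `linRem`. -/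
noncomputable def taylorFluct (K : ℝ → ℝ) (T : Matrix (Fin 4) (Fin 4) ℝ) (h : ℝ) (f m : ℕ → ℝ → ℝ)
    (d : Fin 4) (X : Fin n → ℝ) : ℝ :=
  ∫ x in (0 : ℝ)..1, f 0 x * ∑ b : Fin 4, T d b *
    (lpMoment K h X x (fun t => taylorRem m x (X t)) b - lpMean K h (taylorRem m) x b)

/-- The contribution of the mean of the Taylor remainders to `linRem`. -/
noncomputable def taylorBias (K : ℝ → ℝ) (T : Matrix (Fin 4) (Fin 4) ℝ) (h : ℝ) (f m : ℕ → ℝ → ℝ)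
    (d : Fin 4) : ℝ :=
  ∫ x in (0 : ℝ)..1, f 0 x * ∑ b : Fin 4, T d b * lpMean K h (taylorRem m) x b

/-- The contribution of the fluctuation of the design to `linRem`. -/
noncomputable def designFluct (K : ℝ → ℝ) (T : Matrix (Fin 4) (Fin 4) ℝ) (h : ℝ) (f m : ℕ → ℝ → ℝ)
    (d : Fin 4) (X e : Fin n → ℝ) : ℝ :=
  ∫ x in (0 : ℝ)..1, f 0 x * ∑ b : Fin 4, T d b * ∑ a : Fin 4,
    (kernelMoment K (a + b) - lpMoment K h X x (fun _ => 1) (a + b)) * lpErr K h X m e x a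

theorem continuous_lpMoment_taylorRem (hK : KernelCondition K) (hm : SmoothFun M m) (b : ℕ) :
    Continuous fun x => lpMoment K h X x (fun t => taylorRem m x (X t)) b :=
  continuous_lpMoment hK.continuous h b (by fun_prop) (by fun_prop)
    (continuous_pi fun t => hm.continuous_taylorRem.comp
      (by fun_prop : Continuous fun x : ℝ => (x, X t)))

theorem TestFun.sq_le (hf : TestFun L (w 0) f) (x : ℝ) : f 0 x ^ 2 ≤ L ^ 2 * w 0 x ^ 2 := by
  rw [← mul_pow, ← sq_abs]
  exact pow_le_pow_left₀ (abs_nonneg _) (hf.bound_weight x) 2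

theorem sumSq_nonneg (T : Matrix (Fin 4) (Fin 4) ℝ) : 0 ≤ sumSq T :=
  Finset.sum_nonneg fun _ _ => Finset.sum_nonneg fun _ _ => sq_nonneg _

/-- A test function is dominated by the weight, so Cauchy–Schwarz produces the weighted deviation,
the one that is small up to the ends of the interval. -/
theorem sq_taylorFluct_le (hK : KernelCondition K) (hwc : Continuous (w 0)) (hf : TestFun L (w 0) f)
    (hm : SmoothFun M m) (d : Fin 4) :
    taylorFluct K T h f m d X ^ 2 ≤ L ^ 2 * sumSq T * devTaylor K h (w 0) m X := by
  have hS0 := sumSq_nonneg T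
  have hlm := fun b : ℕ => continuous_lpMoment_taylorRem (h := h) (X := X) hK hm b
  have hmean : ∀ b : ℕ, Continuous fun x => lpMean K h (taylorRem m) x b := fun b =>
    hm.continuous_lpMean hK h b
  have := sq_intervalIntegral_le (g := fun x => f 0 x * ∑ b : Fin 4, T d b *
    (lpMoment K h X x (fun t => taylorRem m x (X t)) b - lpMean K h (taylorRem m) x b))
    (A := fun _ => L ^ 2 * sumSq T) (D := fun x => ∑ b : Fin 4, w 0 x ^ 2 *
  (lpMoment K h X x (fun t => taylorRem m x (X t)) b - lpMean K h (taylorRem m) x b) ^ 2)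
    (by simp) (Continuous.intervalIntegrable (by
      refine continuous_finsetSum _ fun b _ => ?_
      have h1 := hlm b
      have h2 := hmean b
      fun_prop) _ _) (fun _ _ => by positivity)
    (fun _ _ => Finset.sum_nonneg fun _ _ => by positivity) (fun x _ => by
      rw [mul_pow, ← Finset.mul_sum]
      have h1 := sq_sum_mul_le_sumSq T d fun b : Fin 4 =>
        lpMoment K h X x (fun t => taylorRem m x (X t)) b - lpMean K h (taylorRem m) x b
      calc _ ≤ (L ^ 2 * w 0 x ^ 2) * _ := mul_le_mul (hf.sq_le x) h1 (sq_nonneg _) (by positivity)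
        _ = _ := by ring)
  simpa [devTaylor, taylorFluct] using this

/-- Cauchy–Schwarz separates the two small factors. The deviation of the design moments takes the
weight; the fit error is controlled without it, since the normal equations are well conditioned on
the whole interval. -/
theorem DesignGood.sq_designFluct_le (hX : DesignGood K c₀ C₁ h X) (hK : EquivKernelData K T B)
    (hc : 0 < c₀) (hn : 0 < n) (hh : 0 < h) (hwc : Continuous (w 0)) (hf : TestFun L (w 0) f)
    (hm : SmoothFun M m) (d : Fin 4) :
    designFluct K T h f m d X e ^ 2 ≤ 16 * L ^ 2 * sumSq T * devDesign K h (w 0) X *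
      ((c₀ ^ 2)⁻¹ * (8 * (C₁ * B * (2 * M * h ^ 3)) ^ 2 + 2 * noiseEnergy K h X e)) := by
  have hS0 := sumSq_nonneg T
  have hDD := devDesign_nonneg (K := K) (h := h) (w 0) X
  have hdc : Continuous fun x => ∑ k ∈ Finset.range 7,
      w 0 x ^ 2 * (lpMoment K h X x (fun _ => 1) k - kernelMoment K k) ^ 2 :=
    (continuous_devDesign_integrand (h := h) hK.kernel hwc).comp
      (by fun_prop : Continuous fun x : ℝ => (X, x))
  have := sq_intervalIntegral_le (g := fun x => f 0 x * ∑ b : Fin 4, T d b * ∑ a : Fin 4,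
      (kernelMoment K (a + b) - lpMoment K h X x (fun _ => 1) (a + b)) * lpErr K h X m e x a)
    (A := fun x => 16 * L ^ 2 * sumSq T * ∑ k ∈ Finset.range 7,
      w 0 x ^ 2 * (lpMoment K h X x (fun _ => 1) k - kernelMoment K k) ^ 2)
    (D := fun x => ∑ a, lpErr K h X m e x a ^ 2)
    ((hdc.intervalIntegrable _ _).const_mul _)
    (by
      have := IntervalIntegrable.sum (μ := volume) (a := 0) (b := 1) Finset.univ
        (f := fun (a : Fin 4) x => lpErr K h X m e x a ^ 2) fun a _ => by
          simp_rw [sq]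
          exact hX.intervalIntegrable_lpErr_mul hK hc hn hh hm hm a a
      simpa [Finset.sum_fn] using this)
    (fun _ _ => mul_nonneg (by positivity) (Finset.sum_nonneg fun _ _ => by positivity))
    (fun _ _ => Finset.sum_nonneg fun _ _ => sq_nonneg _) (fun x _ => by
      rw [mul_pow, ← Finset.mul_sum]
      set δ : ℕ → ℝ := fun k => lpMoment K h X x (fun _ => 1) k - kernelMoment K k with hδ
      set ζ : Fin 4 → ℝ := fun a => lpErr K h X m e x a with hζ
      have h1 := sq_sum_mul_le_sumSq T d fun b : Fin 4 => ∑ a : Fin 4,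
        (kernelMoment K (a + b) - lpMoment K h X x (fun _ => 1) (a + b)) * ζ a
      have h2 : ∑ b : Fin 4, (∑ a : Fin 4, (kernelMoment K (a + b) -
          lpMoment K h X x (fun _ => 1) (a + b)) * ζ a) ^ 2 ≤
          16 * (∑ k ∈ Finset.range 7, δ k ^ 2) * ∑ a, ζ a ^ 2 := by
        have h3 : ∀ b : Fin 4, (∑ a : Fin 4, (kernelMoment K (a + b) -
          lpMoment K h X x (fun _ => 1) (a + b)) * ζ a) ^ 2 ≤
          4 * (∑ k ∈ Finset.range 7, δ k ^ 2) * ∑ a, ζ a ^ 2 := by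
          intro b
          refine (Finset.sum_mul_sq_le_sq_mul_sq Finset.univ _ ζ).trans ?_
          refine mul_le_mul_of_nonneg_right ?_ (Finset.sum_nonneg fun _ _ => sq_nonneg _)
          calc ∑ a : Fin 4, (kernelMoment K (a + b) -
                lpMoment K h X x (fun _ => 1) (a + b)) ^ 2
              = ∑ a : Fin 4, δ (a + b) ^ 2 :=
                Finset.sum_congr rfl fun a _ => by rw [hδ]; ring
            -- The orders `a + b` with `a, b ≤ 3` are at most 6.
            _ ≤ ∑ a : Fin 4, ∑ k ∈ Finset.range 7, δ k ^ 2 := by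
                refine Finset.sum_le_sum fun a _ => ?_
                exact Finset.single_le_sum (f := fun k => δ k ^ 2) (fun _ _ => sq_nonneg _)
                  (Finset.mem_range.2 (by omega))
            _ = _ := by simp
        refine (Finset.sum_le_sum fun b _ => h3 b).trans (le_of_eq ?_)
        simp only [Finset.sum_const, Finset.card_univ, Fintype.card_fin, nsmul_eq_mul,
          Nat.cast_ofNat]
        ring
      calc _ ≤ (L ^ 2 * w 0 x ^ 2) *
            (sumSq T * (16 * (∑ k ∈ Finset.range 7, δ k ^ 2) * ∑ a, ζ a ^ 2)) :=
            mul_le_mul (hf.sq_le x) (h1.trans (by gcongr)) (sq_nonneg _) (by positivity)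
        _ = _ := by ring)
  rw [intervalIntegral.integral_const_mul] at this
  refine this.trans ?_
  have h5 := hX.integral_sum_sq_lpErr_le (e := e) hK hc hn hh hm
  exact mul_le_mul_of_nonneg_left h5 (by
    change 0 ≤ 16 * L ^ 2 * sumSq T * devDesign K h (w 0) X
    positivity)

/-- Four sources of error: the fluctuation and the mean of the Taylor remainders, the smoothing of
the influence function, and the fluctuation of the design multiplied by the fit error. -/
theorem DesignGood.linRem_eq (hX : DesignGood K c₀ C₁ h X) (hK : EquivKernelData K T B)
    (hc : 0 < c₀) (hn : 0 < n) (hh : 0 < h) (hf : TestFun L (w 0) f) (hm : SmoothFun M m)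
    (d : Fin 2) :
    linRem K h f m d X e =
      (h ^ (d : ℕ))⁻¹ * taylorFluct K T h f m (Fin.castLE (by omega) d) X
      + (h ^ (d : ℕ))⁻¹ * taylorBias K T h f m (Fin.castLE (by omega) d)
      + ∑ t, smoothingCoef K T h f d n (X t) * e t
      + (h ^ (d : ℕ))⁻¹ * designFluct K T h f m (Fin.castLE (by omega) d) X e := by
  have hKc := hK.kernel.continuous
  have hfc : Continuous (f 0) := hf.continuous (by omega)
  set D : Fin 4 := Fin.castLE (by omega) d with hD
  have hlm := fun b : ℕ => continuous_lpMoment_taylorRem (h := h) (X := X) hK.kernel hm b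
  have hmean : ∀ b : ℕ, Continuous fun x => lpMean K h (taylorRem m) x b := fun b =>
    hm.continuous_lpMean hK.kernel h b
  have hnm : ∀ b : ℕ, Continuous fun x => lpMoment K h X x e b := fun b =>
    continuous_lpMoment hKc h b (by fun_prop) (by fun_prop) (by fun_prop)
  have hζi : ∀ a, IntervalIntegrable (fun x => lpErr K h X m e x a) volume 0 1 := fun a =>
    hX.intervalIntegrable_lpErr hK hc hn hh hm a
  have i1 : Continuous fun x => f 0 x * ∑ b : Fin 4, T D b *
      (lpMoment K h X x (fun t => taylorRem m x (X t)) b - lpMean K h (taylorRem m) x b) := by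
    refine hfc.mul (continuous_finsetSum _ fun b _ => ?_)
    exact continuous_const.mul ((hlm b).sub (hmean b))
  have i2 : Continuous fun x => f 0 x * ∑ b : Fin 4, T D b * lpMean K h (taylorRem m) x b := by
    refine hfc.mul (continuous_finsetSum _ fun b _ => ?_)
    exact continuous_const.mul (hmean b)
  have i3 : Continuous fun x => f 0 x * ((h ^ (d : ℕ))⁻¹ * ∑ b : Fin 4, T D b *
      lpMoment K h X x e b) := by
    refine hfc.mul (continuous_const.mul (continuous_finsetSum _ fun b _ => ?_))
    exact continuous_const.mul (hnm b)
  have i4 : IntervalIntegrable (fun x => f 0 x * ∑ b : Fin 4, T D b * ∑ a : Fin 4,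
      (kernelMoment K (a + b) - lpMoment K h X x (fun _ => 1) (a + b)) * lpErr K h X m e x a)
      volume 0 1 := by
    refine IntervalIntegrable.continuousOn_mul ?_ hfc.continuousOn
    have := IntervalIntegrable.sum (μ := volume) (a := 0) (b := 1) Finset.univ
      (f := fun (b : Fin 4) x => T D b * ∑ a : Fin 4, (kernelMoment K (a + b) -
        lpMoment K h X x (fun _ => 1) (a + b)) * lpErr K h X m e x a) fun b _ => by
        refine IntervalIntegrable.const_mul ?_ _
        have := IntervalIntegrable.sum (μ := volume) (a := 0) (b := 1) Finset.univ
          (f := fun (a : Fin 4) x => (kernelMoment K (a + b) -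
            lpMoment K h X x (fun _ => 1) (a + b)) * lpErr K h X m e x a) fun a _ => by
            refine (hζi a).continuousOn_mul (Continuous.continuousOn ?_)
            exact continuous_const.sub (continuous_lpMoment hKc h _ (by fun_prop) (by fun_prop)
              (by fun_prop))
        simpa [Finset.sum_fn] using this
    simpa [Finset.sum_fn] using this
  have hpt : ∫ x in (0 : ℝ)..1, f 0 x * ((h ^ (d : ℕ))⁻¹ * lpErr K h X m e x D) =
      ∫ x in (0 : ℝ)..1, ((h ^ (d : ℕ))⁻¹ * (f 0 x * ∑ b : Fin 4, T D b *
      (lpMoment K h X x (fun t => taylorRem m x (X t)) b - lpMean K h (taylorRem m) x b))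
      + (h ^ (d : ℕ))⁻¹ * (f 0 x * ∑ b : Fin 4, T D b * lpMean K h (taylorRem m) x b)
      + f 0 x * ((h ^ (d : ℕ))⁻¹ * ∑ b : Fin 4, T D b * lpMoment K h X x e b)
      + (h ^ (d : ℕ))⁻¹ * (f 0 x * ∑ b : Fin 4, T D b * ∑ a : Fin 4,
      (kernelMoment K (a + b) - lpMoment K h X x (fun _ => 1) (a + b))
        * lpErr K h X m e x a)) := by
    refine intervalIntegral.integral_congr fun x hx => ?_
    rw [uIcc_of_le zero_le_one] at hx
    conv_lhs => rw [hX.lpErr_decomp hK hc hn hh hx D]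
    simp_rw [mul_sub, Finset.sum_sub_distrib]
    ring
  rw [linRem, hpt, intervalIntegral.integral_add, intervalIntegral.integral_add,
    intervalIntegral.integral_add, intervalIntegral.integral_const_mul,
    intervalIntegral.integral_const_mul, intervalIntegral.integral_const_mul,
    integral_equivKernel_noise hK.kernel hn hh hfc d]
  · have : (∑ t, smoothingCoef K T h f d n (X t) * e t) = ∑ t, ((n : ℝ)⁻¹ * ∫ x in (0 : ℝ)..1, f 0 x * ((h ^ (1 + (d : ℕ)))⁻¹ *
        equivKernel K T (Fin.castLE (by omega) d) ((X t - x) / h))) * e t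
        - (-1) ^ (d : ℕ) * ((n : ℝ)⁻¹ * ∑ t, f d (X t) * e t) := by
      rw [Finset.mul_sum, Finset.mul_sum, ← Finset.sum_sub_distrib]
      refine Finset.sum_congr rfl fun t _ => ?_
      rw [smoothingCoef]
      ring
    rw [this]
    simp only [taylorFluct, taylorBias, designFluct]
    ring
  · exact ((i1.intervalIntegrable _ _).const_mul _)
  · exact ((i2.intervalIntegrable _ _).const_mul _)
  · exact ((i1.intervalIntegrable _ _).const_mul _).add ((i2.intervalIntegrable _ _).const_mul _)
  · exact i3.intervalIntegrable _ _
  · exact (((i1.intervalIntegrable _ _).const_mul _).add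
      ((i2.intervalIntegrable _ _).const_mul _)).add (i3.intervalIntegrable _ _)
  · exact i4.const_mul _

/-- Real arithmetic only, with the integrals replaced by variables; `q` stands for `(h ^ d)⁻¹`. It
collects the bounds of the four terms into one constant times the expression `remBound`. -/
theorem sq_le_of_remainder_bounds {R q h J₁ J₂ J₃ J₄ S B L M C c dT dD N : ℝ} (hh : 0 < h)
    (hS : 0 ≤ S) (hc : 0 ≤ c) (hdT : 0 ≤ dT) (hdD : 0 ≤ dD) (hN : 0 ≤ N)
    (hR : R = q * J₁ + q * J₂ + J₃ + q * J₄) (hq : q ^ 2 ≤ (h ^ 2)⁻¹)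
    (e1 : J₁ ^ 2 ≤ L ^ 2 * S * dT) (e2 : |J₂| ≤ 6 * B * (L * M) * h ^ 4)
    (e4 : J₄ ^ 2 ≤ 16 * L ^ 2 * S * dD * (c * (8 * (C * B * (2 * M * h ^ 3)) ^ 2 + 2 * N))) :
    R ^ 2 ≤ 4 * (L ^ 2 * S + 36 * B ^ 2 * (L * M) ^ 2 + 1
        + 16 * L ^ 2 * S * c * (32 * (C * B * M) ^ 2 + 2))
      * (h ^ 6 + J₃ ^ 2 + (h ^ 2)⁻¹ * (dT + dD * (h ^ 6 + N))) := by
  have hsq : R ^ 2 ≤ 4 * (q ^ 2 * J₁ ^ 2 + q ^ 2 * J₂ ^ 2 + J₃ ^ 2 + q ^ 2 * J₄ ^ 2) := by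
    rw [hR]
    have h4 : ∀ a b c d : ℝ, (a + b + c + d) ^ 2 ≤ 4 * (a ^ 2 + b ^ 2 + c ^ 2 + d ^ 2) := by
      intro a b c d
      nlinarith [sq_nonneg (a - b), sq_nonneg (a - c), sq_nonneg (a - d), sq_nonneg (b - c),
        sq_nonneg (b - d), sq_nonneg (c - d)]
    refine (h4 _ _ _ _).trans (le_of_eq ?_)
    ring
  have hh2 : 0 ≤ (h ^ 2)⁻¹ := by positivity
  have b1 : q ^ 2 * J₁ ^ 2 ≤ L ^ 2 * S * ((h ^ 2)⁻¹ * dT) :=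
    calc q ^ 2 * J₁ ^ 2 ≤ (h ^ 2)⁻¹ * (L ^ 2 * S * dT) := mul_le_mul hq e1 (sq_nonneg _) hh2
      _ = _ := by ring
  have b2 : q ^ 2 * J₂ ^ 2 ≤ 36 * B ^ 2 * (L * M) ^ 2 * h ^ 6 := by
    have : J₂ ^ 2 ≤ (6 * B * (L * M) * h ^ 4) ^ 2 := by
      rw [← sq_abs]; gcongr
    calc q ^ 2 * J₂ ^ 2 ≤ (h ^ 2)⁻¹ * (6 * B * (L * M) * h ^ 4) ^ 2 :=
          mul_le_mul hq this (sq_nonneg _) hh2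
      _ = _ := by field_simp; ring
  have b4 : q ^ 2 * J₄ ^ 2 ≤ 16 * L ^ 2 * S * c * (32 * (C * B * M) ^ 2 + 2) *
      ((h ^ 2)⁻¹ * (dD * (h ^ 6 + N))) := by
    calc q ^ 2 * J₄ ^ 2 ≤ (h ^ 2)⁻¹ * (16 * L ^ 2 * S * dD * (c *
          (8 * (C * B * (2 * M * h ^ 3)) ^ 2 + 2 * N))) := mul_le_mul hq e4 (sq_nonneg _) hh2
      _ = 16 * L ^ 2 * S * c * ((h ^ 2)⁻¹ * dD) * (32 * (C * B * M) ^ 2 * h ^ 6 + 2 * N) := by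
          ring
      _ ≤ 16 * L ^ 2 * S * c * ((h ^ 2)⁻¹ * dD) * ((32 * (C * B * M) ^ 2 + 2) * (h ^ 6 + N)) := by
          gcongr
          have : 0 ≤ (C * B * M) ^ 2 * N := by positivity
          have : 0 ≤ h ^ 6 := by positivity
          nlinarith
      _ = _ := by ring
  have hP : 0 ≤ (h ^ 2)⁻¹ * dT := by positivity
  have hQ : 0 ≤ (h ^ 2)⁻¹ * (dD * (h ^ 6 + N)) := by positivity
  have hc1 : 0 ≤ L ^ 2 * S := by positivity
  have hc2 : 0 ≤ 36 * B ^ 2 * (L * M) ^ 2 := by positivity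
  have hc4 : 0 ≤ 16 * L ^ 2 * S * c * (32 * (C * B * M) ^ 2 + 2) := by positivity
  rw [mul_add (h ^ 2)⁻¹]
  generalize (h ^ 2)⁻¹ * dT = P at *
  generalize (h ^ 2)⁻¹ * (dD * (h ^ 6 + N)) = Q at *
  generalize L ^ 2 * S = c1 at hsq b1 hc1 ⊢
  generalize 36 * B ^ 2 * (L * M) ^ 2 = c2 at *
  generalize 16 * L ^ 2 * S * c * (32 * (C * B * M) ^ 2 + 2) = c4 at *
  have h6 : 0 ≤ h ^ 6 := by positivity
  have h7 : 0 ≤ J₃ ^ 2 := sq_nonneg _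
  have r1 : c1 * P ≤ c1 * (h ^ 6 + J₃ ^ 2 + (P + Q)) :=
    mul_le_mul_of_nonneg_left (by linarith) hc1
  have r2 : c2 * h ^ 6 ≤ c2 * (h ^ 6 + J₃ ^ 2 + (P + Q)) :=
    mul_le_mul_of_nonneg_left (by linarith) hc2
  have r4 : c4 * Q ≤ c4 * (h ^ 6 + J₃ ^ 2 + (P + Q)) :=
    mul_le_mul_of_nonneg_left (by linarith) hc4
  linarith

theorem DesignGood.linRem_sq_le (hX : DesignGood K c₀ C₁ h X) (hK : EquivKernelData K T B)
    (hc : 0 < c₀) (hn : 0 < n) (hh : 0 < h) (hh1 : h ≤ 1) (hw : WeightFun L' w)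
    (hf : TestFun L (w 0) f) (hm : SmoothFun M m) (d : Fin 2) :
    linRem K h f m d X e ^ 2 ≤
      4 * (L ^ 2 * sumSq T + 36 * B ^ 2 * (L * M) ^ 2 + 1
        + 16 * L ^ 2 * sumSq T * (c₀ ^ 2)⁻¹ * (32 * (C₁ * B * M) ^ 2 + 2))
      * remBound K T h w f m d X e := by
  have hL := hf.nonneg_bound
  have hM := hm.nonneg_bound
  have hB := hK.nonneg
  have hKc := hK.kernel.continuous
  have hfc : Continuous (f 0) := hf.continuous (by omega)
  have hwc : Continuous (w 0) := hw.continuous (by omega)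
  have hS0 := sumSq_nonneg T
  have hDT := devTaylor_nonneg (K := K) (h := h) (w 0) m X
  have hDD := devDesign_nonneg (K := K) (h := h) (w 0) X
  have hNE := noiseEnergy_nonneg (K := K) (h := h) X e
  refine sq_le_of_remainder_bounds hh (sumSq_nonneg T) (by positivity)
    (devTaylor_nonneg (K := K) (h := h) (w 0) m X) (devDesign_nonneg (K := K) (h := h) (w 0) X)
    (noiseEnergy_nonneg (K := K) (h := h) X e) (hX.linRem_eq hK hc hn hh hf hm d) ?_
    (sq_taylorFluct_le hK.kernel hwc hf hm _)
    (abs_integral_equivKernel_bias_le hK.kernel hB hK.abs_equiv_le hw hf hm hh _)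
    (hX.sq_designFluct_le (e := e) hK hc hn hh hwc hf hm _)
  rw [inv_pow, ← pow_mul]
  exact inv_anti₀ (by positivity) (pow_le_pow_of_le_one hh.le hh1 (by omega))

end Functional

/-! ### Expected size of the remainders -/

section Expectation

variable {n : ℕ} {K : ℝ → ℝ} {T : Matrix (Fin 4) (Fin 4) ℝ} {B h c₀ C₁ L L' M : ℝ}
  {w f m : ℕ → ℝ → ℝ}

theorem lintegral_ofReal_add_le {α : Type*} [MeasurableSpace α] {μ : Measure α} {f g : α → ℝ}
    {a b : ℝ} (hf : Measurable f) (ha : 0 ≤ a) (hb : 0 ≤ b)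
    (h1 : ∫⁻ x, ENNReal.ofReal (f x) ∂μ ≤ ENNReal.ofReal a)
    (h2 : ∫⁻ x, ENNReal.ofReal (g x) ∂μ ≤ ENNReal.ofReal b) :
    ∫⁻ x, ENNReal.ofReal (f x + g x) ∂μ ≤ ENNReal.ofReal (a + b) :=
  calc ∫⁻ x, ENNReal.ofReal (f x + g x) ∂μ
      ≤ ∫⁻ x, (ENNReal.ofReal (f x) + ENNReal.ofReal (g x)) ∂μ :=
        lintegral_mono fun _ => ENNReal.ofReal_add_le
    _ = ∫⁻ x, ENNReal.ofReal (f x) ∂μ + ∫⁻ x, ENNReal.ofReal (g x) ∂μ :=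
        lintegral_add_left hf.ennreal_ofReal _
    _ ≤ ENNReal.ofReal a + ENNReal.ofReal b := add_le_add h1 h2
    _ = _ := (ENNReal.ofReal_add ha hb).symm

theorem lintegral_ofReal_mul_le {α : Type*} [MeasurableSpace α] {μ : Measure α} {f : α → ℝ}
    {a c : ℝ} (hf : Measurable f) (hc : 0 ≤ c)
    (h1 : ∫⁻ x, ENNReal.ofReal (f x) ∂μ ≤ ENNReal.ofReal a) :
    ∫⁻ x, ENNReal.ofReal (c * f x) ∂μ ≤ ENNReal.ofReal (c * a) := by
  simp_rw [ENNReal.ofReal_mul hc]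
  rw [lintegral_const_mul _ hf.ennreal_ofReal]
  gcongr

theorem lintegral_ofReal_const_le {α : Type*} [MeasurableSpace α] {μ : Measure α}
    [IsProbabilityMeasure μ] (c : ℝ) :
    ∫⁻ _, ENNReal.ofReal c ∂μ ≤ ENNReal.ofReal c := by simp

theorem continuous_smoothingCoef (hK : KernelCondition K) (hf : TestFun L (w 0) f) (d : Fin 2) :
    Continuous fun y => smoothingCoef K T h f d n y := by
  have hfc : Continuous (f 0) := hf.continuous (by omega)
  have hfd : Continuous (f d) := hf.continuous (by omega)
  have hkc := continuous_equivKernel (T := T) hK (Fin.castLE (by omega) d)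
  have h1 : Continuous fun y => ∫ x in (0 : ℝ)..1, f 0 x * ((h ^ (1 + (d : ℕ)))⁻¹ *
      equivKernel K T (Fin.castLE (by omega) d) ((y - x) / h)) :=
    intervalIntegral.continuous_parametric_intervalIntegral_of_continuous' (by fun_prop) 0 1
  unfold smoothingCoef
  fun_prop

/-- Each coefficient is `1 / n` times a smoothing error of order `h`, and there are `n` of them. -/
theorem sum_sq_smoothingCoef_le (hK : EquivKernelData K T B) (hw : WeightFun L' w)
    (hf : TestFun L (w 0) f) (hn : 0 < n) (hh : 0 < h) (d : Fin 2) (X : Fin n → ℝ) :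
    ∑ t, smoothingCoef K T h f d n (X t) ^ 2 ≤ (2 * B * L) ^ 2 * (h ^ 2 / n) := by
  have hn' : (0 : ℝ) < n := by exact_mod_cast hn
  have hL := hf.nonneg_bound
  have h1 : ∀ t, smoothingCoef K T h f d n (X t) ^ 2 ≤ ((n : ℝ)⁻¹ * (2 * B * L * h)) ^ 2 := by
    intro t
    rw [← sq_abs, smoothingCoef, abs_mul, abs_of_nonneg (by positivity : (0 : ℝ) ≤ (n : ℝ)⁻¹)]
    have := hf.abs_convolution_sub_le hK.kernel hK.inverse hK.nonneg hK.abs_equiv_le hw hh d (X t)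
    gcongr
  calc ∑ t, smoothingCoef K T h f d n (X t) ^ 2 ≤ ∑ _t : Fin n, ((n : ℝ)⁻¹ * (2 * B * L * h)) ^ 2 :=
        Finset.sum_le_sum fun t _ => h1 t
    _ = _ := by
        rw [Finset.sum_const, Finset.card_univ, Fintype.card_fin, nsmul_eq_mul]
        field_simp

theorem remBound_nonneg (hh : 0 < h) (d : Fin 2) (X e : Fin n → ℝ) :
    0 ≤ remBound K T h w f m d X e := by
  have hDT := devTaylor_nonneg (K := K) (h := h) (w 0) m X
  have hDD := devDesign_nonneg (K := K) (h := h) (w 0) X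
  have hNE := noiseEnergy_nonneg (K := K) (h := h) X e
  unfold remBound
  positivity

theorem continuous_remBound (hK : KernelCondition K) (hw : WeightFun L' w)
    (hf : TestFun L (w 0) f) (hm : SmoothFun M m) (d : Fin 2) :
    Continuous fun q : (Fin n → ℝ) × (Fin n → ℝ) => remBound K T h w f m d q.1 q.2 := by
  have h1 := continuous_smoothingCoef (T := T) (h := h) (n := n) hK hf d
  have hwc : Continuous (w 0) := hw.continuous (by omega)
  have h2 : Continuous fun q : (Fin n → ℝ) × (Fin n → ℝ) => devTaylor K h (w 0) m q.1 :=
    (continuous_devTaylor hK hwc hm).comp continuous_fst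
  have h3 : Continuous fun q : (Fin n → ℝ) × (Fin n → ℝ) => devDesign K h (w 0) q.1 :=
    (continuous_devDesign hK hwc).comp continuous_fst
  have h4 := continuous_noiseEnergy (n := n) (h := h) hK
  unfold remBound
  fun_prop

theorem lintegral_remBound_noise_le {p : ℕ} (σ : ℝ) (hK : EquivKernelData K T B)
    (hw : WeightFun L' w) (hf : TestFun L (w 0) f) {X : Fin n → ℝ}
    (hX : DesignGood K c₀ C₁ h X) (hC : 0 ≤ C₁) (hn : 0 < n) (hh : 0 < h) (d : Fin 2) (j : Fin p) :
    ∫⁻ e, ENNReal.ofReal (remBound K T h w f m d X fun t => e (t, j))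
        ∂noiseLaw σ (Fin n × Fin p) ≤
      ENNReal.ofReal (h ^ 6 + σ ^ 2 * ((2 * B * L) ^ 2 * (h ^ 2 / n)) +
        ((h ^ 2)⁻¹ * devTaylor K h (w 0) m X + (h ^ 2)⁻¹ * (h ^ 6 +
          4 * (σ ^ 2 * (B ^ 2 * C₁ / (n * h)))) * devDesign K h (w 0) X)) := by
  have hDT := devTaylor_nonneg (K := K) (h := h) (w 0) m X
  have hDD := devDesign_nonneg (K := K) (h := h) (w 0) X
  have h4 : Measurable fun e : Fin n × Fin p → ℝ => noiseEnergy K h X fun t => e (t, j) :=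
    ((continuous_noiseEnergy (n := n) (h := h) hK.kernel).comp (by fun_prop :
      Continuous fun e : Fin n × Fin p → ℝ => (X, fun t => e (t, j)))).measurable
  have h5 : ∀ e : Fin n × Fin p → ℝ, remBound K T h w f m d X (fun t => e (t, j)) =
      h ^ 6 + (∑ t, smoothingCoef K T h f d n (X t) * e (t, j)) ^ 2 +
        ((h ^ 2)⁻¹ * devTaylor K h (w 0) m X + (h ^ 2)⁻¹ * devDesign K h (w 0) X *
          (h ^ 6 + noiseEnergy K h X fun t => e (t, j))) := fun e => by
    rw [remBound]; ring
  simp_rw [h5]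
  refine lintegral_ofReal_add_le (by fun_prop) (by positivity) (by positivity)
    (lintegral_ofReal_add_le (by fun_prop) (by positivity) (by positivity)
      (lintegral_ofReal_const_le _) ?_)
    (lintegral_ofReal_add_le (by fun_prop) (by positivity) (by positivity)
      (lintegral_ofReal_const_le _) ?_)
  · rw [lintegral_sq_noise_column]
    refine ENNReal.ofReal_le_ofReal ?_
    gcongr
    exact sum_sq_smoothingCoef_le hK hw hf hn hh d X
  · have := lintegral_ofReal_mul_le (c := (h ^ 2)⁻¹ * devDesign K h (w 0) X)
      (μ := noiseLaw σ (Fin n × Fin p)) (f := fun e => h ^ 6 + noiseEnergy K h X fun t => e (t, j))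
      (by fun_prop) (by positivity)
      (lintegral_ofReal_add_le (by fun_prop) (by positivity) (by positivity)
        (lintegral_ofReal_const_le _) (lintegral_noiseEnergy_le σ hK.kernel hK.abs_le hX hn hh j))
    refine this.trans (ENNReal.ofReal_le_ofReal (le_of_eq ?_))
    ring

/-- The rate of the remainders in the linearization. -/
noncomputable def remRate (n : ℕ) (h : ℝ) : ℝ := h ^ 3 + 1 / (n * h ^ 2)

/-- Put `q = 1 / (n h)`. The design deviation has expectation of order `q + h ^ 4`, and the other
factor in the last term of `remBound`, of order `h ^ 6 + q`, is no larger. Their product over `h ^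
2` is exactly of order `remRate ^ 2`, because `(q + h ^ 4) / h = remRate`. The remaining terms are
not larger than that. -/
theorem lintegral_remBound_le {p : ℕ} (σ : ℝ) (hK : EquivKernelData K T B)
    (hw : WeightFun L' w) (hf : TestFun L (w 0) f) (hm : SmoothFun M m) (hC : 0 ≤ C₁) (hn : 0 < n)
    (hh : 0 < h) (hh1 : h ≤ 1) {A : Set (Fin n → ℝ)} (hA : MeasurableSet A)
    (hX : ∀ X ∈ A, DesignGood K c₀ C₁ h X) (d : Fin 2) (j : Fin p) :
    ∫⁻ q in A ×ˢ univ, ENNReal.ofReal (remBound K T h w f m d q.1 fun t => q.2 (t, j))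
        ∂(designLaw n).prod (noiseLaw σ (Fin n × Fin p)) ≤
      ENNReal.ofReal ((1 + σ ^ 2 * (2 * B * L) ^ 2 + 576 * (B * L' * M) ^ 2
        + 252 * (B * L') ^ 2 * (1 + 4 * (σ ^ 2 * (B ^ 2 * C₁)))) * remRate n h ^ 2) := by
  have hn' : (0 : ℝ) < n := by exact_mod_cast hn
  have hwc : Continuous (w 0) := hw.continuous (by omega)
  have hmeas : Measurable fun q : (Fin n → ℝ) × (Fin n × Fin p → ℝ) =>
      remBound K T h w f m d q.1 fun t => q.2 (t, j) :=
    ((continuous_remBound (n := n) (T := T) (h := h) hK.kernel hw hf hm d).comp (by fun_prop :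
      Continuous fun q : (Fin n → ℝ) × (Fin n × Fin p → ℝ) =>
        (q.1, fun t => q.2 (t, j)))).measurable
  have h1 : Measurable fun X : Fin n → ℝ => devTaylor K h (w 0) m X :=
    (continuous_devTaylor hK.kernel hwc hm).measurable
  have h2 : Measurable fun X : Fin n → ℝ => devDesign K h (w 0) X :=
    (continuous_devDesign hK.kernel hwc).measurable
  rw [setLIntegral_prod _ hmeas.ennreal_ofReal.aemeasurable]
  simp only [Measure.restrict_univ]
  refine (setLIntegral_mono' hA fun X hXA =>
    lintegral_remBound_noise_le σ hK hw hf (hX X hXA) hC hn hh d j).trans ?_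
  refine (setLIntegral_le_lintegral _ _).trans ?_
  have h3 := lintegral_ofReal_add_le (μ := designLaw n)
    (f := fun _ => h ^ 6 + σ ^ 2 * ((2 * B * L) ^ 2 * (h ^ 2 / n)))
    (by fun_prop) (by positivity) (by positivity) (lintegral_ofReal_const_le _)
    (lintegral_ofReal_add_le (by fun_prop) (by positivity) (by positivity)
      (lintegral_ofReal_mul_le (c := (h ^ 2)⁻¹) h1 (by positivity)
        (lintegral_devTaylor_le hK.kernel hK.abs_le hw hm hn hh))
      (lintegral_ofReal_mul_le (c := (h ^ 2)⁻¹ * (h ^ 6 + 4 * (σ ^ 2 * (B ^ 2 * C₁ / (n * h))))) h2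
        (by positivity) (lintegral_devDesign_le hK.kernel hK.abs_le hw hn hh)))
  refine h3.trans (ENNReal.ofReal_le_ofReal ?_)
  set q := 1 / ((n : ℝ) * h) with hq
  have hq0 : 0 < q := by positivity
  have hom : remRate n h = h ^ 3 + q / h := by rw [remRate, hq]; field_simp
  have e1 : h ^ 2 / n = h ^ 3 * q := by rw [hq]; field_simp
  have e2 : B ^ 2 * C₁ / (n * h) = B ^ 2 * C₁ * q := by rw [hq]; field_simp
  have e0 : (h ^ 2)⁻¹ * (q + h ^ 4) ^ 2 = remRate n h ^ 2 := by rw [hom]; field_simp; ring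
  have hR : h ^ 6 + 2 * (h ^ 2 * q) + (h ^ 2)⁻¹ * q ^ 2 = remRate n h ^ 2 := by
    rw [hom]; field_simp; ring
  have hqh : 0 ≤ (h ^ 2)⁻¹ * q ^ 2 := by positivity
  have hhq : 0 ≤ h ^ 2 * q := by positivity
  have h60 : 0 ≤ h ^ 6 := by positivity
  have b1 : h ^ 6 ≤ remRate n h ^ 2 := by linarith
  have b2 : h ^ 3 * q ≤ remRate n h ^ 2 := by
    have : h ^ 3 * q ≤ h ^ 2 * q := by gcongr ?_ * q; exact pow_le_pow_of_le_one hh.le hh1 (by omega)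
    linarith
  have b3 : (h ^ 2)⁻¹ * (h ^ 6 * (q + h ^ 4)) ≤ remRate n h ^ 2 := by
    rw [← e0]
    gcongr
    rw [sq]
    gcongr
    have : h ^ 6 ≤ h ^ 4 := pow_le_pow_of_le_one hh.le hh1 (by omega)
    linarith
  have b4 : (h ^ 2)⁻¹ * ((h ^ 6 + 4 * (σ ^ 2 * (B ^ 2 * C₁ * q))) * (q + h ^ 4)) ≤
      (1 + 4 * (σ ^ 2 * (B ^ 2 * C₁))) * remRate n h ^ 2 := by
    rw [← e0]
    have : h ^ 6 ≤ h ^ 4 := pow_le_pow_of_le_one hh.le hh1 (by omega)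
    have h7 : h ^ 6 + 4 * (σ ^ 2 * (B ^ 2 * C₁ * q)) ≤
        (1 + 4 * (σ ^ 2 * (B ^ 2 * C₁))) * (q + h ^ 4) := by
      have : 0 ≤ 4 * (σ ^ 2 * (B ^ 2 * C₁)) * h ^ 4 := by positivity
      nlinarith
    calc _ ≤ (h ^ 2)⁻¹ * ((1 + 4 * (σ ^ 2 * (B ^ 2 * C₁))) * (q + h ^ 4) * (q + h ^ 4)) := by
          gcongr
      _ = _ := by ring
  rw [e1, e2]
  have b2' := mul_le_mul_of_nonneg_left b2 (by positivity : 0 ≤ σ ^ 2 * (2 * B * L) ^ 2)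
  have b3' := mul_le_mul_of_nonneg_left b3 (by positivity : 0 ≤ 576 * (B * L' * M) ^ 2)
  have b4' := mul_le_mul_of_nonneg_left b4 (by positivity : 0 ≤ 252 * (B * L') ^ 2)
  calc _ = h ^ 6 + σ ^ 2 * (2 * B * L) ^ 2 * (h ^ 3 * q) + 576 * (B * L' * M) ^ 2 *
        ((h ^ 2)⁻¹ * (h ^ 6 * (q + h ^ 4))) + 252 * (B * L') ^ 2 *
        ((h ^ 2)⁻¹ * ((h ^ 6 + 4 * (σ ^ 2 * (B ^ 2 * C₁ * q))) * (q + h ^ 4))) := by ring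
    _ ≤ _ := by linarith

/-- Markov's inequality on a good event for the first component. -/
theorem measure_lt_le_of_setLIntegral_le {Ω α β : Type*} [MeasurableSpace Ω] [MeasurableSpace α]
    [MeasurableSpace β] {P : Measure Ω} {μ : Measure α} {ν : Measure β} [IsProbabilityMeasure μ]
    [IsProbabilityMeasure ν] {Z : Ω → α × β} (hZ : HasLaw Z (μ.prod ν) P) {A : Set α}
    (hA : MeasurableSet A) {U : α × β → ℝ} (hU : Measurable U) {c t : ℝ} (ht : 0 < t)
    (hc : ∫⁻ q in A ×ˢ univ, ENNReal.ofReal (U q) ∂μ.prod ν ≤ ENNReal.ofReal c) :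
    P {ω | (Z ω).1 ∈ A ∧ t < U (Z ω)} ≤ ENNReal.ofReal (c / t) := by
  have hm : MeasurableSet (A ×ˢ (univ : Set β)) := hA.prod MeasurableSet.univ
  have h0 : MeasurableSet {q : α × β | q.1 ∈ A ∧ t < U q} :=
    (measurable_fst hA).inter (measurableSet_lt measurable_const hU)
  have h1 : P {ω | (Z ω).1 ∈ A ∧ t < U (Z ω)} = (μ.prod ν) {q | q.1 ∈ A ∧ t < U q} := by
    rw [← hZ.map_eq, Measure.map_apply_of_aemeasurable hZ.aemeasurable h0]
    rfl
  rw [h1, ENNReal.ofReal_div_of_pos ht,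
    ENNReal.le_div_iff_mul_le (Or.inl (by simpa using ht)) (Or.inl ENNReal.ofReal_ne_top),
    mul_comm]
  refine le_trans ?_ hc
  calc ENNReal.ofReal t * (μ.prod ν) {q | q.1 ∈ A ∧ t < U q}
      ≤ ENNReal.ofReal t * ((μ.prod ν).restrict (A ×ˢ univ))
          {q | ENNReal.ofReal t ≤ ENNReal.ofReal (U q)} := by
        gcongr ENNReal.ofReal t * ?_
        rw [Measure.restrict_apply' hm]
        refine measure_mono fun q hq => ⟨?_, hq.1, trivial⟩
        exact ENNReal.ofReal_le_ofReal hq.2.le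
    _ ≤ _ := mul_meas_ge_le_lintegral hU.ennreal_ofReal _

end Expectation

/-! ### The plug-in estimators and their linearization -/

/-- The product of a function with a weight function, with its first two derivatives. -/
def weighted (w m : ℕ → ℝ → ℝ) (d : ℕ) (x : ℝ) : ℝ :=
  match d with
  | 0 => m 0 x * w 0 x
  | 1 => m 1 x * w 0 x + m 0 x * w 1 x
  | _ => m 2 x * w 0 x + 2 * (m 1 x * w 1 x) + m 0 x * w 2 x

section PlugIn

variable {n p : ℕ} {K : ℝ → ℝ} {T : Matrix (Fin 4) (Fin 4) ℝ} {B h c₀ C₁ L M : ℝ}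
  {w : ℕ → ℝ → ℝ} {m : Fin p → ℕ → ℝ → ℝ} {X : Fin n → ℝ} {e : Fin n × Fin p → ℝ}

theorem SmoothFun.testFun {m : ℕ → ℝ → ℝ} (hm : SmoothFun M m) (hw : WeightFun L w) :
    TestFun (max M (4 * M * L)) (w 0) (weighted w m) :=
  hw.testFun_mul (fun d hd x => hm.hasDerivAt d (by omega) x) (hm.continuous (by omega))
    hm.nonneg_bound fun d hd x hx => hm.bound d (by omega) x hx

theorem SmoothFun.testFun_deriv {m : ℕ → ℝ → ℝ} (hm : SmoothFun M m) (hw : WeightFun L w) :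
    TestFun (max M (4 * M * L)) (w 0) (weighted w fun d => m (d + 1)) :=
  hw.testFun_mul (fun d hd x => hm.hasDerivAt (d + 1) (by omega) x) (hm.continuous (by omega))
    hm.nonneg_bound fun d hd x hx => hm.bound (d + 1) (by omega) x hx

/-- The local cubic estimators computed from the design and the noise. -/
noncomputable def lpFit (K : ℝ → ℝ) (h : ℝ) (m : Fin p → ℕ → ℝ → ℝ) (X : Fin n → ℝ)
    (e : Fin n × Fin p → ℝ) (j : Fin p) (d : Fin 4) (x : ℝ) : ℝ :=
  lpEst 3 K h X (fun t => m j 0 (X t) + e (t, j)) d x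

/-- The plug-in estimator of the Gram matrix. -/
noncomputable def gramHat (K : ℝ → ℝ) (h : ℝ) (w : ℕ → ℝ → ℝ) (m : Fin p → ℕ → ℝ → ℝ)
    (X : Fin n → ℝ) (e : Fin n × Fin p → ℝ) (i j : Fin p) : ℝ :=
  ∫ x in (0 : ℝ)..1, lpFit K h m X e i 0 x * lpFit K h m X e j 0 x * w 0 x

/-- The integrals `∫ m₁' mᵢ w`. -/
noncomputable def crossMoment [NeZero p] (w : ℕ → ℝ → ℝ) (m : Fin p → ℕ → ℝ → ℝ) (i : Fin p) : ℝ :=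
  ∫ x in (0 : ℝ)..1, m 0 1 x * m i 0 x * w 0 x

/-- The plug-in estimator of `∫ m₁' mᵢ w`. -/
noncomputable def crossHat [NeZero p] (K : ℝ → ℝ) (h : ℝ) (w : ℕ → ℝ → ℝ) (m : Fin p → ℕ → ℝ → ℝ)
    (X : Fin n → ℝ) (e : Fin n × Fin p → ℝ) (i : Fin p) : ℝ :=
  ∫ x in (0 : ℝ)..1, lpFit K h m X e 0 1 x * lpFit K h m X e i 0 x * w 0 x

/-- The linear part of the error of `gramHat`. -/
noncomputable def linGram (w : ℕ → ℝ → ℝ) (m : Fin p → ℕ → ℝ → ℝ) (X : Fin n → ℝ)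
    (e : Fin n × Fin p → ℝ) (i j : Fin p) : ℝ :=
  (n : ℝ)⁻¹ * ∑ t, weighted w (m i) 0 (X t) * e (t, j)
    + (n : ℝ)⁻¹ * ∑ t, weighted w (m j) 0 (X t) * e (t, i)

/-- The linear part of the error of `crossHat`. -/
noncomputable def linCross [NeZero p] (w : ℕ → ℝ → ℝ) (m : Fin p → ℕ → ℝ → ℝ) (X : Fin n → ℝ)
    (e : Fin n × Fin p → ℝ) (i : Fin p) : ℝ :=
  (n : ℝ)⁻¹ * ∑ t, weighted w (fun d => m 0 (d + 1)) 0 (X t) * e (t, i)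
    - (n : ℝ)⁻¹ * ∑ t, weighted w (m i) 1 (X t) * e (t, 0)

/-- The squared Frobenius norm of the remainders in the linearizations. -/
noncomputable def remSq [NeZero p] (K : ℝ → ℝ) (h : ℝ) (w : ℕ → ℝ → ℝ) (m : Fin p → ℕ → ℝ → ℝ)
    (X : Fin n → ℝ) (e : Fin n × Fin p → ℝ) : ℝ :=
  ∑ i, ∑ j, (gramHat K h w m X e i j - gram (w 0) (fun j => m j 0) i j - linGram w m X e i j) ^ 2
    + ∑ i, (crossHat K h w m X e i - crossMoment w m i - linCross w m X e i) ^ 2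

theorem lpFit_eq (hh : 0 < h) (j : Fin p) (d : Fin 2) (x : ℝ) :
    lpFit K h m X e j (Fin.castLE (by omega) d) x = m j d x +
      (h ^ (d : ℕ))⁻¹ * lpErr K h X (m j) (fun t => e (t, j)) x (Fin.castLE (by omega) d) := by
  rw [lpFit, lpEst, lpErr]
  fin_cases d
  · simp
  · simp
    field_simp
    ring

theorem integral_mul_mul_sub {u v w η θ : ℝ → ℝ} (hu : Continuous u) (hv : Continuous v)
    (hw : Continuous w) (hη : IntervalIntegrable η volume 0 1)
    (hθ : IntervalIntegrable θ volume 0 1)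
    (hηθ : IntervalIntegrable (fun x => η x * θ x) volume 0 1) :
    (∫ x in (0 : ℝ)..1, (u x + η x) * (v x + θ x) * w x) - ∫ x in (0 : ℝ)..1, u x * v x * w x =
      (∫ x in (0 : ℝ)..1, u x * w x * θ x) + (∫ x in (0 : ℝ)..1, v x * w x * η x) +
        ∫ x in (0 : ℝ)..1, w x * (η x * θ x) := by
  have i0 : IntervalIntegrable (fun x => u x * v x * w x) volume 0 1 :=
    Continuous.intervalIntegrable (by fun_prop) _ _
  have i1 : IntervalIntegrable (fun x => u x * w x * θ x) volume 0 1 :=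
    hθ.continuousOn_mul (hu.mul hw).continuousOn
  have i2 : IntervalIntegrable (fun x => v x * w x * η x) volume 0 1 :=
    hη.continuousOn_mul (hv.mul hw).continuousOn
  have i3 : IntervalIntegrable (fun x => w x * (η x * θ x)) volume 0 1 :=
    hηθ.continuousOn_mul hw.continuousOn
  have e1 : ∀ x, (u x + η x) * (v x + θ x) * w x =
      u x * v x * w x + u x * w x * θ x + v x * w x * η x + w x * (η x * θ x) := fun x => by ring
  simp_rw [e1]
  rw [intervalIntegral.integral_add ((i0.add i1).add i2) i3,
    intervalIntegral.integral_add (i0.add i1) i2, intervalIntegral.integral_add i0 i1]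
  ring

section Good

variable (hX : DesignGood K c₀ C₁ h X) (hK : EquivKernelData K T B) (hc : 0 < c₀) (hn : 0 < n)
  (hh : 0 < h) (hw : WeightFun L w) (hm : ∀ j, SmoothFun M (m j))
include hX hK hc hn hh hw hm

/-- Expand the product of two fits. Each linear term is a smooth functional of one fit error, the
test function being the other trajectory times the weight; the product of the two errors remains. -/
theorem gramHat_sub_gram_eq (i j : Fin p) :
    gramHat K h w m X e i j - gram (w 0) (fun j => m j 0) i j - linGram w m X e i j =
      linRem K h (weighted w (m i)) (m j) 0 X (fun t => e (t, j))
      + linRem K h (weighted w (m j)) (m i) 0 X (fun t => e (t, i))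
      + ∫ x in (0 : ℝ)..1, w 0 x * (lpErr K h X (m i) (fun t => e (t, i)) x 0
          * lpErr K h X (m j) (fun t => e (t, j)) x 0) := by
  have h1 := integral_mul_mul_sub ((hm i).continuous (d := 0) (by omega))
    ((hm j).continuous (d := 0) (by omega)) (hw.continuous (d := 0) (by omega))
    (hX.intervalIntegrable_lpErr (e := fun t => e (t, i)) hK hc hn hh (hm i) 0)
    (hX.intervalIntegrable_lpErr (e := fun t => e (t, j)) hK hc hn hh (hm j) 0)
    (hX.intervalIntegrable_lpErr_mul (e := fun t => e (t, i)) (e' := fun t => e (t, j))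
      hK hc hn hh (hm i) (hm j) 0 0)
  have h2 : ∀ i x, lpFit K h m X e i 0 x = m i 0 x + lpErr K h X (m i) (fun t => e (t, i)) x 0 := by
    intro i x
    simpa using lpFit_eq (K := K) (m := m) (X := X) (e := e) hh i 0 x
  simp only [gramHat, gram, Matrix.of_apply, h2]
  rw [h1, linGram, linRem, linRem]
  simp [weighted]
  ring

/-- The same expansion with the derivative in one factor. Its error is integrated against `m i`
times the weight, and the linearization with `d = 1` puts the derivative on this product, with a
minus sign. -/
theorem crossHat_sub_crossMoment_eq [NeZero p] (i : Fin p) :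
    crossHat K h w m X e i - crossMoment w m i - linCross w m X e i =
      linRem K h (weighted w fun d => m 0 (d + 1)) (m i) 0 X (fun t => e (t, i))
      + linRem K h (weighted w (m i)) (m 0) 1 X (fun t => e (t, 0))
      + h⁻¹ * ∫ x in (0 : ℝ)..1, w 0 x * (lpErr K h X (m 0) (fun t => e (t, 0)) x 1
          * lpErr K h X (m i) (fun t => e (t, i)) x 0) := by
  have i0 := hX.intervalIntegrable_lpErr (e := fun t => e (t, 0)) hK hc hn hh (hm 0) 1
  have i2 := hX.intervalIntegrable_lpErr_mul (e := fun t => e (t, 0)) (e' := fun t => e (t, i))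
      hK hc hn hh (hm 0) (hm i) 1 0
  have h1 := integral_mul_mul_sub ((hm 0).continuous (d := 1) (by omega))
    ((hm i).continuous (d := 0) (by omega)) (hw.continuous (d := 0) (by omega))
    (η := fun x => h⁻¹ * lpErr K h X (m 0) (fun t => e (t, 0)) x 1) (i0.const_mul _)
    (hX.intervalIntegrable_lpErr (e := fun t => e (t, i)) hK hc hn hh (hm i) 0)
    (by simpa only [mul_assoc] using i2.const_mul h⁻¹)
  have h2 : ∀ i x, lpFit K h m X e i 0 x = m i 0 x + lpErr K h X (m i) (fun t => e (t, i)) x 0 := by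
    intro i x
    simpa using lpFit_eq (K := K) (m := m) (X := X) (e := e) hh i 0 x
  have h3 : ∀ x, lpFit K h m X e 0 1 x =
      m 0 1 x + h⁻¹ * lpErr K h X (m 0) (fun t => e (t, 0)) x 1 := by
    intro x
    simpa using lpFit_eq (K := K) (m := m) (X := X) (e := e) hh 0 1 x
  have h4 : ∀ x, w 0 x * (h⁻¹ * lpErr K h X (m 0) (fun t => e (t, 0)) x 1 *
      lpErr K h X (m i) (fun t => e (t, i)) x 0) = h⁻¹ * (w 0 x *
      (lpErr K h X (m 0) (fun t => e (t, 0)) x 1 * lpErr K h X (m i) (fun t => e (t, i)) x 0)) :=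
    fun x => by ring
  simp only [crossHat, crossMoment, h2, h3]
  rw [h1, linCross, linRem, linRem]
  simp_rw [h4, intervalIntegral.integral_const_mul]
  simp [weighted]
  ring

theorem sq_integral_lpErr_mul_le (i j : Fin p) (a b : Fin 4) :
    (∫ x in (0 : ℝ)..1, w 0 x * (lpErr K h X (m i) (fun t => e (t, i)) x a
          * lpErr K h X (m j) (fun t => e (t, j)) x b)) ^ 2 ≤ L ^ 2 *
      ((∫ x in (0 : ℝ)..1, ∑ a, lpErr K h X (m i) (fun t => e (t, i)) x a ^ 2) *
        ∫ x in (0 : ℝ)..1, ∑ a, lpErr K h X (m j) (fun t => e (t, j)) x a ^ 2) := by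
  have hi : ∀ i, IntervalIntegrable
      (fun x => ∑ a, lpErr K h X (m i) (fun t => e (t, i)) x a ^ 2) volume 0 1 := by
    intro i
    have := IntervalIntegrable.sum (μ := volume) (a := 0) (b := 1) Finset.univ
      (f := fun (a : Fin 4) x => lpErr K h X (m i) (fun t => e (t, i)) x a ^ 2) fun a _ => by
        simp_rw [sq]
        exact hX.intervalIntegrable_lpErr_mul hK hc hn hh (hm i) (hm i) a a
    simpa [Finset.sum_fn] using this
  have h1 := sq_intervalIntegral_le (g := fun x => w 0 x *
      (lpErr K h X (m i) (fun t => e (t, i)) x a * lpErr K h X (m j) (fun t => e (t, j)) x b))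
    ((hi i).const_mul (L ^ 2)) (hi j)
    (fun x _ => mul_nonneg (sq_nonneg _) (Finset.sum_nonneg fun _ _ => sq_nonneg _))
    (fun x _ => Finset.sum_nonneg fun _ _ => sq_nonneg _) fun x _ => by
      rw [mul_pow, mul_pow, mul_assoc]
      have h2 : w 0 x ^ 2 ≤ L ^ 2 := by
        rw [← sq_abs]
        exact pow_le_pow_left₀ (abs_nonneg _) (hw.bound 0 (by omega) x) 2
      refine mul_le_mul h2 (mul_le_mul ?_ ?_ (sq_nonneg _)
        (Finset.sum_nonneg fun _ _ => sq_nonneg _)) (by positivity) (sq_nonneg _)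
      · exact Finset.single_le_sum (f := fun a => lpErr K h X (m i) (fun t => e (t, i)) x a ^ 2)
          (fun _ _ => sq_nonneg _) (Finset.mem_univ a)
      · exact Finset.single_le_sum (f := fun a => lpErr K h X (m j) (fun t => e (t, j)) x a ^ 2)
          (fun _ _ => sq_nonneg _) (Finset.mem_univ b)
  rwa [intervalIntegral.integral_const_mul, mul_assoc] at h1

end Good

/-- The sum of the bounds for the squared remainders of the smooth functionals. -/
noncomputable def remBoundSum [NeZero p] (K : ℝ → ℝ) (T : Matrix (Fin 4) (Fin 4) ℝ) (h : ℝ)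
    (w : ℕ → ℝ → ℝ) (m : Fin p → ℕ → ℝ → ℝ) (X : Fin n → ℝ) (e : Fin n × Fin p → ℝ) : ℝ :=
  ∑ i, ∑ j, remBound K T h w (weighted w (m i)) (m j) 0 X (fun t => e (t, j))
    + (∑ i, remBound K T h w (weighted w fun d => m 0 (d + 1)) (m i) 0 X (fun t => e (t, i))
      + ∑ i, remBound K T h w (weighted w (m i)) (m 0) 1 X (fun t => e (t, 0)))

/-- The bound for the quadratic terms. -/
noncomputable def noiseEnergySum (K : ℝ → ℝ) (h : ℝ) (X : Fin n → ℝ) (e : Fin n × Fin p → ℝ) : ℝ :=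
  ∑ j : Fin p, h⁻¹ * (h ^ 6 + noiseEnergy K h X fun t => e (t, j))

-- The quadratic terms factorize: summed over all pairs they are at most the square of `∑ j, Z j`,
-- where `Z j` is the integrated squared fit error of variable `j`. The factor `h⁻¹` that the
-- derivative costs can be put on both sums because `h ≤ 1`.
set_option maxHeartbeats 800000 in
theorem exists_remSq_le (hK : EquivKernelData K T B) (hc : 0 < c₀) (hw : WeightFun L w)
    (M C₁ : ℝ) : ∃ D, 0 ≤ D ∧ ∀ (n p : ℕ) [NeZero p] (h : ℝ) (m : Fin p → ℕ → ℝ → ℝ)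
      (X : Fin n → ℝ) (e : Fin n × Fin p → ℝ), 0 < n → 0 < h → h ≤ 1 →
      (∀ j, SmoothFun M (m j)) → DesignGood K c₀ C₁ h X →
      remSq K h w m X e ≤ D * (remBoundSum K T h w m X e + noiseEnergySum K h X e ^ 2) := by
  set L₂ := max M (4 * M * L)
  set D₁ := 4 * (L₂ ^ 2 * sumSq T + 36 * B ^ 2 * (L₂ * M) ^ 2 + 1
        + 16 * L₂ ^ 2 * sumSq T * (c₀ ^ 2)⁻¹ * (32 * (C₁ * B * M) ^ 2 + 2)) with hD1
  set D₂ := (c₀ ^ 2)⁻¹ * (32 * (C₁ * B * M) ^ 2 + 2) with hD2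
  have hS := sumSq_nonneg T
  have hD1' : 0 ≤ D₁ := by positivity
  have hD2' : 0 ≤ D₂ := by positivity
  refine ⟨6 * D₁ + 6 * L ^ 2 * D₂ ^ 2, by positivity, ?_⟩
  intro n p _ h m X e hn hh hh1 hm hX
  set Z : Fin p → ℝ := fun j => ∫ x in (0 : ℝ)..1, ∑ a, lpErr K h X (m j) (fun t => e (t, j)) x a ^ 2
    with hZ
  have hZ0 : ∀ j, 0 ≤ Z j := fun j => intervalIntegral.integral_nonneg zero_le_one
    fun _ _ => Finset.sum_nonneg fun _ _ => sq_nonneg _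
  have hNE : ∀ j, 0 ≤ noiseEnergy K h X fun t => e (t, j) := fun j => noiseEnergy_nonneg _ _
  have hZle : ∀ j, Z j ≤ D₂ * (h ^ 6 + noiseEnergy K h X fun t => e (t, j)) := by
    intro j
    refine (hX.integral_sum_sq_lpErr_le hK hc hn hh (hm j)).trans ?_
    rw [hD2]
    refine le_trans ?_ (le_of_eq (mul_assoc _ _ _).symm)
    refine mul_le_mul_of_nonneg_left ?_ (inv_nonneg.2 (sq_nonneg c₀))
    have : 0 ≤ (C₁ * B * M) ^ 2 * noiseEnergy K h X fun t => e (t, j) :=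
      mul_nonneg (sq_nonneg _) (hNE j)
    have : 0 ≤ h ^ 6 := by positivity
    have := hNE j
    nlinarith
  have hinv : 1 ≤ h⁻¹ := (one_le_inv₀ hh).2 hh1
  have hZsum : h⁻¹ * ∑ j, Z j ≤ D₂ * noiseEnergySum K h X e := by
    rw [noiseEnergySum, Finset.mul_sum, Finset.mul_sum]
    refine Finset.sum_le_sum fun j _ => ?_
    calc h⁻¹ * Z j ≤ h⁻¹ * (D₂ * (h ^ 6 + noiseEnergy K h X fun t => e (t, j))) :=
          mul_le_mul_of_nonneg_left (hZle j) (by positivity)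
      _ = _ := by ring
  have hZs0 : 0 ≤ ∑ j, Z j := Finset.sum_nonneg fun j _ => hZ0 j
  have hsq : (h⁻¹ * ∑ j, Z j) ^ 2 ≤ D₂ ^ 2 * noiseEnergySum K h X e ^ 2 := by
    rw [← mul_pow]
    exact pow_le_pow_left₀ (by positivity) hZsum 2
  have h3 : ∀ a b c : ℝ, (a + b + c) ^ 2 ≤ 3 * (a ^ 2 + b ^ 2 + c ^ 2) := fun a b c => by
    nlinarith [sq_nonneg (a - b), sq_nonneg (a - c), sq_nonneg (b - c)]
  have hrem : ∀ {f mm : ℕ → ℝ → ℝ} (d : Fin 2) (ee : Fin n → ℝ), TestFun L₂ (w 0) f →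
      SmoothFun M mm → linRem K h f mm d X ee ^ 2 ≤ D₁ * remBound K T h w f mm d X ee :=
    fun d ee hf hmm => hX.linRem_sq_le hK hc hn hh hh1 hw hf hmm d
  have hφ : ∀ i, TestFun L₂ (w 0) (weighted w (m i)) := fun i => (hm i).testFun hw
  have hψ : TestFun L₂ (w 0) (weighted w fun d => m 0 (d + 1)) := (hm 0).testFun_deriv hw
  set R₁ : Fin p → Fin p → ℝ := fun i j =>
    remBound K T h w (weighted w (m i)) (m j) 0 X (fun t => e (t, j)) with hR1
  set R₂ : Fin p → ℝ := fun i =>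
    remBound K T h w (weighted w fun d => m 0 (d + 1)) (m i) 0 X (fun t => e (t, i)) with hR2
  set R₃ : Fin p → ℝ := fun i =>
    remBound K T h w (weighted w (m i)) (m 0) 1 X (fun t => e (t, 0)) with hR3
  have hR10 : 0 ≤ ∑ i, ∑ j, R₁ i j :=
    Finset.sum_nonneg fun i _ => Finset.sum_nonneg fun j _ => remBound_nonneg hh _ _ _
  have hR20 : 0 ≤ ∑ i, R₂ i := Finset.sum_nonneg fun i _ => remBound_nonneg hh _ _ _
  have hR30 : 0 ≤ ∑ i, R₃ i := Finset.sum_nonneg fun i _ => remBound_nonneg hh _ _ _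
  have g1 : ∑ i, ∑ j, (gramHat K h w m X e i j - gram (w 0) (fun j => m j 0) i j
      - linGram w m X e i j) ^ 2 ≤
      6 * D₁ * ∑ i, ∑ j, R₁ i j + 3 * L ^ 2 * (∑ j, Z j) ^ 2 := by
    have : ∀ i j, (gramHat K h w m X e i j - gram (w 0) (fun j => m j 0) i j
      - linGram w m X e i j) ^ 2 ≤ 3 * D₁ * R₁ i j + 3 * D₁ * R₁ j i
        + 3 * L ^ 2 * (Z i * Z j) := by
      intro i j
      rw [gramHat_sub_gram_eq hX hK hc hn hh hw hm]
      refine (h3 _ _ _).trans ?_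
      have a1 := hrem 0 (fun t => e (t, j)) (hφ i) (hm j)
      have a2 := hrem 0 (fun t => e (t, i)) (hφ j) (hm i)
      have a3 := sq_integral_lpErr_mul_le (e := e) hX hK hc hn hh hw hm i j 0 0
      simp only [hR1, hZ]
      linarith
    refine (Finset.sum_le_sum fun i _ => Finset.sum_le_sum fun j _ => this i j).trans (le_of_eq ?_)
    simp_rw [Finset.sum_add_distrib, ← Finset.mul_sum]
    rw [Finset.sum_comm (f := fun i j => R₁ j i), ← Finset.sum_mul, ← sq]
    ring
  have g2 : ∑ i, (crossHat K h w m X e i - crossMoment w m i - linCross w m X e i) ^ 2 ≤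
      3 * D₁ * ∑ i, R₂ i + 3 * D₁ * ∑ i, R₃ i + 3 * L ^ 2 * (h⁻¹ * ∑ j, Z j) ^ 2 := by
    have : ∀ i, (crossHat K h w m X e i - crossMoment w m i - linCross w m X e i) ^ 2 ≤
        3 * D₁ * R₂ i + 3 * D₁ * R₃ i + 3 * L ^ 2 * (h⁻¹ ^ 2 * (Z 0 * Z i)) := by
      intro i
      rw [crossHat_sub_crossMoment_eq hX hK hc hn hh hw hm]
      refine (h3 _ _ _).trans ?_
      have a1 := hrem 0 (fun t => e (t, i)) hψ (hm i)
      have a2 := hrem 1 (fun t => e (t, 0)) (hφ i) (hm 0)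
      have a3 := mul_le_mul_of_nonneg_left
        (sq_integral_lpErr_mul_le (e := e) hX hK hc hn hh hw hm 0 i 1 0) (sq_nonneg h⁻¹)
      simp only [hR2, hR3, hZ]
      rw [mul_pow]
      linarith
    refine (Finset.sum_le_sum fun i _ => this i).trans ?_
    simp_rw [Finset.sum_add_distrib, ← Finset.mul_sum]
    have hz : Z 0 ≤ ∑ j, Z j := Finset.single_le_sum (fun j _ => hZ0 j) (Finset.mem_univ 0)
    have : h⁻¹ ^ 2 * (Z 0 * ∑ j, Z j) ≤ (h⁻¹ * ∑ j, Z j) ^ 2 := by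
      rw [mul_pow, sq (∑ j, Z j)]
      gcongr
    nlinarith [sq_nonneg L]
  have g3 : (∑ j, Z j) ^ 2 ≤ (h⁻¹ * ∑ j, Z j) ^ 2 :=
    pow_le_pow_left₀ hZs0 (le_mul_of_one_le_left hZs0 hinv) 2
  have hL2 : 0 ≤ 6 * L ^ 2 := by positivity
  have g4 := mul_le_mul_of_nonneg_left (g3.trans hsq) hL2
  have g5 := mul_le_mul_of_nonneg_left hsq hL2
  have g6 := add_le_add g1 g2
  have hN := sq_nonneg (noiseEnergySum K h X e)
  rw [remSq, remBoundSum]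
  refine g6.trans ?_
  change _ ≤ _ * (∑ i, ∑ j, R₁ i j + (∑ i, R₂ i + ∑ i, R₃ i) + _)
  clear_value D₁ D₂ R₁ R₂ R₃ Z
  generalize noiseEnergySum K h X e ^ 2 = N at *
  generalize ∑ i, ∑ j, R₁ i j = r₁ at *
  generalize ∑ i, R₂ i = r₂ at *
  generalize ∑ i, R₃ i = r₃ at *
  generalize (h⁻¹ * ∑ j, Z j) ^ 2 = z at *
  generalize (∑ j, Z j) ^ 2 = z' at *
  clear g1 g2 g6 hsq hrem h3 hφ hψ hZsum hZle hNE
  have t1 : 0 ≤ D₁ * r₂ := by positivity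
  have t2 : 0 ≤ D₁ * r₃ := by positivity
  have t3 : 0 ≤ D₁ * N := by positivity
  have t4 : 0 ≤ L ^ 2 * D₂ ^ 2 * (r₁ + (r₂ + r₃)) := by positivity
  linear_combination (1 / 2) * g4 + (1 / 2) * g5 + 3 * t1 + 3 * t2 + 6 * t3 + 6 * t4

end PlugIn

/-! ### Linear statistics of the noise -/

section LinStat

variable {n p : ℕ} {L M : ℝ} {w : ℕ → ℝ → ℝ} {m : Fin p → ℕ → ℝ → ℝ} {X : Fin n → ℝ}
  {e : Fin n × Fin p → ℝ}

/-- The linear statistic with influence functions `F`. -/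
noncomputable def linStat (F : Fin p → ℝ → ℝ) (X : Fin n → ℝ) (e : Fin n × Fin p → ℝ) : ℝ :=
  (n : ℝ)⁻¹ * ∑ t, ∑ l, F l (X t) * e (t, l)

theorem linStat_eq_sum (F : Fin p → ℝ → ℝ) (X : Fin n → ℝ) (e : Fin n × Fin p → ℝ) :
    linStat F X e = ∑ s, (n : ℝ)⁻¹ * F s.2 (X s.1) * e s := by
  rw [linStat, Fintype.sum_prod_type, Finset.mul_sum]
  refine Finset.sum_congr rfl fun t _ => ?_
  rw [Finset.mul_sum]
  exact Finset.sum_congr rfl fun l _ => by ring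

theorem continuous_linStat {F : Fin p → ℝ → ℝ} (hF : ∀ l, Continuous (F l)) :
    Continuous fun q : (Fin n → ℝ) × (Fin n × Fin p → ℝ) => linStat F q.1 q.2 := by
  unfold linStat
  fun_prop

theorem lintegral_sq_linStat_noise (σ : ℝ) (F : Fin p → ℝ → ℝ) (X : Fin n → ℝ) :
    ∫⁻ e, ENNReal.ofReal (linStat F X e ^ 2) ∂noiseLaw σ (Fin n × Fin p) =
      ENNReal.ofReal (σ ^ 2 * ((n : ℝ)⁻¹ ^ 2 * ∑ t, ∑ l, F l (X t) ^ 2)) := by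
  simp_rw [linStat_eq_sum]
  rw [lintegral_sq_noise, Fintype.sum_prod_type]
  congr 2
  simp_rw [mul_pow, ← Finset.mul_sum]

theorem lintegral_sampleMean {φ : ℝ → ℝ} (hφ : Continuous φ) (h0 : ∀ x, 0 ≤ φ x) (hn : 0 < n) :
    ∫⁻ X, ENNReal.ofReal ((n : ℝ)⁻¹ * ∑ t, φ (X t)) ∂designLaw n =
      ENNReal.ofReal (∫ x in (0 : ℝ)..1, φ x) := by
  have hn' : (0 : ℝ) < n := by exact_mod_cast hn
  have h1 : ∀ X : Fin n → ℝ, ENNReal.ofReal ((n : ℝ)⁻¹ * ∑ t, φ (X t)) =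
      ENNReal.ofReal (n : ℝ)⁻¹ * ∑ t, ENNReal.ofReal (φ (X t)) := fun X => by
    rw [ENNReal.ofReal_mul (by positivity), ENNReal.ofReal_sum_of_nonneg fun t _ => h0 _]
  simp_rw [h1]
  rw [lintegral_const_mul _ (by fun_prop), lintegral_finsetSum _ (fun t _ => by fun_prop)]
  have h2 : ∀ t : Fin n, ∫⁻ X, ENNReal.ofReal (φ (X t)) ∂designLaw n =
      ENNReal.ofReal (∫ x in (0 : ℝ)..1, φ x) := by
    intro t
    have := (measurePreserving_eval (fun _ : Fin n => unifLaw) t).lintegral_comp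
      (f := fun x => ENNReal.ofReal (φ x)) (by fun_prop)
    refine Eq.trans this ?_
    rw [← integral_unifLaw, ofReal_integral_eq_lintegral_ofReal _ (.of_forall h0)]
    have : IntegrableOn φ (Icc 0 1) := hφ.continuousOn.integrableOn_Icc
    exact this.mono_set Ioo_subset_Icc_self
  simp_rw [h2]
  rw [Finset.sum_const, Finset.card_univ, Fintype.card_fin, nsmul_eq_mul, ← mul_assoc,
    ENNReal.ofReal_inv_of_pos hn', ENNReal.ofReal_natCast, ENNReal.inv_mul_cancel, one_mul]
  · exact_mod_cast hn.ne'
  · exact ENNReal.natCast_ne_top n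

/-- Condition on the design first: the variance of the statistic is then `σ ^ 2 / n` times the
sample mean of `∑ l, F l ^ 2`, and the average over the design turns this into an integral. -/
theorem lintegral_sq_linStat_le (σ : ℝ) {F : Fin p → ℝ → ℝ} (hF : ∀ l, Continuous (F l))
    {c : ℝ → ℝ} (hc : Continuous c) (hc0 : ∀ x, 0 ≤ c x) (hFc : ∀ x, ∑ l, F l x ^ 2 ≤ c x)
    (hn : 0 < n) :
    ∫⁻ q, ENNReal.ofReal (linStat F q.1 q.2 ^ 2)
        ∂(designLaw n).prod (noiseLaw σ (Fin n × Fin p)) ≤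
      ENNReal.ofReal (σ ^ 2 / n * ∫ x in (0 : ℝ)..1, c x) := by
  have hm : Measurable fun q : (Fin n → ℝ) × (Fin n × Fin p → ℝ) =>
      ENNReal.ofReal (linStat F q.1 q.2 ^ 2) :=
    ((continuous_linStat hF).measurable.pow_const 2).ennreal_ofReal
  rw [lintegral_prod _ hm.aemeasurable]
  simp_rw [lintegral_sq_linStat_noise]
  calc ∫⁻ X, ENNReal.ofReal (σ ^ 2 * ((n : ℝ)⁻¹ ^ 2 * ∑ t, ∑ l, F l (X t) ^ 2)) ∂designLaw n
      ≤ ∫⁻ X, ENNReal.ofReal (σ ^ 2 / n) * ENNReal.ofReal ((n : ℝ)⁻¹ * ∑ t, c (X t))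
          ∂designLaw n := by
        refine lintegral_mono fun X => ?_
        rw [← ENNReal.ofReal_mul (by positivity)]
        refine ENNReal.ofReal_le_ofReal ?_
        calc _ ≤ σ ^ 2 * ((n : ℝ)⁻¹ ^ 2 * ∑ t, c (X t)) := by
              gcongr with t
              exact hFc _
          _ = _ := by ring
    _ = _ := by
        rw [lintegral_const_mul _ (by fun_prop), lintegral_sampleMean hc hc0 hn,
          ENNReal.ofReal_mul (by positivity)]

theorem linGram_eq_linStat (i j : Fin p) :
    linGram w m X e i j = linStat (fun l x => (if l = j then weighted w (m i) 0 x else 0)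
      + if l = i then weighted w (m j) 0 x else 0) X e := by
  simp only [linGram, linStat, add_mul, ite_mul, zero_mul, Finset.sum_add_distrib,
    Finset.sum_ite_eq', Finset.mem_univ, if_true, mul_add]

theorem linCross_eq_linStat [NeZero p] (i : Fin p) :
    linCross w m X e i =
      linStat (fun l x => (if l = i then weighted w (fun d => m 0 (d + 1)) 0 x else 0)
        - if l = 0 then weighted w (m i) 1 x else 0) X e := by
  simp only [linCross, linStat, sub_mul, ite_mul, zero_mul, Finset.sum_sub_distrib,
    Finset.sum_ite_eq', Finset.mem_univ, if_true, mul_sub]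

/-- The linear part of the error of the estimated normal equations at `β`. -/
noncomputable def linErr [NeZero p] (w : ℕ → ℝ → ℝ) (m : Fin p → ℕ → ℝ → ℝ) (β : Fin p → ℝ)
    (X : Fin n → ℝ) (e : Fin n × Fin p → ℝ) (i : Fin p) : ℝ :=
  linCross w m X e i - ∑ j, linGram w m X e i j * β j

/-- The residual of the first equation. -/
noncomputable def resid [NeZero p] (m : Fin p → ℕ → ℝ → ℝ) (β : Fin p → ℝ) (x : ℝ) : ℝ :=
  m 0 1 x - ∑ j, β j * m j 0 x

/-- The noise of variable `i` carries `m₁' w` from the cross moments and `-(∑ j, β j * m j) w` from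
the Gram matrix. They combine into the residual, whose weighted norm is bounded by minimality,
whatever the number of variables. -/
theorem linErr_eq_linStat [NeZero p] (β : Fin p → ℝ) (i : Fin p) :
    linErr w m β X e i = linStat (fun l x => (if l = i then resid m β x * w 0 x else 0)
      - (if l = 0 then weighted w (m i) 1 x else 0) - β l * weighted w (m i) 0 x) X e := by
  have h1 : ∑ j, linGram w m X e i j * β j = linStat (fun l x =>
      β l * weighted w (m i) 0 x + if l = i then (∑ j, β j * m j 0 x) * w 0 x else 0) X e := by
    simp only [linGram, linStat, weighted, add_mul, ite_mul, zero_mul, Finset.sum_add_distrib,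
      Finset.sum_ite_eq', Finset.mem_univ, if_true, mul_add, Finset.mul_sum, Finset.sum_mul]
    congr 1
    · rw [Finset.sum_comm]
      exact Finset.sum_congr rfl fun _ _ => Finset.sum_congr rfl fun _ _ => by ring
    · rw [Finset.sum_comm]
      exact Finset.sum_congr rfl fun _ _ => Finset.sum_congr rfl fun _ _ => by ring
  rw [linErr, h1, linCross_eq_linStat, linStat, linStat, linStat, ← mul_sub,
    ← Finset.sum_sub_distrib]
  congr 1
  refine Finset.sum_congr rfl fun t _ => ?_
  rw [← Finset.sum_sub_distrib]
  refine Finset.sum_congr rfl fun l _ => ?_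
  simp only [weighted, resid]
  split_ifs <;> ring

variable (hw : WeightFun L w) (hm : ∀ j, SmoothFun M (m j))
include hw hm

theorem lintegral_sq_linGram_le (σ : ℝ) (hn : 0 < n) (i j : Fin p) :
    ∫⁻ q, ENNReal.ofReal (linGram w m q.1 q.2 i j ^ 2)
        ∂(designLaw n).prod (noiseLaw σ (Fin n × Fin p)) ≤
      ENNReal.ofReal (σ ^ 2 / n * (4 * max M (4 * M * L) ^ 2)) := by
  have hφ : ∀ i, TestFun (max M (4 * M * L)) (w 0) (weighted w (m i)) := fun i => (hm i).testFun hw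
  have hc : ∀ i, Continuous (weighted w (m i) 0) := fun i => (hφ i).continuous (by omega)
  have hb : ∀ i x, weighted w (m i) 0 x ^ 2 ≤ max M (4 * M * L) ^ 2 := fun i x => by
    rw [← sq_abs]
    exact pow_le_pow_left₀ (abs_nonneg _) ((hφ i).bound 0 (by omega) x) 2
  simp_rw [linGram_eq_linStat]
  refine (lintegral_sq_linStat_le σ (fun l => by
    split_ifs <;> fun_prop) (c := fun _ => 4 * max M (4 * M * L) ^ 2) (by fun_prop)
    (fun _ => by positivity) (fun x => ?_) hn).trans (by simp)
  have h1 : ∀ l : Fin p, ((if l = j then weighted w (m i) 0 x else 0)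
      + if l = i then weighted w (m j) 0 x else 0) ^ 2 ≤
      2 * (if l = j then weighted w (m i) 0 x ^ 2 else 0) +
        2 * if l = i then weighted w (m j) 0 x ^ 2 else 0 := by
    intro l
    have h2 : ∀ a b : ℝ, (a + b) ^ 2 ≤ 2 * a ^ 2 + 2 * b ^ 2 := fun a b => by
      nlinarith [sq_nonneg (a - b)]
    refine (h2 _ _).trans (le_of_eq ?_)
    simp only [ite_pow, ne_eq, OfNat.ofNat_ne_zero, not_false_eq_true, zero_pow]
  refine (Finset.sum_le_sum fun l _ => h1 l).trans ?_
  rw [Finset.sum_add_distrib, ← Finset.mul_sum, ← Finset.mul_sum]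
  simp only [Finset.sum_ite_eq', Finset.mem_univ, if_true]
  linarith [hb i x, hb j x]

/-- The residual need not be bounded pointwise uniformly in `p`, but `(resid * w) ^ 2 ≤ L * (resid ^
2 * w)` has a bounded integral. In the application `∑ l, β l ^ 2` is of order `p`, and summing over
`i` gives the rate `p ^ 2 / n`. -/
theorem lintegral_sq_linErr_le [NeZero p] (σ : ℝ) (hn : 0 < n) (β : Fin p → ℝ)
    (hβ : ∫ x in (0 : ℝ)..1, resid m β x ^ 2 * w 0 x ≤ M ^ 2 * L) (i : Fin p) :
    ∫⁻ q, ENNReal.ofReal (linErr w m β q.1 q.2 i ^ 2)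
        ∂(designLaw n).prod (noiseLaw σ (Fin n × Fin p)) ≤
      ENNReal.ofReal (σ ^ 2 / n * (3 * ((M * L) ^ 2 +
        max M (4 * M * L) ^ 2 * (1 + ∑ l, β l ^ 2)))) := by
  set L₂ := max M (4 * M * L) with hL2
  have hL := hw.nonneg_bound
  have hφ : TestFun L₂ (w 0) (weighted w (m i)) := (hm i).testFun hw
  have hc0 : Continuous (weighted w (m i) 0) := hφ.continuous (by omega)
  have hc1 : Continuous (weighted w (m i) 1) := hφ.continuous (by omega)
  have hwc : Continuous (w 0) := hw.continuous (by omega)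
  have hmc : ∀ j, Continuous (m j 0) := fun j => (hm j).continuous (by omega)
  have hmc1 : Continuous (m 0 1) := (hm 0).continuous (by omega)
  have hr : Continuous (resid m β) := by unfold resid; fun_prop
  have hb : ∀ d ≤ 2, ∀ x, weighted w (m i) d x ^ 2 ≤ L₂ ^ 2 := fun d hd x => by
    rw [← sq_abs]
    exact pow_le_pow_left₀ (abs_nonneg _) (hφ.bound d hd x) 2
  simp_rw [linErr_eq_linStat]
  refine (lintegral_sq_linStat_le σ (fun l => ?_) (c := fun x => 3 * (L * (resid m β x ^ 2 * w 0 x)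
    + L₂ ^ 2 * (1 + ∑ l, β l ^ 2))) (by fun_prop) (fun x => ?_) (fun x => ?_) hn).trans ?_
  · split_ifs <;> fun_prop
  · have := hw.nonneg x
    positivity
  · have h1 : ∀ l : Fin p, ((if l = i then resid m β x * w 0 x else 0)
      - (if l = 0 then weighted w (m i) 1 x else 0) - β l * weighted w (m i) 0 x) ^ 2 ≤
        3 * ((if l = i then (resid m β x * w 0 x) ^ 2 else 0) +
          (if l = 0 then weighted w (m i) 1 x ^ 2 else 0) + β l ^ 2 * weighted w (m i) 0 x ^ 2) := by
      intro l
      have h2 : ∀ a b c : ℝ, (a - b - c) ^ 2 ≤ 3 * (a ^ 2 + b ^ 2 + c ^ 2) := fun a b c => by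
        nlinarith [sq_nonneg (a + b), sq_nonneg (a + c), sq_nonneg (b - c)]
      refine (h2 _ _ _).trans (le_of_eq ?_)
      simp only [ite_pow, ne_eq, OfNat.ofNat_ne_zero, not_false_eq_true, zero_pow, mul_pow]
    refine (Finset.sum_le_sum fun l _ => h1 l).trans ?_
    rw [← Finset.mul_sum, Finset.sum_add_distrib, Finset.sum_add_distrib, ← Finset.sum_mul]
    simp only [Finset.sum_ite_eq', Finset.mem_univ, if_true]
    have h3 : (resid m β x * w 0 x) ^ 2 ≤ L * (resid m β x ^ 2 * w 0 x) := by
      have h4 : w 0 x ≤ L := (le_abs_self _).trans (hw.bound 0 (by omega) x)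
      have h5 := mul_le_mul_of_nonneg_left h4 (mul_nonneg (sq_nonneg (resid m β x)) (hw.nonneg x))
      linarith
    have h4 := mul_le_mul_of_nonneg_left (hb 0 (by omega) x)
      (Finset.sum_nonneg fun l (_ : l ∈ Finset.univ) => sq_nonneg (β l))
    linarith [hb 1 (by omega) x]
  · refine ENNReal.ofReal_le_ofReal ?_
    gcongr
    rw [intervalIntegral.integral_const_mul, intervalIntegral.integral_add
      (Continuous.intervalIntegrable (by fun_prop) _ _) (by simp),
      intervalIntegral.integral_const_mul]
    simp only [intervalIntegral.integral_const, sub_zero, one_smul]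
    have := mul_le_mul_of_nonneg_left hβ hL
    nlinarith

end LinStat

/-! ### Events of high probability -/

section Tight

variable {Ω : ℕ → Type*} [∀ n, MeasurableSpace (Ω n)] {P : ∀ n, Measure (Ω n)}

/-- A family of events, increasing in `D`, whose probabilities are eventually close to one when `D`
is large. -/
structure TightEvents (P : ∀ n, Measure (Ω n)) (A : ℝ → ∀ n, Set (Ω n)) : Prop where
  mono : ∀ D D', 0 ≤ D → D ≤ D' → ∀ᶠ n in atTop, A D n ⊆ A D' n
  small : ∀ δ : ENNReal, 0 < δ → ∃ D : ℝ, 0 ≤ D ∧ ∀ᶠ n in atTop, P n (A D n)ᶜ ≤ δ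

theorem TightEvents.inter {A A' : ℝ → ∀ n, Set (Ω n)} (hA : TightEvents P A)
    (hA' : TightEvents P A') : TightEvents P fun D n => A D n ∩ A' D n := by
  refine ⟨fun D D' h0 h => ?_, fun δ hδ => ?_⟩
  · filter_upwards [hA.mono D D' h0 h, hA'.mono D D' h0 h] with n h1 h2
    exact inter_subset_inter h1 h2
  · obtain ⟨D₁, h1, hD1⟩ := hA.small (δ / 2) (ENNReal.half_pos hδ.ne')
    obtain ⟨D₂, h2, hD2⟩ := hA'.small (δ / 2) (ENNReal.half_pos hδ.ne')
    refine ⟨max D₁ D₂, h1.trans (le_max_left _ _), ?_⟩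
    filter_upwards [hD1, hD2, hA.mono _ _ h1 (le_max_left D₁ D₂),
      hA'.mono _ _ h2 (le_max_right D₁ D₂)] with n a b c d
    rw [compl_inter]
    calc _ ≤ P n (A (max D₁ D₂) n)ᶜ + P n (A' (max D₁ D₂) n)ᶜ := measure_union_le _ _
      _ ≤ P n (A D₁ n)ᶜ + P n (A' D₂ n)ᶜ := by gcongr
      _ ≤ δ / 2 + δ / 2 := add_le_add a b
      _ = δ := ENNReal.add_halves δ

theorem TightEvents.mono_set {A A' : ℝ → ∀ n, Set (Ω n)} (hA : TightEvents P A)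
    (hA' : ∀ D D', 0 ≤ D → D ≤ D' → ∀ᶠ n in atTop, A' D n ⊆ A' D' n)
    (h : ∀ D, 0 ≤ D → ∃ D', 0 ≤ D' ∧ ∀ᶠ n in atTop, A D n ⊆ A' D' n) : TightEvents P A' := by
  refine ⟨hA', fun δ hδ => ?_⟩
  obtain ⟨D, h1, hD⟩ := hA.small δ hδ
  obtain ⟨D', h2, hD'⟩ := h D h1
  refine ⟨D', h2, ?_⟩
  filter_upwards [hD, hD'] with n a b
  exact (measure_mono (compl_subset_compl.2 b)).trans a

theorem TightEvents.of_wpt {E : ∀ n, Set (Ω n)} (hE : WithProbTendingToOne P E) :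
    TightEvents P fun _ n => E n :=
  ⟨fun _ _ _ _ => .of_forall fun _ => Subset.rfl, fun _ hδ =>
    ⟨0, le_rfl, (ENNReal.tendsto_nhds_zero.1 hE) _ hδ⟩⟩

theorem TightEvents.of_bigOP {Z : ∀ n, Ω n → ℝ} {r : ℕ → ℝ} (hZ : IsBigOP P Z r)
    (hr : ∀ᶠ n in atTop, 0 ≤ r n) : TightEvents P fun D n => {ω | |Z n ω| ≤ D * r n} := by
  refine ⟨fun D D' h0 h => ?_, fun δ hδ => ?_⟩
  · filter_upwards [hr] with n hn ω hω
    exact le_trans (b := D * r n) hω (by gcongr)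
  · obtain ⟨C, hC⟩ := hZ δ hδ
    refine ⟨max C 0, le_max_right _ _, ?_⟩
    filter_upwards [hC, hr] with n h1 h2
    refine le_trans (measure_mono fun ω hω => ?_) h1
    have h3 : max C 0 * r n < |Z n ω| := not_le.1 hω
    exact lt_of_le_of_lt (mul_le_mul_of_nonneg_right (le_max_left _ _) h2) h3

/-- Fixing `D` costs only a probability `δ`. A claim that holds on `A D n` for every fixed `D` and
all large `n` therefore holds with probability tending to one. -/
theorem TightEvents.wpt {A : ℝ → ∀ n, Set (Ω n)} (hA : TightEvents P A) {F : ∀ n, Set (Ω n)}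
    (h : ∀ D, 0 ≤ D → ∀ᶠ n in atTop, A D n ⊆ F n) : WithProbTendingToOne P F := by
  refine ENNReal.tendsto_nhds_zero.2 fun δ hδ => ?_
  obtain ⟨D, h1, hD⟩ := hA.small δ hδ
  filter_upwards [hD, h D h1] with n a b
  exact (measure_mono (compl_subset_compl.2 b)).trans a

theorem TightEvents.bigOP {A : ℝ → ∀ n, Set (Ω n)} (hA : TightEvents P A) {Z : ∀ n, Ω n → ℝ}
    {s : ℕ → ℝ} (h : ∀ D, 0 ≤ D → ∃ C, ∀ᶠ n in atTop, ∀ ω ∈ A D n, |Z n ω| ≤ C * s n) :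
    IsBigOP P Z s := by
  intro δ hδ
  obtain ⟨D, h1, hD⟩ := hA.small δ hδ
  obtain ⟨C, hC⟩ := h D h1
  refine ⟨C, ?_⟩
  filter_upwards [hD, hC] with n a b
  refine (measure_mono fun ω hω => ?_).trans a
  exact fun h' => absurd (b ω h') (not_le.2 hω)

/-- Events controlled by a moment bound on a sequence of good events for the first component. -/
theorem tightEvents_of_moment {α β : ℕ → Type*} [∀ n, MeasurableSpace (α n)]
    [∀ n, MeasurableSpace (β n)] {μ : ∀ n, Measure (α n)} {ν : ∀ n, Measure (β n)}
    [∀ n, IsProbabilityMeasure (μ n)] [∀ n, IsProbabilityMeasure (ν n)]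
    {Z : ∀ n, Ω n → α n × β n} (hZ : ∀ n, HasLaw (Z n) ((μ n).prod (ν n)) (P n))
    {A : ∀ n, Set (α n)} (hA : ∀ n, MeasurableSet (A n))
    (hA' : WithProbTendingToOne P fun n => {ω | (Z n ω).1 ∈ A n})
    {U : ∀ n, α n × β n → ℝ} (hU : ∀ n, Measurable (U n)) {c : ℝ} {s : ℕ → ℝ}
    (hs : ∀ᶠ n in atTop, 0 < s n)
    (hc : ∀ᶠ n in atTop, ∫⁻ q in A n ×ˢ univ, ENNReal.ofReal (U n q) ∂(μ n).prod (ν n) ≤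
      ENNReal.ofReal (c * s n)) :
    TightEvents P fun D n => {ω | (Z n ω).1 ∈ A n ∧ U n (Z n ω) ≤ D * s n} := by
  refine ⟨fun D D' h0 h => ?_, fun δ hδ => ?_⟩
  · filter_upwards [hs] with n hn ω hω
    exact ⟨hω.1, hω.2.trans (by gcongr)⟩
  · have hδ2 : 0 < δ / 2 := ENNReal.half_pos hδ.ne'
    -- Markov's inequality bounds the probability of exceeding `D * s n` on the good event by `c /
    -- D`, uniformly in `n`. This fixes the choice of `D`.
    have h1 : Tendsto (fun D : ℝ => ENNReal.ofReal (c / D)) atTop (𝓝 0) := by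
      have := ENNReal.tendsto_ofReal (tendsto_const_nhds.div_atTop tendsto_id :
        Tendsto (fun D : ℝ => c / D) atTop (𝓝 0))
      simpa using this
    obtain ⟨D, hD, hD0⟩ := ((ENNReal.tendsto_nhds_zero.1 h1 _ hδ2).and
      (eventually_gt_atTop 0)).exists
    refine ⟨D, hD0.le, ?_⟩
    filter_upwards [hs, hc, ENNReal.tendsto_nhds_zero.1 hA' _ hδ2] with n hn hcn hAn
    have h2 := measure_lt_le_of_setLIntegral_le (hZ n) (hA n) (hU n)
      (mul_pos hD0 hn) hcn
    calc P n {ω | (Z n ω).1 ∈ A n ∧ U n (Z n ω) ≤ D * s n}ᶜ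
        ≤ P n ({ω | (Z n ω).1 ∈ A n}ᶜ ∪ {ω | (Z n ω).1 ∈ A n ∧ D * s n < U n (Z n ω)}) := by
          refine measure_mono fun ω hω => ?_
          by_cases h : (Z n ω).1 ∈ A n
          · exact Or.inr ⟨h, not_le.1 fun h' => hω ⟨h, h'⟩⟩
          · exact Or.inl h
      _ ≤ δ / 2 + δ / 2 := by
          refine (measure_union_le _ _).trans (add_le_add hAn (h2.trans ?_))
          rwa [mul_div_mul_right _ _ hn.ne']
      _ = δ := ENNReal.add_halves δ

end Tight

-- Consequences of the bandwidth conditions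

section Bandwidth

variable {h : ℕ → ℝ} {p : ℕ → ℕ}

theorem BandwidthCondition.tendsto_zero (hE : BandwidthCondition h p) :
    Tendsto h atTop (𝓝 0) := by
  have h1 : ∀ᶠ n : ℕ in atTop, h n ^ 6 ≤ (n : ℝ) * h n ^ 6 := by
    filter_upwards [eventually_ge_atTop 1] with n hn
    have : (1 : ℝ) ≤ n := by exact_mod_cast hn
    have := (hE.pos n).le
    exact le_mul_of_one_le_left (by positivity) (by assumption)
  have h2 : Tendsto (fun n => h n ^ 6) atTop (𝓝 0) :=
    squeeze_zero' (.of_forall fun n => by positivity) h1 hE.tendsto_six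
  have h3 := (Real.continuous_sqrt.tendsto 0).comp h2
  have h4 : Tendsto (fun n => h n ^ 3) atTop (𝓝 0) := by
    refine (h3.congr fun n => ?_).trans (by simp)
    have := (hE.pos n).le
    simp only [Function.comp_apply]
    rw [show h n ^ 6 = (h n ^ 3) ^ 2 by ring, Real.sqrt_sq (by positivity)]
  rw [Metric.tendsto_atTop] at h4 ⊢
  intro ε hε
  obtain ⟨N, hN⟩ := h4 (ε ^ 3) (by positivity)
  refine ⟨N, fun n hn => ?_⟩
  have h5 := hN n hn
  have h6 := hE.pos n
  simp only [dist_zero_right, Real.norm_eq_abs] at h5 ⊢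
  rw [abs_of_pos (by positivity)] at h5
  rw [abs_of_pos h6]
  exact lt_of_pow_lt_pow_left₀ 3 hε.le h5

theorem BandwidthCondition.tendsto_inv (hE : BandwidthCondition h p) (C : ℝ) :
    Tendsto (fun n : ℕ => ENNReal.ofReal (C / (n * h n ^ 2))) atTop (𝓝 0) := by
  have h1 : Tendsto (fun n : ℕ => (n : ℝ) * h n ^ 2) atTop atTop := by
    refine tendsto_atTop_mono' _ ?_ hE.tendsto_four
    filter_upwards [hE.tendsto_zero.eventually_le_const zero_lt_one] with n hn
    have h2 : h n ^ 4 ≤ h n ^ 2 := pow_le_pow_of_le_one (hE.pos n).le hn (by omega)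
    gcongr
  have := ENNReal.tendsto_ofReal (tendsto_const_nhds.div_atTop h1 :
    Tendsto (fun n : ℕ => C / (n * h n ^ 2)) atTop (𝓝 0))
  simpa using this

end Bandwidth

-- Simultaneous control of the design, the linear terms and the remainders

section Master

variable {Ω : ℕ → Type*} [∀ n, MeasurableSpace (Ω n)] {P : ∀ n, Measure (Ω n)}
  {p : ℕ → ℕ} [∀ n, NeZero (p n)] {K : ℝ → ℝ} {T : Matrix (Fin 4) (Fin 4) ℝ} {B L M σ : ℝ}
  {h : ℕ → ℝ} {w : ℕ → ℝ → ℝ} {m : ∀ n, Fin (p n) → ℕ → ℝ → ℝ}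
  {Z : ∀ n, Ω n → (Fin n → ℝ) × (Fin n × Fin (p n) → ℝ)} {β : ∀ n, Fin (p n) → ℝ}

theorem lintegral_sum_le_const {α ι : Type*} [Fintype ι] [MeasurableSpace α] {μ : Measure α}
    {F : ι → α → ℝ} (hF : ∀ i, Measurable (F i)) (hF0 : ∀ i a, 0 ≤ F i a) {c : ℝ}
    (hc : ∀ i, ∫⁻ a, ENNReal.ofReal (F i a) ∂μ ≤ ENNReal.ofReal c) :
    ∫⁻ a, ENNReal.ofReal (∑ i, F i a) ∂μ ≤ ENNReal.ofReal (Fintype.card ι * c) :=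
  lintegral_ofReal_sum_le μ Finset.univ (fun i _ => hF i) (fun i _ => hF0 i) fun i _ => hc i

theorem measurable_remBound_column {n p : ℕ} {h : ℝ} {f w m : ℕ → ℝ → ℝ} (hK : KernelCondition K)
    (hw : WeightFun L w) {L' : ℝ} (hf : TestFun L' (w 0) f) (hm : SmoothFun M m) (d : Fin 2)
    (j : Fin p) :
    Measurable fun q : (Fin n → ℝ) × (Fin n × Fin p → ℝ) =>
      remBound K T h w f m d q.1 fun t => q.2 (t, j) :=
  ((continuous_remBound (n := n) (T := T) (h := h) hK hw hf hm d).comp (by fun_prop :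
    Continuous fun q : (Fin n → ℝ) × (Fin n × Fin p → ℝ) => (q.1, fun t => q.2 (t, j)))).measurable

/-- There are `p ^ 2 + 2 * p ≤ 3 * p ^ 2` remainders, each with expectation of order `remRate ^ 2`
on the good design. -/
theorem exists_lintegral_remBoundSum_le (hK : EquivKernelData K T B) (hw : WeightFun L w)
    {c₀ C₁ : ℝ} (hC : 0 ≤ C₁) (M σ : ℝ) : ∃ D, ∀ (n p : ℕ) [NeZero p] (h : ℝ)
      (m : Fin p → ℕ → ℝ → ℝ) (A : Set (Fin n → ℝ)), 0 < n → 0 < h → h ≤ 1 →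
      (∀ j, SmoothFun M (m j)) → MeasurableSet A → (∀ X ∈ A, DesignGood K c₀ C₁ h X) →
      (Measurable fun q : (Fin n → ℝ) × (Fin n × Fin p → ℝ) => remBoundSum K T h w m q.1 q.2) ∧
      ∫⁻ q in A ×ˢ univ, ENNReal.ofReal (remBoundSum K T h w m q.1 q.2)
        ∂(designLaw n).prod (noiseLaw σ (Fin n × Fin p)) ≤
        ENNReal.ofReal (D * (p * remRate n h) ^ 2) := by
  set L₂ := max M (4 * M * L)
  set D := 1 + σ ^ 2 * (2 * B * L₂) ^ 2 + 576 * (B * L * M) ^ 2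
        + 252 * (B * L) ^ 2 * (1 + 4 * (σ ^ 2 * (B ^ 2 * C₁))) with hD
  have hD0 : 0 ≤ D := by positivity
  refine ⟨3 * D, fun n p _ h m A hn hh hh1 hm hA hX => ?_⟩
  have hφ : ∀ i, TestFun L₂ (w 0) (weighted w (m i)) := fun i => (hm i).testFun hw
  have hψ : TestFun L₂ (w 0) (weighted w fun d => m 0 (d + 1)) := (hm 0).testFun_deriv hw
  have m1 : ∀ i j, Measurable fun q : (Fin n → ℝ) × (Fin n × Fin p → ℝ) =>
      remBound K T h w (weighted w (m i)) (m j) 0 q.1 (fun t => q.2 (t, j)) := fun i j =>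
    measurable_remBound_column hK.kernel hw (hφ i) (hm j) 0 j
  have m2 : ∀ i, Measurable fun q : (Fin n → ℝ) × (Fin n × Fin p → ℝ) =>
      remBound K T h w (weighted w fun d => m 0 (d + 1)) (m i) 0 q.1 (fun t => q.2 (t, i)) :=
    fun i => measurable_remBound_column hK.kernel hw hψ (hm i) 0 i
  have m3 : ∀ i, Measurable fun q : (Fin n → ℝ) × (Fin n × Fin p → ℝ) =>
      remBound K T h w (weighted w (m i)) (m 0) 1 q.1 (fun t => q.2 (t, 0)) := fun i =>
    measurable_remBound_column hK.kernel hw (hφ i) (hm 0) 1 0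
  refine ⟨(Finset.measurable_fun_sum _ fun i _ => Finset.measurable_fun_sum _ fun j _ => m1 i j).add
    ((Finset.measurable_fun_sum _ fun i _ => m2 i).add
      (Finset.measurable_fun_sum _ fun i _ => m3 i)), ?_⟩
  have hp : (1 : ℝ) ≤ p := by exact_mod_cast NeZero.one_le
  have hr := sq_nonneg (remRate n h)
  have s1 := lintegral_sum_le_const (fun i => Finset.measurable_fun_sum Finset.univ
      fun j _ => m1 i j) (fun i _ => Finset.sum_nonneg fun j _ => remBound_nonneg hh _ _ _)
    fun i => lintegral_sum_le_const (m1 i) (fun j _ => remBound_nonneg hh _ _ _)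
      fun j => lintegral_remBound_le σ hK hw (hφ i) (hm j) hC hn hh hh1 hA hX 0 j
  have s2 := lintegral_sum_le_const m2 (fun j _ => remBound_nonneg hh _ _ _)
      fun i => lintegral_remBound_le σ hK hw hψ (hm i) hC hn hh hh1 hA hX 0 i
  have s3 := lintegral_sum_le_const m3 (fun j _ => remBound_nonneg hh _ _ _)
      fun i => lintegral_remBound_le σ hK hw (hφ i) (hm 0) hC hn hh hh1 hA hX 1 0
  simp only [Fintype.card_fin] at s1 s2 s3
  refine (lintegral_ofReal_add_le (Finset.measurable_fun_sum _ fun i _ =>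
    Finset.measurable_fun_sum _ fun j _ => m1 i j) (by positivity) (by positivity) s1
    (lintegral_ofReal_add_le (Finset.measurable_fun_sum _ fun i _ => m2 i) (by positivity)
      (by positivity) s2 s3)).trans (ENNReal.ofReal_le_ofReal ?_)
  rw [← hD]
  have hDr : 0 ≤ D * remRate n h ^ 2 := by positivity
  have h1 : (p : ℝ) * (D * remRate n h ^ 2) ≤ p * (p * (D * remRate n h ^ 2)) := by
    exact mul_le_mul_of_nonneg_left (le_mul_of_one_le_left hDr hp) (by positivity)
  calc _ ≤ 3 * (p * (p * (D * remRate n h ^ 2))) := by linarith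
    _ = _ := by ring

/-- Per variable the expectation is of order `h⁻¹ * (h ^ 6 + 1 / (n * h)) = h ^ 5 + 1 / (n * h ^
2)`, which is at most `remRate`. -/
theorem exists_lintegral_noiseEnergySum_le (hK : EquivKernelData K T B) {c₀ C₁ : ℝ} (hC : 0 ≤ C₁)
    (σ : ℝ) : ∃ D, ∀ (n p : ℕ) (h : ℝ) (A : Set (Fin n → ℝ)), 0 < n → 0 < h → h ≤ 1 →
      MeasurableSet A → (∀ X ∈ A, DesignGood K c₀ C₁ h X) →
      (Measurable fun q : (Fin n → ℝ) × (Fin n × Fin p → ℝ) => noiseEnergySum K h q.1 q.2) ∧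
      ∫⁻ q in A ×ˢ univ, ENNReal.ofReal (noiseEnergySum K h q.1 q.2)
        ∂(designLaw n).prod (noiseLaw σ (Fin n × Fin p)) ≤
        ENNReal.ofReal (D * (p * remRate n h)) := by
  refine ⟨1 + 4 * (σ ^ 2 * (B ^ 2 * C₁)), fun n p h A hn hh hh1 hA hX => ?_⟩
  have hn' : (0 : ℝ) < n := by exact_mod_cast hn
  have m1 : ∀ j : Fin p, Measurable fun q : (Fin n → ℝ) × (Fin n × Fin p → ℝ) =>
      noiseEnergy K h q.1 fun t => q.2 (t, j) := fun j =>
    ((continuous_noiseEnergy (n := n) (h := h) hK.kernel).comp (by fun_prop :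
      Continuous fun q : (Fin n → ℝ) × (Fin n × Fin p → ℝ) =>
        (q.1, fun t => q.2 (t, j)))).measurable
  have m2 : Measurable fun q : (Fin n → ℝ) × (Fin n × Fin p → ℝ) =>
      noiseEnergySum K h q.1 q.2 :=
    Finset.measurable_fun_sum _ fun j _ => (measurable_const.add (m1 j)).const_mul _
  refine ⟨m2, ?_⟩
  rw [setLIntegral_prod _ m2.ennreal_ofReal.aemeasurable]
  simp only [Measure.restrict_univ]
  have h1 : ∀ X ∈ A, ∫⁻ e, ENNReal.ofReal (noiseEnergySum K h X e)
      ∂noiseLaw σ (Fin n × Fin p) ≤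
      ENNReal.ofReal (p * (h⁻¹ * (h ^ 6 + 4 * (σ ^ 2 * (B ^ 2 * C₁ / (n * h)))))) := by
    intro X hXA
    have m3 : ∀ j : Fin p, Measurable fun e : Fin n × Fin p → ℝ =>
        noiseEnergy K h X fun t => e (t, j) := fun j =>
      ((continuous_noiseEnergy (n := n) (h := h) hK.kernel).comp (by fun_prop :
        Continuous fun e : Fin n × Fin p → ℝ => (X, fun t => e (t, j)))).measurable
    have := lintegral_sum_le_const (μ := noiseLaw σ (Fin n × Fin p)) (F := fun (j : Fin p) e =>
      h⁻¹ * (h ^ 6 + noiseEnergy K h X fun t => e (t, j)))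
      (fun j => (measurable_const.add (m3 j)).const_mul _)
      (fun j e => by have := noiseEnergy_nonneg (K := K) (h := h) X fun t => e (t, j); positivity)
      fun j => lintegral_ofReal_mul_le (measurable_const.add (m3 j)) (by positivity)
        (lintegral_ofReal_add_le (by fun_prop) (by positivity) (by positivity)
          (lintegral_ofReal_const_le _)
          (lintegral_noiseEnergy_le σ hK.kernel hK.abs_le (hX X hXA) hn hh j))
    simpa [noiseEnergySum] using this
  refine (setLIntegral_mono' hA h1).trans ((setLIntegral_le_lintegral _ _).trans ?_)
  refine (lintegral_ofReal_const_le _).trans (ENNReal.ofReal_le_ofReal ?_)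
  have e1 : h⁻¹ * (h ^ 6 + 4 * (σ ^ 2 * (B ^ 2 * C₁ / (n * h)))) =
      h ^ 5 + 4 * (σ ^ 2 * (B ^ 2 * C₁)) * (1 / (n * h ^ 2)) := by field_simp
  have h5 : h ^ 5 ≤ h ^ 3 := pow_le_pow_of_le_one hh.le hh1 (by omega)
  have h6 : 0 ≤ 1 / (n * h ^ 2) := by positivity
  have h7 : 0 ≤ 4 * (σ ^ 2 * (B ^ 2 * C₁)) * h ^ 3 := by positivity
  calc _ ≤ (p : ℝ) * ((1 + 4 * (σ ^ 2 * (B ^ 2 * C₁))) * remRate n h) := by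
        rw [e1, remRate]
        gcongr
        linarith
    _ = _ := by ring

theorem remRate_pos {n : ℕ} {h : ℝ} (hh : 0 < h) : 0 < remRate n h := by
  unfold remRate
  positivity

/-- The joint control of the design, of the linear terms and of the remainders. -/
structure SampleGood (K : ℝ → ℝ) (c₀ C₁ h : ℝ) (w : ℕ → ℝ → ℝ) {n p : ℕ} [NeZero p]
    (m : Fin p → ℕ → ℝ → ℝ) (β : Fin p → ℝ) (D : ℝ) (X : Fin n → ℝ) (e : Fin n × Fin p → ℝ) :
    Prop where
  design : DesignGood K c₀ C₁ h X
  rem : remSq K h w m X e ≤ D * (p * remRate n h) ^ 2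
  gram : ∑ i, ∑ j, linGram w m X e i j ^ 2 ≤ D * (p ^ 2 / n)
  err : ∑ i, linErr w m β X e i ^ 2 ≤ D * (p ^ 2 / n)

theorem SampleGood.mono {c₀ C₁ h : ℝ} {n p : ℕ} [NeZero p] {m : Fin p → ℕ → ℝ → ℝ} {β : Fin p → ℝ}
    {D D' : ℝ} {X : Fin n → ℝ} {e : Fin n × Fin p → ℝ} (hD : D ≤ D')
    (hX : SampleGood K c₀ C₁ h w m β D X e) : SampleGood K c₀ C₁ h w m β D' X e :=
  ⟨hX.design, hX.rem.trans (by gcongr), hX.gram.trans (by gcongr), hX.err.trans (by gcongr)⟩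

/-- Markov's inequality on the event of a good design. `remSq` is not integrated itself; on that
event it is dominated by `remBoundSum` and the square of `noiseEnergySum`, whose expectations are
known. -/
theorem exists_tightEvents_sampleGood [∀ n, IsProbabilityMeasure (P n)] (hK : KernelCondition K)
    (hw : WeightFun L w) (hm : ∀ n j, SmoothFun M (m n j)) (hE : BandwidthCondition h p)
    (hZ : ∀ n, HasLaw (Z n) ((designLaw n).prod (noiseLaw σ (Fin n × Fin (p n)))) (P n))
    (hβ : ∀ n, ∫ x in (0 : ℝ)..1, resid (m n) (β n) x ^ 2 * w 0 x ≤ M ^ 2 * L)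
    {Cβ : ℝ} (hβ2 : ∀ n, ∑ j, β n j ^ 2 ≤ Cβ * p n) :
    ∃ c₀ C₁, 0 < c₀ ∧ TightEvents P fun D n =>
      {ω | SampleGood K c₀ C₁ (h n) w (m n) (β n) D (Z n ω).1 (Z n ω).2} := by
  obtain ⟨T, B, hKT⟩ := hK.exists_equivKernelData
  obtain ⟨c₀, C₁, C₂, hc₀, hC₁, hC₂, hgood⟩ := hK.exists_designGood
  refine ⟨c₀, C₁, hc₀, ?_⟩
  have hex : ∀ n : ℕ, ∃ A : Set (Fin n → ℝ), MeasurableSet A ∧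
      (∀ X ∈ A, DesignGood K c₀ C₁ (h n) X) ∧
      (0 < n → h n ≤ 1 / 2 → designLaw n Aᶜ ≤ ENNReal.ofReal (C₂ / (n * h n ^ 2))) := by
    intro n
    by_cases hcase : 0 < n ∧ h n ≤ 1 / 2
    · obtain ⟨A, h1, h2, h3⟩ := hgood n (h n) hcase.1 (hE.pos n) hcase.2
      exact ⟨A, h1, h3, fun _ _ => h2⟩
    -- The empty set serves where the design lemma does not apply; as `h n` tends to zero, this
    -- concerns finitely many `n`.
    · exact ⟨∅, MeasurableSet.empty, by simp, fun a b => absurd ⟨a, b⟩ hcase⟩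
  choose A hA hAX hAP using hex
  have hA' : WithProbTendingToOne P fun n => {ω | (Z n ω).1 ∈ A n} := by
    refine tendsto_of_tendsto_of_tendsto_of_le_of_le' tendsto_const_nhds (hE.tendsto_inv C₂)
      (.of_forall fun _ => zero_le) ?_
    filter_upwards [eventually_gt_atTop 0, hE.tendsto_zero.eventually_le_const
      (by norm_num : (0 : ℝ) < 1 / 2)] with n hn hh
    refine le_trans (le_of_eq ?_) (hAP n hn hh)
    have h1 : {ω | (Z n ω).1 ∈ A n}ᶜ = Z n ⁻¹' ((A n)ᶜ ×ˢ univ) := by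
      ext ω; simp
    rw [h1, ← Measure.map_apply_of_aemeasurable (hZ n).aemeasurable
      ((hA n).compl.prod MeasurableSet.univ), (hZ n).map_eq, Measure.prod_prod]
    simp
  have hp : ∀ n, (1 : ℝ) ≤ p n := fun n => by exact_mod_cast NeZero.one_le
  have hn0 : ∀ᶠ n : ℕ in atTop, 0 < n := eventually_gt_atTop 0
  have hh1 : ∀ᶠ n in atTop, h n ≤ 1 := hE.tendsto_zero.eventually_le_const zero_lt_one
  obtain ⟨D₁, hD1⟩ := exists_lintegral_remBoundSum_le (c₀ := c₀) hKT hw hC₁.le M σ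
  obtain ⟨D₂, hD2⟩ := exists_lintegral_noiseEnergySum_le (c₀ := c₀) hKT hC₁.le σ
  obtain ⟨D₃, hD30, hD3⟩ := exists_remSq_le hKT hc₀ hw M C₁
  have hL2 : 0 ≤ max M (4 * M * L) := (hm 0 0).nonneg_bound.trans (le_max_left _ _)
  set L₂ := max M (4 * M * L) with hL₂
  have t1 := tightEvents_of_moment hZ hA hA' (U := fun n q => remBoundSum K T (h n) w (m n) q.1 q.2)
    (c := D₁) (s := fun n => (p n * remRate n (h n)) ^ 2)
    (fun n => by
      have hφ : ∀ i, TestFun L₂ (w 0) (weighted w (m n i)) := fun i => (hm n i).testFun hw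
      have hψ : TestFun L₂ (w 0) (weighted w fun d => m n 0 (d + 1)) := (hm n 0).testFun_deriv hw
      exact (Finset.measurable_fun_sum _ fun i _ => Finset.measurable_fun_sum _ fun j _ =>
        measurable_remBound_column hK hw (hφ i) (hm n j) 0 j).add
        ((Finset.measurable_fun_sum _ fun i _ => measurable_remBound_column hK hw hψ (hm n i) 0 i).add
          (Finset.measurable_fun_sum _ fun i _ =>
            measurable_remBound_column hK hw (hφ i) (hm n 0) 1 0)))
    (.of_forall fun n => by
      have := remRate_pos (n := n) (hE.pos n)
      have := hp n
      positivity)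
    (by
      filter_upwards [hn0, hh1] with n a b
      exact (hD1 n (p n) (h n) (m n) (A n) a (hE.pos n) b (hm n) (hA n) (hAX n)).2)
  have t2 := tightEvents_of_moment hZ hA hA' (U := fun n q => noiseEnergySum K (h n) q.1 q.2)
    (c := D₂) (s := fun n => p n * remRate n (h n))
    (fun n => Finset.measurable_fun_sum _ fun j _ => (measurable_const.add
      ((continuous_noiseEnergy (n := n) (h := h n) hK).comp (by fun_prop :
      Continuous fun q : (Fin n → ℝ) × (Fin n × Fin (p n) → ℝ) =>
        (q.1, fun t => q.2 (t, j)))).measurable).const_mul _)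
    (.of_forall fun n => by
      have := remRate_pos (n := n) (hE.pos n)
      have := hp n
      positivity)
    (by
      filter_upwards [hn0, hh1] with n a b
      exact (hD2 n (p n) (h n) (A n) a (hE.pos n) b (hA n) (hAX n)).2)
  have mG : ∀ n i j, Measurable fun q : (Fin n → ℝ) × (Fin n × Fin (p n) → ℝ) =>
      linGram w (m n) q.1 q.2 i j ^ 2 := by
    intro n i j
    have hc : ∀ i, Continuous (weighted w (m n i) 0) := fun i =>
      ((hm n i).testFun hw).continuous (by omega)
    unfold linGram
    exact Continuous.measurable (by fun_prop)
  have mE : ∀ n i, Measurable fun q : (Fin n → ℝ) × (Fin n × Fin (p n) → ℝ) =>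
      linErr w (m n) (β n) q.1 q.2 i ^ 2 := by
    intro n i
    have hc : ∀ i, Continuous (weighted w (m n i) 0) := fun i =>
      ((hm n i).testFun hw).continuous (by omega)
    have hc1 : ∀ i, Continuous (weighted w (m n i) 1) := fun i =>
      ((hm n i).testFun hw).continuous (by omega)
    have hc2 : Continuous (weighted w (fun d => m n 0 (d + 1)) 0) :=
      ((hm n 0).testFun_deriv hw).continuous (by omega)
    unfold linErr linCross linGram
    exact Continuous.measurable (by fun_prop)
  have t3 := tightEvents_of_moment hZ hA hA'
    (U := fun n q => ∑ i, ∑ j, linGram w (m n) q.1 q.2 i j ^ 2)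
    (c := σ ^ 2 * (4 * L₂ ^ 2)) (s := fun n => (p n : ℝ) ^ 2 / n)
    (fun n => Finset.measurable_fun_sum _ fun i _ => Finset.measurable_fun_sum _ fun j _ => mG n i j)
    (by
      filter_upwards [hn0] with n hn
      have := hp n
      positivity)
    (by
      filter_upwards [hn0] with n hn
      refine (setLIntegral_le_lintegral _ _).trans ((lintegral_sum_le_const (fun i =>
        Finset.measurable_fun_sum Finset.univ fun j _ => mG n i j)
        (fun i _ => Finset.sum_nonneg fun j _ => sq_nonneg _)
        fun i => lintegral_sum_le_const (mG n i) (fun j _ => sq_nonneg _)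
          fun j => lintegral_sq_linGram_le hw (hm n) σ hn i j).trans
        (ENNReal.ofReal_le_ofReal (le_of_eq ?_)))
      simp only [Fintype.card_fin]
      ring)
  have t4 := tightEvents_of_moment hZ hA hA'
    (U := fun n q => ∑ i, linErr w (m n) (β n) q.1 q.2 i ^ 2)
    (c := σ ^ 2 * (3 * ((M * L) ^ 2 + L₂ ^ 2 * (1 + Cβ)))) (s := fun n => (p n : ℝ) ^ 2 / n)
    (fun n => Finset.measurable_fun_sum _ fun i _ => mE n i)
    (by
      filter_upwards [hn0] with n hn
      have := hp n
      positivity)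
    (by
      filter_upwards [hn0] with n hn
      refine (setLIntegral_le_lintegral _ _).trans ((lintegral_sum_le_const (mE n)
        (fun i _ => sq_nonneg _)
        fun i => lintegral_sq_linErr_le hw (hm n) σ hn (β n) (hβ n) i).trans
        (ENNReal.ofReal_le_ofReal ?_))
      simp only [Fintype.card_fin]
      have hpn := hp n
      have h1 : (M * L) ^ 2 + L₂ ^ 2 * (1 + ∑ l, β n l ^ 2) ≤
          ((M * L) ^ 2 + L₂ ^ 2 * (1 + Cβ)) * p n := by
        have a1 : (M * L) ^ 2 ≤ (M * L) ^ 2 * p n := le_mul_of_one_le_right (sq_nonneg _) hpn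
        have a2 : L₂ ^ 2 * (1 + ∑ l, β n l ^ 2) ≤ L₂ ^ 2 * ((1 + Cβ) * p n) :=
          mul_le_mul_of_nonneg_left (by linarith [hβ2 n]) (sq_nonneg _)
        linarith
      calc _ ≤ (p n : ℝ) * (σ ^ 2 / n * (3 * (((M * L) ^ 2 + L₂ ^ 2 * (1 + Cβ)) * p n))) := by
            gcongr
        _ = _ := by ring)
  refine ((t1.inter t2).inter (t3.inter t4)).mono_set
    (fun D D' _ hD => .of_forall fun n ω hω => SampleGood.mono hD hω) fun D hD => ?_
  -- The sum of the noise energies enters `remSq` squared, hence `D ^ 2`; the maximum with `D`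
  -- serves the two linear terms.
  refine ⟨max D (D₃ * (D + D ^ 2)), hD.trans (le_max_left _ _), ?_⟩
  filter_upwards [hn0, hh1] with n hn hhn ω hω
  obtain ⟨⟨⟨hXA, hω1⟩, -, hω2⟩, ⟨-, hω3⟩, -, hω4⟩ := hω
  have hX := hAX n _ hXA
  have hpn := hp n
  refine ⟨hX, ?_, hω3.trans ?_, hω4.trans ?_⟩
  · have h1 := hD3 n (p n) (h n) (m n) (Z n ω).1 (Z n ω).2 hn (hE.pos n) hhn (hm n) hX
    have hN0 : 0 ≤ noiseEnergySum K (h n) (Z n ω).1 (Z n ω).2 :=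
      Finset.sum_nonneg fun j _ => by
        have := noiseEnergy_nonneg (K := K) (h := h n) (Z n ω).1 fun t => (Z n ω).2 (t, j)
        have := hE.pos n
        positivity
    have h2 : noiseEnergySum K (h n) (Z n ω).1 (Z n ω).2 ^ 2 ≤ (D * (p n * remRate n (h n))) ^ 2 :=
      pow_le_pow_left₀ hN0 hω2 2
    calc _ ≤ D₃ * (D * (p n * remRate n (h n)) ^ 2 + (D * (p n * remRate n (h n))) ^ 2) :=
          h1.trans (by gcongr)
      _ = D₃ * (D + D ^ 2) * (p n * remRate n (h n)) ^ 2 := by ring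
      _ ≤ _ := by gcongr; exact le_max_right _ _
  · gcongr
    exact le_max_left _ _
  · gcongr
    exact le_max_left _ _

end Master

/-! ### Local minimizers of penalized quadratic criteria -/

section Scad

variable {a lam t : ℝ}

theorem continuous_scadDeriv (ha : 1 < a) (hl : 0 < lam) : Continuous (scadDeriv a lam) := by
  unfold scadDeriv
  refine continuous_const.mul (Continuous.if_le (by fun_prop) (by fun_prop) (by fun_prop)
    (by fun_prop) fun x hx => ?_)
  have : a - 1 ≠ 0 := by linarith
  rw [hx, show a * lam - lam = (a - 1) * lam by ring, max_eq_left (by nlinarith)]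
  field_simp

/-- Three facts about the penalty carry the oracle argument: it is linear with slope `lam` up to
`lam`, constant beyond `a * lam`, and zero at the origin. Its shape in between plays no role. -/
theorem scad_of_le (hl : 0 < lam) (ht : t ≤ lam) : scad a lam t = lam * t := by
  rw [scad, intervalIntegral.integral_congr (g := fun _ => lam) fun u hu => ?_]
  · simp [mul_comm]
  · have : u ≤ lam := by
      rcases le_total 0 t with h | h
      · rw [uIcc_of_le h] at hu
        exact hu.2.trans ht
      · rw [uIcc_of_ge h] at hu
        exact hu.2.trans hl.le
    simp [scadDeriv, this]

/-- The derivative of the penalty vanishes beyond `a * lam`. Large coefficients are therefore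
estimated without shrinkage. -/
theorem scad_of_ge (ha : 1 < a) (hl : 0 < lam) (ht : a * lam ≤ t) :
    scad a lam t = scad a lam (a * lam) := by
  have hc := continuous_scadDeriv ha hl
  rw [scad, scad, ← intervalIntegral.integral_add_adjacent_intervals
    (hc.intervalIntegrable 0 (a * lam)) (hc.intervalIntegrable _ t)]
  rw [intervalIntegral.integral_congr (a := a * lam) (b := t) (g := fun _ => 0) fun u hu => ?_]
  · simp
  · rw [uIcc_of_le ht] at hu
    have h1 : ¬ u ≤ lam := by have := hu.1; nlinarith
    have h2 : a * lam - u ≤ 0 := by linarith [hu.1]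
    simp [scadDeriv, h1, h2]

theorem scad_zero : scad a lam 0 = 0 := by simp [scad]

end Scad

-- Stationarity conditions for a quadratic loss with SCAD penalty

section Quadratic

open Matrix

variable {q : ℕ} {Q : Matrix (Fin q) (Fin q) ℝ} {b : Fin q → ℝ} {c a lam : ℝ}
  {S : EuclideanSpace ℝ (Fin q) → ℝ} {T : EuclideanSpace ℝ (Fin q)}

/-- A quadratic loss function. -/
def quadLoss (Q : Matrix (Fin q) (Fin q) ℝ) (b : Fin q → ℝ) (c : ℝ) (β : Fin q → ℝ) : ℝ :=
  c - 2 * (b ⬝ᵥ β) + β ⬝ᵥ Q *ᵥ β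

theorem quadLoss_add (hQ : Q.IsSymm) (β δ : Fin q → ℝ) :
    quadLoss Q b c (β + δ) = quadLoss Q b c β + 2 * ((Q *ᵥ β - b) ⬝ᵥ δ) + δ ⬝ᵥ Q *ᵥ δ := by
  have h1 : β ⬝ᵥ Q *ᵥ δ = (Q *ᵥ β) ⬝ᵥ δ := by
    rw [dotProduct_mulVec, ← mulVec_transpose, hQ.eq]
  have h2 : δ ⬝ᵥ Q *ᵥ β = (Q *ᵥ β) ⬝ᵥ δ := dotProduct_comm _ _
  simp only [quadLoss, mulVec_add, dotProduct_add, add_dotProduct, sub_dotProduct, h1, h2]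
  ring

/-- Moving a single coordinate makes a local minimum a statement about a function of one variable:
the other penalty terms cancel, and the loss changes by a quadratic polynomial in `s`. -/
theorem eventually_nonneg_of_isLocalMin (hQ : Q.IsSymm)
    (hS : ∀ β, S β = quadLoss Q b c β + ∑ j, scad a lam |β j|) (hT : IsLocalMin S T) (j : Fin q) :
    ∀ᶠ s in 𝓝 (0 : ℝ), 0 ≤ 2 * (Q *ᵥ T - b) j * s + Q j j * s ^ 2 +
      (scad a lam |T j + s| - scad a lam |T j|) := by
  have hcont : Continuous fun s : ℝ => T + EuclideanSpace.single j s :=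
    continuous_const.add ((PiLp.continuous_toLp 2 _).comp
      (continuous_single (A := fun _ : Fin q => ℝ) j))
  have h0 : Tendsto (fun s : ℝ => T + EuclideanSpace.single j s) (𝓝 0) (𝓝 T) := by
    have := hcont.tendsto 0
    rwa [show EuclideanSpace.single j (0 : ℝ) = 0 by ext i; simp [EuclideanSpace.single],
      add_zero] at this
  filter_upwards [h0.eventually hT] with s hs
  have h1 : (fun i => (T + EuclideanSpace.single j s) i) = (fun i => T i) + Pi.single j s := by
    ext i
    simp [EuclideanSpace.single, Pi.single_apply]
  have h2 : quadLoss Q b c (WithLp.ofLp (T + EuclideanSpace.single j s)) =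
      quadLoss Q b c T + 2 * (Q *ᵥ T - b) j * s + Q j j * s ^ 2 := by
    have := quadLoss_add (b := b) (c := c) hQ (fun i => T i) (Pi.single j s)
    rw [← h1] at this
    refine this.trans ?_
    simp [mul_assoc]
    ring
  have h3 : ∑ i, scad a lam |(T + EuclideanSpace.single j s) i| =
      ∑ i, scad a lam |T i| + (scad a lam |T j + s| - scad a lam |T j|) := by
    rw [← Finset.add_sum_erase _ _ (Finset.mem_univ j),
      ← Finset.add_sum_erase _ (fun i => scad a lam |T i|) (Finset.mem_univ j)]
    have : ∑ i ∈ Finset.univ.erase j, scad a lam |(T + EuclideanSpace.single j s) i| =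
        ∑ i ∈ Finset.univ.erase j, scad a lam |T i| := by
      refine Finset.sum_congr rfl fun i hi => ?_
      simp [Finset.ne_of_mem_erase hi]
    rw [this]
    simp
    ring
  have h4 := hS T
  have h5 := hS (T + EuclideanSpace.single j s)
  rw [h2, h3] at h5
  linarith

theorem eq_zero_of_eventually_nonneg {u v : ℝ}
    (h : ∀ᶠ s in 𝓝 (0 : ℝ), 0 ≤ u * s + v * s ^ 2) : u = 0 := by
  have h1 : IsLocalMin (fun s : ℝ => u * s + v * s ^ 2) 0 := by
    filter_upwards [h] with s hs
    simpa using hs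
  have h2 : HasDerivAt (fun s : ℝ => u * s + v * s ^ 2) (u * 1 + v * (2 * 0 ^ 1 * 1)) 0 := by
    exact ((hasDerivAt_id (0 : ℝ)).const_mul u).add (((hasDerivAt_id (0 : ℝ)).fun_pow 2).const_mul v)
  have h3 := h1.hasDerivAt_eq_zero h2
  linarith

/-- At a nonzero coordinate below `lam` the penalty is differentiable with slope `±lam`, and
stationarity makes twice the gradient entry equal to `∓lam`. This rules out small nonzero
coefficients wherever the gradient is smaller than `lam / 2`. -/
theorem abs_gradient_eq_of_isLocalMin (hl : 0 < lam) (hQ : Q.IsSymm)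
    (hS : ∀ β, S β = quadLoss Q b c β + ∑ j, scad a lam |β j|) (hT : IsLocalMin S T) {j : Fin q}
    (hj : T j ≠ 0) (hj' : |T j| < lam) : |(Q *ᵥ T - b) j| = lam / 2 := by
  have h1 := eventually_nonneg_of_isLocalMin hQ hS hT j
  have hc : Tendsto (fun s : ℝ => T j + s) (𝓝 0) (𝓝 (T j)) := by
    simpa using (by fun_prop : Continuous fun s : ℝ => T j + s).tendsto 0
  have h2 : ∀ᶠ s in 𝓝 (0 : ℝ), |T j + s| < lam := (hc.abs).eventually_lt_const hj'
  rcases lt_or_gt_of_ne hj with h | h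
  · have h3 : ∀ᶠ s in 𝓝 (0 : ℝ), T j + s < 0 := hc.eventually_lt_const h
    have h4 : 2 * (Q *ᵥ T - b) j - lam = 0 := by
      refine eq_zero_of_eventually_nonneg (v := Q j j) ?_
      filter_upwards [h1, h2, h3] with s a1 a2 a3
      rw [scad_of_le hl a2.le, scad_of_le hl hj'.le, abs_of_neg a3, abs_of_neg h] at a1
      linarith
    rw [show (Q *ᵥ T - b) j = lam / 2 by linarith]
    exact abs_of_pos (by linarith)
  · have h3 : ∀ᶠ s in 𝓝 (0 : ℝ), 0 < T j + s := hc.eventually_const_lt h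
    have h4 : 2 * (Q *ᵥ T - b) j + lam = 0 := by
      refine eq_zero_of_eventually_nonneg (v := Q j j) ?_
      filter_upwards [h1, h2, h3] with s a1 a2 a3
      rw [scad_of_le hl a2.le, scad_of_le hl hj'.le, abs_of_pos a3, abs_of_pos h] at a1
      linarith
    rw [show (Q *ᵥ T - b) j = -(lam / 2) by linarith, abs_neg]
    exact abs_of_pos (by linarith)

/-- Beyond `a * lam` the penalty is locally constant, so the loss alone is stationary in this
coordinate. -/
theorem gradient_eq_zero_of_isLocalMin (ha : 1 < a) (hl : 0 < lam) (hQ : Q.IsSymm)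
    (hS : ∀ β, S β = quadLoss Q b c β + ∑ j, scad a lam |β j|) (hT : IsLocalMin S T) {j : Fin q}
    (hj : a * lam < |T j|) : (Q *ᵥ T - b) j = 0 := by
  have h1 := eventually_nonneg_of_isLocalMin hQ hS hT j
  have hc : Tendsto (fun s : ℝ => T j + s) (𝓝 0) (𝓝 (T j)) := by
    simpa using (by fun_prop : Continuous fun s : ℝ => T j + s).tendsto 0
  have h2 : ∀ᶠ s in 𝓝 (0 : ℝ), a * lam < |T j + s| := (hc.abs).eventually_const_lt hj
  have h4 : 2 * (Q *ᵥ T - b) j = 0 := by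
    refine eq_zero_of_eventually_nonneg (v := Q j j) ?_
    filter_upwards [h1, h2] with s a1 a2
    rw [scad_of_ge ha hl a2.le, scad_of_ge ha hl hj.le] at a1
    linarith
  linarith

/-- The loss is convex, so it increases at least by its linear part. This part vanishes at the large
coordinates, and at the zero coordinates it is absorbed by the increase `lam * |β j|` of the
penalty. -/
theorem isLocalMin_of_gradient (ha : 1 < a) (hl : 0 < lam) (hQ : Q.IsSymm)
    (hQ0 : ∀ δ : Fin q → ℝ, 0 ≤ δ ⬝ᵥ Q *ᵥ δ)
    (hS : ∀ β, S β = quadLoss Q b c β + ∑ j, scad a lam |β j|)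
    (h : ∀ j, (a * lam < |T j| ∧ (Q *ᵥ T - b) j = 0) ∨ (T j = 0 ∧ |(Q *ᵥ T - b) j| ≤ lam / 2)) :
    IsLocalMin S T := by
  have hcj : ∀ j, Tendsto (fun β : EuclideanSpace ℝ (Fin q) => β j) (𝓝 T) (𝓝 (T j)) := fun j =>
    (by fun_prop : Continuous fun β : EuclideanSpace ℝ (Fin q) => β j).tendsto T
  have h1 : ∀ᶠ β in 𝓝 T, ∀ j, 0 ≤ 2 * (Q *ᵥ T - b) j * (β j - T j) +
      (scad a lam |β j| - scad a lam |T j|) := by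
    refine eventually_all.2 fun j => ?_
    rcases h j with ⟨h2, h3⟩ | ⟨h2, h3⟩
    · filter_upwards [((hcj j).abs).eventually_const_lt h2] with β hβ
      rw [scad_of_ge ha hl h2.le, scad_of_ge ha hl hβ.le, h3]
      simp
    · have h4 := (hcj j).abs
      rw [h2, abs_zero] at h4
      filter_upwards [h4.eventually_le_const hl] with β hβ
      rw [h2, scad_of_le hl hβ, abs_zero, scad_zero, sub_zero, sub_zero]
      have h5 : |2 * (Q *ᵥ T - b) j * β j| ≤ lam * |β j| := by
        rw [abs_mul, abs_mul, abs_two]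
        exact mul_le_mul_of_nonneg_right (by linarith) (abs_nonneg _)
      linarith [neg_abs_le (2 * (Q *ᵥ T - b) j * β j)]
  filter_upwards [h1] with β hβ
  rw [hS, hS]
  have h2 := quadLoss_add (b := b) (c := c) hQ (fun j => T j) (fun j => β j - T j)
  rw [show (fun j => T j) + (fun j => β j - T j) = fun j => β j by ext; simp] at h2
  have h3 := Finset.sum_nonneg fun j (_ : j ∈ Finset.univ) => hβ j
  rw [Finset.sum_add_distrib, Finset.sum_sub_distrib] at h3
  have h4 : ∑ j, 2 * (Q *ᵥ T - b) j * (β j - T j) =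
      2 * ((Q *ᵥ T - b) ⬝ᵥ fun j => β j - T j) := by
    rw [dotProduct, Finset.mul_sum]
    exact Finset.sum_congr rfl fun j _ => by ring
  have h5 := hQ0 fun j => β j - T j
  change quadLoss Q b c (fun j => T j) + _ ≤ quadLoss Q b c (fun j => β j) + _
  rw [h4] at h3
  linarith

end Quadratic

/-! ### The criterion as a penalized quadratic form -/

section Criterion

open Matrix

variable {n p k : ℕ} {K : ℝ → ℝ} {T : Matrix (Fin 4) (Fin 4) ℝ} {B h c₀ C₁ L M a lam : ℝ}
  {w : ℕ → ℝ → ℝ} {m : Fin p → ℕ → ℝ → ℝ} {X : Fin n → ℝ} {e : Fin n × Fin p → ℝ}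

theorem measurable_lpFit (hK : KernelCondition K) (hm : ∀ j, SmoothFun M (m j)) (j : Fin p)
    (d : Fin 4) : Measurable fun q : ((Fin n → ℝ) × (Fin n × Fin p → ℝ)) × ℝ =>
      lpFit K h m q.1.1 q.1.2 j d q.2 := by
  have hc : Continuous (m j 0) := (hm j).continuous (by omega)
  have h1 := (measurable_lpCoef (n := n) hK.continuous h d).comp
    (by fun_prop : Measurable fun q : ((Fin n → ℝ) × (Fin n × Fin p → ℝ)) × ℝ =>
      (q.1.1, (fun t => m j 0 (q.1.1 t) + q.1.2 (t, j)), q.2))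
  exact h1.const_mul _

theorem measurable_intervalIntegral {α : Type*} [MeasurableSpace α] {F : α × ℝ → ℝ}
    (hF : Measurable F) : Measurable fun q => ∫ x in (0 : ℝ)..1, F (q, x) := by
  simp_rw [intervalIntegral.integral_of_le zero_le_one]
  exact (StronglyMeasurable.integral_prod_right (f := fun q x => F (q, x))
    hF.stronglyMeasurable).measurable

theorem measurable_gramHat (hK : KernelCondition K) (hw : WeightFun L w)
    (hm : ∀ j, SmoothFun M (m j)) (i j : Fin p) :
    Measurable fun q : (Fin n → ℝ) × (Fin n × Fin p → ℝ) => gramHat K h w m q.1 q.2 i j := by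
  have hwc : Continuous (w 0) := hw.continuous (by omega)
  exact measurable_intervalIntegral (((measurable_lpFit hK hm i 0).mul
    (measurable_lpFit hK hm j 0)).mul (hwc.measurable.comp measurable_snd))

theorem measurable_crossHat [NeZero p] (hK : KernelCondition K) (hw : WeightFun L w)
    (hm : ∀ j, SmoothFun M (m j)) (i : Fin p) :
    Measurable fun q : (Fin n → ℝ) × (Fin n × Fin p → ℝ) => crossHat K h w m q.1 q.2 i := by
  have hwc : Continuous (w 0) := hw.continuous (by omega)
  exact measurable_intervalIntegral (((measurable_lpFit hK hm 0 1).mul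
    (measurable_lpFit hK hm i 0)).mul (hwc.measurable.comp measurable_snd))

theorem DesignGood.exists_abs_lpFit_le (hX : DesignGood K c₀ C₁ h X) (hK : EquivKernelData K T B)
    (hc : 0 < c₀) (hn : 0 < n) (hh : 0 < h) (hm : ∀ j, SmoothFun M (m j)) (j : Fin p)
    {d : Fin 4} (hd : (d : ℕ) < 2) :
    ∃ D, ∀ x ∈ Icc (0 : ℝ) 1, |lpFit K h m X e j d x| ≤ D := by
  have hcast : Fin.castLE (by omega) (⟨d, hd⟩ : Fin 2) = d := rfl
  obtain ⟨D, hD⟩ := hX.exists_abs_lpErr_le (e := fun t => e (t, j)) hK hc hn hh (hm j)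
  refine ⟨M + (h ^ (d : ℕ))⁻¹ * D, fun x hx => ?_⟩
  rw [← hcast, lpFit_eq hh]
  refine (abs_add_le _ _).trans (add_le_add ((hm j).bound d (by omega) x hx) ?_)
  rw [abs_mul, abs_of_nonneg (by positivity : 0 ≤ (h ^ (d : ℕ))⁻¹)]
  exact mul_le_mul_of_nonneg_left (hD x hx _) (by positivity)

theorem intervalIntegrable_mul_mul {u v w : ℝ → ℝ} (hu : Measurable u) (hv : Measurable v)
    (hw : Measurable w) {D D' L : ℝ} (h1 : ∀ x ∈ Icc (0 : ℝ) 1, |u x| ≤ D)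
    (h2 : ∀ x ∈ Icc (0 : ℝ) 1, |v x| ≤ D') (h3 : ∀ x ∈ Icc (0 : ℝ) 1, |w x| ≤ L) :
    IntervalIntegrable (fun x => u x * v x * w x) volume 0 1 := by
  refine intervalIntegrable_of_abs_le ((hu.mul hv).mul hw) (M := D * D' * L) fun x hx => ?_
  have h4 := (abs_nonneg _).trans (h1 x hx)
  have h5 := (abs_nonneg _).trans (h2 x hx)
  rw [abs_mul, abs_mul]
  exact mul_le_mul (mul_le_mul (h1 x hx) (h2 x hx) (abs_nonneg _) h4) (h3 x hx) (abs_nonneg _)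
    (mul_nonneg h4 h5)

theorem DesignGood.intervalIntegrable_lpFit_mul (hX : DesignGood K c₀ C₁ h X)
    (hK : EquivKernelData K T B) (hc : 0 < c₀) (hn : 0 < n) (hh : 0 < h) (hw : WeightFun L w)
    (hm : ∀ j, SmoothFun M (m j)) (i j : Fin p) {d d' : Fin 4} (hd : (d : ℕ) < 2)
    (hd' : (d' : ℕ) < 2) :
    IntervalIntegrable (fun x => lpFit K h m X e i d x * lpFit K h m X e j d' x * w 0 x)
      volume 0 1 := by
  obtain ⟨D, hD⟩ := hX.exists_abs_lpFit_le (e := e) hK hc hn hh hm i hd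
  obtain ⟨D', hD'⟩ := hX.exists_abs_lpFit_le (e := e) hK hc hn hh hm j hd'
  have hwc : Continuous (w 0) := hw.continuous (by omega)
  have hmeas : ∀ i (d : Fin 4), Measurable fun x => lpFit K h m X e i d x := fun i d => by
    have := (measurable_lpFit (h := h) hK.kernel hm i d).comp (by fun_prop :
      Measurable fun x : ℝ => ((X, e), x))
    simpa only [Function.comp_def] using this
  exact intervalIntegrable_mul_mul (hmeas i _) (hmeas j _) hwc.measurable hD hD'
    fun x _ => hw.bound 0 (by omega) x

theorem sum_padZero {k p : ℕ} (hk : k ≤ p) (v : EuclideanSpace ℝ (Fin k)) (F : Fin p → ℝ → ℝ)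
    (hF : ∀ j, F j 0 = 0) :
    ∑ j, F j (padZero p v j) = ∑ i, F (Fin.castLE hk i) (v i) := by
  have h1 : ∑ i, F (Fin.castLE hk i) (v i) =
      ∑ j ∈ Finset.univ.map (Fin.castLEEmb hk), F j (padZero p v j) := by
    rw [Finset.sum_map]
    refine Finset.sum_congr rfl fun i _ => ?_
    simp [padZero]
  rw [h1]
  refine (Finset.sum_subset (Finset.subset_univ _) fun j _ hj => ?_).symm
  have : ¬ (j : ℕ) < k := fun h => hj (Finset.mem_map.2 ⟨⟨j, h⟩, Finset.mem_univ _, by ext; simp⟩)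
  simp [padZero, this, hF]

/-- The leading block of a matrix. -/
def headBlock (hk : k ≤ p) (Q : Matrix (Fin p) (Fin p) ℝ) : Matrix (Fin k) (Fin k) ℝ :=
  Q.submatrix (Fin.castLE hk) (Fin.castLE hk)

theorem quadLoss_padZero (hk : k ≤ p) (Q : Matrix (Fin p) (Fin p) ℝ) (b : Fin p → ℝ) (c : ℝ)
    (v : EuclideanSpace ℝ (Fin k)) :
    quadLoss Q b c (padZero p v) = quadLoss (headBlock hk Q) (fun i => b (Fin.castLE hk i)) c v := by
  have h1 : b ⬝ᵥ (padZero p v) = (fun i => b (Fin.castLE hk i)) ⬝ᵥ v :=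
    sum_padZero hk v (fun j x => b j * x) (by simp)
  have h2 : ∀ i, (Q *ᵥ (padZero p v)) i = ∑ j, Q i (Fin.castLE hk j) * v j := fun i =>
    sum_padZero hk v (fun j x => Q i j * x) (by simp)
  have h3 : (padZero p v) ⬝ᵥ Q *ᵥ (padZero p v) = v ⬝ᵥ headBlock hk Q *ᵥ v :=
    (sum_padZero hk v (fun j x => x * (Q *ᵥ (padZero p v)) j) (by simp)).trans
      (Finset.sum_congr rfl fun i _ => by rw [h2]; rfl)
  rw [quadLoss, quadLoss, h1, h3]

variable [NeZero p] (hX : DesignGood K c₀ C₁ h X) (hK : EquivKernelData K T B) (hc : 0 < c₀)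
  (hn : 0 < n) (hh : 0 < h) (hw : WeightFun L w) (hm : ∀ j, SmoothFun M (m j))
include hX hK hc hn hh hw hm

/-- Expanding the square under the integral requires integrable products of fits; on a good design
the fits are bounded and measurable on the interval. -/
theorem DesignGood.integral_sq_sub_eq (β : Fin p → ℝ) :
    ∫ x in (0 : ℝ)..1, (lpFit K h m X e 0 1 x - ∑ j, β j * lpFit K h m X e j 0 x) ^ 2 * w 0 x =
      quadLoss (Matrix.of (gramHat K h w m X e)) (crossHat K h w m X e)
        (∫ x in (0 : ℝ)..1, lpFit K h m X e 0 1 x * lpFit K h m X e 0 1 x * w 0 x) β := by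
  have e1 : ∀ x, (lpFit K h m X e 0 1 x - ∑ j, β j * lpFit K h m X e j 0 x) ^ 2 * w 0 x =
      lpFit K h m X e 0 1 x * lpFit K h m X e 0 1 x * w 0 x
      - ∑ j, 2 * β j * (lpFit K h m X e 0 1 x * lpFit K h m X e j 0 x * w 0 x)
      + ∑ i, ∑ j, β i * β j * (lpFit K h m X e i 0 x * lpFit K h m X e j 0 x * w 0 x) := by
    intro x
    have h1 : (∑ j, β j * lpFit K h m X e j 0 x) ^ 2 * w 0 x =
        ∑ i, ∑ j, β i * β j * (lpFit K h m X e i 0 x * lpFit K h m X e j 0 x * w 0 x) := by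
      rw [sq, Finset.sum_mul_sum, Finset.sum_mul]
      refine Finset.sum_congr rfl fun i _ => ?_
      rw [Finset.sum_mul]
      exact Finset.sum_congr rfl fun j _ => by ring
    have h2 : ∑ j, 2 * β j * (lpFit K h m X e 0 1 x * lpFit K h m X e j 0 x * w 0 x) =
        2 * lpFit K h m X e 0 1 x * w 0 x * ∑ j, β j * lpFit K h m X e j 0 x := by
      rw [Finset.mul_sum]
      exact Finset.sum_congr rfl fun j _ => by ring
    rw [← h1, h2]
    ring
  have i0 : IntervalIntegrable (fun x => lpFit K h m X e 0 1 x * lpFit K h m X e 0 1 x * w 0 x)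
      volume 0 1 := hX.intervalIntegrable_lpFit_mul (e := e) hK hc hn hh hw hm 0 0
      (by simp) (by simp)
  have i1 : ∀ j, IntervalIntegrable
      (fun x => lpFit K h m X e 0 1 x * lpFit K h m X e j 0 x * w 0 x) volume 0 1 := fun j =>
    hX.intervalIntegrable_lpFit_mul (e := e) hK hc hn hh hw hm 0 j
      (by simp) (by simp)
  have i2 : ∀ i j, IntervalIntegrable
      (fun x => lpFit K h m X e i 0 x * lpFit K h m X e j 0 x * w 0 x) volume 0 1 := fun i j =>
    hX.intervalIntegrable_lpFit_mul (e := e) hK hc hn hh hw hm i j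
      (by simp) (by simp)
  have s1 : IntervalIntegrable (fun x => ∑ j, 2 * β j *
      (lpFit K h m X e 0 1 x * lpFit K h m X e j 0 x * w 0 x)) volume 0 1 := by
    have := IntervalIntegrable.sum (μ := volume) (a := 0) (b := 1) Finset.univ
      (f := fun j x => 2 * β j * (lpFit K h m X e 0 1 x * lpFit K h m X e j 0 x * w 0 x))
      fun j _ => (i1 j).const_mul _
    simpa [Finset.sum_fn] using this
  have s2' : ∀ i, IntervalIntegrable (fun x => ∑ j, β i * β j *
      (lpFit K h m X e i 0 x * lpFit K h m X e j 0 x * w 0 x)) volume 0 1 := by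
    intro i
    have := IntervalIntegrable.sum (μ := volume) (a := 0) (b := 1) Finset.univ
      (f := fun j x => β i * β j * (lpFit K h m X e i 0 x * lpFit K h m X e j 0 x * w 0 x))
      fun j _ => (i2 i j).const_mul _
    simpa [Finset.sum_fn] using this
  have s2 : IntervalIntegrable (fun x => ∑ i, ∑ j, β i * β j *
      (lpFit K h m X e i 0 x * lpFit K h m X e j 0 x * w 0 x)) volume 0 1 := by
    have := IntervalIntegrable.sum (μ := volume) (a := 0) (b := 1) Finset.univ
      (f := fun i x => ∑ j, β i * β j * (lpFit K h m X e i 0 x * lpFit K h m X e j 0 x * w 0 x))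
      fun i _ => s2' i
    simpa [Finset.sum_fn] using this
  simp_rw [e1]
  rw [intervalIntegral.integral_add (IntervalIntegrable.sub i0 s1) s2,
    intervalIntegral.integral_sub i0 s1,
    intervalIntegral.integral_finsetSum fun j _ => (i1 j).const_mul _,
    intervalIntegral.integral_finsetSum fun i _ => s2' i]
  simp_rw [fun i => intervalIntegral.integral_finsetSum fun j (_ : j ∈ Finset.univ) =>
    (i2 i j).const_mul (β i * β j), intervalIntegral.integral_const_mul]
  rw [quadLoss, dotProduct, dotProduct, Finset.mul_sum]
  congr 1
  · congr 1
    exact Finset.sum_congr rfl fun j _ => by rw [crossHat]; ring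
  · refine Finset.sum_congr rfl fun i _ => ?_
    rw [mulVec, dotProduct, Finset.mul_sum]
    exact Finset.sum_congr rfl fun j _ => by simp [gramHat]; ring

theorem DesignGood.criterion_eq (β : EuclideanSpace ℝ (Fin p)) :
    criterion K h (w 0) a lam X (fun t j => m j 0 (X t) + e (t, j)) β =
      quadLoss (Matrix.of (gramHat K h w m X e)) (crossHat K h w m X e)
        (∫ x in (0 : ℝ)..1, lpFit K h m X e 0 1 x * lpFit K h m X e 0 1 x * w 0 x) β
      + ∑ j, scad a lam |β j| := by
  rw [← hX.integral_sq_sub_eq hK hc hn hh hw hm]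
  rfl

omit [NeZero p] in
theorem DesignGood.gramHat_nonneg (β : Fin p → ℝ) :
    0 ≤ β ⬝ᵥ Matrix.of (gramHat K h w m X e) *ᵥ β := by
  have i2 : ∀ i j, IntervalIntegrable
      (fun x => lpFit K h m X e i 0 x * lpFit K h m X e j 0 x * w 0 x) volume 0 1 := fun i j =>
    hX.intervalIntegrable_lpFit_mul (e := e) hK hc hn hh hw hm i j
      (by simp) (by simp)
  have s2' : ∀ i, IntervalIntegrable (fun x => ∑ j, β i * β j *
      (lpFit K h m X e i 0 x * lpFit K h m X e j 0 x * w 0 x)) volume 0 1 := by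
    intro i
    have := IntervalIntegrable.sum (μ := volume) (a := 0) (b := 1) Finset.univ
      (f := fun j x => β i * β j * (lpFit K h m X e i 0 x * lpFit K h m X e j 0 x * w 0 x))
      fun j _ => (i2 i j).const_mul _
    simpa [Finset.sum_fn] using this
  have h1 : β ⬝ᵥ Matrix.of (gramHat K h w m X e) *ᵥ β =
      ∫ x in (0 : ℝ)..1, (∑ j, β j * lpFit K h m X e j 0 x) ^ 2 * w 0 x := by
    have e1 : ∀ x, (∑ j, β j * lpFit K h m X e j 0 x) ^ 2 * w 0 x =
        ∑ i, ∑ j, β i * β j * (lpFit K h m X e i 0 x * lpFit K h m X e j 0 x * w 0 x) := by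
      intro x
      rw [sq, Finset.sum_mul_sum, Finset.sum_mul]
      refine Finset.sum_congr rfl fun i _ => ?_
      rw [Finset.sum_mul]
      exact Finset.sum_congr rfl fun j _ => by ring
    simp_rw [e1]
    rw [intervalIntegral.integral_finsetSum fun i _ => s2' i]
    simp_rw [fun i => intervalIntegral.integral_finsetSum fun j (_ : j ∈ Finset.univ) =>
      (i2 i j).const_mul (β i * β j), intervalIntegral.integral_const_mul]
    refine Finset.sum_congr rfl fun i _ => ?_
    rw [mulVec, dotProduct, Finset.mul_sum]
    exact Finset.sum_congr rfl fun j _ => by simp [gramHat]; ring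
  rw [h1]
  exact intervalIntegral.integral_nonneg zero_le_one fun x _ =>
    mul_nonneg (sq_nonneg _) (hw.nonneg x)

end Criterion

theorem isSymm_gramHat {n p : ℕ} (K : ℝ → ℝ) (h : ℝ) (w : ℕ → ℝ → ℝ) (m : Fin p → ℕ → ℝ → ℝ)
    (X : Fin n → ℝ) (e : Fin n × Fin p → ℝ) : (Matrix.of (gramHat K h w m X e)).IsSymm := by
  refine Matrix.IsSymm.ext fun i j => ?_
  simp only [Matrix.of_apply, gramHat]
  exact intervalIntegral.integral_congr fun x _ => by ring

/-! ### Oracle properties of penalized quadratic criteria -/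

section Oracle

open Matrix

theorem sq_dotProduct_le {ι : Type*} [Fintype ι] (u v : ι → ℝ) :
    (u ⬝ᵥ v) ^ 2 ≤ (u ⬝ᵥ u) * (v ⬝ᵥ v) := by
  have := Finset.sum_mul_sq_le_sq_mul_sq Finset.univ u v
  simpa [dotProduct, sq] using this

theorem dotProduct_self_nonneg' {ι : Type*} [Fintype ι] (v : ι → ℝ) : 0 ≤ v ⬝ᵥ v :=
  Finset.sum_nonneg fun _ _ => mul_self_nonneg _

theorem sq_le_dotProduct_self {ι : Type*} [Fintype ι] (v : ι → ℝ) (i : ι) : v i ^ 2 ≤ v ⬝ᵥ v := by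
  rw [sq]
  exact Finset.single_le_sum (f := fun i => v i * v i) (fun _ _ => mul_self_nonneg _)
    (Finset.mem_univ i)

theorem norm_sub_sq_eq {q : ℕ} (u v : EuclideanSpace ℝ (Fin q)) :
    ‖u - v‖ ^ 2 = (fun j => u j - v j) ⬝ᵥ fun j => u j - v j := by
  rw [EuclideanSpace.real_norm_sq_eq]
  simp [dotProduct, sq]

theorem mulVec_dotProduct_self_le {ι κ : Type*} [Fintype ι] [Fintype κ] (A : Matrix ι κ ℝ)
    (v : κ → ℝ) : (A *ᵥ v) ⬝ᵥ (A *ᵥ v) ≤ (∑ i, ∑ j, A i j ^ 2) * (v ⬝ᵥ v) := by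
  rw [dotProduct, Finset.sum_mul]
  refine Finset.sum_le_sum fun i _ => ?_
  rw [← sq, mulVec]
  refine (sq_dotProduct_le _ _).trans (le_of_eq ?_)
  simp [dotProduct, sq]

/-- The Cauchy–Schwarz inequality for a positive semidefinite quadratic form. -/
theorem sq_dotProduct_mulVec_le {ι : Type*} [Fintype ι] {Q : Matrix ι ι ℝ}
    (hQ : Q.IsSymm) (hQ0 : ∀ v, 0 ≤ v ⬝ᵥ Q *ᵥ v) (u v : ι → ℝ) :
    (u ⬝ᵥ Q *ᵥ v) ^ 2 ≤ (u ⬝ᵥ Q *ᵥ u) * (v ⬝ᵥ Q *ᵥ v) := by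
  have hs : v ⬝ᵥ Q *ᵥ u = u ⬝ᵥ Q *ᵥ v := by
    rw [dotProduct_mulVec, ← mulVec_transpose, hQ.eq, dotProduct_comm]
  have key : ∀ t : ℝ, 0 ≤ (u ⬝ᵥ Q *ᵥ u) * (t * t) + (2 * (u ⬝ᵥ Q *ᵥ v)) * t + v ⬝ᵥ Q *ᵥ v := by
    intro t
    have := hQ0 (t • u + v)
    simp only [mulVec_add, mulVec_smul, add_dotProduct, dotProduct_add, smul_dotProduct,
      dotProduct_smul, smul_eq_mul, hs] at this
    linarith
  have := discrim_le_zero key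
  rw [discrim] at this
  linarith

variable {p k : ℕ} {Q Qh : Matrix (Fin p) (Fin p) ℝ} {bh : Fin p → ℝ}
  {β₀ T : EuclideanSpace ℝ (Fin p)} {S : EuclideanSpace ℝ (Fin p) → ℝ} {a lam τ ρ₁ ρ₂ R : ℝ}

/-- The criterion is a penalized quadratic form whose coefficients are close to their targets. -/
structure EstGood (Q Qh : Matrix (Fin p) (Fin p) ℝ) (bh : Fin p → ℝ)
    (β₀ : EuclideanSpace ℝ (Fin p)) (S : EuclideanSpace ℝ (Fin p) → ℝ) (a lam τ : ℝ) : Prop where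
  symm : Qh.IsSymm
  nonneg : ∀ δ, 0 ≤ δ ⬝ᵥ Qh *ᵥ δ
  crit : ∃ c, ∀ β : EuclideanSpace ℝ (Fin p), S β = quadLoss Qh bh c β + ∑ j, scad a lam |β j|
  gram : ∑ i, ∑ j, (Qh i j - Q i j) ^ 2 ≤ τ ^ 2
  err : ∑ i, (bh i - (Qh *ᵥ β₀) i) ^ 2 ≤ τ ^ 2

/-- Two-sided bounds for the quadratic form of a symmetric matrix. -/
structure QuadBounds (Q : Matrix (Fin p) (Fin p) ℝ) (ρ₁ ρ₂ : ℝ) : Prop where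
  symm : Q.IsSymm
  pos : 0 < ρ₁
  lower : ∀ v, ρ₁ * (v ⬝ᵥ v) ≤ v ⬝ᵥ Q *ᵥ v
  upper : ∀ v, v ⬝ᵥ Q *ᵥ v ≤ ρ₂ * (v ⬝ᵥ v)

/-- Cauchy–Schwarz for the form `Q`, applied to `v` and a basis vector, each of which contributes a
factor `√ρ₂`. -/
theorem QuadBounds.abs_mulVec_le (hQ : QuadBounds Q ρ₁ ρ₂) (h2 : 0 ≤ ρ₂) {v : Fin p → ℝ}
    (hv : v ⬝ᵥ v ≤ R ^ 2) (hR : 0 ≤ R) (j : Fin p) : |(Q *ᵥ v) j| ≤ ρ₂ * R := by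
  refine abs_le_of_sq_le_sq ?_ (by positivity)
  have h0 : ∀ v, 0 ≤ v ⬝ᵥ Q *ᵥ v := fun v =>
    (mul_nonneg hQ.pos.le (dotProduct_self_nonneg' v)).trans (hQ.lower v)
  have h1 := sq_dotProduct_mulVec_le hQ.symm h0 (Pi.single j 1) v
  rw [single_one_dotProduct] at h1
  refine h1.trans ?_
  have h3 : (Pi.single j 1 : Fin p → ℝ) ⬝ᵥ Q *ᵥ Pi.single j 1 ≤ ρ₂ := by
    simpa using hQ.upper (Pi.single j 1)
  calc _ ≤ ρ₂ * (ρ₂ * R ^ 2) :=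
        mul_le_mul h3 ((hQ.upper v).trans (mul_le_mul_of_nonneg_left hv h2)) (h0 v) h2
    _ = _ := by ring

namespace EstGood

variable (hE : EstGood Q Qh bh β₀ S a lam τ)
include hE

theorem abs_dev_mulVec_le (hτ : 0 ≤ τ) {v : Fin p → ℝ} (hv : v ⬝ᵥ v ≤ R ^ 2) (hR : 0 ≤ R)
    (j : Fin p) : |((Qh - Q) *ᵥ v) j| ≤ τ * R := by
  refine abs_le_of_sq_le_sq ?_ (by positivity)
  refine (sq_le_dotProduct_self ((Qh - Q) *ᵥ v) j).trans
    ((mulVec_dotProduct_self_le _ _).trans ?_)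
  rw [mul_pow]
  exact mul_le_mul (by simpa using hE.gram) hv (dotProduct_self_nonneg' v) (sq_nonneg _)

/-- The quadratic form changes by at most the Frobenius distance of the matrices, and `τ ≤ ρ₁ / 2`
leaves half of the lower bound. -/
theorem lower (hQ : QuadBounds Q ρ₁ ρ₂) (hτ : 0 ≤ τ) (hτ1 : τ ≤ ρ₁ / 2) (v : Fin p → ℝ) :
    ρ₁ / 2 * (v ⬝ᵥ v) ≤ v ⬝ᵥ Qh *ᵥ v := by
  have h1 : v ⬝ᵥ Qh *ᵥ v = v ⬝ᵥ Q *ᵥ v + v ⬝ᵥ (Qh - Q) *ᵥ v := by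
    rw [sub_mulVec, dotProduct_sub]; ring
  have h2 : |v ⬝ᵥ (Qh - Q) *ᵥ v| ≤ τ * (v ⬝ᵥ v) := by
    have hvv := dotProduct_self_nonneg' v
    refine abs_le_of_sq_le_sq ?_ (by positivity)
    refine (sq_dotProduct_le _ _).trans ?_
    have h3 := (mulVec_dotProduct_self_le (Qh - Q) v).trans
      (mul_le_mul_of_nonneg_right (by simpa using hE.gram) hvv)
    calc _ ≤ (v ⬝ᵥ v) * (τ ^ 2 * (v ⬝ᵥ v)) := mul_le_mul_of_nonneg_left h3 hvv
      _ = _ := by ring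
  have h4 := hQ.lower v
  have h5 := mul_le_mul_of_nonneg_right hτ1 (dotProduct_self_nonneg' v)
  linarith [neg_abs_le (v ⬝ᵥ (Qh - Q) *ᵥ v)]

/-- `Qh T - bh = Q (T - β₀) + (Qh - Q) (T - β₀) - (bh - Qh β₀)`, and the three terms are bounded by
`ρ₂ R`, `τ R` and `τ`. -/
theorem abs_gradient_le (hQ : QuadBounds Q ρ₁ ρ₂) (h2 : 0 ≤ ρ₂) (hτ : 0 ≤ τ) (hR : 0 ≤ R)
    (hT : ‖T - β₀‖ ≤ R) (j : Fin p) : |(Qh *ᵥ T - bh) j| ≤ (ρ₂ + τ) * R + τ := by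
  have hv : (fun j => T j - β₀ j) ⬝ᵥ (fun j => T j - β₀ j) ≤ R ^ 2 := by
    rw [← norm_sub_sq_eq]
    exact pow_le_pow_left₀ (norm_nonneg _) hT 2
  have h1 : (Qh *ᵥ T - bh) j = (Q *ᵥ fun j => T j - β₀ j) j
      + ((Qh - Q) *ᵥ fun j => T j - β₀ j) j - (bh j - (Qh *ᵥ β₀) j) := by
    have : (fun j => T j - β₀ j) = WithLp.ofLp T - WithLp.ofLp β₀ := rfl
    rw [this, sub_mulVec, mulVec_sub, mulVec_sub]
    simp only [Pi.sub_apply]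
    ring
  have h3 := hQ.abs_mulVec_le h2 hv hR j
  have h4 := hE.abs_dev_mulVec_le hτ hv hR j
  have h5 : |bh j - (Qh *ᵥ β₀) j| ≤ τ := by
    refine abs_le_of_sq_le_sq ?_ hτ
    exact (Finset.single_le_sum (f := fun i => (bh i - (Qh *ᵥ β₀) i) ^ 2)
      (fun _ _ => sq_nonneg _) (Finset.mem_univ j)).trans hE.err
  rw [h1]
  calc _ ≤ |(Q *ᵥ fun j => T j - β₀ j) j + ((Qh - Q) *ᵥ fun j => T j - β₀ j) j|
        + |bh j - (Qh *ᵥ β₀) j| := abs_sub _ _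
    _ ≤ |(Q *ᵥ fun j => T j - β₀ j) j| + |((Qh - Q) *ᵥ fun j => T j - β₀ j) j|
        + |bh j - (Qh *ᵥ β₀) j| := by gcongr; exact abs_add_le _ _
    _ ≤ _ := by linarith

end EstGood

theorem abs_sub_apply_le_norm (T β₀ : EuclideanSpace ℝ (Fin p)) (j : Fin p) :
    |T j - β₀ j| ≤ ‖T - β₀‖ := by
  refine abs_le_of_sq_le_sq ?_ (norm_nonneg _)
  rw [norm_sub_sq_eq]
  exact sq_le_dotProduct_self (fun j => T j - β₀ j) j

theorem eq_padZero_head (hk : k ≤ p) (hT : ∀ j : Fin p, k ≤ (j : ℕ) → T j = 0) :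
    T = padZero p (head hk T) := by
  ext j
  by_cases h : (j : ℕ) < k
  · simp [padZero, head, h]
  · simp [padZero, h, hT j (not_lt.1 h)]

theorem mulVec_padZero (hk : k ≤ p) (A : Matrix (Fin p) (Fin p) ℝ) (v : EuclideanSpace ℝ (Fin k))
    (i : Fin k) : (A *ᵥ padZero p v) (Fin.castLE hk i) = (headBlock hk A *ᵥ v) i :=
  sum_padZero hk v (fun j x => A (Fin.castLE hk i) j * x) (by simp)

theorem norm_padZero_sub (hk : k ≤ p) (u v : EuclideanSpace ℝ (Fin k)) :
    ‖padZero p u - padZero p v‖ = ‖u - v‖ := by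
  rw [← sq_eq_sq₀ (norm_nonneg _) (norm_nonneg _), EuclideanSpace.real_norm_sq_eq,
    EuclideanSpace.real_norm_sq_eq]
  have h1 : padZero p u - padZero p v = padZero p (u - v) := by
    ext j
    by_cases h : (j : ℕ) < k <;> simp [padZero, h]
  rw [h1]
  exact sum_padZero hk (u - v) (fun _ x => x ^ 2) (by simp)

theorem dotProduct_padZero (hk : k ≤ p) (A : Matrix (Fin p) (Fin p) ℝ)
    (v : EuclideanSpace ℝ (Fin k)) :
    (padZero p v) ⬝ᵥ A *ᵥ (padZero p v) = v ⬝ᵥ headBlock hk A *ᵥ v :=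
  (sum_padZero hk v (fun j x => x * (A *ᵥ (padZero p v)) j) (by simp)).trans
    (Finset.sum_congr rfl fun i _ => by rw [mulVec_padZero])

theorem dotProduct_padZero_self (hk : k ≤ p) (v : EuclideanSpace ℝ (Fin k)) :
    (padZero p v) ⬝ᵥ (padZero p v) = v ⬝ᵥ v := by
  exact sum_padZero hk v (fun _ x => x * x) (by simp)

/-- The leading block of the error of the estimated normal equations. -/
def headErr (hk : k ≤ p) (Qh : Matrix (Fin p) (Fin p) ℝ) (bh : Fin p → ℝ)
    (β₀ : EuclideanSpace ℝ (Fin p)) (i : Fin k) : ℝ :=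
  bh (Fin.castLE hk i) - (Qh *ᵥ β₀) (Fin.castLE hk i)

/-- As `β₀` vanishes beyond the first `k` coordinates, the block applied to its head is the head of
`Qh β₀`. The block normal equations thus become a linear system for the estimation error. -/
theorem headBlock_mulVec_sub_eq (hk : k ≤ p) (hβ : ∀ j : Fin p, k ≤ (j : ℕ) → β₀ j = 0)
    {v : EuclideanSpace ℝ (Fin k)}
    (hv : ∀ i : Fin k, (headBlock hk Qh *ᵥ v) i = bh (Fin.castLE hk i)) :
    headBlock hk Qh *ᵥ (fun i => v i - head hk β₀ i) = headErr hk Qh bh β₀ := by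
  ext i
  have h1 : (fun i => v i - head hk β₀ i) = WithLp.ofLp v - WithLp.ofLp (head hk β₀) := rfl
  rw [h1, mulVec_sub, Pi.sub_apply, hv i, ← mulVec_padZero, ← eq_padZero_head hk hβ, headErr]

namespace EstGood

variable (hE : EstGood Q Qh bh β₀ S a lam τ)
include hE

/-- Near `β₀` every gradient entry is below `lam / 2`, while a nonzero coefficient that should
vanish is below `lam` and would force an entry equal to `lam / 2`. The other coefficients stay above
`a * lam`, where the gradient must vanish. -/
theorem sparse_of_isLocalMin (hQ : QuadBounds Q ρ₁ ρ₂) (h2 : 0 ≤ ρ₂) (hτ : 0 ≤ τ) (hR : 0 ≤ R)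
    (hk : k ≤ p) (hβ : ∀ j : Fin p, k ≤ (j : ℕ) → β₀ j = 0) (ha : 1 < a) (hl : 0 < lam)
    (hgrad : (ρ₂ + τ) * R + τ < lam / 2) (hRl : R < lam)
    (hlarge : ∀ i : Fin k, a * lam + R < |head hk β₀ i|) (hT : ‖T - β₀‖ ≤ R)
    (hmin : IsLocalMin S T) :
    (∀ j : Fin p, k ≤ (j : ℕ) → T j = 0) ∧
      headBlock hk Qh *ᵥ (fun i => head hk T i - head hk β₀ i) = headErr hk Qh bh β₀ := by
  obtain ⟨c, hc⟩ := hE.crit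
  have h1 : ∀ j : Fin p, k ≤ (j : ℕ) → T j = 0 := by
    intro j hj
    by_contra hne
    have h3 : |T j| < lam := by
      have := abs_sub_apply_le_norm T β₀ j
      rw [hβ j hj, sub_zero] at this
      linarith
    have h4 := abs_gradient_eq_of_isLocalMin hl hE.symm hc hmin hne h3
    have h5 := hE.abs_gradient_le hQ h2 hτ hR hT j
    linarith
  refine ⟨h1, headBlock_mulVec_sub_eq hk hβ fun i => ?_⟩
  have h3 : a * lam < |T (Fin.castLE hk i)| := by
    have h4 := abs_sub_apply_le_norm T β₀ (Fin.castLE hk i)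
    have h5 := hlarge i
    have h6 : |head hk β₀ i| ≤ |T (Fin.castLE hk i)| + |T (Fin.castLE hk i) - β₀ (Fin.castLE hk i)| := by
      have : head hk β₀ i = T (Fin.castLE hk i) - (T (Fin.castLE hk i) - β₀ (Fin.castLE hk i)) := by
        simp [head]
      rw [this]
      exact abs_sub _ _
    linarith
  have h4 := gradient_eq_zero_of_isLocalMin ha hl hE.symm hc hmin h3
  rw [← mulVec_padZero, ← eq_padZero_head hk h1]
  simpa [sub_eq_zero] using h4

/-- With the zeros known, all remaining coefficients lie in the flat part of the penalty. The
resulting linear system is that of `sparse_of_isLocalMin`, hence the common limit law. -/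
theorem headBlock_eq_of_isLocalMin (hk : k ≤ p) (hβ : ∀ j : Fin p, k ≤ (j : ℕ) → β₀ j = 0)
    (ha : 1 < a) (hl : 0 < lam) (hlarge : ∀ i : Fin k, a * lam + R < |head hk β₀ i|)
    {v : EuclideanSpace ℝ (Fin k)} (hv : ‖v - head hk β₀‖ ≤ R)
    (hmin : IsLocalMin (fun v => S (padZero p v)) v) :
    headBlock hk Qh *ᵥ (fun i => v i - head hk β₀ i) = headErr hk Qh bh β₀ := by
  obtain ⟨c, hc⟩ := hE.crit
  have hc' : ∀ v : EuclideanSpace ℝ (Fin k), S (padZero p v) =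
      quadLoss (headBlock hk Qh) (fun i => bh (Fin.castLE hk i)) c v + ∑ i, scad a lam |v i| := by
    intro v
    rw [hc, quadLoss_padZero hk]
    congr 1
    exact sum_padZero hk v (fun _ x => scad a lam |x|) (by simp [scad_zero])
  refine headBlock_mulVec_sub_eq hk hβ fun i => ?_
  have h3 : a * lam < |v i| := by
    have h4 := abs_sub_apply_le_norm v (head hk β₀) i
    have h5 := hlarge i
    have h6 : |head hk β₀ i| ≤ |v i| + |v i - head hk β₀ i| := by
      have : head hk β₀ i = v i - (v i - head hk β₀ i) := by ring
      conv_lhs => rw [this]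
      exact abs_sub _ _
    linarith
  have h4 := gradient_eq_zero_of_isLocalMin ha hl (hE.symm.submatrix _) hc' hmin h3
  exact sub_eq_zero.1 h4

theorem headBlock_lower (hQ : QuadBounds Q ρ₁ ρ₂) (hτ : 0 ≤ τ) (hτ1 : τ ≤ ρ₁ / 2) (hk : k ≤ p)
    (v : Fin k → ℝ) : ρ₁ / 2 * (v ⬝ᵥ v) ≤ v ⬝ᵥ headBlock hk Qh *ᵥ v := by
  have := hE.lower hQ hτ hτ1 (padZero p (WithLp.toLp 2 v))
  rwa [dotProduct_padZero hk, dotProduct_padZero_self hk] at this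

theorem headErr_le (hk : k ≤ p) : headErr hk Qh bh β₀ ⬝ᵥ headErr hk Qh bh β₀ ≤ τ ^ 2 := by
  refine le_trans ?_ hE.err
  have h1 : headErr hk Qh bh β₀ ⬝ᵥ headErr hk Qh bh β₀ =
      ∑ j ∈ Finset.univ.map (Fin.castLEEmb hk), (bh j - (Qh *ᵥ β₀) j) ^ 2 := by
    rw [Finset.sum_map]
    simp [dotProduct, headErr, sq]
  rw [h1]
  exact Finset.sum_le_sum_of_subset_of_nonneg (Finset.subset_univ _) fun _ _ _ => sq_nonneg _

/-- Coercivity: `ρ₁ / 2 * |δ|² ≤ δ · headErr ≤ |δ| * τ`. -/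
theorem dotProduct_self_le_of_headBlock (hQ : QuadBounds Q ρ₁ ρ₂) (hτ : 0 ≤ τ)
    (hτ1 : τ ≤ ρ₁ / 2) (hk : k ≤ p) {δ : Fin k → ℝ}
    (hδ : headBlock hk Qh *ᵥ δ = headErr hk Qh bh β₀) : δ ⬝ᵥ δ ≤ (2 * τ / ρ₁) ^ 2 := by
  have hρ := hQ.pos
  have h1 := hE.headBlock_lower hQ hτ hτ1 hk δ
  rw [hδ] at h1
  have h2 := (sq_dotProduct_le δ (headErr hk Qh bh β₀)).trans
    (mul_le_mul_of_nonneg_left (hE.headErr_le hk) (dotProduct_self_nonneg' δ))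
  have h3 := dotProduct_self_nonneg' δ
  rcases h3.eq_or_lt with h0 | h0
  · rw [← h0]; positivity
  · have h4 : (ρ₁ / 2 * (δ ⬝ᵥ δ)) ^ 2 ≤ (δ ⬝ᵥ δ) * τ ^ 2 :=
      (pow_le_pow_left₀ (by positivity) h1 2).trans h2
    have h5 : (ρ₁ / 2) ^ 2 * (δ ⬝ᵥ δ) ≤ τ ^ 2 := by
      refine le_of_mul_le_mul_left ?_ h0
      calc _ = (ρ₁ / 2 * (δ ⬝ᵥ δ)) ^ 2 := by ring
        _ ≤ _ := h4
    rw [div_pow, le_div_iff₀ (by positivity)]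
    nlinarith

/-- The candidate solves the unpenalized normal equations of the leading block and is padded by
zeros. It lies within `2 * τ / ρ₁` of `β₀`, so its nonzero part is in the flat region of the penalty
and its gradient at the zero coordinates is at most `lam / 2`. -/
theorem exists_isLocalMin (hQ : QuadBounds Q ρ₁ ρ₂) (h2 : 0 ≤ ρ₂) (hτ : 0 ≤ τ)
    (hτ1 : τ ≤ ρ₁ / 2) (hk : k ≤ p) (hβ : ∀ j : Fin p, k ≤ (j : ℕ) → β₀ j = 0) (ha : 1 < a)
    (hl : 0 < lam) (hgrad : (ρ₂ + τ) * (2 * τ / ρ₁) + τ ≤ lam / 2)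
    (hlarge : ∀ i : Fin k, a * lam + 2 * τ / ρ₁ < |head hk β₀ i|) :
    IsLocalMin S (padZero p (WithLp.toLp 2
        ((headBlock hk Qh)⁻¹ *ᵥ fun i => bh (Fin.castLE hk i)))) ∧
      ‖padZero p (WithLp.toLp 2 ((headBlock hk Qh)⁻¹ *ᵥ fun i => bh (Fin.castLE hk i))) - β₀‖
        ≤ 2 * τ / ρ₁ := by
  obtain ⟨c, hc⟩ := hE.crit
  have hρ := hQ.pos
  have hdet : IsUnit (headBlock hk Qh).det := by
    rw [isUnit_iff_ne_zero]
    intro h0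
    obtain ⟨v, hv, hv0⟩ := exists_mulVec_eq_zero_iff.2 h0
    have h1 := hE.headBlock_lower hQ hτ hτ1 hk v
    rw [hv0, dotProduct_zero] at h1
    have h3 : v ⬝ᵥ v = 0 := le_antisymm (by
      by_contra h; have : 0 < v ⬝ᵥ v := not_le.1 h
      have : 0 < ρ₁ / 2 * (v ⬝ᵥ v) := by positivity
      linarith) (dotProduct_self_nonneg' v)
    exact hv (dotProduct_self_eq_zero.1 h3)
  set v : EuclideanSpace ℝ (Fin k) :=
    WithLp.toLp 2 ((headBlock hk Qh)⁻¹ *ᵥ fun i => bh (Fin.castLE hk i)) with hv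
  have h1 : headBlock hk Qh *ᵥ v = fun i => bh (Fin.castLE hk i) := by
    rw [hv]
    simp [mulVec_mulVec, mul_nonsing_inv _ hdet]
  have h3 := headBlock_mulVec_sub_eq (Qh := Qh) hk hβ fun i => congrFun h1 i
  have h4 := hE.dotProduct_self_le_of_headBlock hQ hτ hτ1 hk h3
  have hR : 0 ≤ 2 * τ / ρ₁ := by positivity
  have h5 : ‖v - head hk β₀‖ ≤ 2 * τ / ρ₁ := by
    refine le_of_sq_le_sq ?_ hR
    rw [norm_sub_sq_eq]
    exact h4
  have h6 : ‖padZero p v - β₀‖ ≤ 2 * τ / ρ₁ := by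
    rw [eq_padZero_head hk hβ, norm_padZero_sub hk]
    exact h5
  refine ⟨isLocalMin_of_gradient ha hl hE.symm hE.nonneg hc fun j => ?_, h6⟩
  by_cases hj : (j : ℕ) < k
  · left
    have hjk : j = Fin.castLE hk ⟨j, hj⟩ := rfl
    constructor
    · have a1 := abs_sub_apply_le_norm (padZero p v) β₀ j
      have a2 := hlarge ⟨j, hj⟩
      have a3 : |β₀ j| ≤ |padZero p v j| + |padZero p v j - β₀ j| := by
        have : β₀ j = padZero p v j - (padZero p v j - β₀ j) := by ring
        conv_lhs => rw [this]
        exact abs_sub _ _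
      change _ < |β₀ j| at a2
      linarith
    · rw [Pi.sub_apply, hjk, mulVec_padZero, h1, sub_self]
  · right
    exact ⟨by simp [padZero, hj], (hE.abs_gradient_le hQ h2 hτ hR h6 j).trans hgrad⟩

end EstGood

end Oracle

/-! ### The oracle property for sequences of criteria -/

section OracleSequence

open Matrix

variable {p k : ℕ → ℕ} [∀ n, NeZero (p n)] {ρ₁ ρ₂ lam r : ℕ → ℝ} {a : ℝ}

/-- The inequalities between the rates that hold for all large sample sizes. -/
structure RateBounds (ρ₁ ρ₂ lam r τ R : ℝ) : Prop where
  tau_le : τ ≤ ρ₁ / 2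
  grad : (ρ₂ + τ) * R + τ < lam / 2
  radius : R < lam
  tau_div : 2 * τ / ρ₁ ≤ R

/-- Everything is compared with `s = p / √n`. It is `o(ρ₁)`, and since `p ≥ 1` also `s ≤ ρ₁ r ≤ ρ₂
r`. The gradient bound is thus at most `(2 * D' + D) * ρ₂ * r`, which is `o(lam)` by the last tuning
condition, and `r = o(lam)` by the one before it. -/
theorem TuningCondition.eventually_rateBounds (hG : TuningCondition p ρ₁ ρ₂ lam)
    (hρ : ∀ n, 0 < ρ₁ n) (hρ2 : ∀ n, ρ₁ n ≤ ρ₂ n)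
    (hr : ∀ n, r n = (p n : ℝ) ^ 2 / (√(n : ℝ) * ρ₁ n)) {D D' : ℝ} (hD : 0 ≤ D)
    (hD' : 2 * D ≤ D') :
    ∀ᶠ n : ℕ in atTop, RateBounds (ρ₁ n) (ρ₂ n) (lam n) (r n) (D * (p n / √n)) (D' * r n) := by
  have e1 := (hG.littleO_one.def (c := 1 / (2 * (D + 1))) (by positivity))
  have e2 : Tendsto (fun n => (D' + 1) * (r n / lam n)) atTop (𝓝 0) := by
    have := hG.tendsto_one.const_mul (D' + 1)
    rw [mul_zero] at this
    refine this.congr fun n => ?_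
    rw [hr, div_div]
  have e3 : Tendsto (fun n => (2 * D' + D + 1) * (ρ₂ n * r n / lam n)) atTop (𝓝 0) := by
    have := hG.tendsto_two.const_mul (2 * D' + D + 1)
    rw [mul_zero] at this
    refine this.congr fun n => ?_
    rw [hr]
    ring
  filter_upwards [e1, e2.eventually_lt_const zero_lt_one,
    e3.eventually_lt_const (by norm_num : (0 : ℝ) < 1 / 2), eventually_gt_atTop 0] with n h1 h2 h3 hn
  have hl := hG.lam_pos n
  have hρn := hρ n
  have hρn2 := hρ2 n
  have hn' : (0 : ℝ) < √n := Real.sqrt_pos.2 (by exact_mod_cast hn)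
  have hp : (1 : ℝ) ≤ p n := by exact_mod_cast NeZero.one_le
  set s := (p n : ℝ) / √n with hs
  have hs0 : 0 < s := by positivity
  have hsr : s / ρ₁ n ≤ r n := by
    rw [hr, hs, div_div]
    gcongr
    nlinarith
  have hr0 : 0 < r n := lt_of_lt_of_le (by positivity) hsr
  rw [Real.norm_of_nonneg hs0.le, Real.norm_of_nonneg hρn.le] at h1
  have hτ : D * s ≤ ρ₁ n / 2 := by
    calc D * s ≤ (D + 1) * (1 / (2 * (D + 1)) * ρ₁ n) := by gcongr; linarith
      _ = _ := by field_simp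
  have hsr2 : s ≤ ρ₂ n * r n := by
    rw [div_le_iff₀ hρn] at hsr
    nlinarith
  rw [← mul_div_assoc, div_lt_iff₀ hl] at h2 h3
  have hρr : 0 ≤ ρ₂ n * r n := mul_nonneg (hρn.le.trans hρn2) hr0.le
  refine ⟨hτ, ?_, ?_, ?_⟩
  · have h4 : (ρ₂ n + D * s) * (D' * r n) ≤ (2 * ρ₂ n) * (D' * r n) := by
      have : 0 ≤ D' * r n := mul_nonneg (by linarith) hr0.le
      exact mul_le_mul_of_nonneg_right (by linarith) this
    have h5 := mul_le_mul_of_nonneg_left hsr2 hD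
    nlinarith
  · nlinarith
  · calc 2 * (D * s) / ρ₁ n = 2 * D * (s / ρ₁ n) := by ring
      _ ≤ D' * r n := mul_le_mul hD' hsr (by positivity) (by linarith)

theorem measurable_inv_mulVec {q : ℕ} (i : Fin q) :
    Measurable fun z : (Fin q → Fin q → ℝ) × (Fin q → ℝ) => ((Matrix.of z.1)⁻¹ *ᵥ z.2) i := by
  have h0 : Continuous fun z : (Fin q → Fin q → ℝ) × (Fin q → ℝ) => Matrix.of z.1 :=
    continuous_matrix fun i j => by simp only [Matrix.of_apply]; fun_prop
  simp_rw [Matrix.inv_def, Ring.inverse_eq_inv', smul_mulVec, Pi.smul_apply, smul_eq_mul]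
  have h1 : Measurable fun z : (Fin q → Fin q → ℝ) × (Fin q → ℝ) => (Matrix.of z.1).det⁻¹ :=
    h0.matrix_det.measurable.inv
  exact h1.mul ((continuous_apply i).comp (h0.matrix_adjugate.matrix_mulVec continuous_snd)).measurable

theorem aemeasurable_padZero_inv_mulVec {Ω : Type*} [MeasurableSpace Ω] {μ : Measure Ω} {q : ℕ}
    (p : ℕ) {A : Ω → Matrix (Fin q) (Fin q) ℝ} {b : Ω → Fin q → ℝ}
    (hA : ∀ i j, AEMeasurable (fun ω => A ω i j) μ) (hb : ∀ i, AEMeasurable (fun ω => b ω i) μ) :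
    AEMeasurable (fun ω => padZero p (WithLp.toLp 2 ((A ω)⁻¹ *ᵥ b ω))) μ := by
  have h1 : AEMeasurable (fun ω => ((fun i j => A ω i j), b ω)) μ :=
    (aemeasurable_pi_lambda _ fun i => aemeasurable_pi_lambda _ fun j => hA i j).prodMk
      (aemeasurable_pi_lambda _ hb)
  unfold padZero
  refine (PiLp.continuous_toLp 2 fun _ => ℝ).measurable.comp_aemeasurable
    (aemeasurable_pi_lambda _ fun j => ?_)
  by_cases hj : (j : ℕ) < q
  · simp only [hj, dite_true]
    have h2 := (measurable_inv_mulVec (⟨j, hj⟩ : Fin q)).comp_aemeasurable h1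
    have h3 : ∀ ω, Matrix.of (fun i j => A ω i j) = A ω := fun ω => rfl
    simp only [Function.comp_def, h3] at h2
    exact h2
  · simp [hj]

variable {Ω : ℕ → Type*} [∀ n, MeasurableSpace (Ω n)] {P : ∀ n, Measure (Ω n)}
  {hk : ∀ n, k n ≤ p n} {β₀ : ∀ n, EuclideanSpace ℝ (Fin (p n))}
  {S : ∀ n, Ω n → EuclideanSpace ℝ (Fin (p n)) → ℝ} {Q : ∀ n, Matrix (Fin (p n)) (Fin (p n)) ℝ}
  {Qh : ∀ n, Ω n → Matrix (Fin (p n)) (Fin (p n)) ℝ} {bh : ∀ n, Ω n → Fin (p n) → ℝ}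

/-- The hypotheses of the oracle property on the population quantities and on the rates. -/
structure OracleSetting (p k : ℕ → ℕ) (hk : ∀ n, k n ≤ p n)
    (β₀ : ∀ n, EuclideanSpace ℝ (Fin (p n))) (Q : ∀ n, Matrix (Fin (p n)) (Fin (p n)) ℝ)
    (a : ℝ) (lam ρ₁ ρ₂ r : ℕ → ℝ) : Prop where
  one_lt : 1 < a
  sparse : ∀ n (j : Fin (p n)), k n ≤ (j : ℕ) → β₀ n j = 0
  bounds : ∀ n, QuadBounds (Q n) (ρ₁ n) (ρ₂ n)
  le : ∀ n, ρ₁ n ≤ ρ₂ n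
  tuning : TuningCondition p ρ₁ ρ₂ lam
  signal : ∀ B : ℝ, ∀ᶠ n in atTop, ∀ j : Fin (k n), B ≤ |head (hk n) (β₀ n) j| / lam n
  rate : ∀ n, r n = (p n : ℝ) ^ 2 / (√(n : ℝ) * ρ₁ n)

namespace OracleSetting

variable (hO : OracleSetting p k hk β₀ Q a lam ρ₁ ρ₂ r)
include hO

omit [∀ n, NeZero (p n)] in
theorem rate_nonneg (n : ℕ) : 0 ≤ r n := by
  have := (hO.bounds n).pos
  rw [hO.rate]
  positivity

omit [∀ n, NeZero (p n)] in
theorem eventually_signal :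
    ∀ᶠ n in atTop, ∀ R < lam n, ∀ i : Fin (k n), a * lam n + R < |head (hk n) (β₀ n) i| := by
  filter_upwards [hO.signal (a + 1)] with n hn R hR i
  have h1 := hn i
  rw [le_div_iff₀ (hO.tuning.lam_pos n)] at h1
  linarith

variable (hA : TightEvents P fun D n =>
  {ω | EstGood (Q n) (Qh n ω) (bh n ω) (β₀ n) (S n ω) a (lam n) (D * (p n / √n))})
include hA

/-- The witness is an explicit formula in the plug-in estimators, so it is measurable. It is defined
for every outcome, since the inverse of a singular block has a default value. -/
theorem exists_isConsistentLocalMinimizer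
    (hmQ : ∀ n i j, AEMeasurable (fun ω => Qh n ω i j) (P n))
    (hmb : ∀ n i, AEMeasurable (fun ω => bh n ω i) (P n)) :
    ∃ βhat, IsConsistentLocalMinimizer P S β₀ r βhat := by
  refine ⟨fun n ω => padZero (p n) (WithLp.toLp 2 ((headBlock (hk n) (Qh n ω))⁻¹ *ᵥ
    fun i => bh n ω (Fin.castLE (hk n) i))), fun n => ?_, ?_, ?_⟩
  · exact aemeasurable_padZero_inv_mulVec (p n) (A := fun ω => headBlock (hk n) (Qh n ω))
      (fun i j => hmQ n _ _) fun i => hmb n _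
  · refine hA.wpt fun D hD => ?_
    filter_upwards [hO.tuning.eventually_rateBounds (fun n => (hO.bounds n).pos) hO.le hO.rate hD
      le_rfl, hO.eventually_signal] with n hn hs ω hω
    have hρ := (hO.bounds n).pos
    have h2 : 0 ≤ ρ₂ n := hρ.le.trans (hO.le n)
    have hτ : 0 ≤ D * ((p n : ℝ) / √n) := by positivity
    refine (EstGood.exists_isLocalMin hω (hO.bounds n) h2 hτ hn.tau_le (hk n)
      (hO.sparse n) hO.one_lt (hO.tuning.lam_pos n) ?_ ?_).1
    · refine le_trans ?_ hn.grad.le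
      have := hn.tau_div
      gcongr
    · exact hs _ (hn.tau_div.trans_lt hn.radius)
  · refine hA.bigOP fun D hD => ⟨2 * D, ?_⟩
    filter_upwards [hO.tuning.eventually_rateBounds (fun n => (hO.bounds n).pos) hO.le hO.rate hD
      le_rfl, hO.eventually_signal] with n hn hs ω hω
    have hρ := (hO.bounds n).pos
    have h2 : 0 ≤ ρ₂ n := hρ.le.trans (hO.le n)
    have hτ : 0 ≤ D * ((p n : ℝ) / √n) := by positivity
    rw [abs_of_nonneg (norm_nonneg _)]
    refine (EstGood.exists_isLocalMin hω (hO.bounds n) h2 hτ hn.tau_le (hk n)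
      (hO.sparse n) hO.one_lt (hO.tuning.lam_pos n) ?_ ?_).2.trans hn.tau_div
    · refine le_trans ?_ hn.grad.le
      have := hn.tau_div
      gcongr
    · exact hs _ (hn.tau_div.trans_lt hn.radius)

theorem sparse_of_isConsistentLocalMinimizer {T : ∀ n, Ω n → EuclideanSpace ℝ (Fin (p n))}
    (hT : IsConsistentLocalMinimizer P S β₀ r T) :
    WithProbTendingToOne P fun n => {ω | (∀ j : Fin (p n), k n ≤ (j : ℕ) → T n ω j = 0) ∧
      headBlock (hk n) (Qh n ω) *ᵥ (fun i => head (hk n) (T n ω) i - head (hk n) (β₀ n) i) =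
        headErr (hk n) (Qh n ω) (bh n ω) (β₀ n)} := by
  refine ((hA.inter (TightEvents.of_wpt hT.isLocalMin)).inter
    (TightEvents.of_bigOP hT.rate (.of_forall hO.rate_nonneg))).wpt fun D hD => ?_
  -- The estimator is within `D * r n` of `β₀`; the radius is enlarged to `2 * D * r n` because the
  -- rate inequalities also require `2 * τ / ρ₁ ≤ R`.
  filter_upwards [hO.tuning.eventually_rateBounds (fun n => (hO.bounds n).pos) hO.le hO.rate hD
    (D' := 2 * D) le_rfl, hO.eventually_signal] with n hn hs ω hω
  obtain ⟨⟨hω1, hω2⟩, hω3⟩ := hω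
  have hρ := (hO.bounds n).pos
  have h2 : 0 ≤ ρ₂ n := hρ.le.trans (hO.le n)
  have hτ : 0 ≤ D * ((p n : ℝ) / √n) := by positivity
  have hr := hO.rate_nonneg n
  refine EstGood.sparse_of_isLocalMin hω1 (hO.bounds n) h2 hτ (R := 2 * D * r n) (by positivity)
    (hk n) (hO.sparse n) hO.one_lt (hO.tuning.lam_pos n) hn.grad hn.radius (hs _ hn.radius) ?_ hω2
  have h3 : |‖T n ω - β₀ n‖| ≤ D * r n := hω3
  rw [abs_of_nonneg (norm_nonneg _)] at h3
  nlinarith [mul_nonneg hD hr]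

theorem headBlock_eq_of_isConsistentLocalMinimizer
    {v : ∀ n, Ω n → EuclideanSpace ℝ (Fin (k n))}
    (hv : IsConsistentLocalMinimizer P (fun n ω v => S n ω (padZero (p n) v))
      (fun n => head (hk n) (β₀ n)) r v) :
    WithProbTendingToOne P fun n =>
      {ω | headBlock (hk n) (Qh n ω) *ᵥ (fun i => v n ω i - head (hk n) (β₀ n) i) =
        headErr (hk n) (Qh n ω) (bh n ω) (β₀ n)} := by
  refine ((hA.inter (TightEvents.of_wpt hv.isLocalMin)).inter
    (TightEvents.of_bigOP hv.rate (.of_forall hO.rate_nonneg))).wpt fun D hD => ?_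
  filter_upwards [hO.tuning.eventually_rateBounds (fun n => (hO.bounds n).pos) hO.le hO.rate hD
    (D' := 2 * D) le_rfl, hO.eventually_signal] with n hn hs ω hω
  obtain ⟨⟨hω1, hω2⟩, hω3⟩ := hω
  have hr := hO.rate_nonneg n
  refine EstGood.headBlock_eq_of_isLocalMin hω1 (R := 2 * D * r n) (hk n) (hO.sparse n) hO.one_lt
    (hO.tuning.lam_pos n) (hs _ hn.radius) ?_ hω2
  have h3 : |‖v n ω - head (hk n) (β₀ n)‖| ≤ D * r n := hω3
  rw [abs_of_nonneg (norm_nonneg _)] at h3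
  nlinarith [mul_nonneg hD hr]

end OracleSetting

end OracleSequence

/-! ### Spectral bounds and the sandwich covariance -/

section Spectral

open Matrix

theorem le_dotProduct_mulVec_of_spectrum {ι : Type*} [Fintype ι] [DecidableEq ι]
    {A : Matrix ι ι ℝ} (hA : A.IsSymm) {c : ℝ} (hc : ∀ μ ∈ spectrum ℝ A, c ≤ μ) (v : ι → ℝ) :
    c * (v ⬝ᵥ v) ≤ v ⬝ᵥ A *ᵥ v := by
  have h1 : (A - algebraMap ℝ (Matrix ι ι ℝ) c).PosSemidef := by
    rw [posSemidef_iff_isHermitian_and_spectrum_nonneg]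
    refine ⟨?_, fun μ hμ => ?_⟩
    · rw [algebraMap_eq_diagonal]
      exact IsHermitian.sub (by rwa [IsHermitian, conjTranspose_eq_transpose_of_trivial])
        (isHermitian_diagonal _)
    · rw [← spectrum.sub_singleton_eq] at hμ
      obtain ⟨ν, hν, c', rfl, rfl⟩ := hμ
      exact sub_nonneg.2 (hc ν hν)
  have h2 := h1.dotProduct_mulVec_nonneg v
  rw [sub_mulVec, dotProduct_sub, Algebra.algebraMap_eq_smul_one, smul_mulVec, one_mulVec,
    dotProduct_smul] at h2
  simpa using h2

theorem dotProduct_mulVec_le_of_spectrum {ι : Type*} [Fintype ι] [DecidableEq ι]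
    {A : Matrix ι ι ℝ} (hA : A.IsSymm) {c : ℝ} (hc : ∀ μ ∈ spectrum ℝ A, μ ≤ c) (v : ι → ℝ) :
    v ⬝ᵥ A *ᵥ v ≤ c * (v ⬝ᵥ v) := by
  have h1 := le_dotProduct_mulVec_of_spectrum (A := -A) hA.neg (c := -c) (fun μ hμ => by
    rw [← spectrum.neg_eq, Set.mem_neg] at hμ
    linarith [hc _ hμ]) v
  rw [neg_mulVec, dotProduct_neg] at h1
  linarith

theorem EigenvalueCondition.quadBounds {p : ℕ} {Q : Matrix (Fin p) (Fin p) ℝ} {ρ₁ ρ₂ : ℝ}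
    (hQ : Q.IsSymm) (hF : EigenvalueCondition Q ρ₁ ρ₂) : QuadBounds Q ρ₁ ρ₂ :=
  ⟨hQ, hF.pos, le_dotProduct_mulVec_of_spectrum hQ fun μ hμ => (hF.bounds μ hμ).1,
    dotProduct_mulVec_le_of_spectrum hQ fun μ hμ => (hF.bounds μ hμ).2⟩

theorem QuadBounds.le [NeZero p] {Q : Matrix (Fin p) (Fin p) ℝ} {ρ₁ ρ₂ : ℝ}
    (hQ : QuadBounds Q ρ₁ ρ₂) : ρ₁ ≤ ρ₂ := by
  have h1 := (hQ.lower (Pi.single 0 1)).trans (hQ.upper _)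
  simpa using h1

theorem QuadBounds.le_diag [NeZero p] {Q : Matrix (Fin p) (Fin p) ℝ} {ρ₁ ρ₂ : ℝ}
    (hQ : QuadBounds Q ρ₁ ρ₂) : ρ₁ ≤ Q 0 0 := by
  have h1 := hQ.lower (Pi.single 0 1)
  simpa using h1

theorem QuadBounds.isUnit_headBlock {p k : ℕ} {Q : Matrix (Fin p) (Fin p) ℝ} {ρ₁ ρ₂ : ℝ}
    (hQ : QuadBounds Q ρ₁ ρ₂) (hk : k ≤ p) : IsUnit (headBlock hk Q).det := by
  rw [isUnit_iff_ne_zero]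
  intro h0
  obtain ⟨v, hv, hv0⟩ := exists_mulVec_eq_zero_iff.2 h0
  have h1 := hQ.lower (padZero p (WithLp.toLp 2 v))
  rw [dotProduct_padZero hk, dotProduct_padZero_self hk] at h1
  change ρ₁ * (v ⬝ᵥ v) ≤ v ⬝ᵥ _ *ᵥ v at h1
  rw [hv0, dotProduct_zero] at h1
  have h3 : v ⬝ᵥ v ≤ 0 := by
    by_contra h
    have : 0 < ρ₁ * (v ⬝ᵥ v) := mul_pos hQ.pos (not_le.1 h)
    linarith
  exact hv (dotProduct_self_eq_zero.1 (le_antisymm h3 (dotProduct_self_nonneg' v)))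

theorem invSqrt_isSymm {q : ℕ} (V : Matrix (Fin q) (Fin q) ℝ) : (invSqrt V).IsSymm := by
  have : IsSelfAdjoint (invSqrt V) := cfc_predicate _ _
  rw [isSelfAdjoint_iff, star_eq_conjTranspose, conjTranspose_eq_transpose_of_trivial] at this
  exact this

theorem invSqrt_mul_mul {q : ℕ} {V : Matrix (Fin q) (Fin q) ℝ} (hV : V.PosDef) :
    invSqrt V * V * invSqrt V = 1 := by
  have hsa : IsSelfAdjoint V := hV.isHermitian
  have hpos : ∀ μ ∈ spectrum ℝ V, 0 < μ := by
    intro μ hμ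
    rw [hV.isHermitian.spectrum_real_eq_range_eigenvalues] at hμ
    obtain ⟨i, rfl⟩ := hμ
    exact hV.eigenvalues_pos i
  have hcont : ContinuousOn (fun t : ℝ => (√t)⁻¹) (spectrum ℝ V) := by
    refine ContinuousOn.inv₀ (by fun_prop) fun t ht => ?_
    exact (Real.sqrt_pos.2 (hpos t ht)).ne'
  have h1 : invSqrt V * V = cfc (fun t : ℝ => (√t)⁻¹ * t) V := by
    rw [cfc_mul (fun t : ℝ => (√t)⁻¹) (fun t => t) V hcont (by fun_prop)]
    rw [cfc_id' ℝ V]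
    rfl
  rw [h1, invSqrt, ← cfc_mul (fun t : ℝ => (√t)⁻¹ * t) (fun t : ℝ => (√t)⁻¹) V
    (hcont.mul (by fun_prop)) hcont]
  rw [← cfc_one ℝ V]
  refine cfc_congr fun t ht => ?_
  have ht0 := hpos t ht
  have hs := Real.sqrt_pos.2 ht0
  have := Real.mul_self_sqrt ht0.le
  simp only [Pi.one_apply]
  field_simp
  rw [sq, this]

/-- In the columns that belong to `b` the duplication matrix acts as the identity. These columns
already give the sandwich matrix full rank. -/
theorem sandwich_mul_dup_inl {q : ℕ} (β : Fin q → ℝ) (Q : Matrix (Fin q) (Fin q) ℝ) (r i : Fin q) :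
    (sandwich β Q * dup q) r (Sum.inl i) = Q⁻¹ r i := by
  simp [Matrix.mul_apply, sandwich, dup, Fintype.sum_prod_type, kroneckerMap_apply]

/-- The sandwich matrix maps a perturbation `[b, C]` to `Q⁻¹ (b - C β)`, the first order change of
the solution of the normal equations. This is why it appears in the asymptotic covariance. -/
theorem sandwich_mulVec_vec {q : ℕ} (β : Fin q → ℝ) (Q : Matrix (Fin q) (Fin q) ℝ)
    (C : Matrix (Fin q) (Unit ⊕ Fin q) ℝ) :
    sandwich β Q *ᵥ C.vec =
      Q⁻¹ *ᵥ fun i => C i (Sum.inl ()) - ∑ j, C i (Sum.inr j) * β j := by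
  ext r
  simp only [mulVec, dotProduct, sandwich, Fintype.sum_prod_type, submatrix_apply,
    kroneckerMap_apply, of_apply, Fintype.sum_sum_type, id, Sum.elim_inl, Sum.elim_inr, vec,
    Finset.univ_unique, Finset.sum_singleton, mul_sub, Finset.sum_sub_distrib, Finset.mul_sum]
  rw [Finset.sum_comm (s := Finset.univ (α := Fin q)), sub_eq_add_neg, ← Finset.sum_neg_distrib]
  congr 1
  · exact Finset.sum_congr rfl fun i _ => by simp
  · refine Finset.sum_congr rfl fun i _ => ?_
    rw [← Finset.sum_neg_distrib]
    exact Finset.sum_congr rfl fun j _ => by ring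

/-- The linear functional `δ ↦ γᵀ V^{-1/2} δ`, in terms of the error `Q δ` of the normal equations
and of the half-vectorization of its coefficients. -/
theorem exists_sandwich_functional {q : ℕ} (β : Fin q → ℝ) {Q : Matrix (Fin q) (Fin q) ℝ}
    (hQ : IsUnit Q.det) {G : Matrix (VechIdx q) (VechIdx q) ℝ} (hGs : G.IsSymm) {g : ℝ}
    (hg : 0 < g) (hG : ∀ v, g * (v ⬝ᵥ v) ≤ v ⬝ᵥ G *ᵥ v) {γ : Fin q → ℝ} (hγ : γ ⬝ᵥ γ = 1) :
    ∃ (y : Fin q → ℝ) (c : VechIdx q → ℝ),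
      (∀ δ, γ ⬝ᵥ invSqrt (sandwichCov β Q G) *ᵥ δ = y ⬝ᵥ Q *ᵥ δ) ∧ c ⬝ᵥ G *ᵥ c = 1 ∧
      c ⬝ᵥ c ≤ 1 / g ∧ y ⬝ᵥ y ≤ 1 / g ∧
      ∀ C : Matrix (Fin q) (Unit ⊕ Fin q) ℝ, (∀ i j, C i (Sum.inr j) = C j (Sum.inr i)) →
        c ⬝ᵥ vech C = y ⬝ᵥ fun i => C i (Sum.inl ()) - ∑ j, C i (Sum.inr j) * β j := by
  set A := sandwich β Q * dup q with hA
  set V := sandwichCov β Q G with hV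
  have hVA : V = A * G * Aᵀ := by
    rw [hV, hA, sandwichCov, transpose_mul]
    simp only [Matrix.mul_assoc]
  have hinl : ∀ v i, (Aᵀ *ᵥ v) (Sum.inl i) = ((Q⁻¹)ᵀ *ᵥ v) i := by
    intro v i
    simp only [mulVec, dotProduct, transpose_apply, hA, sandwich_mul_dup_inl]
  -- The entries of `Aᵀ v` that belong to `b` form `(Q⁻¹)ᵀ v`, so `Aᵀ` is injective and the
  -- positivity of `G` passes to `V`.
  have hle : ∀ v, ((Q⁻¹)ᵀ *ᵥ v) ⬝ᵥ ((Q⁻¹)ᵀ *ᵥ v) ≤ (Aᵀ *ᵥ v) ⬝ᵥ (Aᵀ *ᵥ v) := by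
    intro v
    simp only [dotProduct, Fintype.sum_sum_type, hinl]
    exact le_add_of_nonneg_right (Finset.sum_nonneg fun _ _ => mul_self_nonneg _)
  have hquad : ∀ v, v ⬝ᵥ V *ᵥ v = (Aᵀ *ᵥ v) ⬝ᵥ G *ᵥ (Aᵀ *ᵥ v) := by
    intro v
    rw [hVA, ← mulVec_mulVec, ← mulVec_mulVec, dotProduct_mulVec, ← mulVec_transpose]
  have hVpos : V.PosDef := by
    refine PosDef.of_dotProduct_mulVec_pos ?_ fun v hv => ?_
    · rw [IsHermitian, conjTranspose_eq_transpose_of_trivial, hVA, transpose_mul (A * G),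
        transpose_mul A, transpose_transpose, hGs.eq, Matrix.mul_assoc A]
    · have h1 : (Q⁻¹)ᵀ *ᵥ v ≠ 0 := by
        intro h0
        apply hv
        have h2 : Qᵀ *ᵥ ((Q⁻¹)ᵀ *ᵥ v) = v := by
          rw [mulVec_mulVec, ← transpose_mul, nonsing_inv_mul _ hQ, transpose_one, one_mulVec]
        rw [← h2, h0, mulVec_zero]
      have h2 : 0 < ((Q⁻¹)ᵀ *ᵥ v) ⬝ᵥ ((Q⁻¹)ᵀ *ᵥ v) :=
        (dotProduct_self_nonneg' _).lt_of_ne fun h => h1 (dotProduct_self_eq_zero.1 h.symm)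
      rw [star_trivial, hquad]
      exact (mul_pos hg (h2.trans_le (hle v))).trans_le (hG _)
  set U := invSqrt V with hU
  have hUs : U.IsSymm := invSqrt_isSymm V
  have hUVU : U * V * U = 1 := invSqrt_mul_mul hVpos
  have hswap : ∀ δ, γ ⬝ᵥ U *ᵥ δ = (U *ᵥ γ) ⬝ᵥ δ := by
    intro δ
    rw [dotProduct_mulVec, ← mulVec_transpose, hUs.eq]
  have hcG : (Aᵀ *ᵥ (U *ᵥ γ)) ⬝ᵥ G *ᵥ (Aᵀ *ᵥ (U *ᵥ γ)) = 1 := by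
    rw [← hquad, ← hswap, mulVec_mulVec, mulVec_mulVec, hUVU, one_mulVec, hγ]
  have hcc : (Aᵀ *ᵥ (U *ᵥ γ)) ⬝ᵥ (Aᵀ *ᵥ (U *ᵥ γ)) ≤ 1 / g := by
    rw [le_div_iff₀ hg, ← hcG, mul_comm]
    exact hG _
  have hyv : ∀ z, ((Q⁻¹)ᵀ *ᵥ (U *ᵥ γ)) ⬝ᵥ z = (U *ᵥ γ) ⬝ᵥ Q⁻¹ *ᵥ z := by
    intro z
    rw [dotProduct_mulVec, ← mulVec_transpose]
  -- With `U = V^(-1/2)`, the vector `c = Aᵀ U γ` has `c G c = γ U V U γ = 1`, and `g |c|² ≤ c G c`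
  -- bounds its norm. The vector `y = (Q⁻¹)ᵀ U γ` consists of the entries of `c` that belong to `b`.
  refine ⟨(Q⁻¹)ᵀ *ᵥ (U *ᵥ γ), Aᵀ *ᵥ (U *ᵥ γ), fun δ => ?_, hcG, hcc, (hle _).trans hcc,
    fun C hC => ?_⟩
  · rw [hyv, mulVec_mulVec, nonsing_inv_mul _ hQ, one_mulVec, hswap]
  · rw [hyv, ← sandwich_mulVec_vec, vec_eq_dup_mulVec_vech C hC, mulVec_mulVec (vech C), ← hA,
      dotProduct_mulVec, ← mulVec_transpose]

theorem isSymm_gram {q : ℕ} (w : ℝ → ℝ) (m : Fin q → ℝ → ℝ) : (gram w m).IsSymm := by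
  refine Matrix.IsSymm.ext fun i j => ?_
  simp only [gram, Matrix.of_apply]
  exact intervalIntegral.integral_congr fun x _ => by ring

theorem isSymm_asympCov {p q : ℕ} [NeZero p] (n : ℕ) (σ : ℝ) (w : ℝ → ℝ) (m : Fin p → ℝ → ℝ)
    (e : Fin q → Fin p) : (asympCov n σ w m e).IsSymm := by
  refine Matrix.IsSymm.ext fun i j => ?_
  simp only [asympCov, Matrix.of_apply]
  congr 1
  refine Finset.sum_congr rfl fun l _ => ?_
  exact intervalIntegral.integral_congr fun x _ => mul_comm _ _

/-- The quadratic form of `G` at `c` is the variance of the linear statistic whose influence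
functions are combined with the coefficients `c`. This identity makes the statistic of the central
limit theorem standardized. -/
theorem dotProduct_asympCov_mulVec {p q : ℕ} [NeZero p] (n : ℕ) (σ : ℝ) {w : ℝ → ℝ}
    {m : Fin p → ℝ → ℝ} {e : Fin q → Fin p} (hc : ∀ a l, Continuous (infl w m e a l))
    (c : VechIdx q → ℝ) :
    c ⬝ᵥ asympCov n σ w m e *ᵥ c =
      σ ^ 2 / n * ∫ x in (0 : ℝ)..1, ∑ l, (∑ a, c a * infl w m e a l x) ^ 2 := by
  have e1 : ∀ x, ∑ l, (∑ a, c a * infl w m e a l x) ^ 2 =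
      ∑ a, ∑ b, c a * c b * ∑ l, infl w m e a l x * infl w m e b l x := by
    intro x
    simp_rw [sq, Finset.sum_mul_sum, Finset.mul_sum]
    rw [Finset.sum_comm]
    refine Finset.sum_congr rfl fun a _ => ?_
    rw [Finset.sum_comm]
    exact Finset.sum_congr rfl fun b _ => Finset.sum_congr rfl fun l _ => by ring
  simp_rw [e1]
  rw [intervalIntegral.integral_finsetSum fun a _ =>
    Continuous.intervalIntegrable (by fun_prop) _ _]
  simp_rw [fun a => intervalIntegral.integral_finsetSum (s := Finset.univ) (a := 0) (b := 1)
    (μ := volume) (f := fun b x => c a * c b * ∑ l, infl w m e a l x * infl w m e b l x)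
    fun b _ => Continuous.intervalIntegrable (by fun_prop) _ _]
  simp_rw [intervalIntegral.integral_const_mul]
  simp_rw [fun a b => intervalIntegral.integral_finsetSum (s := Finset.univ) (a := 0) (b := 1)
    (μ := volume) (f := fun l x => infl w m e a l x * infl w m e b l x)
    fun l _ => Continuous.intervalIntegrable (by fun_prop) _ _]
  rw [dotProduct, Finset.mul_sum]
  refine Finset.sum_congr rfl fun a _ => ?_
  rw [mulVec, dotProduct, Finset.mul_sum, Finset.mul_sum]
  refine Finset.sum_congr rfl fun b _ => ?_
  simp only [asympCov, of_apply]
  ring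

end Spectral

/-! ### From the sample to the penalized quadratic form -/

section SampleEst

open Matrix

variable {n p : ℕ} [NeZero p] {K : ℝ → ℝ} {T : Matrix (Fin 4) (Fin 4) ℝ} {B h c₀ C₁ L M D Cβ a lam : ℝ}
  {w : ℕ → ℝ → ℝ} {m : Fin p → ℕ → ℝ → ℝ} {X : Fin n → ℝ} {e : Fin n × Fin p → ℝ}
  {β : EuclideanSpace ℝ (Fin p)}

/-- The remainder in the linearization of `gramHat`. -/
noncomputable def gramRem (K : ℝ → ℝ) (h : ℝ) (w : ℕ → ℝ → ℝ) (m : Fin p → ℕ → ℝ → ℝ)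
    (X : Fin n → ℝ) (e : Fin n × Fin p → ℝ) (i j : Fin p) : ℝ :=
  gramHat K h w m X e i j - gram (w 0) (fun j => m j 0) i j - linGram w m X e i j

/-- The remainder in the linearization of `crossHat`. -/
noncomputable def crossRem (K : ℝ → ℝ) (h : ℝ) (w : ℕ → ℝ → ℝ) (m : Fin p → ℕ → ℝ → ℝ)
    (X : Fin n → ℝ) (e : Fin n × Fin p → ℝ) (i : Fin p) : ℝ :=
  crossHat K h w m X e i - crossMoment w m i - linCross w m X e i

theorem remSq_eq : remSq K h w m X e =
    ∑ i, ∑ j, gramRem K h w m X e i j ^ 2 + ∑ i, crossRem K h w m X e i ^ 2 := rfl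

/-- `β` solves the population normal equations, so the population terms cancel and only linear parts
and remainders are left. -/
theorem normalErr_eq (hβ : gram (w 0) (fun j => m j 0) *ᵥ β = crossMoment w m) (i : Fin p) :
    crossHat K h w m X e i - (Matrix.of (gramHat K h w m X e) *ᵥ β) i =
      linErr w m β X e i + (crossRem K h w m X e i - ∑ j, gramRem K h w m X e i j * β j) := by
  have h1 := congrFun hβ i
  simp only [mulVec, dotProduct, of_apply] at h1 ⊢
  simp only [linErr, crossRem, gramRem, sub_mul, Finset.sum_sub_distrib, ← h1]
  ring

theorem sum_sq_combined_rem_le :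
    ∑ i, (crossRem K h w m X e i - ∑ j, gramRem K h w m X e i j * β j) ^ 2 ≤
      2 * (1 + ∑ j, β j ^ 2) * remSq K h w m X e := by
  have h1 : ∀ i, (crossRem K h w m X e i - ∑ j, gramRem K h w m X e i j * β j) ^ 2 ≤
      2 * crossRem K h w m X e i ^ 2 + 2 * ((∑ j, gramRem K h w m X e i j ^ 2) * ∑ j, β j ^ 2) := by
    intro i
    have h2 := Finset.sum_mul_sq_le_sq_mul_sq Finset.univ (gramRem K h w m X e i) β
    nlinarith [sq_nonneg (crossRem K h w m X e i + ∑ j, gramRem K h w m X e i j * β j)]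
  refine (Finset.sum_le_sum fun i _ => h1 i).trans ?_
  rw [Finset.sum_add_distrib, ← Finset.mul_sum, ← Finset.mul_sum, ← Finset.sum_mul, remSq_eq]
  have h3 : 0 ≤ ∑ i, ∑ j, gramRem K h w m X e i j ^ 2 :=
    Finset.sum_nonneg fun _ _ => Finset.sum_nonneg fun _ _ => sq_nonneg _
  have h4 : 0 ≤ ∑ i, crossRem K h w m X e i ^ 2 := Finset.sum_nonneg fun _ _ => sq_nonneg _
  have h5 : 0 ≤ ∑ j, β j ^ 2 := Finset.sum_nonneg fun _ _ => sq_nonneg _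
  nlinarith [mul_nonneg h4 h5]

theorem sq_add_le_two_mul (x y : ℝ) : (x + y) ^ 2 ≤ 2 * x ^ 2 + 2 * y ^ 2 := by
  linarith [sq_nonneg (x - y), sub_sq x y, add_sq x y]

/-- Since `p * remRate ≤ 1 / √n`, the squared remainders are at most `D / n`, not larger than the
order `p ^ 2 / n` of the linear parts. For the normal equations the constant is `2 * D` from the
linear part and `4 * (1 + Cβ) * D` from the remainder. -/
theorem SampleGood.estGood (hg : SampleGood K c₀ C₁ h w m β D X e) (hK : EquivKernelData K T B)
    (hc : 0 < c₀) (hn : 0 < n) (hh : 0 < h) (hw : WeightFun L w) (hm : ∀ j, SmoothFun M (m j))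
    (hβ : LinODE.gram (w 0) (fun j => m j 0) *ᵥ β = crossMoment w m) (hD : 0 ≤ D)
    (hCβ : 0 ≤ Cβ) (hβ2 : ∑ j, β j ^ 2 ≤ Cβ * p) (hrate : √n * p * remRate n h ≤ 1)
    {S : EuclideanSpace ℝ (Fin p) → ℝ}
    (hS : S = criterion K h (w 0) a lam X (fun t j => m j 0 (X t) + e (t, j))) :
    EstGood (LinODE.gram (w 0) fun j => m j 0) (Matrix.of (gramHat K h w m X e)) (crossHat K h w m X e)
      β S a lam ((D * (6 + 4 * Cβ) + 1) * (p / √n)) := by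
  have hn' : (0 : ℝ) < n := by exact_mod_cast hn
  have hp : (1 : ℝ) ≤ p := by exact_mod_cast NeZero.one_le
  have hs : 0 < √(n : ℝ) := Real.sqrt_pos.2 hn'
  have hrem : remSq K h w m X e ≤ D * (1 / n) := by
    refine hg.rem.trans (mul_le_mul_of_nonneg_left ?_ hD)
    have h1 : p * remRate n h ≤ 1 / √n := by
      rw [le_div_iff₀ hs]
      linarith
    have h2 := remRate_pos (n := n) hh
    refine (pow_le_pow_left₀ (by positivity) h1 2).trans (le_of_eq ?_)
    rw [div_pow, one_pow, Real.sq_sqrt hn'.le]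
  have hpn : 1 / (n : ℝ) ≤ (p : ℝ) ^ 2 / n := by gcongr; nlinarith
  have hpn1 : (p : ℝ) * (1 / n) ≤ (p : ℝ) ^ 2 / n := by
    rw [mul_one_div]
    gcongr
    nlinarith
  -- `x ≤ (x + 1) ^ 2` for `x ≥ 0` avoids a square root in the constant.
  have hτ : D * (6 + 4 * Cβ) * ((p : ℝ) ^ 2 / n) ≤ ((D * (6 + 4 * Cβ) + 1) * (p / √n)) ^ 2 := by
    rw [mul_pow, div_pow, Real.sq_sqrt hn'.le]
    refine mul_le_mul_of_nonneg_right ?_ (by positivity)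
    have : 0 ≤ D * (6 + 4 * Cβ) := by positivity
    nlinarith
  have hq : 0 ≤ (p : ℝ) ^ 2 / n := by positivity
  refine ⟨isSymm_gramHat .., hg.design.gramHat_nonneg hK hc hn hh hw hm, ⟨_, fun b => by
    rw [hS]; exact hg.design.criterion_eq hK hc hn hh hw hm b⟩, ?_, ?_⟩
  · refine le_trans ?_ hτ
    have h1 : ∀ i j, (Matrix.of (gramHat K h w m X e) i j - LinODE.gram (w 0) (fun j => m j 0) i j) ^ 2 ≤
        2 * linGram w m X e i j ^ 2 + 2 * gramRem K h w m X e i j ^ 2 := by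
      intro i j
      refine le_trans (le_of_eq ?_) (sq_add_le_two_mul _ _)
      rw [gramRem, of_apply]
      ring
    refine (Finset.sum_le_sum fun i _ => Finset.sum_le_sum fun j _ => h1 i j).trans ?_
    simp only [Finset.sum_add_distrib, ← Finset.mul_sum]
    have h2 : ∑ i, ∑ j, gramRem K h w m X e i j ^ 2 ≤ remSq K h w m X e := by
      rw [remSq_eq]
      exact le_add_of_nonneg_right (Finset.sum_nonneg fun _ _ => sq_nonneg _)
    have h3 := hg.gram
    have h4 := mul_le_mul_of_nonneg_left hpn hD
    have h5 : 0 ≤ D * Cβ * ((p : ℝ) ^ 2 / n) := by positivity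
    have h6 : 0 ≤ D * ((p : ℝ) ^ 2 / n) := by positivity
    linarith
  · refine le_trans ?_ hτ
    have h1 : ∀ i, (crossHat K h w m X e i - (Matrix.of (gramHat K h w m X e) *ᵥ β) i) ^ 2 ≤
        2 * linErr w m β X e i ^ 2 +
          2 * (crossRem K h w m X e i - ∑ j, gramRem K h w m X e i j * β j) ^ 2 := by
      intro i
      rw [normalErr_eq hβ]
      exact sq_add_le_two_mul _ _
    refine (Finset.sum_le_sum fun i _ => h1 i).trans ?_
    simp only [Finset.sum_add_distrib, ← Finset.mul_sum]
    have h2 := sum_sq_combined_rem_le (K := K) (h := h) (w := w) (m := m) (X := X) (e := e) (β := β)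
    have h3 := hg.err
    have h0 : 0 ≤ remSq K h w m X e := by
      rw [remSq_eq]
      exact add_nonneg (Finset.sum_nonneg fun _ _ => Finset.sum_nonneg fun _ _ => sq_nonneg _)
        (Finset.sum_nonneg fun _ _ => sq_nonneg _)
    have h4 : 2 * (1 + ∑ j, β j ^ 2) * remSq K h w m X e ≤
        2 * (1 + Cβ * p) * (D * (1 / n)) := by
      have : 0 ≤ ∑ j, β j ^ 2 := Finset.sum_nonneg fun _ _ => sq_nonneg _
      gcongr
    have h5 := mul_le_mul_of_nonneg_left hpn hD
    have h6 := mul_le_mul_of_nonneg_left hpn1 (mul_nonneg hD hCβ)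
    linarith

end SampleEst

section SampleEstSequence

variable {Ω : ℕ → Type*} [∀ n, MeasurableSpace (Ω n)] {P : ∀ n, Measure (Ω n)} {p : ℕ → ℕ}
  [∀ n, NeZero (p n)] {K : ℝ → ℝ} {T : Matrix (Fin 4) (Fin 4) ℝ} {B c₀ C₁ L M Cβ a : ℝ}
  {h lam : ℕ → ℝ} {w : ℕ → ℝ → ℝ} {m : ∀ n, Fin (p n) → ℕ → ℝ → ℝ}
  {Z : ∀ n, Ω n → (Fin n → ℝ) × (Fin n × Fin (p n) → ℝ)}
  {β : ∀ n, EuclideanSpace ℝ (Fin (p n))} {S : ∀ n, Ω n → EuclideanSpace ℝ (Fin (p n)) → ℝ}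

theorem tightEvents_estGood (hc : 0 < c₀) (hA : TightEvents P fun D n =>
      {ω | SampleGood K c₀ C₁ (h n) w (m n) (β n) D (Z n ω).1 (Z n ω).2})
    (hK : EquivKernelData K T B) (hE : BandwidthCondition h p) (hw : WeightFun L w)
    (hm : ∀ n j, SmoothFun M (m n j))
    (hβ : ∀ n, (gram (w 0) fun j => m n j 0).mulVec (β n) = crossMoment w (m n))
    (hCβ : 0 ≤ Cβ) (hβ2 : ∀ n, ∑ j, β n j ^ 2 ≤ Cβ * p n)
    (hS : ∀ n, ∀ᵐ ω ∂P n, S n ω = criterion K (h n) (w 0) a (lam n) (Z n ω).1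
      (fun t j => m n j 0 ((Z n ω).1 t) + (Z n ω).2 (t, j))) :
    TightEvents P fun D n => {ω | EstGood (gram (w 0) fun j => m n j 0)
      (Matrix.of (gramHat K (h n) w (m n) (Z n ω).1 (Z n ω).2))
      (crossHat K (h n) w (m n) (Z n ω).1 (Z n ω).2) (β n) (S n ω) a (lam n)
      (D * (p n / √n))} := by
  have hS' : WithProbTendingToOne P fun n => {ω | S n ω = criterion K (h n) (w 0) a (lam n)
      (Z n ω).1 (fun t j => m n j 0 ((Z n ω).1 t) + (Z n ω).2 (t, j))} := by
    refine tendsto_const_nhds.congr fun n => ?_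
    exact (ae_iff.1 (hS n)).symm
  refine (hA.inter (TightEvents.of_wpt hS')).mono_set (fun D D' h0 hDD => ?_) fun D hD => ?_
  · refine .of_forall fun n ω hω => ⟨hω.symm, hω.nonneg, hω.crit, hω.gram.trans ?_,
      hω.err.trans ?_⟩ <;> gcongr
  · refine ⟨D * (6 + 4 * Cβ) + 1, by positivity, ?_⟩
    filter_upwards [hE.tendsto_dim.eventually_lt_const zero_lt_one, eventually_gt_atTop 0]
      with n h1 hn ω hω
    exact SampleGood.estGood hω.1 hK hc hn (hE.pos n) hw (hm n) (hβ n) hD hCβ (hβ2 n) h1.le hω.2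

end SampleEstSequence

/-! ### A central limit theorem for linear statistics -/

section CLT

theorem abs_exp_neg_sub_exp_neg_le {x y : ℝ} (hx : 0 ≤ x) (hy : 0 ≤ y) :
    |Real.exp (-x) - Real.exp (-y)| ≤ |x - y| := by
  wlog hxy : x ≤ y generalizing x y
  · rw [abs_sub_comm, abs_sub_comm x]
    exact this hy hx (not_le.1 hxy).le
  have h1 : Real.exp (-y) = Real.exp (-x) * Real.exp (-(y - x)) := by
    rw [← Real.exp_add]; congr 1; ring
  have h2 := Real.one_sub_le_exp_neg (y - x)
  have h3 : Real.exp (-x) ≤ 1 := Real.exp_le_one_iff.2 (by linarith)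
  have h4 : Real.exp (-(y - x)) ≤ 1 := Real.exp_le_one_iff.2 (by linarith)
  rw [h1, abs_of_nonneg (by nlinarith [Real.exp_pos (-x)]), abs_of_nonpos (by linarith)]
  nlinarith [Real.exp_pos (-x)]

theorem norm_cexp_sub_cexp_le (a b : ℝ) :
    ‖Complex.exp (a * Complex.I) - Complex.exp (b * Complex.I)‖ ≤ |a - b| := by
  have h1 : Complex.exp (a * Complex.I) - Complex.exp (b * Complex.I) =
      Complex.exp (b * Complex.I) * (Complex.exp (Complex.I * (a - b : ℝ)) - 1) := by
    rw [mul_sub, ← Complex.exp_add, mul_one]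
    congr 2
    push_cast
    ring
  rw [h1, norm_mul, Complex.norm_exp_ofReal_mul_I, one_mul]
  exact Real.norm_exp_I_mul_ofReal_sub_one_le

variable {n p : ℕ}

theorem integral_cexp_linStat_noise (σ s : ℝ) (F : Fin p → ℝ → ℝ) (X : Fin n → ℝ) :
    ∫ e, Complex.exp (s * (linStat F X e : ℝ) * Complex.I) ∂noiseLaw σ (Fin n × Fin p) =
      Complex.exp (-(s ^ 2 * ((n : ℝ)⁻¹ * ∑ t, σ ^ 2 / n * ∑ l, F l (X t) ^ 2) / 2 : ℝ)) := by
  simp_rw [linStat_eq_sum]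
  rw [integral_cexp_noise, Fintype.sum_prod_type]
  congr 5
  rw [← Finset.mul_sum]
  simp_rw [mul_pow, ← Finset.mul_sum]
  ring

/-- Quantitative central limit theorem for a linear statistic with Gaussian noise. -/
theorem norm_integral_cexp_linStat_sub_le (σ s : ℝ) {F : Fin p → ℝ → ℝ}
    (hF : ∀ l, Continuous (F l)) {B : ℝ} (hB : ∀ x ∈ Ioo (0 : ℝ) 1, ∑ l, F l x ^ 2 ≤ B)
    (hn : 0 < n) (h1 : σ ^ 2 / n * ∫ x in (0 : ℝ)..1, ∑ l, F l x ^ 2 = 1) :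
    ‖∫ q, Complex.exp (s * (linStat F q.1 q.2 : ℝ) * Complex.I)
        ∂(designLaw n).prod (noiseLaw σ (Fin n × Fin p)) - Complex.exp (-(s ^ 2 / 2 : ℝ))‖ ≤
      s ^ 2 / 2 * √(σ ^ 2 * B / n ^ 2) := by
  have hn' : (0 : ℝ) < n := by exact_mod_cast hn
  set φ : ℝ → ℝ := fun x => σ ^ 2 / n * ∑ l, F l x ^ 2 with hφ
  have hφc : Continuous φ := by fun_prop
  have hφ0 : ∀ x, 0 ≤ φ x := fun x => by positivity
  have hφB : ∀ x ∈ Ioo (0 : ℝ) 1, φ x ≤ σ ^ 2 / n * B := fun x hx =>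
    mul_le_mul_of_nonneg_left (hB x hx) (by positivity)
  have hφ1 : ∫ x in (0 : ℝ)..1, φ x = 1 := by
    rw [hφ, intervalIntegral.integral_const_mul, h1]
  -- `v X` is the variance of the statistic given the design. The conditional characteristic
  -- function is exactly `exp (-s² v X / 2)`, so only the deviation of `v` from its mean 1 matters.
  set v : (Fin n → ℝ) → ℝ := fun X => (n : ℝ)⁻¹ * ∑ t, φ (X t) with hv
  have hv0 : ∀ X, 0 ≤ v X := fun X => by
    rw [hv]
    exact mul_nonneg (by positivity) (Finset.sum_nonneg fun t _ => hφ0 _)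
  have hvc : Continuous v := by fun_prop
  have hφL : MemLp φ 2 unifLaw := memLp_unifLaw hφc.measurable (M := σ ^ 2 / n * B) fun x hx => by
    rw [abs_of_nonneg (hφ0 x)]
    exact hφB x hx
  have hvL : MemLp (fun X => v X - 1) 2 (designLaw n) := by
    refine MemLp.sub ?_ (memLp_const _)
    refine MemLp.const_mul ?_ _
    exact memLp_finsetSum _ fun i _ =>
      hφL.comp_measurePreserving (measurePreserving_eval (fun _ : Fin n => unifLaw) i)
  have hcont : Continuous fun q : (Fin n → ℝ) × (Fin n × Fin p → ℝ) =>
      Complex.exp (s * (linStat F q.1 q.2 : ℝ) * Complex.I) := by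
    have := continuous_linStat (n := n) hF
    fun_prop
  have hint : Integrable (fun q : (Fin n → ℝ) × (Fin n × Fin p → ℝ) =>
      Complex.exp (s * (linStat F q.1 q.2 : ℝ) * Complex.I))
      ((designLaw n).prod (noiseLaw σ (Fin n × Fin p))) := by
    refine Integrable.of_bound hcont.aestronglyMeasurable 1 (.of_forall fun q => ?_)
    rw [← Complex.ofReal_mul, Complex.norm_exp_ofReal_mul_I]
  have h2 : ∫ q, Complex.exp (s * (linStat F q.1 q.2 : ℝ) * Complex.I)
        ∂(designLaw n).prod (noiseLaw σ (Fin n × Fin p)) =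
      ((∫ X, Real.exp (-(s ^ 2 * v X / 2)) ∂designLaw n : ℝ) : ℂ) := by
    rw [integral_prod _ hint, ← integral_complex_ofReal]
    refine integral_congr_ae (.of_forall fun X => ?_)
    simp only
    rw [integral_cexp_linStat_noise, ← Complex.ofReal_neg, Complex.ofReal_exp]
  have hint2 : Integrable (fun X => Real.exp (-(s ^ 2 * v X / 2))) (designLaw n) := by
    refine Integrable.of_bound (by fun_prop) 1 (.of_forall fun X => ?_)
    rw [Real.norm_of_nonneg (Real.exp_pos _).le, Real.exp_le_one_iff]
    have := hv0 X
    rw [Left.neg_nonpos_iff]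
    positivity
  have h3 : ∫ X, Real.exp (-(s ^ 2 * v X / 2)) ∂designLaw n - Real.exp (-(s ^ 2 / 2)) =
      ∫ X, (Real.exp (-(s ^ 2 * v X / 2)) - Real.exp (-(s ^ 2 / 2))) ∂designLaw n := by
    rw [integral_sub hint2 (integrable_const _)]
    simp
  have h4 : ∫ X, |v X - 1| ∂designLaw n ≤ √(σ ^ 2 * B / n ^ 2) := by
    refine Real.le_sqrt_of_sq_le ?_
    have h5 := variance_nonneg (fun X => |v X - 1|) (designLaw n)
    have h6 : MemLp (fun X => |v X - 1|) 2 (designLaw n) := hvL.norm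
    rw [variance_eq_sub h6] at h5
    simp only [Pi.pow_apply, sq_abs] at h5
    refine (sub_nonneg.1 h5).trans ?_
    have h7 := lintegral_sq_sampleMean_le (n := n) hφc.measurable (M := σ ^ 2 / n * B)
      fun x hx => by rw [abs_of_nonneg (hφ0 x)]; exact hφB x hx
    rw [if_neg hn.ne', add_zero, hφ1, ← ofReal_integral_eq_lintegral_ofReal hvL.integrable_sq
      (.of_forall fun _ => sq_nonneg _)] at h7
    -- `∫ φ² ≤ sup φ * ∫ φ` and `∫ φ = 1`; no fourth moments of the influence functions are needed.
    have h8 : ∫ y in (0 : ℝ)..1, φ y ^ 2 ≤ σ ^ 2 / n * B := by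
      calc ∫ y in (0 : ℝ)..1, φ y ^ 2 ≤ ∫ y in (0 : ℝ)..1, (σ ^ 2 / n * B) * φ y := by
            refine intervalIntegral.integral_mono_on_of_le_Ioo zero_le_one
              (Continuous.intervalIntegrable (by fun_prop) _ _)
              (Continuous.intervalIntegrable (by fun_prop) _ _) fun x hx => ?_
            rw [sq]
            exact mul_le_mul_of_nonneg_right (hφB x hx) (hφ0 x)
        _ = _ := by rw [intervalIntegral.integral_const_mul, hφ1, mul_one]
    have h9 : 0 ≤ ∫ y in (0 : ℝ)..1, φ y ^ 2 :=
      intervalIntegral.integral_nonneg zero_le_one fun _ _ => sq_nonneg _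
    rw [ENNReal.ofReal_le_ofReal_iff (by positivity)] at h7
    refine h7.trans ?_
    calc (n : ℝ)⁻¹ * ∫ y in (0 : ℝ)..1, φ y ^ 2 ≤ (n : ℝ)⁻¹ * (σ ^ 2 / n * B) := by gcongr
      _ = _ := by ring
  rw [h2, ← Complex.ofReal_neg, ← Complex.ofReal_exp, ← Complex.ofReal_sub, Complex.norm_real, h3]
  calc ‖∫ X, (Real.exp (-(s ^ 2 * v X / 2)) - Real.exp (-(s ^ 2 / 2))) ∂designLaw n‖
      ≤ ∫ X, ‖Real.exp (-(s ^ 2 * v X / 2)) - Real.exp (-(s ^ 2 / 2))‖ ∂designLaw n :=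
        norm_integral_le_integral_norm _
    _ ≤ ∫ X, s ^ 2 / 2 * |v X - 1| ∂designLaw n := by
        refine integral_mono (hint2.sub (integrable_const _)).norm
          ((hvL.integrable one_le_two).abs.const_mul _) fun X => ?_
        have := hv0 X
        refine (abs_exp_neg_sub_exp_neg_le (by positivity) (by positivity)).trans (le_of_eq ?_)
        rw [show s ^ 2 * v X / 2 - s ^ 2 / 2 = s ^ 2 / 2 * (v X - 1) by ring, abs_mul,
          abs_of_nonneg (by positivity : (0 : ℝ) ≤ s ^ 2 / 2)]
    _ ≤ _ := by
        rw [integral_const_mul]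
        gcongr

variable {Ω : ℕ → Type*} [∀ n, MeasurableSpace (Ω n)] {P : ∀ n, Measure (Ω n)}
  [∀ n, IsProbabilityMeasure (P n)]

/-- The exponentials differ by at most `|s| * δ` where `Z` and `Y` are `δ`-close, and by at most 2
elsewhere. -/
theorem norm_integral_cexp_sub_le {Ω : Type*} [MeasurableSpace Ω] {P : Measure Ω}
    [IsProbabilityMeasure P] {Z Y : Ω → ℝ} (hZ : AEMeasurable Z P) (hY : AEMeasurable Y P) (s : ℝ)
    {δ : ℝ} (hδ : 0 ≤ δ) :
    ‖∫ ω, Complex.exp (s * Z ω * Complex.I) ∂P - ∫ ω, Complex.exp (s * Y ω * Complex.I) ∂P‖ ≤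
      |s| * δ + 2 * (P {ω | |Z ω - Y ω| ≤ δ}ᶜ).toReal := by
  -- The exceptional set is replaced by a measurable set of the same probability, to be used in an
  -- indicator.
  set N := toMeasurable P {ω | |Z ω - Y ω| ≤ δ}ᶜ with hN
  have hNm : MeasurableSet N := measurableSet_toMeasurable _ _
  have hint : ∀ W : Ω → ℝ, AEMeasurable W P →
      Integrable (fun ω => Complex.exp (s * W ω * Complex.I)) P := fun W hW => by
    refine Integrable.of_bound ?_ 1 (.of_forall fun ω => ?_)
    · have h1 : Continuous fun x : ℝ => Complex.exp (s * x * Complex.I) := by fun_prop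
      exact (h1.measurable.comp_aemeasurable hW).aestronglyMeasurable
    · rw [← Complex.ofReal_mul, Complex.norm_exp_ofReal_mul_I]
  have hi : Integrable (fun ω => |s| * δ + N.indicator (fun _ => (2 : ℝ)) ω) P :=
    (integrable_const _).add ((integrable_const _).indicator hNm)
  rw [← integral_sub (hint Z hZ) (hint Y hY)]
  calc _ ≤ ∫ ω, (|s| * δ + N.indicator (fun _ => (2 : ℝ)) ω) ∂P := by
        refine norm_integral_le_of_norm_le hi (.of_forall fun ω => ?_)
        by_cases hω : ω ∈ N
        · rw [indicator_of_mem hω]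
          refine (norm_sub_le _ _).trans ?_
          rw [← Complex.ofReal_mul, ← Complex.ofReal_mul, Complex.norm_exp_ofReal_mul_I,
            Complex.norm_exp_ofReal_mul_I]
          have : 0 ≤ |s| * δ := by positivity
          linarith
        · rw [indicator_of_notMem hω, add_zero, ← Complex.ofReal_mul, ← Complex.ofReal_mul]
          have h1 : |Z ω - Y ω| ≤ δ := by
            by_contra h
            exact hω (subset_toMeasurable _ _ h)
          refine (norm_cexp_sub_cexp_le _ _).trans ?_
          rw [← mul_sub, abs_mul]
          gcongr
    _ = _ := by
        rw [integral_add (integrable_const _) ((integrable_const _).indicator hNm),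
          integral_indicator hNm, setIntegral_const, integral_const, probReal_univ, one_smul,
          measureReal_def, hN, measure_toMeasurable, smul_eq_mul, mul_comm _ (2 : ℝ)]

/-- Convergence in distribution to the standard normal law, from the convergence of the
characteristic functions of an approximating sequence. -/
theorem tendstoInDistribution_of_charFun {Z Y : ∀ n, Ω n → ℝ} (hZ : ∀ n, AEMeasurable (Z n) (P n))
    (hY : ∀ n, AEMeasurable (Y n) (P n))
    (hZY : ∀ δ > 0, WithProbTendingToOne P fun n => {ω | |Z n ω - Y n ω| ≤ δ})
    (hchar : ∀ s : ℝ, Tendsto (fun n => ∫ ω, Complex.exp (s * Y n ω * Complex.I) ∂P n) atTop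
      (𝓝 (Complex.exp (-(s ^ 2 / 2 : ℝ))))) :
    TendstoInDistribution Z atTop (id : ℝ → ℝ) P (gaussianReal 0 1) where
  forall_aemeasurable := hZ
  tendsto := by
    refine ProbabilityMeasure.tendsto_iff_tendsto_charFun.2 fun s => ?_
    have h1 : charFun ((gaussianReal 0 1).map id) s = Complex.exp (-(s ^ 2 / 2 : ℝ)) := by
      rw [Measure.map_id, charFun_gaussianReal]
      congr 1
      push_cast
      simp
    have h2 : ∀ n, charFun ((P n).map (Z n)) s =
        ∫ ω, Complex.exp (s * Z n ω * Complex.I) ∂P n := by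
      intro n
      rw [charFun_apply_real, integral_map (hZ n)
        (Continuous.aestronglyMeasurable (by fun_prop))]
    simp only [ProbabilityMeasure.coe_mk]
    rw [h1]
    simp_rw [h2]
    have h3 : Tendsto (fun n => ∫ ω, Complex.exp (s * Z n ω * Complex.I) ∂P n -
        ∫ ω, Complex.exp (s * Y n ω * Complex.I) ∂P n) atTop (𝓝 0) := by
      refine NormedAddGroup.tendsto_nhds_zero.2 fun ε hε => ?_
      have h4 : 0 < ε / (2 * (|s| + 1)) := by positivity
      have h5 := (ENNReal.tendsto_toReal ENNReal.zero_ne_top).comp (hZY _ h4)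
      filter_upwards [h5.eventually_lt_const (u := ε / 4) (by simpa using hε)] with n hn
      refine (norm_integral_cexp_sub_le (hZ n) (hY n) s h4.le).trans_lt ?_
      have h6 : |s| * (ε / (2 * (|s| + 1))) ≤ ε / 2 := by
        rw [mul_div_assoc', div_le_div_iff₀ (by positivity) (by positivity)]
        nlinarith [abs_nonneg s]
      simp only [Function.comp_apply] at hn
      linarith
    simpa using h3.add (hchar s)

end CLT

/-! ### The influence functions and the linear functional -/

section Influence

open Matrix

variable {n p k : ℕ} [NeZero p] {K : ℝ → ℝ} {h L M : ℝ} {w : ℕ → ℝ → ℝ} {m : Fin p → ℕ → ℝ → ℝ}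
  {X : Fin n → ℝ} {e : Fin n × Fin p → ℝ} {ι : Fin k → Fin p}

/-- The matrix `[b, Q]` of the linear terms. -/
noncomputable def linMatrix (w : ℕ → ℝ → ℝ) (m : Fin p → ℕ → ℝ → ℝ) (ι : Fin k → Fin p)
    (X : Fin n → ℝ) (e : Fin n × Fin p → ℝ) : Matrix (Fin k) (Unit ⊕ Fin k) ℝ :=
  Matrix.of fun i c => Sum.elim (fun _ => linCross w m X e (ι i))
    (fun j => linGram w m X e (ι i) (ι j)) c

/-- The matrix `[b, Q]` of the remainders. -/
noncomputable def remMatrix (K : ℝ → ℝ) (h : ℝ) (w : ℕ → ℝ → ℝ) (m : Fin p → ℕ → ℝ → ℝ)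
    (ι : Fin k → Fin p) (X : Fin n → ℝ) (e : Fin n × Fin p → ℝ) :
    Matrix (Fin k) (Unit ⊕ Fin k) ℝ :=
  Matrix.of fun i c => Sum.elim (fun _ => crossRem K h w m X e (ι i))
    (fun j => gramRem K h w m X e (ι i) (ι j)) c

omit [NeZero p] in
theorem linGram_comm (i j : Fin p) : linGram w m X e i j = linGram w m X e j i := by
  rw [linGram, linGram, add_comm]

omit [NeZero p] in
theorem gramRem_comm (i j : Fin p) : gramRem K h w m X e i j = gramRem K h w m X e j i := by
  have h1 := (isSymm_gramHat K h w m X e).apply j i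
  have h2 := (isSymm_gram (w 0) fun j => m j 0).apply j i
  simp only [of_apply] at h1
  rw [gramRem, gramRem, linGram_comm, h1, h2]

theorem sum_comp_le_of_injective {α κ : Type*} [Fintype α] [Fintype κ] {ι : κ → α}
    (hι : Function.Injective ι) {f : α → ℝ} (hf : ∀ i, 0 ≤ f i) : ∑ i, f (ι i) ≤ ∑ i, f i := by
  refine (Finset.sum_map Finset.univ (⟨ι, hι⟩ : κ ↪ α) f).symm.trans_le ?_
  exact Finset.sum_le_sum_of_subset_of_nonneg (Finset.subset_univ _) fun i _ _ => hf i

theorem vech_sq_sum_le {q : ℕ} (C : Matrix (Fin q) (Unit ⊕ Fin q) ℝ) :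
    vech C ⬝ᵥ vech C ≤ ∑ i, C i (Sum.inl ()) ^ 2 + ∑ i, ∑ j, C i (Sum.inr j) ^ 2 := by
  rw [dotProduct, Fintype.sum_sum_type]
  simp only [vech, ← sq]
  gcongr
  rw [← Fintype.sum_prod_type' fun i j => C i (Sum.inr j) ^ 2]
  exact sum_comp_le_of_injective Subtype.val_injective
    (f := fun ij : Fin q × Fin q => C ij.1 (Sum.inr ij.2) ^ 2) fun _ => sq_nonneg _

theorem remMatrix_vech_le (hι : Function.Injective ι) :
    vech (remMatrix K h w m ι X e) ⬝ᵥ vech (remMatrix K h w m ι X e) ≤ remSq K h w m X e := by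
  have hsum := fun f => sum_comp_le_of_injective hι (f := f)
  refine (vech_sq_sum_le _).trans ?_
  rw [remSq_eq, add_comm]
  simp only [remMatrix, of_apply, Sum.elim_inl, Sum.elim_inr]
  refine add_le_add ?_ (hsum (fun i => crossRem K h w m X e i ^ 2) fun _ => sq_nonneg _)
  refine (Finset.sum_le_sum fun i _ => hsum (fun j => gramRem K h w m X e (ι i) j ^ 2)
    fun _ => sq_nonneg _).trans ?_
  exact hsum (fun i => ∑ j, gramRem K h w m X e i j ^ 2) fun _ =>
    Finset.sum_nonneg fun _ _ => sq_nonneg _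

section Smooth

variable (hw : WeightFun L w) (hm : ∀ j, SmoothFun M (m j))
include hw hm

theorem infl_inl_eq (i : Fin k) (l : Fin p) (x : ℝ) :
    infl (w 0) (fun j => m j 0) ι (Sum.inl i) l x =
      (if l = ι i then weighted w (fun d => m 0 (d + 1)) 0 x else 0)
        - if l = 0 then weighted w (m (ι i)) 1 x else 0 := by
  have h1 : deriv (m 0 0) x = m 0 1 x := ((hm 0).hasDerivAt 0 (by omega) x).deriv
  have h2 : deriv (fun y => m (ι i) 0 y * w 0 y) x = weighted w (m (ι i)) 1 x :=
    (((hm (ι i)).testFun hw).hasDerivAt 0 (by omega) x).deriv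
  rw [infl, h1, h2]
  rfl

omit hw hm in
theorem infl_inr_eq (ij : {ij : Fin k × Fin k // ij.2 ≤ ij.1}) (l : Fin p) (x : ℝ) :
    infl (w 0) (fun j => m j 0) ι (Sum.inr ij) l x =
      (if l = ι ij.1.2 then weighted w (m (ι ij.1.1)) 0 x else 0)
        + if l = ι ij.1.1 then weighted w (m (ι ij.1.2)) 0 x else 0 := by
  rw [infl, add_mul, ite_mul, ite_mul, zero_mul]
  rfl

/-- This identifies the functions `infl`, through which the covariance `G` is defined, with the
influence functions found in the linearization of the plug-in estimators. -/
theorem linStat_infl (a : VechIdx k) :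
    linStat (infl (w 0) (fun j => m j 0) ι a) X e = vech (linMatrix w m ι X e) a := by
  rcases a with i | ij
  · have : infl (w 0) (fun j => m j 0) ι (Sum.inl i) = fun l x =>
      (if l = ι i then weighted w (fun d => m 0 (d + 1)) 0 x else 0)
        - if l = 0 then weighted w (m (ι i)) 1 x else 0 := by
      ext l x; exact infl_inl_eq hw hm i l x
    rw [this, ← linCross_eq_linStat]
    rfl
  · have : infl (w 0) (fun j => m j 0) ι (Sum.inr ij) = fun l x =>
      (if l = ι ij.1.2 then weighted w (m (ι ij.1.1)) 0 x else 0)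
        + if l = ι ij.1.1 then weighted w (m (ι ij.1.2)) 0 x else 0 := by
      ext l x; exact infl_inr_eq ij l x
    rw [this, ← linGram_eq_linStat]
    rfl

/-- The influence functions of a linear combination of the entries of `vech [b, Q]`. -/
noncomputable def combInfl (w : ℕ → ℝ → ℝ) (m : Fin p → ℕ → ℝ → ℝ) (ι : Fin k → Fin p)
    (c : VechIdx k → ℝ) (l : Fin p) (x : ℝ) : ℝ :=
  ∑ a, c a * infl (w 0) (fun j => m j 0) ι a l x

theorem linStat_combInfl (c : VechIdx k → ℝ) :
    linStat (combInfl w m ι c) X e = c ⬝ᵥ vech (linMatrix w m ι X e) := by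
  rw [dotProduct]
  simp_rw [← linStat_infl hw hm, linStat_eq_sum, combInfl, Finset.mul_sum, Finset.sum_mul]
  rw [Finset.sum_comm]
  refine Finset.sum_congr rfl fun a _ => Finset.sum_congr rfl fun s _ => by ring

theorem continuous_infl (a : VechIdx k) (l : Fin p) :
    Continuous (infl (w 0) (fun j => m j 0) ι a l) := by
  have hφ : ∀ i, TestFun (max M (4 * M * L)) (w 0) (weighted w (m i)) := fun i => (hm i).testFun hw
  have hc0 : ∀ i, Continuous (weighted w (m i) 0) := fun i => (hφ i).continuous (by omega)
  have hc1 : ∀ i, Continuous (weighted w (m i) 1) := fun i => (hφ i).continuous (by omega)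
  rcases a with i | ij
  · rw [funext (infl_inl_eq hw hm i l)]
    have hc2 : Continuous (weighted w (fun d => m 0 (d + 1)) 0) :=
      ((hm 0).continuous (by omega)).mul (hw.continuous (by omega))
    split_ifs <;> fun_prop
  · rw [funext (infl_inr_eq ij l)]
    split_ifs <;> fun_prop

theorem continuous_combInfl (c : VechIdx k → ℝ) (l : Fin p) : Continuous (combInfl w m ι c l) :=
  continuous_finsetSum _ fun a _ => (continuous_infl hw hm a l).const_mul _

/-- The noise of at most two variables enters each entry, so the bound does not depend on `p`. -/
theorem sum_sq_infl_le (a : VechIdx k) {x : ℝ} (hx : x ∈ Ioo (0 : ℝ) 1) :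
    ∑ l, infl (w 0) (fun j => m j 0) ι a l x ^ 2 ≤ 4 * max M (4 * M * L) ^ 2 := by
  have hM := (hm 0).nonneg_bound
  have hL := hw.nonneg_bound
  have hφ : ∀ i, TestFun (max M (4 * M * L)) (w 0) (weighted w (m i)) := fun i => (hm i).testFun hw
  have hb : ∀ d ≤ 2, ∀ i, weighted w (m i) d x ^ 2 ≤ max M (4 * M * L) ^ 2 := fun d hd i => by
    rw [← sq_abs]
    exact pow_le_pow_left₀ (abs_nonneg _) ((hφ i).bound d hd x) 2
  have hb' : weighted w (fun d => m 0 (d + 1)) 0 x ^ 2 ≤ max M (4 * M * L) ^ 2 := by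
    rw [← sq_abs]
    refine pow_le_pow_left₀ (abs_nonneg _) ?_ 2
    calc |m 0 1 x * w 0 x| ≤ M * L := by
          rw [abs_mul]
          exact mul_le_mul ((hm 0).bound 1 (by omega) x (Ioo_subset_Icc_self hx))
            (hw.bound 0 (by omega) x) (abs_nonneg _) hM
      _ ≤ 4 * M * L := by nlinarith [mul_nonneg hM hL]
      _ ≤ _ := le_max_right _ _
  have h0 : ∀ (i j : Fin p) (u v : ℝ), u ^ 2 ≤ max M (4 * M * L) ^ 2 →
      v ^ 2 ≤ max M (4 * M * L) ^ 2 →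
      ∑ l, ((if l = i then u else 0) + if l = j then v else 0) ^ 2 ≤ 4 * max M (4 * M * L) ^ 2 := by
    intro i j u v hu hv
    refine (Finset.sum_le_sum fun l _ => sq_add_le_two_mul _ _).trans ?_
    simp only [ite_pow, ne_eq, OfNat.ofNat_ne_zero, not_false_eq_true, zero_pow,
      Finset.sum_add_distrib, ← Finset.mul_sum, Finset.sum_ite_eq', Finset.mem_univ, if_true]
    linarith
  rcases a with i | ij
  · have h1 := h0 (ι i) 0 (weighted w (fun d => m 0 (d + 1)) 0 x) (-weighted w (m (ι i)) 1 x) hb'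
      (by rw [neg_sq]; exact hb 1 (by omega) _)
    refine le_trans (le_of_eq (Finset.sum_congr rfl fun l _ => ?_)) h1
    rw [infl_inl_eq hw hm]
    split_ifs <;> ring
  · simp_rw [infl_inr_eq]
    exact h0 _ _ _ _ (hb 0 (by omega) _) (hb 0 (by omega) _)

/-- Cauchy–Schwarz over the entries of `vech`, of which there are at most `2 * p ^ 2`. -/
theorem sum_sq_combInfl_le (c : VechIdx k → ℝ) (hk : k ≤ p) {x : ℝ} (hx : x ∈ Ioo (0 : ℝ) 1) :
    ∑ l, combInfl w m ι c l x ^ 2 ≤ 8 * max M (4 * M * L) ^ 2 * p ^ 2 * (c ⬝ᵥ c) := by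
  have hcard : (Fintype.card (VechIdx k) : ℝ) ≤ 2 * p ^ 2 := by
    have h1 : Fintype.card (VechIdx k) ≤ k + k * k := by
      rw [Fintype.card_sum, Fintype.card_fin]
      gcongr
      exact (Fintype.card_subtype_le _).trans (by simp)
    have h2 : k + k * k ≤ 2 * p ^ 2 := by
      have := NeZero.one_le (n := p)
      nlinarith
    exact_mod_cast h1.trans h2
  have hcc := dotProduct_self_nonneg' c
  calc ∑ l, combInfl w m ι c l x ^ 2
      ≤ ∑ l, (c ⬝ᵥ c) * ∑ a, infl (w 0) (fun j => m j 0) ι a l x ^ 2 := by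
        refine Finset.sum_le_sum fun l _ => ?_
        refine (Finset.sum_mul_sq_le_sq_mul_sq _ _ _).trans (le_of_eq ?_)
        simp [dotProduct, sq]
    _ = (c ⬝ᵥ c) * ∑ a, ∑ l, infl (w 0) (fun j => m j 0) ι a l x ^ 2 := by
        rw [← Finset.mul_sum, Finset.sum_comm]
    _ ≤ (c ⬝ᵥ c) * ∑ _a : VechIdx k, 4 * max M (4 * M * L) ^ 2 := by
        gcongr with a
        exact sum_sq_infl_le hw hm a hx
    _ = (c ⬝ᵥ c) * (Fintype.card (VechIdx k) * (4 * max M (4 * M * L) ^ 2)) := by simp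
    _ ≤ (c ⬝ᵥ c) * (2 * p ^ 2 * (4 * max M (4 * M * L) ^ 2)) := by gcongr
    _ = _ := by ring

theorem integral_sum_sq_combInfl (σ : ℝ) (c : VechIdx k → ℝ) :
    σ ^ 2 / n * ∫ x in (0 : ℝ)..1, ∑ l, combInfl w m ι c l x ^ 2 =
      c ⬝ᵥ asympCov n σ (w 0) (fun j => m j 0) ι *ᵥ c :=
  (dotProduct_asympCov_mulVec n σ (continuous_infl hw hm) c).symm

/-- Write `Q δ = Qh δ - (Qh - Q) δ` on the leading block. The first term is the error of the normal
equations, linear part plus remainder; `y` turns both into `c` applied to half-vectorizations, and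
the linear one is the statistic. What is left is at most `κ √remSq` from the remainder and `κ τ
|δ|`, with `|δ| ≤ 2 τ / ρ₁`, from the second term. -/
theorem abs_functional_sub_linStat_le (hk : k ≤ p) {β : EuclideanSpace ℝ (Fin p)}
    {S : EuclideanSpace ℝ (Fin p) → ℝ} {a lam τ ρ₁ ρ₂ κ : ℝ}
    (hQ : QuadBounds (gram (w 0) fun j => m j 0) ρ₁ ρ₂)
    (hE : EstGood (gram (w 0) fun j => m j 0) (Matrix.of (gramHat K h w m X e))
      (crossHat K h w m X e) β S a lam τ)
    (hτ : 0 ≤ τ) (hτ1 : τ ≤ ρ₁ / 2)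
    (hβ : gram (w 0) (fun j => m j 0) *ᵥ β = crossMoment w m)
    (hs : ∀ j : Fin p, k ≤ (j : ℕ) → β j = 0) {δ : Fin k → ℝ}
    (hδ : headBlock hk (Matrix.of (gramHat K h w m X e)) *ᵥ δ =
      headErr hk (Matrix.of (gramHat K h w m X e)) (crossHat K h w m X e) β)
    {y : Fin k → ℝ} {c : VechIdx k → ℝ} (hκ : 0 ≤ κ) (hcκ : c ⬝ᵥ c ≤ κ ^ 2) (hyκ : y ⬝ᵥ y ≤ κ ^ 2)
    (hyc : ∀ C : Matrix (Fin k) (Unit ⊕ Fin k) ℝ, (∀ i j, C i (Sum.inr j) = C j (Sum.inr i)) →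
        c ⬝ᵥ vech C = y ⬝ᵥ fun i => C i (Sum.inl ()) - ∑ j, C i (Sum.inr j) * head hk β j) :
    |y ⬝ᵥ headBlock hk (gram (w 0) fun j => m j 0) *ᵥ δ -
        linStat (combInfl w m (Fin.castLE hk) c) X e| ≤
      κ * √(remSq K h w m X e) + κ * (τ * (2 * τ / ρ₁)) := by
  set Q := gram (w 0) fun j => m j 0 with hQdef
  set Qh := Matrix.of (gramHat K h w m X e) with hQh
  have hρ := hQ.pos
  have hsum : ∀ f : Fin p → ℝ, ∑ j, f j * β j = ∑ j, f (Fin.castLE hk j) * head hk β j := by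
    intro f
    conv_lhs => rw [eq_padZero_head hk hs]
    exact sum_padZero hk (head hk β) (fun j x => f j * x) (by simp)
  have e1 : headErr hk Qh (crossHat K h w m X e) β = (fun i =>
      linMatrix w m (Fin.castLE hk) X e i (Sum.inl ()) -
        ∑ j, linMatrix w m (Fin.castLE hk) X e i (Sum.inr j) * head hk β j) + fun i =>
      remMatrix K h w m (Fin.castLE hk) X e i (Sum.inl ()) -
        ∑ j, remMatrix K h w m (Fin.castLE hk) X e i (Sum.inr j) * head hk β j := by
    ext i
    rw [headErr, hQh, normalErr_eq hβ, linErr, hsum, hsum]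
    rfl
  have e2 : headBlock hk Q *ᵥ δ = headErr hk Qh (crossHat K h w m X e) β -
      (headBlock hk Qh - headBlock hk Q) *ᵥ δ := by
    rw [← hδ, sub_mulVec, sub_sub_cancel]
  have e3 : y ⬝ᵥ headBlock hk Q *ᵥ δ - linStat (combInfl w m (Fin.castLE hk) c) X e =
      c ⬝ᵥ vech (remMatrix K h w m (Fin.castLE hk) X e) -
        y ⬝ᵥ (headBlock hk Qh - headBlock hk Q) *ᵥ δ := by
    rw [linStat_combInfl hw hm, hyc (linMatrix w m (Fin.castLE hk) X e) (fun i j => linGram_comm _ _),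
      hyc (remMatrix K h w m (Fin.castLE hk) X e) (fun i j => gramRem_comm _ _), e2,
      dotProduct_sub, e1, dotProduct_add]
    ring
  rw [e3]
  refine (abs_sub _ _).trans (add_le_add ?_ ?_)
  · refine abs_le_of_sq_le_sq ?_ (by positivity)
    have h0 : 0 ≤ remSq K h w m X e := (dotProduct_self_nonneg' _).trans
      (remMatrix_vech_le (Fin.castLE_injective hk))
    rw [mul_pow, Real.sq_sqrt h0]
    exact (sq_dotProduct_le _ _).trans (mul_le_mul hcκ
      (remMatrix_vech_le (Fin.castLE_injective hk)) (dotProduct_self_nonneg' _) (sq_nonneg _))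
  · refine abs_le_of_sq_le_sq ?_ (by positivity)
    rw [mul_pow]
    refine (sq_dotProduct_le _ _).trans (mul_le_mul hyκ ?_ (dotProduct_self_nonneg' _)
      (sq_nonneg _))
    refine (mulVec_dotProduct_self_le _ _).trans ?_
    rw [mul_pow]
    refine mul_le_mul ?_ (hE.dotProduct_self_le_of_headBlock hQ hτ hτ1 hk hδ)
      (dotProduct_self_nonneg' _) (sq_nonneg _)
    refine le_trans ?_ hE.gram
    have hsub := fun f => sum_comp_le_of_injective (Fin.castLE_injective hk) (f := f)
    refine (Finset.sum_le_sum fun i _ => hsub (fun j => (Qh (Fin.castLE hk i) j -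
      Q (Fin.castLE hk i) j) ^ 2) fun _ => sq_nonneg _).trans ?_
    exact hsub (fun i => ∑ j, (Qh i j - Q i j) ^ 2) fun _ =>
      Finset.sum_nonneg fun _ _ => sq_nonneg _

end Smooth

end Influence

/-! ### Asymptotic normality -/

section Normality

open Matrix

variable {Ω : ℕ → Type*} [∀ n, MeasurableSpace (Ω n)] {P : ∀ n, Measure (Ω n)}
  [∀ n, IsProbabilityMeasure (P n)] {p k : ℕ → ℕ} [∀ n, NeZero (p n)] {hk : ∀ n, k n ≤ p n}
  {K : ℝ → ℝ} {c₀ C₁ L M a σ : ℝ} {h lam ρ₁ ρ₂ r : ℕ → ℝ} {w : ℕ → ℝ → ℝ}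
  {m : ∀ n, Fin (p n) → ℕ → ℝ → ℝ}
  {Z : ∀ n, Ω n → (Fin n → ℝ) × (Fin n × Fin (p n) → ℝ)}
  {β : ∀ n, EuclideanSpace ℝ (Fin (p n))} {S : ∀ n, Ω n → EuclideanSpace ℝ (Fin (p n)) → ℝ}

/-- `ρ₁` is at most the first diagonal entry `∫ m₁² w`, which is bounded uniformly in `n`. -/
theorem QuadBounds.le_sq_mul {p : ℕ} [NeZero p] {m : Fin p → ℕ → ℝ → ℝ} {ρ₁ ρ₂ : ℝ}
    (hQ : QuadBounds (gram (w 0) fun j => m j 0) ρ₁ ρ₂) (hw : WeightFun L w)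
    (hm : ∀ j, SmoothFun M (m j)) : ρ₁ ≤ M * M * L := by
  have hM := (hm 0).nonneg_bound
  refine hQ.le_diag.trans ((le_abs_self _).trans ?_)
  have h1 := intervalIntegral.norm_integral_le_of_norm_le_const (a := 0) (b := 1)
    (f := fun x => m 0 0 x * m 0 0 x * w 0 x) (C := M * M * L) fun x hx => by
      rw [uIoc_of_le zero_le_one] at hx
      have h2 := (hm 0).bound 0 (by omega) x (Ioc_subset_Icc_self hx)
      rw [Real.norm_eq_abs, abs_mul, abs_mul]
      exact mul_le_mul (mul_le_mul h2 h2 (abs_nonneg _) hM) (hw.bound 0 (by omega) x)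
        (abs_nonneg _) (by positivity)
  simpa [gram] using h1

/-- As `ρ₁ ≤ R` and `p ≥ 1`, the quantity `p / √(n g)` is at most `R` times the expression that
tends to zero; the claim is about its square. It makes the conditional variance of the linear
statistic concentrate. -/
theorem tendsto_dim_sq_div {R : ℝ} {g : ℕ → ℝ} (hρ : ∀ n, 0 < ρ₁ n)
    (hR : ∀ n, ρ₁ n ≤ R) (hg : ∀ n, 0 < g n)
    (h : Tendsto (fun n : ℕ => (p n : ℝ) ^ 2 / (√(n : ℝ) * ρ₁ n * √(g n))) atTop (𝓝 0)) :
    Tendsto (fun n : ℕ => (p n : ℝ) ^ 2 * (n / g n) / n ^ 2) atTop (𝓝 0) := by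
  have h1 : Tendsto (fun n : ℕ => (R * ((p n : ℝ) ^ 2 / (√(n : ℝ) * ρ₁ n * √(g n)))) ^ 2) atTop
      (𝓝 0) := by
    simpa using (h.const_mul R).pow 2
  refine squeeze_zero' (.of_forall fun n => ?_) ?_ h1
  · have := hg n
    positivity
  filter_upwards [eventually_gt_atTop 0] with n hn
  have hn' : (0 : ℝ) < n := by exact_mod_cast hn
  have hgn := hg n
  have hρn := hρ n
  have hp : (1 : ℝ) ≤ p n := by exact_mod_cast NeZero.one_le
  have hs : 0 < √(n : ℝ) := Real.sqrt_pos.2 hn'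
  have hsg : 0 < √(g n) := Real.sqrt_pos.2 hgn
  have h2 : (p n : ℝ) / (√n * √(g n)) ≤ R * ((p n : ℝ) ^ 2 / (√(n : ℝ) * ρ₁ n * √(g n))) := by
    calc (p n : ℝ) / (√n * √(g n)) ≤ (p n : ℝ) ^ 2 / (√n * √(g n)) := by
          gcongr
          nlinarith
      _ = ρ₁ n * ((p n : ℝ) ^ 2 / (√(n : ℝ) * ρ₁ n * √(g n))) := by field_simp
      _ ≤ _ := by gcongr; exact hR n
  refine le_trans (le_of_eq ?_) (pow_le_pow_left₀ (by positivity) h2 2)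
  rw [div_pow, mul_pow, Real.sq_sqrt hn'.le, Real.sq_sqrt hgn.le]
  field_simp

/-- The asymptotic normality of the solution of the estimated normal equations. -/
theorem tendstoInDistribution_functional
    (hA : TightEvents P fun D n =>
      {ω | SampleGood K c₀ C₁ (h n) w (m n) (β n) D (Z n ω).1 (Z n ω).2})
    (hA' : TightEvents P fun D n => {ω | EstGood (gram (w 0) fun j => m n j 0)
      (Matrix.of (gramHat K (h n) w (m n) (Z n ω).1 (Z n ω).2))
      (crossHat K (h n) w (m n) (Z n ω).1 (Z n ω).2) (β n) (S n ω) a (lam n)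
      (D * (p n / √n))})
    (hO : OracleSetting p k hk β (fun n => gram (w 0) fun j => m n j 0) a lam ρ₁ ρ₂ r)
    (hE : BandwidthCondition h p) (hw : WeightFun L w) (hm : ∀ n j, SmoothFun M (m n j))
    (hβ : ∀ n, (gram (w 0) fun j => m n j 0) *ᵥ (β n) = crossMoment w (m n))
    (hZ : ∀ n, HasLaw (Z n) ((designLaw n).prod (noiseLaw σ (Fin n × Fin (p n)))) (P n))
    {G : ∀ n, Matrix (VechIdx (k n)) (VechIdx (k n)) ℝ}
    (hG : ∀ n, G n = asympCov n σ (w 0) (fun j => m n j 0) (Fin.castLE (hk n)))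
    (hND : NondegeneracyCondition p h ρ₁ G)
    {δ : ∀ n, Ω n → Fin (k n) → ℝ} (hδm : ∀ n i, AEMeasurable (fun ω => δ n ω i) (P n))
    (hδ : WithProbTendingToOne P fun n => {ω |
      headBlock (hk n) (Matrix.of (gramHat K (h n) w (m n) (Z n ω).1 (Z n ω).2)) *ᵥ δ n ω =
        headErr (hk n) (Matrix.of (gramHat K (h n) w (m n) (Z n ω).1 (Z n ω).2))
          (crossHat K (h n) w (m n) (Z n ω).1 (Z n ω).2) (β n)})
    {γ : ∀ n, Fin (k n) → ℝ} (hγ : ∀ᶠ n in atTop, γ n ⬝ᵥ γ n = 1) :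
    TendstoInDistribution (fun n ω => γ n ⬝ᵥ invSqrt (sandwichCov (fun j => head (hk n) (β n) j)
      (headBlock (hk n) (gram (w 0) fun j => m n j 0)) (G n)) *ᵥ δ n ω)
      atTop (id : ℝ → ℝ) P (gaussianReal 0 1) := by
  obtain ⟨g, hg, hGspec, hND1, hND2⟩ := hND
  have hρ : ∀ n, 0 < ρ₁ n := fun n => (hO.bounds n).pos
  -- The functional exists when `γ n` is a unit vector and the eigenvalue bound holds, that is for
  -- all large `n`. Zeros are chosen otherwise, so that the approximating statistic is defined for
  -- every `n`.
  have hfun : ∀ n, ∃ (y : Fin (k n) → ℝ) (c : VechIdx (k n) → ℝ), 0 < n → γ n ⬝ᵥ γ n = 1 →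
      (∀ μ ∈ spectrum ℝ (G n), g n / (n : ℝ) ≤ μ) →
      (∀ δ, γ n ⬝ᵥ invSqrt (sandwichCov (fun j => head (hk n) (β n) j)
        (headBlock (hk n) (gram (w 0) fun j => m n j 0)) (G n)) *ᵥ δ =
          y ⬝ᵥ headBlock (hk n) (gram (w 0) fun j => m n j 0) *ᵥ δ) ∧
      c ⬝ᵥ G n *ᵥ c = 1 ∧ c ⬝ᵥ c ≤ √(n / g n) ^ 2 ∧ y ⬝ᵥ y ≤ √(n / g n) ^ 2 ∧
      ∀ C : Matrix (Fin (k n)) (Unit ⊕ Fin (k n)) ℝ, (∀ i j, C i (Sum.inr j) = C j (Sum.inr i)) →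
        c ⬝ᵥ vech C = y ⬝ᵥ fun i => C i (Sum.inl ()) -
          ∑ j, C i (Sum.inr j) * head (hk n) (β n) j := by
    intro n
    by_cases hcond : 0 < n ∧ γ n ⬝ᵥ γ n = 1 ∧ ∀ μ ∈ spectrum ℝ (G n), g n / (n : ℝ) ≤ μ
    · obtain ⟨hn, h1, h2⟩ := hcond
      have hn' : (0 : ℝ) < n := by exact_mod_cast hn
      have hgn := hg n
      have hGs : (G n).IsSymm := by rw [hG]; exact isSymm_asympCov ..
      obtain ⟨y, c, h3, h4, h5, h6, h7⟩ := exists_sandwich_functional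
        (fun j => head (hk n) (β n) j) ((hO.bounds n).isUnit_headBlock (hk n)) hGs
        (g := g n / n) (by positivity) (le_dotProduct_mulVec_of_spectrum hGs h2) h1
      have h8 : √(n / g n) ^ 2 = 1 / (g n / n) := by
        rw [Real.sq_sqrt (by positivity), one_div_div]
      exact ⟨y, c, fun _ _ _ => ⟨h3, h4, h8 ▸ h5, h8 ▸ h6, h7⟩⟩
    · exact ⟨0, 0, fun h1 h2 h3 => absurd ⟨h1, h2, h3⟩ hcond⟩
  choose y c hyc using hfun
  set κ : ℕ → ℝ := fun n => √(n / g n) with hκ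
  set F : ∀ n, Fin (p n) → ℝ → ℝ := fun n => combInfl w (m n) (Fin.castLE (hk n)) (c n) with hF
  have hFc : ∀ n l, Continuous (F n l) := fun n l => continuous_combInfl hw (hm n) (c n) l
  refine tendstoInDistribution_of_charFun (Y := fun n ω => linStat (F n) (Z n ω).1 (Z n ω).2)
    (fun n => ?_) (fun n => ?_) (fun ε hε => ?_) fun s => ?_
  · simp only [dotProduct, mulVec]
    exact Finset.aemeasurable_fun_sum _ fun i _ => (Finset.aemeasurable_fun_sum _ fun j _ =>
      (hδm n j).const_mul _).const_mul _
  · exact (continuous_linStat (hFc n)).measurable.comp_aemeasurable (hZ n).aemeasurable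
  · refine ((hA.inter hA').inter (TightEvents.of_wpt hδ)).wpt fun D hD => ?_
    -- With `κ = √(n / g)` and `τ = D p / √n`, these are the bounds for `κ √remSq` and `κ τ * (2 τ /
    -- ρ₁)`. They are multiples of the two limits in the nondegeneracy condition.
    have h1 : Tendsto (fun n : ℕ => √D * (√(n : ℝ) * p n * (h n ^ 3 + 1 / (n * h n ^ 2)) / √(g n)) +
        2 * D ^ 2 * ((p n : ℝ) ^ 2 / (√(n : ℝ) * ρ₁ n * √(g n)))) atTop (𝓝 0) := by
      simpa using (hND1.const_mul (√D)).add (hND2.const_mul (2 * D ^ 2))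
    filter_upwards [h1.eventually_le_const hε, hGspec, hγ, eventually_gt_atTop 0,
      hO.tuning.eventually_rateBounds hρ hO.le hO.rate hD (D' := 2 * D) le_rfl]
      with n hn1 hn2 hn3 hn hn4 ω hω
    obtain ⟨⟨hω1, hω2⟩, hω3⟩ := hω
    obtain ⟨h3, h4, h5, h6, h7⟩ := hyc n hn hn3 hn2
    have hn' : (0 : ℝ) < n := by exact_mod_cast hn
    have hgn := hg n
    have hρn := hρ n
    have hs : 0 < √(n : ℝ) := Real.sqrt_pos.2 hn'
    have hsg : 0 < √(g n) := Real.sqrt_pos.2 hgn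
    have hrr := remRate_pos (n := n) (hE.pos n)
    refine le_trans ?_ hn1
    rw [h3]
    refine (abs_functional_sub_linStat_le hw (hm n) (hk n) (hO.bounds n) hω2
      (by positivity) hn4.tau_le (hβ n) (hO.sparse n) hω3 (Real.sqrt_nonneg _) h5 h6 h7).trans ?_
    have hκn : √((n : ℝ) / g n) = √n / √(g n) := Real.sqrt_div hn'.le _
    have h8 : √(remSq K (h n) w (m n) (Z n ω).1 (Z n ω).2) ≤ √D * (p n * remRate n (h n)) := by
      refine (Real.sqrt_le_sqrt hω1.rem).trans (le_of_eq ?_)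
      rw [Real.sqrt_mul hD, Real.sqrt_sq (by positivity)]
    rw [hκn]
    refine add_le_add ?_ (le_of_eq ?_)
    · refine (mul_le_mul_of_nonneg_left h8 (by positivity)).trans (le_of_eq ?_)
      rw [remRate]
      ring
    · field_simp
  -- The squared influence functions sum to at most a multiple of `p² |c|² ≤ p² n / g`, so the error
  -- in the central limit theorem is of order `p / √(n g)`.
  · have hW : Tendsto (fun n : ℕ => s ^ 2 / 2 * √(σ ^ 2 * (8 * max M (4 * M * L) ^ 2) *
        ((p n : ℝ) ^ 2 * (n / g n) / n ^ 2))) atTop (𝓝 0) := by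
      have := tendsto_dim_sq_div (p := p) hρ
        (fun n => (hO.bounds n).le_sq_mul hw (hm n)) hg hND2
      have h2 := ((this.const_mul (σ ^ 2 * (8 * max M (4 * M * L) ^ 2))).sqrt).const_mul (s ^ 2 / 2)
      simpa using h2
    refine tendsto_iff_norm_sub_tendsto_zero.2 (squeeze_zero' (.of_forall fun _ => norm_nonneg _)
      ?_ hW)
    filter_upwards [hGspec, hγ, eventually_gt_atTop 0] with n hn2 hn3 hn
    obtain ⟨h3, h4, h5, h6, h7⟩ := hyc n hn hn3 hn2
    have hn' : (0 : ℝ) < n := by exact_mod_cast hn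
    have hgn := hg n
    have h8 : ∫ ω, Complex.exp (s * (linStat (F n) (Z n ω).1 (Z n ω).2 : ℝ) * Complex.I) ∂P n =
        ∫ q, Complex.exp (s * (linStat (F n) q.1 q.2 : ℝ) * Complex.I)
        ∂(designLaw n).prod (noiseLaw σ (Fin n × Fin (p n))) := by
      have hcont : Continuous fun q : (Fin n → ℝ) × (Fin n × Fin (p n) → ℝ) =>
          Complex.exp (s * (linStat (F n) q.1 q.2 : ℝ) * Complex.I) := by
        have := continuous_linStat (n := n) (hFc n)
        fun_prop
      exact (hZ n).integral_comp hcont.aestronglyMeasurable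
    rw [h8]
    rw [Real.sq_sqrt (by positivity)] at h5
    refine (norm_integral_cexp_linStat_sub_le σ s (hFc n)
      (B := 8 * max M (4 * M * L) ^ 2 * p n ^ 2 * (n / g n)) (fun x hx => ?_) hn ?_).trans
      (le_of_eq ?_)
    · refine (sum_sq_combInfl_le hw (hm n) (c n) (hk n) hx).trans ?_
      gcongr
    · rw [hF, integral_sum_sq_combInfl hw (hm n), ← hG, h4]
    · congr 2
      ring

end Normality

/-! ### Replacing the trajectories and the weight by their extensions -/

section Reduction

open Matrix

theorem intervalIntegral_congr_Ioo {f g : ℝ → ℝ} (h : ∀ x ∈ Ioo (0 : ℝ) 1, f x = g x) :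
    ∫ x in (0 : ℝ)..1, f x = ∫ x in (0 : ℝ)..1, g x := by
  rw [intervalIntegral.integral_of_le zero_le_one, intervalIntegral.integral_of_le zero_le_one,
    integral_Ioc_eq_integral_Ioo, integral_Ioc_eq_integral_Ioo]
  exact setIntegral_congr_fun measurableSet_Ioo h

/-- Only in the interior: at an end point `deriv` depends on values outside the interval. For the
integrals the end points do not matter. -/
theorem deriv_eq_of_eq_on_Icc {f g : ℝ → ℝ} (h : ∀ x ∈ Icc (0 : ℝ) 1, f x = g x) {x : ℝ}
    (hx : x ∈ Ioo (0 : ℝ) 1) : deriv f x = deriv g x := by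
  refine Filter.EventuallyEq.deriv_eq ?_
  filter_upwards [Icc_mem_nhds hx.1 hx.2] with y hy using h y hy

variable {n p k : ℕ} [NeZero p] {L M : ℝ} {w : ℝ → ℝ} {W : ℕ → ℝ → ℝ} {m : Fin p → ℝ → ℝ}
  {F : Fin p → ℕ → ℝ → ℝ}

section Congr

variable (hwW : ∀ x ∈ Icc (0 : ℝ) 1, W 0 x = w x)

include hwW in
theorem criterion_congr_weight {K : ℝ → ℝ} {h a lam : ℝ} {X : Fin n → ℝ} {Y : Fin n → Fin p → ℝ} :
    criterion K h w a lam X Y = criterion K h (W 0) a lam X Y := by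
  ext β
  rw [criterion, criterion]
  congr 1
  exact intervalIntegral_congr_Ioo fun x hx => by rw [hwW x (Ioo_subset_Icc_self hx)]

variable (hmF : ∀ j, ∀ x ∈ Icc (0 : ℝ) 1, F j 0 x = m j x)
include hwW hmF

omit [NeZero p] in
theorem gram_congr : gram w m = gram (W 0) fun j => F j 0 := by
  ext i j
  simp only [gram, of_apply]
  refine intervalIntegral_congr_Ioo fun x hx => ?_
  have hx' := Ioo_subset_Icc_self hx
  rw [hwW x hx', hmF i x hx', hmF j x hx']

theorem popLoss_congr (hF : ∀ j, SmoothFun M (F j)) (β : EuclideanSpace ℝ (Fin p)) :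
    popLoss w m β = ∫ x in (0 : ℝ)..1, resid F β x ^ 2 * W 0 x := by
  refine intervalIntegral_congr_Ioo fun x hx => ?_
  have hx' := Ioo_subset_Icc_self hx
  rw [hwW x hx', resid, ← ((hF 0).hasDerivAt 0 (by omega) x).deriv,
    deriv_eq_of_eq_on_Icc (hmF 0) hx]
  simp_rw [fun j => hmF j x hx']

theorem asympCov_congr (σ : ℝ) (ι : Fin k → Fin p) :
    asympCov n σ w m ι = asympCov n σ (W 0) (fun j => F j 0) ι := by
  have h1 : ∀ a l, ∀ x ∈ Ioo (0 : ℝ) 1,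
      infl w m ι a l x = infl (W 0) (fun j => F j 0) ι a l x := by
    intro a l x hx
    have hx' := Ioo_subset_Icc_self hx
    rcases a with i | ij
    · have h2 : deriv (fun y => F (ι i) 0 y * W 0 y) x = deriv (fun y => m (ι i) y * w y) x :=
        deriv_eq_of_eq_on_Icc (fun y hy => by rw [hwW y hy, hmF _ y hy]) hx
      rw [infl, infl, h2, hwW x hx', deriv_eq_of_eq_on_Icc (hmF 0) hx]
    · rw [infl, infl, hwW x hx', hmF _ x hx', hmF _ x hx']
  ext a b
  simp only [asympCov, of_apply]
  congr 1
  refine Finset.sum_congr rfl fun l _ => intervalIntegral_congr_Ioo fun x hx => ?_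
  rw [h1 a l x hx, h1 b l x hx]

end Congr

-- The population loss and its normal equations

section PopLoss

variable (hw : WeightFun L W) (hF : ∀ j, SmoothFun M (F j))
include hw hF

theorem integral_resid_sq_eq (β : Fin p → ℝ) :
    ∫ x in (0 : ℝ)..1, resid F β x ^ 2 * W 0 x =
      quadLoss (gram (W 0) fun j => F j 0) (crossMoment W F)
        (∫ x in (0 : ℝ)..1, F 0 1 x ^ 2 * W 0 x) β := by
  have hwc : Continuous (W 0) := hw.continuous (by omega)
  have hc : ∀ j, Continuous (F j 0) := fun j => (hF j).continuous (by omega)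
  have hc1 : Continuous (F 0 1) := (hF 0).continuous (by omega)
  have hi : ∀ {f : ℝ → ℝ}, Continuous f → IntervalIntegrable f volume 0 1 :=
    fun hf => hf.intervalIntegrable _ _
  have e1 : ∀ x, resid F β x ^ 2 * W 0 x = F 0 1 x ^ 2 * W 0 x -
      ∑ j, 2 * β j * (F 0 1 x * F j 0 x * W 0 x) +
      ∑ i, ∑ j, β i * β j * (F i 0 x * F j 0 x * W 0 x) := by
    intro x
    have h1 : ∑ i, ∑ j, β i * β j * (F i 0 x * F j 0 x * W 0 x) =
        (∑ j, β j * F j 0 x) ^ 2 * W 0 x := by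
      rw [sq, Finset.sum_mul_sum, Finset.sum_mul]
      refine Finset.sum_congr rfl fun i _ => ?_
      rw [Finset.sum_mul]
      exact Finset.sum_congr rfl fun j _ => by ring
    have h2 : ∑ j, 2 * β j * (F 0 1 x * F j 0 x * W 0 x) =
        2 * F 0 1 x * (∑ j, β j * F j 0 x) * W 0 x := by
      rw [Finset.mul_sum, Finset.sum_mul]
      exact Finset.sum_congr rfl fun j _ => by ring
    rw [h1, h2, resid]
    ring
  simp_rw [e1]
  rw [intervalIntegral.integral_add (hi (by fun_prop)) (hi (by fun_prop)),
    intervalIntegral.integral_sub (hi (by fun_prop)) (hi (by fun_prop)),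
    intervalIntegral.integral_finsetSum fun j _ => hi (by fun_prop),
    intervalIntegral.integral_finsetSum fun j _ => hi (by fun_prop)]
  simp_rw [fun i => intervalIntegral.integral_finsetSum (s := Finset.univ) (a := 0) (b := 1)
    (μ := volume) (f := fun j x => β i * β j * (F i 0 x * F j 0 x * W 0 x))
    fun j _ => hi (by fun_prop), intervalIntegral.integral_const_mul]
  rw [quadLoss, dotProduct, dotProduct, Finset.mul_sum]
  congr 1
  · congr 1
    exact Finset.sum_congr rfl fun j _ => by rw [crossMoment]; ring
  · refine Finset.sum_congr rfl fun i _ => ?_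
    rw [mulVec, dotProduct, Finset.mul_sum]
    exact Finset.sum_congr rfl fun j _ => by simp only [gram, of_apply]; ring

/-- The normal equations of the population problem. -/
theorem gram_mulVec_eq_of_min {β : EuclideanSpace ℝ (Fin p)}
    (hβ : ∀ v : EuclideanSpace ℝ (Fin p), ∫ x in (0 : ℝ)..1, resid F β x ^ 2 * W 0 x ≤
      ∫ x in (0 : ℝ)..1, resid F v x ^ 2 * W 0 x) :
    gram (W 0) (fun j => F j 0) *ᵥ β = crossMoment W F := by
  set Q := gram (W 0) fun j => F j 0 with hQ
  set u := Q *ᵥ β - crossMoment W F with hu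
  -- Move from the minimizer along the gradient direction `u`. The increment of the loss is a
  -- nonnegative quadratic polynomial in `t` without constant term, so its linear coefficient `2
  -- |u|²` must vanish.
  have key : ∀ t : ℝ, 0 ≤ (u ⬝ᵥ Q *ᵥ u) * (t * t) + (2 * (u ⬝ᵥ u)) * t + 0 := by
    intro t
    have h1 := hβ (WithLp.toLp 2 (WithLp.ofLp β + t • u))
    rw [integral_resid_sq_eq hw hF, integral_resid_sq_eq hw hF] at h1
    simp only at h1
    rw [quadLoss_add (isSymm_gram _ _)] at h1
    simp only [dotProduct_smul, mulVec_smul, smul_dotProduct, smul_eq_mul] at h1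
    rw [← hQ, ← hu] at h1
    linarith
  have h2 := discrim_le_zero key
  rw [discrim] at h2
  have h3 : u ⬝ᵥ u = 0 := by nlinarith [sq_nonneg (u ⬝ᵥ u)]
  exact sub_eq_zero.1 (dotProduct_self_eq_zero.1 h3)

/-- The loss at `β = 0` bounds the minimal loss, whatever the number of variables. This is the bound
for the residual used in `lintegral_sq_linErr_le`. -/
theorem integral_resid_zero_le :
    ∫ x in (0 : ℝ)..1, resid F (0 : EuclideanSpace ℝ (Fin p)) x ^ 2 * W 0 x ≤ M ^ 2 * L := by
  refine (le_abs_self _).trans ?_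
  have h1 := intervalIntegral.norm_integral_le_of_norm_le_const (a := 0) (b := 1)
    (f := fun x => resid F (0 : EuclideanSpace ℝ (Fin p)) x ^ 2 * W 0 x) (C := M ^ 2 * L)
    fun x hx => by
      rw [uIoc_of_le zero_le_one] at hx
      have h2 := (hF 0).bound 1 (by omega) x (Ioc_subset_Icc_self hx)
      simp only [resid, PiLp.zero_apply, zero_mul, Finset.sum_const_zero, sub_zero]
      rw [Real.norm_eq_abs, abs_mul, abs_pow]
      exact mul_le_mul (pow_le_pow_left₀ (abs_nonneg _) h2 2) (hw.bound 0 (by omega) x)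
        (abs_nonneg _) (by positivity)
  simpa using h1

end PopLoss

omit [NeZero p] in
theorem sum_sq_le_of_sparse (hk : k ≤ p) {β : EuclideanSpace ℝ (Fin p)} {C : ℝ}
    (hs : ∀ j : Fin p, k ≤ (j : ℕ) → β j = 0) (hC : ∀ j : Fin k, |head hk β j| ≤ C) :
    ∑ j, β j ^ 2 ≤ C ^ 2 * p := by
  have h1 : ∀ j, β j ^ 2 ≤ C ^ 2 := by
    intro j
    by_cases hj : (j : ℕ) < k
    · rw [← sq_abs]
      exact pow_le_pow_left₀ (abs_nonneg _) (hC ⟨j, hj⟩) 2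
    · rw [hs j (not_lt.1 hj)]
      simpa using sq_nonneg C
  refine (Finset.sum_le_sum fun j _ => h1 j).trans (le_of_eq ?_)
  simp [mul_comm]

omit [NeZero p] in
theorem SamplingCondition.ae_mem_Ioo {Ω : Type*} [MeasurableSpace Ω] {P : Measure Ω} {σ : ℝ}
    {X : Fin n → Ω → ℝ} {ε : Fin n → Fin p → Ω → ℝ} (h : SamplingCondition P σ X ε) :
    ∀ᵐ ω ∂P, ∀ t, X t ω ∈ Ioo (0 : ℝ) 1 :=
  ae_all_iff.2 fun t => ((h.law_time t).ae_iff (p := fun x => x ∈ Ioo (0 : ℝ) 1)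
    measurableSet_Ioo.mem).2 (ae_restrict_mem measurableSet_Ioo)

end Reduction

end LinODE

-- Assembly of the oracle property

theorem theorem3
    -- triangular array of probability spaces, dimensions, number of nonzero coefficients
    {Ω : ℕ → Type*} [∀ n, MeasurableSpace (Ω n)]
    (P : ∀ n, Measure (Ω n)) [∀ n, IsProbabilityMeasure (P n)]
    (p k : ℕ → ℕ) [∀ n, NeZero (p n)] (hk : ∀ n, k n ≤ p n)
    -- kernel, weight, trajectories, noise level, bandwidth, SCAD parameters, eigenvalue bounds
    (K w : ℝ → ℝ) (m : ∀ n, Fin (p n) → ℝ → ℝ) (σ : ℝ) (h : ℕ → ℝ) (a : ℝ) (lam ρ₁ ρ₂ : ℕ → ℝ)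
    -- observation times and errors
    (X : ∀ n, Fin n → Ω n → ℝ) (ε : ∀ n, Fin n → Fin (p n) → Ω n → ℝ)
    -- true (best approximating) coefficients
    (β₀ : ∀ n, EuclideanSpace ℝ (Fin (p n)))
    (hβ₀ : ∀ n, IsMinOn (popLoss w (m n)) univ (β₀ n))
    (hsparse : ∀ n (j : Fin (p n)), k n ≤ (j : ℕ) → β₀ n j = 0)
    (ha : 2 < a) (hσ : 0 < σ)
    (hA : KernelCondition K)
    (hB : SmoothnessCondition m)
    (hC : WeightCondition w)
    (hD : ∀ n, SamplingCondition (P n) σ (X n) (ε n))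
    (hE : BandwidthCondition h p)
    (hF : ∀ n, EigenvalueCondition (gram w (m n)) (ρ₁ n) (ρ₂ n))
    (hG : TuningCondition p ρ₁ ρ₂ lam)
    (hH : ∃ C : ℝ, ∀ n (j : Fin (k n)), |head (hk n) (β₀ n) j| ≤ C)
    (hI : ∀ B : ℝ, ∀ᶠ n in atTop, ∀ j : Fin (k n), B ≤ |head (hk n) (β₀ n) j| / lam n)
    -- the penalized criterion
    (S : ∀ n, Ω n → EuclideanSpace ℝ (Fin (p n)) → ℝ)
    (hS : ∀ n ω, S n ω = criterion K (h n) w a (lam n) (fun i => X n i ω)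
      (fun i j => m n j (X n i ω) + ε n i j ω))
    -- the rate of convergence
    (r : ℕ → ℝ) (hr : ∀ n, r n = (p n : ℝ) ^ 2 / (√(n : ℝ) * ρ₁ n))
    -- the asymptotic covariances, for the variables with nonzero coefficients
    (G : ∀ n, Matrix (VechIdx (k n)) (VechIdx (k n)) ℝ)
    (hGdef : ∀ n, G n = asympCov n σ w (m n) (Fin.castLE (hk n)))
    (V : ∀ n, Matrix (Fin (k n)) (Fin (k n)) ℝ)
    (hV : ∀ n, V n = sandwichCov (fun j => head (hk n) (β₀ n) j)
      (gram w fun j : Fin (k n) => m n (Fin.castLE (hk n) j)) (G n)) :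
    -- such local minimizers exist
    (∃ βhat : ∀ n, Ω n → EuclideanSpace ℝ (Fin (p n)),
      IsConsistentLocalMinimizer P S β₀ r βhat) ∧
    -- and every such sequence has the oracle property
    (∀ βhat : ∀ n, Ω n → EuclideanSpace ℝ (Fin (p n)),
      IsConsistentLocalMinimizer P S β₀ r βhat →
        WithProbTendingToOne P
            (fun n => {ω | ∀ j : Fin (p n), k n ≤ (j : ℕ) → βhat n ω j = 0}) ∧
        (NondegeneracyCondition p h ρ₁ G →
          ∀ γ : ∀ n, EuclideanSpace ℝ (Fin (k n)), (∀ᶠ n in atTop, ‖γ n‖ = 1) →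
            TendstoInDistribution
              (fun n ω => ∑ i, γ n i *
                (invSqrt (V n)).mulVec (fun j => (head (hk n) (βhat n ω - β₀ n)) j) i)
              atTop (id : ℝ → ℝ) P (gaussianReal 0 1))) ∧
    -- the limit is the same as for the estimator that knows the zero coefficients
    (NondegeneracyCondition p h ρ₁ G →
      ∀ βorc : ∀ n, Ω n → EuclideanSpace ℝ (Fin (k n)),
        IsConsistentLocalMinimizer P (fun n ω v => S n ω (padZero (p n) v))
          (fun n => head (hk n) (β₀ n)) r βorc →
        ∀ γ : ∀ n, EuclideanSpace ℝ (Fin (k n)), (∀ᶠ n in atTop, ‖γ n‖ = 1) →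
          TendstoInDistribution
            (fun n ω => ∑ i, γ n i *
              (invSqrt (V n)).mulVec (fun j => (βorc n ω - head (hk n) (β₀ n)) j) i)
            atTop (id : ℝ → ℝ) P (gaussianReal 0 1)) := by
  have hFeig := hF
  clear hF
  obtain ⟨B, hB⟩ := hB
  -- The trajectories and the weight are replaced by extensions to the line. Integrals over the unit
  -- interval are unchanged, and so, almost surely, is the criterion, because the observation times
  -- lie in the interval.
  choose F hF hFm using fun n j => exists_smoothFun (hB n j).1 (hB n j).2
  obtain ⟨L, W, hW, hWw⟩ := hC.exists_weightFun
  obtain ⟨C, hH⟩ := hH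
  obtain ⟨T, BK, hKT⟩ := hA.exists_equivKernelData
  have hQ : ∀ n, gram w (m n) = gram (W 0) fun j => F n j 0 := fun n => gram_congr hWw (hFm n)
  have hbounds : ∀ n, QuadBounds (gram (W 0) fun j => F n j 0) (ρ₁ n) (ρ₂ n) := fun n =>
    hQ n ▸ (hFeig n).quadBounds (isSymm_gram _ _)
  have hmin : ∀ n (v : EuclideanSpace ℝ (Fin (p n))),
      ∫ x in (0 : ℝ)..1, resid (F n) (β₀ n) x ^ 2 * W 0 x ≤
        ∫ x in (0 : ℝ)..1, resid (F n) v x ^ 2 * W 0 x := fun n v => by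
    rw [← popLoss_congr hWw (hFm n) (hF n), ← popLoss_congr hWw (hFm n) (hF n)]
    exact hβ₀ n (mem_univ v)
  have hnormal := fun n => gram_mulVec_eq_of_min hW (hF n) (hmin n)
  have hres : ∀ n, ∫ x in (0 : ℝ)..1, resid (F n) (β₀ n) x ^ 2 * W 0 x ≤ B ^ 2 * L := fun n =>
    (hmin n 0).trans (integral_resid_zero_le hW (hF n))
  have hβ2 : ∀ n, ∑ j, β₀ n j ^ 2 ≤ C ^ 2 * p n := fun n =>
    sum_sq_le_of_sparse (hk n) (hsparse n) (hH n)
  have hO : OracleSetting p k hk β₀ (fun n => gram (W 0) fun j => F n j 0) a lam ρ₁ ρ₂ r :=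
    ⟨by linarith, hsparse, hbounds, fun n => (hbounds n).le, hG, hI, hr⟩
  have hZ := fun n => (hD n).hasLaw
  obtain ⟨c₀, C₁, hc₀, hgood⟩ := exists_tightEvents_sampleGood hA hW hF hE hZ hres hβ2
  have hScrit : ∀ n, ∀ᵐ ω ∂P n, S n ω = criterion K (h n) (W 0) a (lam n) (fun i => X n i ω)
      (fun i j => F n j 0 (X n i ω) + ε n i j ω) := fun n => by
    filter_upwards [(hD n).ae_mem_Ioo] with ω hω
    rw [hS, criterion_congr_weight hWw]
    congr 1
    ext i j
    rw [hFm n j _ (Ioo_subset_Icc_self (hω i))]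
  have hest := tightEvents_estGood hc₀ hgood hKT hE hW hF hnormal (sq_nonneg C) hβ2 hScrit
  have hGF : ∀ n, G n = asympCov n σ (W 0) (fun j => F n j 0) (Fin.castLE (hk n)) := fun n => by
    rw [hGdef, asympCov_congr hWw (hFm n)]
  have hVF : ∀ n, V n = sandwichCov (fun j => head (hk n) (β₀ n) j)
      (headBlock (hk n) (gram (W 0) fun j => F n j 0)) (G n) := fun n => by
    rw [hV, gram_congr (F := fun j => F n (Fin.castLE (hk n) j)) hWw fun j => hFm n _]
    rfl
  have hγ' : ∀ γ : ∀ n, EuclideanSpace ℝ (Fin (k n)), (∀ᶠ n in atTop, ‖γ n‖ = 1) →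
      ∀ᶠ n in atTop, dotProduct (γ n) (γ n) = 1 := fun γ hγ => by
    filter_upwards [hγ] with n hn
    have h1 := EuclideanSpace.real_norm_sq_eq (γ n)
    rw [hn] at h1
    simpa [dotProduct, sq] using h1.symm
  refine ⟨?_, fun βhat hβhat => ⟨?_, fun hND γ hγ => ?_⟩, fun hND βorc hβorc γ hγ => ?_⟩
  · exact hO.exists_isConsistentLocalMinimizer hest
      (fun n i j => (measurable_gramHat hA hW (hF n) i j).comp_aemeasurable (hZ n).aemeasurable)
      fun n i => (measurable_crossHat hA hW (hF n) i).comp_aemeasurable (hZ n).aemeasurable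
  · have h1 := hO.sparse_of_isConsistentLocalMinimizer hest hβhat
    refine tendsto_of_tendsto_of_tendsto_of_le_of_le tendsto_const_nhds h1 (fun _ => zero_le) ?_
    exact fun n => measure_mono (compl_subset_compl.2 fun ω hω => hω.1)
  · have h1 := hO.sparse_of_isConsistentLocalMinimizer hest hβhat
    -- Apart from measurability, only the linear system satisfied by the estimation error is used
    -- here. It holds with probability tending to one for this estimator and for the one that knows
    -- the zero coefficients.
    have h2 := tendstoInDistribution_functional hgood hest hO hE hW hF hnormal hZ hGF hND
      (δ := fun n ω j => head (hk n) (βhat n ω - β₀ n) j) (fun n j => ?_)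
      (tendsto_of_tendsto_of_tendsto_of_le_of_le tendsto_const_nhds h1 (fun _ => zero_le)
        fun n => measure_mono (compl_subset_compl.2 fun ω hω => hω.2)) (hγ' γ hγ)
    · simp_rw [← hVF] at h2
      exact h2
    · exact ((by fun_prop : Measurable fun v : EuclideanSpace ℝ (Fin (p n)) =>
        v (Fin.castLE (hk n) j) - β₀ n (Fin.castLE (hk n) j))).comp_aemeasurable
        (hβhat.aemeasurable n)
  · have h1 := hO.headBlock_eq_of_isConsistentLocalMinimizer hest hβorc
    have h2 := tendstoInDistribution_functional hgood hest hO hE hW hF hnormal hZ hGF hND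
      (δ := fun n ω j => (βorc n ω - head (hk n) (β₀ n)) j) (fun n j => ?_) h1 (hγ' γ hγ)
    · simp_rw [← hVF] at h2
      exact h2
    · exact ((by fun_prop : Measurable fun v : EuclideanSpace ℝ (Fin (k n)) =>
        v j - head (hk n) (β₀ n) j)).comp_aemeasurable (hβorc.aemeasurable n)
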